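/- A clique-width expression with $k$ labels builds a vertex-labelled graph from the operations: create a single vertex with a label; disjoint union; for two distinct labels $i, j$, add all edges between vertices of label $i$ and vertices of label $j$; change every label $i$ into $j$. It is linear if in every disjoint union the second operand is a single labelled vertex. The clique-width $\mathrm{cwd}(G)$ (linear clique-width $\mathrm{lcwd}(G)$) of a graph $G$ is the least number of labels in an expression (a linear expression) that defines $G$; it is $0$ for the graph without vertices. For $k\ge 2$ let $n=(k-1)(k+1)+2$, and let $S_k$ be the graph on the vertices $v_1,\dots,v_n,w_1,w_2,w_3,w_4$ in which $v_i$ and $v_j$ ($i<j$) are adjacent if and only if $j-i\le k$, and whose remaining edges are $w_1w_2,\ w_2v_1,\ v_nw_3,\ w_3w_4$. For $k\ge 3$ let $S^+_k$ be obtained from $S_k$ by adding one vertex $w^+$ with neighbourhood $\{w_1,w_2,v_1,\dots,v_{k-1}\}$. A graph $G$ is a minimal forbidden induced subgraph for a class of graphs if $G$ is not in the class but every proper induced subgraph of $G$ is. Proposition. 1. For every $k\ge 3$, every proper induced subgraph of $S^+_k$ has clique-width at most $k+1$. 2. For every $k\ge 3$, every proper induced subgraph of $S_k$ has linear clique-width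 at most $k+1$. 3. Every proper induced subgraph of $S_2$ has linear clique-width at most $3$. Consequently, for every $k\ge 3$, $S^+_k$ is a minimal forbidden induced subgraph for the graphs of clique-width at most $k+1$, and $S_k$ is one for the graphs of linear clique-width at most $k+1$; and $S_2$ is a minimal forbidden induced subgraph both for the graphs of clique-width at most $3$ and for the graphs of linear clique-width at most $3$. (In particular $\mathrm{cwd}(S^+_k)\ge k+2$ and $\mathrm{lcwd}(S_k)\ge k+2$ for $k\ge 3$, and $\mathrm{cwd}(S_2)\ge 4$.) -/

import Mathlib

/-- Clique-width expressions over vertex names in `V` and labels in `L`.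
* `vertex v i` creates the vertex `v` with label `i`;
* `union` is the disjoint union;
* `join i j` adds all edges between the vertices of label `i` and the vertices of label `j`;
* `relabel i j` changes every label `i` into `j`. -/
inductive CWExpr (V L : Type) : Type
  | vertex (v : V) (i : L)
  | union (e f : CWExpr V L)
  | join (i j : L) (e : CWExpr V L)
  | relabel (i j : L) (e : CWExpr V L)

namespace CWExpr

variable {V L : Type}

/-- The set of vertices of the labelled graph defined by an expression. -/
def verts : CWExpr V L → Set V
  | vertex v _ => {v}
  | union e f => e.verts ∪ f.verts
  | join _ _ e => e.verts
  | relabel _ _ e => e.verts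

/-- `e.HasLabel v a`: the vertex `v` has label `a` in the labelled graph defined by `e`. -/
def HasLabel : CWExpr V L → V → L → Prop
  | vertex u i, v, a => v = u ∧ a = i
  | union e f, v, a => e.HasLabel v a ∨ f.HasLabel v a
  | join _ _ e, v, a => e.HasLabel v a
  | relabel i j e, v, a => (e.HasLabel v a ∧ a ≠ i) ∨ (e.HasLabel v i ∧ a = j)

/-- Adjacency in the labelled graph defined by an expression. -/
def Adj : CWExpr V L → V → V → Prop
  | vertex _ _, _, _ => False
  | union e f, u, v => e.Adj u v ∨ f.Adj u v
  | join i j e, u, v => e.Adj u v ∨ (e.HasLabel u i ∧ e.HasLabel v j) ∨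
      (e.HasLabel u j ∧ e.HasLabel v i)
  | relabel _ _ e, u, v => e.Adj u v

/-- Well-formedness: unions are disjoint and joins are between two different labels. -/
def WellFormed : CWExpr V L → Prop
  | vertex _ _ => True
  | union e f => e.WellFormed ∧ f.WellFormed ∧ Disjoint e.verts f.verts
  | join i j e => i ≠ j ∧ e.WellFormed
  | relabel _ _ e => e.WellFormed

/-- Linear expressions: in every union the second operand is a single labelled vertex. -/
def IsLinear : CWExpr V L → Prop
  | vertex _ _ => True
  | union e f => e.IsLinear ∧ ∃ v i, f = vertex v i
  | join _ _ e => e.IsLinear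
  | relabel _ _ e => e.IsLinear

/-- The well-formed expression `e` defines the graph `G` (after forgetting the labels). -/
def Defines (e : CWExpr V L) (G : SimpleGraph V) : Prop :=
  e.WellFormed ∧ e.verts = Set.univ ∧ ∀ u v, e.Adj u v ↔ G.Adj u v

end CWExpr

/-- The clique-width of `G`: the least number `k` of labels such that some expression with `k` labels
defines `G` (`⊤` if there is none). The graph without vertices has clique-width `0`. -/
noncomputable def cliqueWidth {V : Type} (G : SimpleGraph V) : ℕ∞ :=
  ⨅ (k : ℕ) (_ : IsEmpty V ∨ ∃ e : CWExpr V (Fin k), e.Defines G), (k : ℕ∞)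

/-- The linear clique-width of `G`: the same with linear expressions only. -/
noncomputable def linearCliqueWidth {V : Type} (G : SimpleGraph V) : ℕ∞ :=
  ⨅ (k : ℕ) (_ : IsEmpty V ∨ ∃ e : CWExpr V (Fin k), e.IsLinear ∧ e.Defines G), (k : ℕ∞)

/-- The graph `G` is a minimal forbidden induced subgraph for the class of graphs `P`: it is not in
the class, but all its proper induced subgraphs are. -/
def IsMinimalForbidden (P : ∀ W : Type, SimpleGraph W → Prop) {V : Type} (G : SimpleGraph V) :
    Prop :=
  ¬ P V G ∧ ∀ s : Set V, s ≠ Set.univ → P s (G.induce s)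

/-- The number `(k - 1) * (k + 1) + 2` of path power vertices of `S_k` (used for `k ≥ 2`). -/
def sSize (k : ℕ) : ℕ := (k - 1) * (k + 1) + 2

/-- The vertices of `S_k`: `v i` stands for `v_{i+1}`, where `0 ≤ i < n`,
and there are four further vertices. -/
inductive SVertex (k : ℕ) : Type
  | v (i : Fin (sSize k))
  | w₁
  | w₂
  | w₃
  | w₄

namespace SVertex

/-- The edges of `S_k`, each listed in one direction. -/
inductive Edge (k : ℕ) : SVertex k → SVertex k → Prop
  | power (i j : Fin (sSize k)) (hlt : i < j) (hle : (j : ℕ) - (i : ℕ) ≤ k) : Edge k (v i) (v j)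
  | w₁w₂ : Edge k w₁ w₂
  | w₂v (i : Fin (sSize k)) (hi : (i : ℕ) = 0) : Edge k w₂ (v i)
  | vw₃ (i : Fin (sSize k)) (hi : (i : ℕ) + 1 = sSize k) : Edge k (v i) w₃
  | w₃w₄ : Edge k w₃ w₄

/-- The neighbourhood `{w_1, w_2, v_1, …, v_{k-1}}` of `w⁺` in `S⁺_k`. -/
def plusNbhd (k : ℕ) : Set (SVertex k) :=
  {w₁, w₂} ∪ {x | ∃ i : Fin (sSize k), (i : ℕ) + 1 ≤ k - 1 ∧ x = v i}

end SVertex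

/-- The graph `S_k`: the `k`-path power on `v_1, …, v_n` with the vertices `w_1, w_2, w_3, w_4` and
the edges `w_1w_2, w_2v_1, v_nw_3, w_3w_4` added. -/
def graphS (k : ℕ) : SimpleGraph (SVertex k) :=
  SimpleGraph.fromRel (SVertex.Edge k)

/-- The graph `S⁺_k`: the graph `S_k` with one vertex `w⁺` (here `none`) of neighbourhood
`{w_1, w_2, v_1, …, v_{k-1}}` added. -/
def graphSPlus (k : ℕ) : SimpleGraph (Option (SVertex k)) :=
  SimpleGraph.fromRel fun x y =>
    match x, y with
    | some a, some b => (graphS k).Adj a b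
    | none, some b => b ∈ SVertex.plusNbhd k
    | _, none => False

/-! Put the vertices on the integer line: `v_i` at `i`, `w_1, w_2` at `-1 - k, 1 - k`, `w⁺` at `-1`,
and `w_3, w_4` at `n + k, n + k + 2`. For `k ≥ 3`, adjacency in `S⁺_k` is then distance at most `k`
(`plus_adj_iff_place`), and `n = (k - 1)(k + 1) + 2 = k² + 1`. The central notion is the type of a
vertex in a set `T`: its set of neighbours outside `T`. Vertices of different types need different
labels; vertices of one type can share a label once the edges inside `T` are complete.

Upper bounds. With `m + 1` labels, any vertex can be added to a buildable set with at most `m` types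
(`Reach.insert`), so it suffices to order the vertices such that the types stay few. The path is
grown in parallel in `k` rows. Their starts advance by `k + 1` and their ends by `k`; whatever
separates two elements of a row then lies in the previous or in the next row, so a row is a single
type (`rowSet_unsplit`). Alone this leaves no label for the ends of the path, but a missing vertex
helps: placed at the start of a row it shifts the later rows by one, so that the last row stays
empty for one level longer and its label is free when row `0` is completed. The residue of the
missing vertex modulo `k + 1` determines the first start `A`, and `w⁺` is taken on the left or,
after a reflection, on the right (`exists_place`). Once the rows are long enough, the gaps between
them are closed from left to right (`reach_finish`). If only `w⁺` is missing, then `S_k` is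
assembled from two pieces by a union that is not linear (`reach_no_plus`).

Lower bounds. A family of vertex sets that contains the singletons and is closed under all unions
that `m` labels permit contains every graph that `m` labels define (`Defines.mem_family`). For `S_2`
such a family is listed and checked by computation. For `k ≥ 3` the family consists of the sets
without a full window (`k + 1` consecutive path vertices) and of certain sets with `k + 1` types.
Consider a union of `A` and `B` that completes the first window. On the path the two sets have no
label in common (`Uni.label_ne`), hence their types together number at most `k + 1`. Counting shows
that they number at least `k + 1` (`Split.false_of_cost`); so nothing off the path is present, and
the equality cases show that the union itself has `k + 1` types (`Joined.main`). The hard case is a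
single vertex that completes a window (`Tight.false`).

From then on all labels are occupied on the path, and a vertex that is added must share the label of
a path vertex. In a linear expression only `w_1` and `w_4` can do so (`Uni.indep_insert`). In
general the other operand `D` may be large; here `w⁺` is used to show that `D` avoids the path and
is not adjacent to the path vertices already present (`Attach.good_union`), and that two sets with
windows are never united (`Attach.false_of_max`). In both situations the set of all vertices, which
has one type only, is never obtained. -/

/-! ### Building labelled graphs by expressions -/

namespace CWExpr

variable {V L : Type}

theorem hasLabel_mem_verts (e : CWExpr V L) {v : V} {a : L} (h : e.HasLabel v a) :
    v ∈ e.verts := by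
  induction e generalizing a with
  | vertex u i => exact h.1
  | union e f ihe ihf => exact h.imp ihe ihf
  | join i j e ih => exact ih h
  | relabel i j e ih => rcases h with h | h <;> exact ih h.1

/-- The expression with all labels renamed by `σ`. -/
def mapLabels {L' : Type} (σ : L → L') : CWExpr V L → CWExpr V L'
  | vertex v i => vertex v (σ i)
  | union e f => union (e.mapLabels σ) (f.mapLabels σ)
  | join i j e => join (σ i) (σ j) (e.mapLabels σ)
  | relabel i j e => relabel (σ i) (σ j) (e.mapLabels σ)

section mapLabels

variable {L' : Type} {σ : L → L'}

theorem verts_mapLabels (e : CWExpr V L) : (e.mapLabels σ).verts = e.verts := by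
  induction e with
  | vertex u i => rfl
  | union e f ihe ihf => simp [mapLabels, verts, ihe, ihf]
  | join i j e ih => simpa [mapLabels, verts] using ih
  | relabel i j e ih => simpa [mapLabels, verts] using ih

theorem hasLabel_mapLabels (hσ : Function.Injective σ) (e : CWExpr V L) (v : V) (b : L') :
    (e.mapLabels σ).HasLabel v b ↔ ∃ a, e.HasLabel v a ∧ b = σ a := by
  induction e generalizing b with
  | vertex u i => simp [mapLabels, HasLabel]
  | union e f ihe ihf =>
    simp only [mapLabels, HasLabel, ihe, ihf, or_and_right, exists_or]
  | join i j e ih => simpa [mapLabels, HasLabel] using ih b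
  | relabel i j e ih =>
    simp only [mapLabels, HasLabel, ih]
    constructor
    · rintro (⟨⟨a, ha, rfl⟩, hne⟩ | ⟨⟨a, ha, hia⟩, rfl⟩)
      · exact ⟨a, Or.inl ⟨ha, fun h => hne (h ▸ rfl)⟩, rfl⟩
      · exact ⟨j, Or.inr ⟨(hσ hia) ▸ ha, rfl⟩, rfl⟩
    · rintro ⟨a, ⟨ha, hne⟩ | ⟨ha, rfl⟩, rfl⟩
      · exact Or.inl ⟨⟨a, ha, rfl⟩, fun h => hne (hσ h)⟩
      · exact Or.inr ⟨⟨i, ha, rfl⟩, rfl⟩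

theorem adj_mapLabels (hσ : Function.Injective σ) (e : CWExpr V L) (u v : V) :
    (e.mapLabels σ).Adj u v ↔ e.Adj u v := by
  induction e with
  | vertex u i => rfl
  | union e f ihe ihf => simp only [mapLabels, Adj, ihe, ihf]
  | join i j e ih =>
    have key : ∀ w a, (e.mapLabels σ).HasLabel w (σ a) ↔ e.HasLabel w a := fun w a => by
      rw [hasLabel_mapLabels hσ]
      exact ⟨fun ⟨b, hb, h⟩ => hσ h ▸ hb, fun h => ⟨a, h, rfl⟩⟩
    simp only [mapLabels, Adj, ih, key]
  | relabel i j e ih => simpa [mapLabels, Adj] using ih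

theorem wellFormed_mapLabels (hσ : Function.Injective σ) (e : CWExpr V L)
    (h : e.WellFormed) : (e.mapLabels σ).WellFormed := by
  induction e with
  | vertex u i => trivial
  | union e f ihe ihf =>
    exact ⟨ihe h.1, ihf h.2.1, by simpa [verts_mapLabels] using h.2.2⟩
  | join i j e ih => exact ⟨fun hij => h.1 (hσ hij), ih h.2⟩
  | relabel i j e ih => exact ih h

theorem isLinear_mapLabels (e : CWExpr V L) (h : e.IsLinear) : (e.mapLabels σ).IsLinear := by
  induction e with
  | vertex u i => trivial
  | union e f ihe ihf =>
    obtain ⟨h1, v, i, rfl⟩ := h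
    exact ⟨ihe h1, v, σ i, rfl⟩
  | join i j e ih => exact ih h
  | relabel i j e ih => exact ih h

end mapLabels

/-- The well-formed (and, if `lin`, linear) expressions build the labelled graph with vertex set
`T`, adjacency `R` and labelling `l`. -/
def Builds (lin : Prop) (T : Set V) (R : V → V → Prop) (l : V → L) : Prop :=
  ∃ e : CWExpr V L, e.WellFormed ∧ (lin → e.IsLinear) ∧ e.verts = T ∧
    (∀ u v, e.Adj u v ↔ R u v) ∧ ∀ v a, e.HasLabel v a ↔ v ∈ T ∧ a = l v

namespace Builds

variable {lin : Prop} {T D : Set V} {R R' : V → V → Prop} {l l' : V → L}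

theorem congr (h : Builds lin T R l) (hR : ∀ u v, R u v ↔ R' u v)
    (hl : ∀ v ∈ T, l v = l' v) : Builds lin T R' l' := by
  obtain ⟨e, h1, h2, h3, h4, h5⟩ := h
  refine ⟨e, h1, h2, h3, fun u v => (h4 u v).trans (hR u v), fun v a => ?_⟩
  rw [h5]
  exact and_congr_right fun hv => by rw [hl v hv]

theorem single (v : V) (hR : ∀ u w, ¬ R u w) : Builds lin {v} R l :=
  ⟨vertex v (l v), trivial, fun _ => trivial, rfl, fun u w => by simp [Adj, hR],
    fun w a => by
      simp only [HasLabel, Set.mem_singleton_iff]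
      exact and_congr_right fun h => by rw [h]⟩

theorem union (h : Builds lin T R l) (h' : Builds lin D R' l) (hTD : Disjoint T D)
    (hlin : lin → ∃ v, D = {v} ∧ ∀ u w, ¬ R' u w) :
    Builds lin (T ∪ D) (fun u v => R u v ∨ R' u v) l := by
  obtain ⟨e, h1, h2, h3, h4, h5⟩ := h
  by_cases hl : lin
  -- A linear union needs a literal vertex as its second operand, so the given expression for the
  -- singleton is replaced by one.
  · obtain ⟨v, rfl, hR'⟩ := hlin hl
    refine ⟨CWExpr.union e (vertex v (l v)), ⟨h1, trivial, ?_⟩, fun _ => ⟨h2 hl, v, l v, rfl⟩,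
      by simp [verts, h3], fun u w => by simp [Adj, h4, hR'], fun w a => ?_⟩
    · rw [h3]; exact hTD
    · simp only [HasLabel, h5, Set.mem_union, Set.mem_singleton_iff, or_and_right]
      refine or_congr_right (and_congr_right fun h => by rw [h])
  · obtain ⟨e', h1', h2', h3', h4', h5'⟩ := h'
    refine ⟨CWExpr.union e e', ⟨h1, h1', by rwa [h3, h3']⟩, fun h => absurd h hl,
      by simp [verts, h3, h3'], fun u w => by simp [Adj, h4, h4'], fun w a => ?_⟩
    simp only [HasLabel, h5, h5', Set.mem_union, or_and_right]

theorem join (h : Builds lin T R l) {i j : L} (hij : i ≠ j) :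
    Builds lin T (fun u v => R u v ∨ u ∈ T ∧ v ∈ T ∧
      (l u = i ∧ l v = j ∨ l u = j ∧ l v = i)) l := by
  obtain ⟨e, h1, h2, h3, h4, h5⟩ := h
  refine ⟨CWExpr.join i j e, ⟨hij, h1⟩, h2, h3, fun u v => ?_, h5⟩
  simp only [Adj, h4, h5]
  constructor
  · rintro (h | ⟨⟨h, rfl⟩, h', rfl⟩ | ⟨⟨h, rfl⟩, h', rfl⟩)
    · exact Or.inl h
    · exact Or.inr ⟨h, h', Or.inl ⟨rfl, rfl⟩⟩
    · exact Or.inr ⟨h, h', Or.inr ⟨rfl, rfl⟩⟩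
  · rintro (h | ⟨h, h', ⟨rfl, rfl⟩ | ⟨rfl, rfl⟩⟩)
    · exact Or.inl h
    · exact Or.inr (Or.inl ⟨⟨h, rfl⟩, h', rfl⟩)
    · exact Or.inr (Or.inr ⟨⟨h, rfl⟩, h', rfl⟩)

theorem joins (h : Builds lin T R l) (S : Finset (L × L)) (hS : ∀ p ∈ S, p.1 ≠ p.2) :
    Builds lin T (fun u v => R u v ∨ u ∈ T ∧ v ∈ T ∧
      ((l u, l v) ∈ S ∨ (l v, l u) ∈ S)) l := by
  classical
  induction S using Finset.induction_on with
  | empty => exact h.congr (by simp) (fun _ _ => rfl)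
  | insert p S hp ih =>
    refine ((ih fun q hq => hS q (Finset.mem_insert_of_mem hq)).join
      (hS p (Finset.mem_insert_self _ _))).congr (fun u v => ?_) (fun _ _ => rfl)
    obtain ⟨i, j⟩ := p
    simp only [Finset.mem_insert, Prod.mk.injEq]
    tauto

theorem relabel_one (h : Builds lin T R l) [DecidableEq L] (i j : L) :
    Builds lin T R (fun v => if l v = i then j else l v) := by
  obtain ⟨e, h1, h2, h3, h4, h5⟩ := h
  refine ⟨CWExpr.relabel i j e, h1, h2, h3, h4, fun v a => ?_⟩
  simp only [HasLabel, h5]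
  constructor
  · rintro (⟨⟨h, rfl⟩, h'⟩ | ⟨⟨h, rfl⟩, rfl⟩)
    · exact ⟨h, by simp [h']⟩
    · exact ⟨h, by simp⟩
  · rintro ⟨h, rfl⟩
    by_cases hv : l v = i
    · exact Or.inr ⟨⟨h, hv.symm⟩, by simp [hv]⟩
    · exact Or.inl ⟨⟨h, by simp [hv]⟩, by simp [hv]⟩

theorem mapLabels (h : Builds lin T R l) {L' : Type} {σ : L → L'} (hσ : Function.Injective σ) :
    Builds lin T R (σ ∘ l) := by
  obtain ⟨e, h1, h2, h3, h4, h5⟩ := h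
  refine ⟨e.mapLabels σ, wellFormed_mapLabels hσ e h1, fun hl => isLinear_mapLabels e (h2 hl),
    by rw [verts_mapLabels, h3], fun u v => by rw [adj_mapLabels hσ, h4], fun v a => ?_⟩
  rw [hasLabel_mapLabels hσ]
  simp only [h5, Function.comp]
  exact ⟨fun ⟨b, ⟨h, hb⟩, h'⟩ => ⟨h, by rw [h', hb]⟩, fun ⟨h, h'⟩ => ⟨l v, ⟨h, rfl⟩, h'⟩⟩

/-- A relabelling operation merges labels; a permutation comes from renaming the labels throughout
the expression. The induction runs over a set `S` that contains the labels in use: if `f` is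
injective on `S`, it agrees there with a permutation, and otherwise two labels with the same image
are merged first. -/
theorem comp [Finite L] (h : Builds lin T R l) (f : L → L) : Builds lin T R (f ∘ l) := by
  classical
  cases nonempty_fintype L
  suffices H : ∀ (N : ℕ) (l : V → L) (S : Finset L), S.card = N → (∀ v ∈ T, l v ∈ S) →
      Builds lin T R l → Builds lin T R (f ∘ l) from
    H _ l Finset.univ rfl (fun _ _ => Finset.mem_univ _) h
  intro N
  induction N with
  | zero =>
    intro l S hS hl h
    refine h.congr (fun _ _ => Iff.rfl) fun v hv => ?_
    rw [Finset.card_eq_zero.1 hS] at hl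
    exact absurd (hl v hv) (by simp)
  | succ N ih =>
    intro l S hS hl h
    by_cases hinj : Set.InjOn f S
    · have hst : Set.BijOn f S (f '' S) := hinj.bijOn_image
      let e : {x // x ∈ (S : Set L)} ≃ {x // x ∈ f '' (S : Set L)} := hst.equiv
      have hσ := (Equiv.extendSubtype e).injective
      refine (h.mapLabels hσ).congr (fun _ _ => Iff.rfl) fun v hv => ?_
      have := Equiv.extendSubtype_apply_of_mem e (l v) (hl v hv)
      simp only [Function.comp]
      rw [this]
      rfl
    · simp only [Set.InjOn, not_forall] at hinj
      obtain ⟨i, hi, j, hj, hij, hne⟩ := hinj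
      have := ih (fun v => if l v = i then j else l v) (S.erase i)
        (by rw [Finset.card_erase_of_mem hi, hS]; rfl) (fun v hv => by
          by_cases h' : l v = i
          · simp only [h', if_true]; exact Finset.mem_erase.2 ⟨Ne.symm hne, hj⟩
          · simp only [h', if_false]; exact Finset.mem_erase.2 ⟨h', hl v hv⟩) (h.relabel_one i j)
      refine this.congr (fun _ _ => Iff.rfl) fun v hv => ?_
      simp only [Function.comp]
      split_ifs with h'
      · rw [h', hij]
      · rfl

/-- On `T` the labelling `l'` factors through `l`, so `comp` applies; labels that `l` does not use
on `T` get an arbitrary image. -/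
theorem of_factor [Finite L] [Nonempty L] (h : Builds lin T R l)
    (hl : ∀ u ∈ T, ∀ v ∈ T, l u = l v → l' u = l' v) : Builds lin T R l' := by
  classical
  let f : L → L := fun a => if ha : ∃ u ∈ T, l u = a then l' ha.choose else Classical.arbitrary L
  refine (h.comp f).congr (fun _ _ => Iff.rfl) fun v hv => ?_
  have ha : ∃ u ∈ T, l u = l v := ⟨v, hv, rfl⟩
  simp only [f, Function.comp, dif_pos ha]
  exact hl _ ha.choose_spec.1 _ hv ha.choose_spec.2

end Builds

end CWExpr

open CWExpr

/-! ### Reachable vertex sets -/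

section Reach

variable {V : Type} (G : SimpleGraph V)

/-- Two vertices have the same neighbours outside of `T`. -/
def SameType (T : Set V) (u v : V) : Prop :=
  ∀ x, x ∉ T → (G.Adj u x ↔ G.Adj v x)

/-- The induced subgraph on `T`, as a relation. -/
def restr (T : Set V) (u v : V) : Prop :=
  u ∈ T ∧ v ∈ T ∧ G.Adj u v

/-- With `m` labels, every labelling of `T` that is constant on types can be built. -/
def Reach (lin : Prop) (m : ℕ) (T : Set V) : Prop :=
  ∀ l : V → Fin m, (∀ u ∈ T, ∀ v ∈ T, SameType G T u v → l u = l v) →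
    Builds lin T (restr G T) l

/-- The types of `T` can be told apart with `m` labels. -/
def TypesLE (T : Set V) (m : ℕ) : Prop :=
  ∃ f : V → ℕ, (∀ u ∈ T, f u < m) ∧ ∀ u ∈ T, ∀ v ∈ T, f u = f v → SameType G T u v

variable {G} {lin : Prop} {m : ℕ} {T D : Set V}

theorem SameType.symm {u v : V} (h : SameType G T u v) : SameType G T v u :=
  fun x hx => (h x hx).symm

theorem SameType.trans {u v w : V} (h : SameType G T u v) (h' : SameType G T v w) :
    SameType G T u w :=
  fun x hx => (h x hx).trans (h' x hx)

theorem SameType.rfl {u : V} : SameType G T u u := fun _ _ => Iff.rfl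

theorem SameType.mono {u v : V} (h : SameType G T u v) (hTD : T ⊆ D) : SameType G D u v :=
  fun x hx => h x fun hx' => hx (hTD hx')

/-- One labelling at least as fine as the types is enough: every labelling that is constant on types
coarsens it. -/
theorem Reach.of_builds (hm : 0 < m) {l : V → Fin m} (h : Builds lin T (restr G T) l)
    (hl : ∀ u ∈ T, ∀ v ∈ T, l u = l v → SameType G T u v) : Reach G lin m T := by
  intro l' hl'
  have : Nonempty (Fin m) := ⟨⟨0, hm⟩⟩
  exact h.of_factor fun u hu v hv huv => hl' u hu v hv (hl u hu v hv huv)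

/-- Types can be told apart by a labelling that is constant on types. -/
theorem TypesLE.exists_exact (h : TypesLE G T m) :
    ∃ f : V → ℕ, (∀ u ∈ T, f u < m) ∧ ∀ u ∈ T, ∀ v ∈ T, f u = f v ↔ SameType G T u v := by
  classical
  obtain ⟨f, hf, hf'⟩ := h
  let s : Setoid T := ⟨fun u v => SameType G T u v,
    ⟨fun _ => SameType.rfl, fun h => h.symm, fun h h' => h.trans h'⟩⟩
  let g : V → ℕ := fun v => if hv : v ∈ T then f ((Quotient.mk s ⟨v, hv⟩).out : T) else 0
  have hout : ∀ u (hu : u ∈ T), SameType G T ((Quotient.mk s ⟨u, hu⟩).out : T) u :=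
    fun u hu => Quotient.exact (Quotient.out_eq (Quotient.mk s ⟨u, hu⟩))
  refine ⟨g, fun u hu => ?_, fun u hu v hv => ⟨fun h => ?_, fun h => ?_⟩⟩
  · simp only [g, dif_pos hu]; exact hf _ (Subtype.coe_prop _)
  · simp only [g, dif_pos hu, dif_pos hv] at h
    have := hf' _ (Subtype.coe_prop _) _ (Subtype.coe_prop _) h
    exact (hout u hu).symm.trans (this.trans (hout v hv))
  · simp only [g, dif_pos hu, dif_pos hv]
    have : Quotient.mk s ⟨u, hu⟩ = Quotient.mk s ⟨v, hv⟩ := Quotient.sound h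
    rw [this]

/-- Disjoint labelled pieces with a common labelling can be united if the labels determine the
edges between them. -/
theorem CWExpr.Builds.unite {l : V → Fin m} (h : Builds lin T (restr G T) l)
    (h' : Builds lin D (restr G D) l) (hTD : Disjoint T D) (hlin : lin → ∃ v, D = {v})
    (hcons : ∀ a ∈ T, ∀ b ∈ D, G.Adj a b → ∀ a' ∈ T ∪ D, ∀ b' ∈ T ∪ D, l a' = l a → l b' = l b →
      G.Adj a' b') : Builds lin (T ∪ D) (restr G (T ∪ D)) l := by
  classical
  let S : Finset (Fin m × Fin m) := Finset.univ.filter fun p =>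
    ∃ a ∈ T, ∃ b ∈ D, G.Adj a b ∧ l a = p.1 ∧ l b = p.2
  -- If the ends of a cross edge had the same label, `hcons` would make a vertex adjacent to itself.
  have hS : ∀ p ∈ S, p.1 ≠ p.2 := by
    rintro ⟨i, j⟩ hp hij
    simp only [S, Finset.mem_filter, Finset.mem_univ, true_and] at hp
    obtain ⟨a, ha, b, hb, hab, rfl, rfl⟩ := hp
    exact G.loopless.irrefl _ (hcons a ha b hb hab a (Or.inl ha) a (Or.inl ha) rfl hij)
  refine ((h.union h' hTD fun hl => ?_).joins S hS).congr (fun u v => ?_) (fun _ _ => rfl)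
  · obtain ⟨v, rfl⟩ := hlin hl
    refine ⟨v, rfl, ?_⟩
    rintro u w ⟨hu, hw, huw⟩
    rw [Set.mem_singleton_iff.1 hu, Set.mem_singleton_iff.1 hw] at huw
    exact G.loopless.irrefl _ huw
  · simp only [S, Finset.mem_filter, Finset.mem_univ, true_and, restr]
    constructor
    · rintro ((⟨h1, h2, h3⟩ | ⟨h1, h2, h3⟩) | ⟨hu, hv, ⟨a, ha, b, hb, hab, h1, h2⟩ |
        ⟨a, ha, b, hb, hab, h1, h2⟩⟩)
      · exact ⟨Or.inl h1, Or.inl h2, h3⟩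
      · exact ⟨Or.inr h1, Or.inr h2, h3⟩
      · exact ⟨hu, hv, hcons a ha b hb hab u hu v hv h1.symm h2.symm⟩
      · exact ⟨hu, hv, (hcons a ha b hb hab v hv u hu h1.symm h2.symm).symm⟩
    · rintro ⟨hu | hu, hv | hv, huv⟩
      · exact Or.inl (Or.inl ⟨hu, hv, huv⟩)
      · exact Or.inr ⟨Or.inl hu, Or.inr hv, Or.inl ⟨u, hu, v, hv, huv, rfl, rfl⟩⟩
      · exact Or.inr ⟨Or.inr hu, Or.inl hv, Or.inr ⟨v, hv, u, hu, huv.symm, rfl, rfl⟩⟩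
      · exact Or.inl (Or.inr ⟨hu, hv, huv⟩)

theorem builds_single {l : V → Fin m} (v : V) : Builds lin {v} (restr G {v}) l :=
  Builds.single v fun u w h => by
    obtain ⟨hu, hw, huw⟩ := h
    rw [Set.mem_singleton_iff.1 hu, Set.mem_singleton_iff.1 hw] at huw
    exact G.loopless.irrefl _ huw

theorem Reach.single (v : V) : Reach G lin m {v} := fun _ _ => builds_single v

/-- A set with at most `m` types can be extended by any vertex if there are `m + 1` labels. -/
theorem Reach.insert (h : Reach G lin (m + 1) T) (hT : TypesLE G T m) (x : V) (hx : x ∉ T) :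
    Reach G lin (m + 1) (insert x T) := by
  classical
  obtain ⟨f, hf, hf'⟩ := hT.exists_exact
  -- The types of `T` use the labels below `m`; the last label is the default elsewhere and thus
  -- belongs to `x`.
  let l : V → Fin (m + 1) := fun v =>
    if hv : v ∈ T then ⟨f v, (hf v hv).trans (Nat.lt_succ_self m)⟩ else Fin.last m
  have hlT : ∀ u ∈ T, (l u : ℕ) = f u := fun u hu => by simp [l, hu]
  have hlx : l x = Fin.last m := by simp [l, hx]
  have hne : ∀ u ∈ T, l u ≠ l x := fun u hu h => by
    have := hf u hu
    rw [← hlT u hu, h, hlx] at this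
    simp at this
  have hb : Builds lin T (restr G T) l := h l fun u hu v hv huv => by
    apply Fin.ext
    rw [hlT u hu, hlT v hv]
    exact (hf' u hu v hv).2 huv
  have heq : ∀ u ∈ T, ∀ v ∈ T, l u = l v → SameType G T u v := fun u hu v hv huv =>
    (hf' u hu v hv).1 (by rw [← hlT u hu, ← hlT v hv, huv])
  have hun : Builds lin (T ∪ {x}) (restr G (T ∪ {x})) l := by
    refine hb.unite (builds_single x) (by simpa using hx) (fun _ => ⟨x, rfl⟩) ?_
    rintro a ha b hb hab a' ha' b' hb' h1 h2
    obtain rfl : b = x := hb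
    have hb'x : b' = b := by
      rcases hb' with hb' | hb'
      · exact absurd h2 (hne b' hb')
      · exact hb'
    have ha'T : a' ∈ T := by
      rcases ha' with ha' | ha'
      · exact ha'
      · rw [Set.mem_singleton_iff.1 ha'] at h1
        exact absurd h1.symm (hne a ha)
    rw [hb'x]
    exact (heq a' ha'T a ha h1 b hx).2 hab
  have hset : T ∪ {x} = Insert.insert x T := by rw [Set.union_comm]; rfl
  rw [hset] at hun
  refine Reach.of_builds (Nat.succ_pos m) hun ?_
  rintro u (rfl | hu) v (rfl | hv) huv
  · exact SameType.rfl
  · exact absurd huv.symm (hne v hv)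
  · exact absurd huv (hne u hu)
  · exact (heq u hu v hv huv).mono (Set.subset_insert _ _)

/-- A vertex `x` may take over the label of a vertex `u` of `T` with the same outside neighbours
if its neighbours in `T` are neighbours of `u`. -/
theorem Reach.insert_compat (h : Reach G lin m T) (hT : TypesLE G T m) (x u : V) (hx : x ∉ T)
    (hu : u ∈ T) (hux : ¬ G.Adj u x) (hout : SameType G (Insert.insert x T) u x)
    (hin : ∀ v ∈ T, G.Adj x v → G.Adj u v)
    (hin' : ∀ v ∈ T, SameType G T v u → ¬ G.Adj v x ∧ ∀ w ∈ T, G.Adj x w → G.Adj v w) :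
    Reach G lin m (Insert.insert x T) := by
  classical
  obtain ⟨f, hf, hf'⟩ := hT.exists_exact
  have hm : 0 < m := lt_of_le_of_lt (Nat.zero_le _) (hf u hu)
  let l : V → Fin m := fun v =>
    if hv : v ∈ T then ⟨f v, hf v hv⟩ else ⟨f u, hf u hu⟩
  have hlT : ∀ u ∈ T, (l u : ℕ) = f u := fun u hu => by simp [l, hu]
  have hlx : l x = l u := by simp [l, hx, hu]
  have hb : Builds lin T (restr G T) l := h l fun u hu v hv huv => by
    apply Fin.ext
    rw [hlT u hu, hlT v hv]
    exact (hf' u hu v hv).2 huv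
  have heq : ∀ u ∈ T, ∀ v ∈ T, l u = l v → SameType G T u v := fun u hu v hv huv =>
    (hf' u hu v hv).1 (by rw [← hlT u hu, ← hlT v hv, huv])
  have hun : Builds lin (T ∪ {x}) (restr G (T ∪ {x})) l := by
    refine hb.unite (builds_single x) (by simpa using hx) (fun _ => ⟨x, rfl⟩) ?_
    rintro a ha b hb hab a' ha' b' hb' h1 h2
    obtain rfl : b = x := hb
    -- No vertex of the type of `u` is adjacent to `x`, so `x` is never joined to its own label. The
    -- joins for `x` also reach the vertices labelled like `u`, and by `hin'` these edges belong to
    -- `G`.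
    have hau : ¬ SameType G T a u := fun hs => (hin' a ha hs).1 hab
    have ha'T : a' ∈ T := by
      rcases ha' with ha' | ha'
      · exact ha'
      · rw [Set.mem_singleton_iff.1 ha', hlx] at h1
        exact absurd (heq u hu a ha h1).symm hau
    have haa' := heq a' ha'T a ha h1
    rcases hb' with hb' | hb'
    · rw [hlx] at h2
      have hb'u := heq b' hb' u hu h2
      exact ((hin' b' hb' hb'u).2 a' ha'T ((haa' b hx).2 hab).symm).symm
    · rw [Set.mem_singleton_iff.1 hb']
      exact (haa' b hx).2 hab
  have hset : T ∪ {x} = Insert.insert x T := by rw [Set.union_comm]; rfl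
  rw [hset] at hun
  refine Reach.of_builds hm hun ?_
  have hsub := Set.subset_insert x T
  rintro a (rfl | ha) b (rfl | hb) hab
  · exact SameType.rfl
  · rw [hlx] at hab
    exact hout.symm.trans ((heq u hu b hb hab).mono hsub)
  · rw [hlx] at hab
    exact ((heq a ha u hu hab).mono hsub).trans hout
  · exact (heq a ha b hb hab).mono hsub


end Reach

/-! ### Induced subgraphs -/

/-- The restriction of an expression along an injection. -/
theorem CWExpr.exists_restrict {V W L : Type} (i : W → V) (hi : Function.Injective i)
    (e : CWExpr V L) (he : e.WellFormed) (hne : ∃ w, i w ∈ e.verts) :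
    ∃ e' : CWExpr W L, e'.WellFormed ∧ (e.IsLinear → e'.IsLinear) ∧
      (∀ w, w ∈ e'.verts ↔ i w ∈ e.verts) ∧ (∀ w a, e'.HasLabel w a ↔ e.HasLabel (i w) a) ∧
      ∀ w w', e'.Adj w w' ↔ e.Adj (i w) (i w') := by
  have hadj : ∀ (e : CWExpr V L) (u v : V), e.Adj u v → u ∈ e.verts ∧ v ∈ e.verts := by
    intro e
    induction e with
    | vertex u i => exact fun _ _ h => h.elim
    | union e f ihe ihf =>
      rintro u v (h | h)
      · exact (ihe u v h).imp Or.inl Or.inl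
      · exact (ihf u v h).imp Or.inr Or.inr
    | join i j e ih =>
      rintro u v (h | ⟨h, h'⟩ | ⟨h, h'⟩)
      · exact ih u v h
      · exact ⟨hasLabel_mem_verts e h, hasLabel_mem_verts e h'⟩
      · exact ⟨hasLabel_mem_verts e h, hasLabel_mem_verts e h'⟩
    | relabel i j e ih => exact ih
  induction e with
  | vertex u a =>
    obtain ⟨w, rfl⟩ := hne
    refine ⟨vertex w a, trivial, fun _ => trivial, fun x => ?_, fun x b => ?_, fun _ _ => Iff.rfl⟩
    · exact ⟨fun h => congrArg i h, fun h => hi h⟩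
    · exact and_congr_left fun _ => ⟨fun h => congrArg i h, fun h => hi h⟩
  | union e f ihe ihf =>
    by_cases h1 : ∃ w, i w ∈ e.verts
    · obtain ⟨e', a1, a2, a3, a4, a5⟩ := ihe he.1 h1
      by_cases h2 : ∃ w, i w ∈ f.verts
      · obtain ⟨f', b1, b2, b3, b4, b5⟩ := ihf he.2.1 h2
        have hdis : Disjoint e'.verts f'.verts := by
          rw [Set.disjoint_left]
          exact fun w hw hw' => Set.disjoint_left.1 he.2.2 ((a3 w).1 hw) ((b3 w).1 hw')
        -- To keep linearity, a second operand that is a vertex has to become a vertex again; `f'`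
        -- is not known to be one.
        by_cases hf : ∃ v c, f = vertex v c
        · obtain ⟨v, c, rfl⟩ := hf
          obtain ⟨w, rfl⟩ := h2
          have key : ∀ x, x = w ↔ i x = i w := fun x =>
            ⟨fun h => congrArg i h, fun h => hi h⟩
          refine ⟨union e' (vertex w c), ⟨a1, trivial, ?_⟩, fun h => ⟨a2 h.1, w, c, rfl⟩,
            fun x => or_congr (a3 x) (key x), fun x a => or_congr (a4 x a)
            (and_congr_left fun _ => key x), fun x y => or_congr (a5 x y) Iff.rfl⟩
          rw [Set.disjoint_right] at hdis ⊢
          intro x hx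
          exact hdis ((b3 x).2 ((key x).1 hx))
        · exact ⟨union e' f', ⟨a1, b1, hdis⟩, fun h => absurd h.2 hf,
            fun w => or_congr (a3 w) (b3 w), fun w a => or_congr (a4 w a) (b4 w a),
            fun w w' => or_congr (a5 w w') (b5 w w')⟩
      · refine ⟨e', a1, fun h => a2 h.1, fun w => ?_, fun w a => ?_, fun w w' => ?_⟩
        · exact (a3 w).trans ⟨Or.inl, fun h => h.resolve_right fun h' => h2 ⟨w, h'⟩⟩
        · exact (a4 w a).trans ⟨Or.inl, fun h => h.resolve_right fun h' =>
            h2 ⟨w, hasLabel_mem_verts f h'⟩⟩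
        · exact (a5 w w').trans ⟨Or.inl, fun h => h.resolve_right fun h' =>
            h2 ⟨w, (hadj f _ _ h').1⟩⟩
    · have h2 : ∃ w, i w ∈ f.verts :=
        hne.imp fun w hw => hw.resolve_left fun h => h1 ⟨w, h⟩
      obtain ⟨f', b1, b2, b3, b4, b5⟩ := ihf he.2.1 h2
      refine ⟨f', b1, ?_, fun w => ?_, fun w a => ?_, fun w w' => ?_⟩
      · rintro ⟨-, v, c, rfl⟩
        exact b2 trivial
      · exact (b3 w).trans ⟨Or.inr, fun h => h.resolve_left fun h' => h1 ⟨w, h'⟩⟩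
      · exact (b4 w a).trans ⟨Or.inr, fun h => h.resolve_left fun h' =>
          h1 ⟨w, hasLabel_mem_verts e h'⟩⟩
      · exact (b5 w w').trans ⟨Or.inr, fun h => h.resolve_left fun h' =>
          h1 ⟨w, (hadj e _ _ h').1⟩⟩
  | join a b e ih =>
    obtain ⟨e', a1, a2, a3, a4, a5⟩ := ih he.2 hne
    refine ⟨join a b e', ⟨he.1, a1⟩, a2, a3, a4, fun w w' => ?_⟩
    simp only [Adj, a4, a5]
  | relabel a b e ih =>
    obtain ⟨e', a1, a2, a3, a4, a5⟩ := ih he hne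
    refine ⟨relabel a b e', a1, a2, a3, fun w c => ?_, a5⟩
    simp only [HasLabel, a4]

theorem Reach.exists_defines {V W : Type} {G : SimpleGraph V} {H : SimpleGraph W} {lin : Prop}
    {m : ℕ} {T : Set V} (h : Reach G lin m T) (hm : 0 < m) (i : W → V)
    (hi : Function.Injective i) (hH : ∀ a b, H.Adj a b ↔ G.Adj (i a) (i b)) (hT : ∀ w, i w ∈ T) :
    IsEmpty W ∨ ∃ e : CWExpr W (Fin m), (lin → e.IsLinear) ∧ e.Defines H := by
  rcases isEmpty_or_nonempty W with hW | ⟨⟨w⟩⟩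
  · exact Or.inl hW
  · obtain ⟨e, h1, h2, h3, h4, -⟩ := h (fun _ => ⟨0, hm⟩) fun _ _ _ _ _ => _root_.rfl
    obtain ⟨e', a1, a2, a3, -, a5⟩ := e.exists_restrict i hi h1 ⟨w, h3 ▸ hT w⟩
    refine Or.inr ⟨e', fun hl => a2 (h2 hl), a1, ?_, fun u v => ?_⟩
    · ext x
      simp only [Set.mem_univ, a3, h3, hT]
    · rw [a5, h4, hH]
      exact ⟨fun h => h.2.2, fun h => ⟨hT u, hT v, h⟩⟩

theorem cliqueWidth_le_of_reach {V W : Type} {G : SimpleGraph V} {H : SimpleGraph W} {lin : Prop}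
    {m : ℕ} {T : Set V} (h : Reach G lin (m + 1) T) (i : W → V)
    (hi : Function.Injective i) (hH : ∀ a b, H.Adj a b ↔ G.Adj (i a) (i b)) (hT : ∀ w, i w ∈ T) :
    cliqueWidth H ≤ (m : ℕ∞) + 1 := by
  have := h.exists_defines (Nat.succ_pos m) i hi hH hT
  exact iInf₂_le_of_le (m + 1) (this.imp id fun ⟨e, he⟩ => ⟨e, he.2⟩) (by push_cast; exact le_rfl)

theorem linearCliqueWidth_le_of_reach {V W : Type} {G : SimpleGraph V} {H : SimpleGraph W}
    {m : ℕ} {T : Set V} (h : Reach G True (m + 1) T) (i : W → V)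
    (hi : Function.Injective i) (hH : ∀ a b, H.Adj a b ↔ G.Adj (i a) (i b)) (hT : ∀ w, i w ∈ T) :
    linearCliqueWidth H ≤ (m : ℕ∞) + 1 := by
  have := h.exists_defines (Nat.succ_pos m) i hi hH hT
  exact iInf₂_le_of_le (m + 1) (this.imp id fun ⟨e, he⟩ => ⟨e, he.1 trivial, he.2⟩)
    (by push_cast; exact le_rfl)

theorem CWExpr.Defines.mapLabels {V L L' : Type} {G : SimpleGraph V} {e : CWExpr V L}
    (h : e.Defines G) {σ : L → L'} (hσ : Function.Injective σ) : (e.mapLabels σ).Defines G :=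
  ⟨wellFormed_mapLabels hσ e h.1, by rw [verts_mapLabels, h.2.1],
    fun u v => by rw [adj_mapLabels hσ, h.2.2]⟩

/-- A bound on the infimum gives an expression with at most `m` labels, which embed into `Fin m`. A
vertex is needed, since an empty graph satisfies the condition without an expression. The parameter
`lin` treats both widths at once. -/
theorem exists_defines_of_iInf_le {V : Type} [Nonempty V] {G : SimpleGraph V} {lin : Prop} {m : ℕ}
    (h : ⨅ (k : ℕ) (_ : IsEmpty V ∨ ∃ e : CWExpr V (Fin k), (lin → e.IsLinear) ∧ e.Defines G),
      (k : ℕ∞) ≤ (m : ℕ∞)) :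
    ∃ e : CWExpr V (Fin m), (lin → e.IsLinear) ∧ e.Defines G := by
  by_contra hcon
  have : ((m + 1 : ℕ) : ℕ∞) ≤ ⨅ (k : ℕ)
      (_ : IsEmpty V ∨ ∃ e : CWExpr V (Fin k), (lin → e.IsLinear) ∧ e.Defines G), (k : ℕ∞) := by
    refine le_iInf₂ fun k hk => ?_
    by_contra hlt
    have hkm : k ≤ m := by
      rw [Nat.cast_le] at hlt
      omega
    obtain ⟨e, he, he'⟩ := hk.resolve_left (not_isEmpty_of_nonempty V)
    exact hcon ⟨e.mapLabels (Fin.castLE hkm), fun hl => isLinear_mapLabels e (he hl),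
      he'.mapLabels (Fin.castLE_injective hkm)⟩
  have h' := this.trans h
  rw [Nat.cast_le] at h'
  omega

/-- If the clique-width is at most `m`, then some expression with `m` labels defines the graph. -/
theorem exists_defines_of_cliqueWidth_le {V : Type} [Nonempty V] {G : SimpleGraph V} {m : ℕ}
    (h : cliqueWidth G ≤ (m : ℕ∞)) : ∃ e : CWExpr V (Fin m), e.Defines G := by
  obtain ⟨e, -, he⟩ := exists_defines_of_iInf_le (G := G) (lin := False) (m := m)
    (by simpa [cliqueWidth] using h)
  exact ⟨e, he⟩

theorem exists_defines_of_linearCliqueWidth_le {V : Type} [Nonempty V] {G : SimpleGraph V} {m : ℕ}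
    (h : linearCliqueWidth G ≤ (m : ℕ∞)) :
    ∃ e : CWExpr V (Fin m), e.IsLinear ∧ e.Defines G := by
  obtain ⟨e, h1, he⟩ := exists_defines_of_iInf_le (G := G) (lin := True) (m := m)
    (by simpa [linearCliqueWidth] using h)
  exact ⟨e, h1 trivial, he⟩

theorem cliqueWidth_le_linearCliqueWidth {V : Type} (G : SimpleGraph V) :
    cliqueWidth G ≤ linearCliqueWidth G :=
  le_iInf₂ fun k hk => iInf₂_le k (hk.imp id fun ⟨e, he⟩ => ⟨e, he.2⟩)

open CWExpr

/-! ### Lower bounds -/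

/-- The disjoint sets `A` and `B` can be united with `m` labels in an expression for `G`: there are
labels at the union that determine the neighbours outside of `A ∪ B` and the edges between `A`
and `B`. -/
def Unitable {V : Type} (G : SimpleGraph V) (m : ℕ) (A B : Set V) : Prop :=
  Disjoint A B ∧ ∃ l : V → Fin m, ∃ J : Fin m → Fin m → Prop, (∀ a, ¬ J a a) ∧
    (∀ a b, J a b → J b a) ∧
    (∀ u ∈ A ∪ B, ∀ v ∈ A ∪ B, l u = l v → SameType G (A ∪ B) u v) ∧
    (∀ u ∈ A ∪ B, ∀ v ∈ A ∪ B, J (l u) (l v) → G.Adj u v) ∧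
    ∀ a ∈ A, ∀ b ∈ B, G.Adj a b ↔ J (l a) (l b)

namespace CWExpr

variable {V L : Type}

theorem verts_nonempty (e : CWExpr V L) : e.verts.Nonempty := by
  induction e with
  | vertex u i => exact ⟨u, rfl⟩
  | union e f ihe ihf => exact ihe.inl
  | join i j e ih => exact ih
  | relabel i j e ih => exact ih

theorem Adj.mem_verts {e : CWExpr V L} {u v : V} (h : e.Adj u v) :
    u ∈ e.verts ∧ v ∈ e.verts := by
  induction e with
  | vertex u i => exact h.elim
  | union e f ihe ihf =>
    rcases h with h | h
    · exact (ihe h).imp Or.inl Or.inl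
    · exact (ihf h).imp Or.inr Or.inr
  | join i j e ih =>
    rcases h with h | ⟨h, h'⟩ | ⟨h, h'⟩
    · exact ih h
    · exact ⟨hasLabel_mem_verts e h, hasLabel_mem_verts e h'⟩
    · exact ⟨hasLabel_mem_verts e h, hasLabel_mem_verts e h'⟩
  | relabel i j e ih => exact ih h

theorem exists_hasLabel (e : CWExpr V L) {v : V} (hv : v ∈ e.verts) : ∃ a, e.HasLabel v a := by
  classical
  induction e with
  | vertex u i => exact ⟨i, hv, rfl⟩
  | union e f ihe ihf =>
    rcases hv with hv | hv
    · exact (ihe hv).imp fun _ => Or.inl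
    · exact (ihf hv).imp fun _ => Or.inr
  | join i j e ih => exact ih hv
  | relabel i j e ih =>
    obtain ⟨a, ha⟩ := ih hv
    by_cases h : a = i
    · exact ⟨j, Or.inr ⟨h ▸ ha, rfl⟩⟩
    · exact ⟨a, Or.inl ⟨ha, h⟩⟩

theorem WellFormed.hasLabel_unique {e : CWExpr V L} (he : e.WellFormed) {v : V} {a b : L}
    (ha : e.HasLabel v a) (hb : e.HasLabel v b) : a = b := by
  induction e generalizing a b with
  | vertex u i => rw [ha.2, hb.2]
  | union e f ihe ihf =>
    rcases ha with ha | ha <;> rcases hb with hb | hb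
    · exact ihe he.1 ha hb
    · exact absurd (hasLabel_mem_verts f hb)
        (Set.disjoint_left.1 he.2.2 (hasLabel_mem_verts e ha))
    · exact absurd (hasLabel_mem_verts f ha)
        (Set.disjoint_left.1 he.2.2 (hasLabel_mem_verts e hb))
    · exact ihf he.2.1 ha hb
  | join i j e ih => exact ih he.2 ha hb
  | relabel i j e ih =>
    rcases ha with ⟨ha, hai⟩ | ⟨ha, rfl⟩ <;> rcases hb with ⟨hb, hbi⟩ | ⟨hb, rfl⟩
    · exact ih he ha hb
    · exact absurd (ih he ha hb) hai
    · exact absurd (ih he hb ha) hbi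
    · rfl

/-- A family of vertex sets that contains the singletons and is closed under the unions that are
possible with `m` labels contains the vertex set of every graph defined with `m` labels. -/
theorem Defines.mem_family {G : SimpleGraph V} {m : ℕ} {e : CWExpr V (Fin m)} (he : e.Defines G)
    {lin : Prop} (hlin : lin → e.IsLinear) (F : Set V → Prop) (hsingle : ∀ v, F {v})
    (hunion : ∀ A B, F A → F B → A.Nonempty → B.Nonempty → (lin → ∃ v, B = {v}) →
      Unitable G m A B → F (A ∪ B)) : F Set.univ := by
  classical
  -- Induction over a subexpression in its context: `J a b` says that the rest of the expression
  -- joins the present labels `a` and `b`, and `O a` consists of the outside neighbours of label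
  -- `a`. At the root both are empty.
  suffices H : ∀ (e : CWExpr V (Fin m)) (J : Fin m → Fin m → Prop) (O : Fin m → V → Prop),
      e.WellFormed → (lin → e.IsLinear) → (∀ a, ¬ J a a) → (∀ a b, J a b → J b a) →
      (∀ u v a b, e.HasLabel u a → e.HasLabel v b → (G.Adj u v ↔ e.Adj u v ∨ J a b)) →
      (∀ u a x, e.HasLabel u a → x ∉ e.verts → (G.Adj u x ↔ O a x)) → F e.verts by
    have := H e (fun _ _ => False) (fun _ _ => False) he.1 hlin (fun _ => id) (fun _ _ => id)
      (fun u v a b _ _ => by rw [he.2.2, or_false])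
      (fun u a x _ hx => absurd (Set.mem_univ x) (he.2.1 ▸ hx))
    rwa [he.2.1] at this
  intro e
  induction e with
  | vertex u i => intros; exact hsingle u
  | union e f ihe ihf =>
    intro J O hw hl hJ hJs hin hout
    have hnot : ∀ x ∈ f.verts, x ∉ e.verts := fun _ h => Set.disjoint_right.1 hw.2.2 h
    have hnot' : ∀ x ∈ e.verts, x ∉ f.verts := fun _ h => Set.disjoint_left.1 hw.2.2 h
    have hcross : ∀ u v a b, e.HasLabel u a → f.HasLabel v b → (G.Adj u v ↔ J a b) := by
      intro u v a b hu hv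
      rw [hin u v a b (Or.inl hu) (Or.inr hv)]
      refine ⟨fun h => h.resolve_left ?_, Or.inr⟩
      rintro (h | h)
      · exact hnot v (hasLabel_mem_verts f hv) h.mem_verts.2
      · exact hnot' u (hasLabel_mem_verts e hu) h.mem_verts.1
    refine hunion _ _ ?_ ?_ e.verts_nonempty f.verts_nonempty ?_ ⟨hw.2.2, ?_⟩
    -- Seen from `e`, the vertices of `f` are outside, and those that label `a` is joined to later
    -- are the ones whose label `b` satisfies `J a b`.
    · refine ihe J (fun a x => if x ∈ f.verts then ∃ b, f.HasLabel x b ∧ J a b else O a x)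
        hw.1 (fun h => (hl h).1) hJ hJs (fun u v a b hu hv => ?_) fun u a x hu hx => ?_
      · rw [hin u v a b (Or.inl hu) (Or.inl hv)]
        refine or_congr_left ⟨fun h => h.resolve_right fun h' => ?_, Or.inl⟩
        exact hnot' u (hasLabel_mem_verts e hu) h'.mem_verts.1
      · by_cases hxf : x ∈ f.verts
        · simp only [hxf, if_true]
          obtain ⟨b, hb⟩ := f.exists_hasLabel hxf
          rw [hcross u x a b hu hb]
          exact ⟨fun h => ⟨b, hb, h⟩, fun ⟨c, hc, h⟩ => hw.2.1.hasLabel_unique hc hb ▸ h⟩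
        · simp only [hxf, if_false]
          exact hout u a x (Or.inl hu) fun h => h.elim hx hxf
    · by_cases hlin' : lin
      · obtain ⟨-, v, i, rfl⟩ := hl hlin'
        exact hsingle v
      refine ihf J (fun a x => if x ∈ e.verts then ∃ b, e.HasLabel x b ∧ J a b else O a x)
        hw.2.1 (fun h => absurd h hlin') hJ hJs (fun u v a b hu hv => ?_) fun u a x hu hx => ?_
      · rw [hin u v a b (Or.inr hu) (Or.inr hv)]
        refine or_congr_left ⟨fun h => h.resolve_left fun h' => ?_, Or.inr⟩
        exact hnot u (hasLabel_mem_verts f hu) h'.mem_verts.1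
      · by_cases hxe : x ∈ e.verts
        · simp only [hxe, if_true]
          obtain ⟨b, hb⟩ := e.exists_hasLabel hxe
          rw [G.adj_comm, hcross x u b a hb hu]
          exact ⟨fun h => ⟨b, hb, hJs _ _ h⟩,
            fun ⟨c, hc, h⟩ => hJs _ _ (hw.1.hasLabel_unique hc hb ▸ h)⟩
        · simp only [hxe, if_false]
          exact hout u a x (Or.inr hu) fun h => h.elim hxe hx
    · intro h
      obtain ⟨-, v, i, rfl⟩ := hl h
      exact ⟨v, rfl⟩
    · obtain ⟨x, hx⟩ := e.verts_nonempty
      obtain ⟨c, -⟩ := e.exists_hasLabel hx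
      let l : V → Fin m := fun v =>
        if hv : ∃ a, (CWExpr.union e f).HasLabel v a then hv.choose else c
      have hlab : ∀ v ∈ e.verts ∪ f.verts, (CWExpr.union e f).HasLabel v (l v) := by
        intro v hv
        have h : ∃ a, (CWExpr.union e f).HasLabel v a :=
          (CWExpr.union e f).exists_hasLabel hv
        simp only [l, dif_pos h]
        exact h.choose_spec
      refine ⟨l, J, hJ, hJs, fun u hu v hv huv x hx => ?_, fun u hu v hv h => ?_,
        fun a ha b hb => ?_⟩
      · rw [hout u _ x (hlab u hu) hx, hout v _ x (hlab v hv) hx, huv]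
      · exact (hin u v _ _ (hlab u hu) (hlab v hv)).2 (Or.inr h)
      · exact hcross a b _ _
          ((hlab a (Or.inl ha)).resolve_right fun h => hnot' a ha (hasLabel_mem_verts f h))
          ((hlab b (Or.inr hb)).resolve_left fun h => hnot b hb (hasLabel_mem_verts e h))
  | join i j e ih =>
    intro J O hw hl hJ hJs hin hout
    -- Below a join, its own pair of labels is among the joins still to come.
    refine ih (fun a b => J a b ∨ (a = i ∧ b = j) ∨ (a = j ∧ b = i)) O hw.2 hl ?_ ?_ ?_ hout
    · rintro a (h | ⟨h, h'⟩ | ⟨h, h'⟩)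
      · exact hJ a h
      · exact hw.1 (h.symm.trans h')
      · exact hw.1 (h'.symm.trans h)
    · rintro a b (h | ⟨h, h'⟩ | ⟨h, h'⟩)
      · exact Or.inl (hJs _ _ h)
      · exact Or.inr (Or.inr ⟨h', h⟩)
      · exact Or.inr (Or.inl ⟨h', h⟩)
    · intro u v a b hu hv
      rw [hin u v a b hu hv]
      have h1 : ∀ c, e.HasLabel u c ↔ a = c := fun c =>
        ⟨fun h => hw.2.hasLabel_unique hu h, fun h => h ▸ hu⟩
      have h2 : ∀ c, e.HasLabel v c ↔ b = c := fun c =>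
        ⟨fun h => hw.2.hasLabel_unique hv h, fun h => h ▸ hv⟩
      simp only [Adj, h1, h2]
      tauto
  | relabel i j e ih =>
    intro J O hw hl hJ hJs hin hout
    have hlab : ∀ u a, e.HasLabel u a →
        (CWExpr.relabel i j e).HasLabel u (if a = i then j else a) := by
      intro u a ha
      by_cases h : a = i
      · simp only [h, if_true]; exact Or.inr ⟨h ▸ ha, rfl⟩
      · simp only [h, if_false]; exact Or.inl ⟨ha, h⟩
    -- Below a relabelling, the future of a label is that of the label it is turned into.
    exact ih (fun a b => J (if a = i then j else a) (if b = i then j else b))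
      (fun a x => O (if a = i then j else a) x) hw hl (fun a => hJ _) (fun a b => hJs _ _)
      (fun u v a b hu hv => hin u v _ _ (hlab u a hu) (hlab v b hv))
      (fun u a x hu hx => hout u _ x (hlab u a hu) hx)

end CWExpr

open CWExpr

/-! ### Adjacency in `S_k` -/

namespace SVertex

variable {k : ℕ}

theorem adj_v_v (i j : Fin (sSize k)) : (graphS k).Adj (v i) (v j) ↔
    (i : ℕ) ≠ j ∧ (i : ℕ) ≤ j + k ∧ (j : ℕ) ≤ i + k := by
  simp only [graphS, SimpleGraph.fromRel_adj, ne_eq, v.injEq, Fin.ext_iff]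
  constructor
  · rintro ⟨hne, h | h⟩ <;> cases h <;> simp only [Fin.lt_def] at * <;> omega
  · rintro ⟨hne, h1, h2⟩
    refine ⟨hne, ?_⟩
    rcases lt_or_gt_of_ne hne with h | h
    · exact Or.inl (Edge.power i j h (by omega))
    · exact Or.inr (Edge.power j i h (by omega))

theorem adj_v_w₁ (i : Fin (sSize k)) : ¬ (graphS k).Adj (v i) w₁ := by
  rintro ⟨-, h | h⟩ <;> cases h

theorem adj_v_w₂ (i : Fin (sSize k)) : (graphS k).Adj (v i) w₂ ↔ (i : ℕ) = 0 := by
  constructor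
  · rintro ⟨-, h | h⟩ <;> cases h
    assumption
  · exact fun h => ⟨by simp, Or.inr (Edge.w₂v i h)⟩

theorem adj_v_w₃ (i : Fin (sSize k)) : (graphS k).Adj (v i) w₃ ↔ (i : ℕ) + 1 = sSize k := by
  constructor
  · rintro ⟨-, h | h⟩ <;> cases h
    assumption
  · exact fun h => ⟨by simp, Or.inl (Edge.vw₃ i h)⟩

theorem adj_v_w₄ (i : Fin (sSize k)) : ¬ (graphS k).Adj (v i) w₄ := by
  rintro ⟨-, h | h⟩ <;> cases h

theorem adj_w₁_w₂ : (graphS k).Adj w₁ w₂ := ⟨by simp, Or.inl Edge.w₁w₂⟩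

theorem adj_w₃_w₄ : (graphS k).Adj w₃ w₄ := ⟨by simp, Or.inl Edge.w₃w₄⟩

theorem not_adj_w₁_w₃ : ¬ (graphS k).Adj w₁ w₃ := by rintro ⟨-, h | h⟩ <;> cases h

theorem not_adj_w₁_w₄ : ¬ (graphS k).Adj w₁ w₄ := by rintro ⟨-, h | h⟩ <;> cases h

theorem not_adj_w₂_w₃ : ¬ (graphS k).Adj w₂ w₃ := by rintro ⟨-, h | h⟩ <;> cases h

theorem not_adj_w₂_w₄ : ¬ (graphS k).Adj w₂ w₄ := by rintro ⟨-, h | h⟩ <;> cases h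

end SVertex

theorem Unitable.symm {V : Type} {G : SimpleGraph V} {m : ℕ} {A B : Set V}
    (h : Unitable G m A B) : Unitable G m B A := by
  obtain ⟨hdis, l, J, hJ, hJs, hout, hin, hcross⟩ := h
  rw [Set.union_comm] at hout hin
  exact ⟨hdis.symm, l, J, hJ, hJs, hout, hin, fun a ha b hb => by
    rw [SimpleGraph.adj_comm, hcross b hb a ha]
    exact ⟨hJs _ _, hJs _ _⟩⟩

/-! ### The graph `S_2` has clique-width at least four -/

namespace STwo

/-- A numbering of the vertices of `S_2`. -/
def idx : SVertex 2 → ℕ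
  | .v i => i
  | .w₁ => 5
  | .w₂ => 6
  | .w₃ => 7
  | .w₄ => 8

/-- The neighbourhoods in `S_2` as bit masks. -/
def nbMask (u : ℕ) : ℕ :=
  [70, 13, 27, 22, 140, 64, 33, 272, 128].getD u 0

/-- The bit `v` of `m`. -/
def bit (m v : ℕ) : Bool := Nat.beq (Nat.land (Nat.shiftRight m v) 1) 1

/-- The vertices `u` and `v` need different labels at the union of `a` and `b`. -/
def conflict (a b u v : ℕ) : Bool :=
  !(Nat.beq (Nat.land (Nat.xor (nbMask u) (nbMask v)) (Nat.xor 511 (Nat.lor a b))) 0 &&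
    Nat.beq (Nat.land (Nat.land (nbMask u) (bif bit a u then b else a))
      (Nat.xor 511 (nbMask v))) 0 &&
    Nat.beq (Nat.land (Nat.land (nbMask v) (bif bit a v then b else a))
      (Nat.xor 511 (nbMask u))) 0)

/-- The labelling `s` is consistent with the edges between `a` and `b`. -/
def consistent (a b : ℕ) (s : List (ℕ × ℕ)) : Bool :=
  s.all fun x => !bit a x.1 || s.all fun y => !(bit b y.1 && bit (nbMask x.1) y.1) ||
    s.all fun p => !Nat.beq p.2 x.2 || s.all fun q => !Nat.beq q.2 y.2 || bit (nbMask p.1) q.1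

/-- Search for a labelling with three labels. -/
def search (a b : ℕ) : List ℕ → List (ℕ × ℕ) → Bool
  | [], s => consistent a b s
  | u :: us, s => [0, 1, 2].any fun c =>
      (s.all fun p => !Nat.beq p.2 c || !conflict a b u p.1) && search a b us ((u, c) :: s)

/-- The vertex sets that occur in expressions with three labels. -/
def family : List ℕ :=
    [1, 2, 3, 4, 5, 6, 7, 8, 9, 10, 11, 12, 13, 14, 15, 16, 17, 18, 19, 20, 21, 22, 23, 24, 25,
    26, 28, 29, 30, 32, 33, 34, 35, 36, 37, 38, 39, 40, 41, 42, 44, 45, 47, 48, 49, 50, 52, 54,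
    55, 56, 64, 65, 66, 67, 68, 69, 70, 72, 73, 74, 76, 77, 80, 81, 82, 84, 86, 88, 89, 96, 97,
    98, 99, 100, 101, 104, 105, 112, 113, 121, 126, 128, 129, 130, 131, 132, 133, 134, 136, 137,
    138, 140, 141, 144, 145, 146, 147, 148, 150, 152, 160, 161, 162, 164, 168, 176, 192, 193, 194,
    196, 200, 208, 224, 225, 256, 257, 258, 259, 260, 261, 262, 264, 265, 266, 268, 269, 272, 273,
    274, 276, 278, 280, 284, 285, 286, 288, 289, 290, 292, 296, 304, 320, 321, 322, 324, 328, 336,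
    352, 353, 382, 384, 385, 386, 388, 392, 399, 400, 401, 402, 403, 404, 408, 416, 431, 432, 448,
    464, 480, 481, 496, 497, 499, 505]


/-- The members of `family` as a bit mask. -/
def familyMask : ℕ :=
  0x20b00030001000100018001011f81174000000300010117000101177157377f000000030001011700010117015f377f4203033f0357377f01d7b7ff77fffffe

-- The finite computation behind the lower bound for `S_2`. As `Unitable` is symmetric, `a ≤ b`
-- suffices. For disjoint masks, either the union is listed again or no labelling with three labels
-- survives the search.
set_option maxHeartbeats 0 in
theorem family_closed : (family.all fun a => family.all fun b => !Nat.ble a b ||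
    !Nat.beq (Nat.land a b) 0 ||
    bit familyMask (Nat.lor a b) ||
    !search a b ([0, 1, 2, 3, 4, 5, 6, 7, 8].filter (bit (Nat.lor a b))) []) = true := by
  decide +kernel

/-- The mask makes membership a test of a single bit in the large check; only this direction is
needed to get back to the list. -/
theorem familyMask_spec : ((List.range 512).all fun t =>
    !bit familyMask t || family.contains t) = true := by
  decide +kernel

theorem bit_eq (m v : ℕ) : bit m v = m.testBit v := by
  rw [bit, Nat.testBit_eq_decide_div_mod_eq, Bool.eq_iff_iff]
  change Nat.beq ((m >>> v) &&& 1) 1 = true ↔ _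
  rw [Nat.beq_eq, Nat.and_one_is_mod, Nat.shiftRight_eq_div_pow, decide_eq_true_iff]

theorem idx_lt (v : SVertex 2) : idx v < 9 := by
  cases v with
  | v i => exact lt_trans i.2 (by decide)
  | _ => decide

theorem exists_idx {n : ℕ} (hn : n < 9) : ∃ v, idx v = n := by
  by_cases h : n < 5
  · exact ⟨.v ⟨n, h⟩, rfl⟩
  · have : n = 5 ∨ n = 6 ∨ n = 7 ∨ n = 8 := by omega
    rcases this with rfl | rfl | rfl | rfl
    exacts [⟨.w₁, rfl⟩, ⟨.w₂, rfl⟩, ⟨.w₃, rfl⟩, ⟨.w₄, rfl⟩]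

theorem idx_injective : Function.Injective idx := by
  intro u v huv
  rcases u with i | _ | _ | _ | _ <;> rcases v with j | _ | _ | _ | _ <;>
    simp only [idx] at huv <;>
    first
    | rfl
    | exact congrArg SVertex.v (Fin.ext huv)
    | exact absurd huv (by decide)
    | (have hi : (i : ℕ) < 5 := i.2
       omega)
    | (have hj : (j : ℕ) < 5 := j.2
       omega)

theorem adj_iff (u v : SVertex 2) : (graphS 2).Adj u v ↔ (nbMask (idx u)).testBit (idx v) := by
  have hs : sSize 2 = 5 := rfl
  have h1 : ∀ n < 5, ∀ m < 5, ((n ≠ m ∧ n ≤ m + 2 ∧ m ≤ n + 2) ↔ (nbMask n).testBit m) := by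
    decide
  have h2 : ∀ n < 5, (nbMask n).testBit 5 = false ∧ ((nbMask n).testBit 6 = decide (n = 0)) ∧
    ((nbMask n).testBit 7 = decide (n + 1 = 5)) ∧ (nbMask n).testBit 8 = false ∧
    (nbMask 5).testBit n = false ∧ ((nbMask 6).testBit n = decide (n = 0)) ∧
    ((nbMask 7).testBit n = decide (n + 1 = 5)) ∧ (nbMask 8).testBit n = false := by
    decide
  have h3 : (nbMask 5).testBit 5 = false ∧ (nbMask 5).testBit 6 ∧
    (nbMask 5).testBit 7 = false ∧ (nbMask 5).testBit 8 = false ∧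
    (nbMask 6).testBit 5 ∧ (nbMask 6).testBit 6 = false ∧
    (nbMask 6).testBit 7 = false ∧ (nbMask 6).testBit 8 = false ∧
    (nbMask 7).testBit 5 = false ∧ (nbMask 7).testBit 6 = false ∧
    (nbMask 7).testBit 7 = false ∧ (nbMask 7).testBit 8 ∧
    (nbMask 8).testBit 5 = false ∧ (nbMask 8).testBit 6 = false ∧
    (nbMask 8).testBit 7 ∧ (nbMask 8).testBit 8 = false := by
    decide
  have hsymm : ∀ n < 9, ∀ m < 9, (nbMask n).testBit m = (nbMask m).testBit n := by decide
  have hvw : ∀ (i : Fin (sSize 2)) (w : SVertex 2), (w = .w₁ ∨ w = .w₂ ∨ w = .w₃ ∨ w = .w₄) →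
      ((graphS 2).Adj (.v i) w ↔ (nbMask i).testBit (idx w)) := by
    rintro i w (rfl | rfl | rfl | rfl) <;>
      simp [idx, h2 i i.2, SVertex.adj_v_w₁, SVertex.adj_v_w₂, SVertex.adj_v_w₃,
        SVertex.adj_v_w₄, hs]
  have hww : ∀ u w : SVertex 2, (w = .w₁ ∨ w = .w₂ ∨ w = .w₃ ∨ w = .w₄) →
      (u = .w₁ ∨ u = .w₂ ∨ u = .w₃ ∨ u = .w₄) → 
      ((graphS 2).Adj u w ↔ (nbMask (idx u)).testBit (idx w)) := by
    have n1 := mt SimpleGraph.Adj.symm (SVertex.not_adj_w₁_w₃ (k := 2))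
    have n2 := mt SimpleGraph.Adj.symm (SVertex.not_adj_w₁_w₄ (k := 2))
    have n3 := mt SimpleGraph.Adj.symm (SVertex.not_adj_w₂_w₃ (k := 2))
    have n4 := mt SimpleGraph.Adj.symm (SVertex.not_adj_w₂_w₄ (k := 2))
    rintro u w (rfl | rfl | rfl | rfl) (rfl | rfl | rfl | rfl) <;>
      simp [idx, h3, n1, n2, n3, n4, SVertex.adj_w₁_w₂, SVertex.adj_w₃_w₄, SVertex.not_adj_w₁_w₃,
        SVertex.not_adj_w₁_w₄, SVertex.not_adj_w₂_w₃, SVertex.not_adj_w₂_w₄,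
        SVertex.adj_w₁_w₂.symm, SVertex.adj_w₃_w₄.symm]
  have hcases : ∀ u : SVertex 2, (∃ i, u = .v i) ∨ (u = .w₁ ∨ u = .w₂ ∨ u = .w₃ ∨ u = .w₄) := by
    rintro (i | _ | _ | _ | _) <;> simp
  rcases hcases u with ⟨i, rfl⟩ | hu <;> rcases hcases v with ⟨j, rfl⟩ | hv
  · exact (SVertex.adj_v_v i j).trans (h1 i i.2 j j.2)
  · exact hvw i v hv
  · rw [SimpleGraph.adj_comm, hvw j u hu, hsymm _ (idx_lt u) _ (idx_lt (.v j))]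
    rfl
  · exact hww u v hv hu

/-- Only completeness of the search matters: a valid labelling `l` is one of its branches, so a
failing search excludes all labellings. -/
theorem search_eq_true {a b : ℕ} {U : List ℕ} {l : ℕ → ℕ} (hl : ∀ u ∈ U, l u < 3)
    (hconf : ∀ u ∈ U, ∀ v ∈ U, l u = l v → conflict a b u v = false)
    (hcons : ∀ s : List (ℕ × ℕ), (∀ x ∈ s, x.1 ∈ U ∧ x.2 = l x.1) → consistent a b s = true)
    (us : List ℕ) (hus : ∀ u ∈ us, u ∈ U) (s : List (ℕ × ℕ))
    (hs : ∀ x ∈ s, x.1 ∈ U ∧ x.2 = l x.1) : search a b us s = true := by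
  induction us generalizing s with
  | nil => exact hcons s hs
  | cons u us ih =>
    have hu := hus u (List.mem_cons_self ..)
    have h3 : l u = 0 ∨ l u = 1 ∨ l u = 2 := by have := hl u hu; omega
    have hmem : l u ∈ [0, 1, 2] := by simpa using h3
    rw [search, List.any_eq_true]
    refine ⟨l u, hmem, ?_⟩
    rw [Bool.and_eq_true]
    refine ⟨?_, ih (fun w hw => hus w (List.mem_cons_of_mem _ hw)) _ ?_⟩
    · rw [List.all_eq_true]
      intro x hx
      by_cases h : x.2 = l u
      · rw [hconf u hu x.1 (hs x hx).1 (by rw [← h, (hs x hx).2])]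
        simp
      · have : Nat.beq x.2 (l u) = false := by
          rw [Bool.eq_false_iff, ne_eq, Nat.beq_eq]; exact h
        simp [this]
    · intro x hx
      rcases List.mem_cons.1 hx with rfl | hx
      · exact ⟨hu, rfl⟩
      · exact hs x hx

/-- The set of vertices given by a bit mask. -/
def maskSet (a : ℕ) : Set (SVertex 2) := {v | a.testBit (idx v) = true}

theorem family_lt : ∀ a ∈ family, a < 512 := by decide +kernel

theorem nbMask_lt (u : ℕ) : nbMask u < 512 := by
  unfold nbMask
  by_cases hu : u < 9
  · interval_cases u <;> decide
  · rw [List.getD_eq_default _ _ (by simpa using hu)]; decide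

theorem eq_zero_of_testBit {m : ℕ} (hm : ∀ i, 9 ≤ i → m.testBit i = false)
    (h : ∀ v : SVertex 2, m.testBit (idx v) = false) : m = 0 := by
  refine Nat.eq_of_testBit_eq fun i => ?_
  rw [Nat.zero_testBit]
  by_cases hi : i < 9
  · obtain ⟨v, rfl⟩ := exists_idx hi
    exact h v
  · exact hm i (by omega)

theorem testBit_of_le {m i : ℕ} (hm : m < 512) (hi : 9 ≤ i) : m.testBit i = false :=
  Nat.testBit_eq_false_of_lt (lt_of_lt_of_le hm (Nat.pow_le_pow_right (n := 2) (by norm_num) hi))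

theorem maskSet_union_mem {a b : ℕ} (ha : a ∈ family) (hb : b ∈ family) (hab : a ≤ b)
    (h : Unitable (graphS 2) 3 (maskSet a) (maskSet b)) :
    ∃ c ∈ family, maskSet a ∪ maskSet b = maskSet c := by
  have hunion : maskSet a ∪ maskSet b = maskSet (a ||| b) := by
    ext v
    simp [maskSet]
  have ha' := family_lt a ha
  have hb' := family_lt b hb
  obtain ⟨hdis, l, J, hJ, hJs, hout, hin, hcross⟩ := h
  have hland : Nat.land a b = 0 := by
    refine eq_zero_of_testBit (m := a &&& b) (fun i hi => ?_) fun v => ?_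
    · rw [Nat.testBit_land, testBit_of_le ha' hi, Bool.false_and]
    · rw [Nat.testBit_land]
      by_contra hne
      rw [Bool.not_eq_false, Bool.and_eq_true] at hne
      exact Set.disjoint_left.1 hdis (show v ∈ maskSet a from hne.1) hne.2
  have hclosed := family_closed
  rw [List.all_eq_true] at hclosed
  have hclosed := hclosed a ha
  rw [List.all_eq_true] at hclosed
  have hclosed := hclosed b hb
  have hble : Nat.ble a b = true := Nat.ble_eq_true_of_le hab
  rw [hland, hble] at hclosed
  by_cases hmem : bit familyMask (Nat.lor a b) = true
  · refine ⟨a ||| b, ?_, hunion⟩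
    have hspec := familyMask_spec
    rw [List.all_eq_true] at hspec
    have := hspec (a ||| b) (List.mem_range.2 (Nat.or_lt_two_pow (n := 9) ha' hb'))
    change (!bit familyMask (Nat.lor a b) || _) = true at this
    rw [hmem] at this
    simpa using this
  exfalso
  rw [Bool.not_eq_true] at hmem
  rw [hmem] at hclosed
  set U := [0, 1, 2, 3, 4, 5, 6, 7, 8].filter (bit (Nat.lor a b)) with hU
  have hclosed : search a b U [] = false := by simpa using hclosed
  have hUmem : ∀ n ∈ U, ∃ v : SVertex 2, idx v = n ∧ v ∈ maskSet a ∪ maskSet b := by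
    intro n hn
    rw [hU, List.mem_filter] at hn
    have hn9 : n < 9 := by
      have := hn.1
      simp only [List.mem_cons, List.not_mem_nil, or_false] at this
      omega
    obtain ⟨v, rfl⟩ := exists_idx hn9
    refine ⟨v, rfl, ?_⟩
    rw [hunion]
    have := hn.2
    rw [bit_eq] at this
    exact this
  classical
  -- The search works with numbers instead of vertices; off the range of `idx` the value is a dummy.
  let l' : ℕ → ℕ := fun n => if h : ∃ v : SVertex 2, idx v = n then (l h.choose : ℕ) else 0
  have hl' : ∀ v, l' (idx v) = l v := by
    intro v
    have h : ∃ u : SVertex 2, idx u = idx v := ⟨v, rfl⟩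
    simp only [l', dif_pos h]
    rw [idx_injective h.choose_spec]
  have key : search a b U [] = true := by
    refine search_eq_true (l := l') (U := U) ?_ ?_ ?_ U (fun u hu => hu) [] (by simp)
    · intro n hn
      obtain ⟨v, rfl, -⟩ := hUmem n hn
      rw [hl']
      exact (l v).2
    · intro n hn m hm hnm
      obtain ⟨u, rfl, hu⟩ := hUmem n hn
      obtain ⟨v, rfl, hv⟩ := hUmem m hm
      rw [hl', hl'] at hnm
      have huv : l u = l v := Fin.ext hnm
      have h511 : ∀ {m : ℕ} {i : ℕ}, m < 512 → 9 ≤ i → (511 ^^^ m).testBit i = false := by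
        intro m i hm hi
        rw [Nat.testBit_xor, testBit_of_le hm hi, testBit_of_le (by norm_num) hi]
        rfl
      have h511' : ∀ (m : ℕ) (x : SVertex 2), (511 ^^^ m).testBit (idx x) =
          !m.testBit (idx x) := by
        intro m x
        have : ∀ n < 9, Nat.testBit 511 n = true := by decide
        rw [Nat.testBit_xor, this _ (idx_lt x), Bool.true_xor]
      -- The edges from `u` to the other operand come from joins at the label of `u`, so they are
      -- made for `v` as well.
      have hside : ∀ u v : SVertex 2, u ∈ maskSet a ∪ maskSet b → v ∈ maskSet a ∪ maskSet b →
          l u = l v → ((nbMask (idx u) &&& (bif bit a (idx u) then b else a)) &&&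
            (511 ^^^ nbMask (idx v))) = 0 := by
        intro u v hu hv huv
        refine eq_zero_of_testBit (fun i hi => ?_) fun x => ?_
        · rw [Nat.testBit_land, h511 (nbMask_lt _) hi, Bool.and_false]
        · rw [Nat.testBit_land, Nat.testBit_land, h511']
          by_contra hne
          simp only [Bool.not_eq_false, Bool.and_eq_true, Bool.not_eq_true'] at hne
          obtain ⟨⟨h1, h2⟩, h3⟩ := hne
          rw [← adj_iff] at h1
          have h3' : ¬ (graphS 2).Adj v x := by rw [adj_iff, h3]; simp
          rw [bit_eq] at h2
          by_cases hua : a.testBit (idx u) = true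
          · rw [hua, cond_true] at h2
            have := (hcross u hua x h2).1 h1
            rw [huv] at this
            exact h3' (hin v hv x (Or.inr h2) this)
          · rw [Bool.not_eq_true] at hua
            rw [hua, cond_false] at h2
            have hub : u ∈ maskSet b := hu.resolve_left (by simp [maskSet, hua])
            have := hJs _ _ ((hcross x h2 u hub).1 h1.symm)
            rw [huv] at this
            exact h3' (hin v hv x (Or.inl h2) this)
      have h1 : ((nbMask (idx u) ^^^ nbMask (idx v)) &&& (511 ^^^ (a ||| b))) = 0 := by
        refine eq_zero_of_testBit (fun i hi => ?_) fun x => ?_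
        · rw [Nat.testBit_land, h511 (Nat.or_lt_two_pow (n := 9) ha' hb') hi, Bool.and_false]
        · rw [Nat.testBit_land, Nat.testBit_xor, h511']
          by_cases hx : (a ||| b).testBit (idx x) = true
          · rw [hx]; simp
          · have := hout u hu v hv huv x (by rw [hunion]; exact hx)
            rw [adj_iff, adj_iff, ← Bool.eq_iff_iff] at this
            rw [this]; simp
      have h2 := hside u v hu hv huv
      have h3 := hside v u hv hu huv.symm
      simp only [conflict]
      change (!(Nat.beq ((nbMask (idx u) ^^^ nbMask (idx v)) &&& (511 ^^^ (a ||| b))) 0 &&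
        Nat.beq ((nbMask (idx u) &&& (bif bit a (idx u) then b else a)) &&&
            (511 ^^^ nbMask (idx v))) 0 &&
        Nat.beq ((nbMask (idx v) &&& (bif bit a (idx v) then b else a)) &&&
            (511 ^^^ nbMask (idx u))) 0)) = false
      rw [h1, h2, h3]
      rfl
    · intro s hs
      simp only [consistent, List.all_eq_true, bit_eq, Bool.or_eq_true, Bool.not_eq_true',
        Bool.and_eq_false_iff]
      intro x hx
      by_cases hxa : a.testBit x.1 = true
      swap
      · exact Or.inl (by simpa using hxa)
      refine Or.inr fun y hy => ?_
      by_cases hyb : b.testBit y.1 = true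
      swap
      · exact Or.inl (Or.inl (by simpa using hyb))
      by_cases hxy : (nbMask x.1).testBit y.1 = true
      swap
      · exact Or.inl (Or.inr (by simpa using hxy))
      refine Or.inr fun p hp => ?_
      by_cases hpx : p.2 = x.2
      swap
      · exact Or.inl (by rw [Bool.eq_false_iff, ne_eq, Nat.beq_eq]; exact hpx)
      refine Or.inr fun q hq => ?_
      by_cases hqy : q.2 = y.2
      swap
      · exact Or.inl (by rw [Bool.eq_false_iff, ne_eq, Nat.beq_eq]; exact hqy)
      refine Or.inr ?_
      obtain ⟨hx1, hx2⟩ := hs x hx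
      obtain ⟨hy1, hy2⟩ := hs y hy
      obtain ⟨hp1, hp2⟩ := hs p hp
      obtain ⟨hq1, hq2⟩ := hs q hq
      obtain ⟨x', ex, -⟩ := hUmem _ hx1
      obtain ⟨y', ey, -⟩ := hUmem _ hy1
      obtain ⟨p', ep, hp'⟩ := hUmem _ hp1
      obtain ⟨q', eq, hq'⟩ := hUmem _ hq1
      rw [hp2, hx2, ← ep, ← ex, hl', hl'] at hpx
      rw [hq2, hy2, ← eq, ← ey, hl', hl'] at hqy
      rw [← ex, ← ey, ← adj_iff] at hxy
      rw [← ex] at hxa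
      rw [← ey] at hyb
      have hJ' := (hcross x' hxa y' hyb).1 hxy
      rw [← Fin.ext hpx, ← Fin.ext hqy] at hJ'
      rw [← ep, ← eq, ← adj_iff]
      exact hin p' hp' q' hq' hJ'
  rw [key] at hclosed
  exact Bool.noConfusion hclosed

/-- The set of all vertices is not in the family; this is the contradiction that an expression with
three labels runs into. -/
theorem not_all_testBit : ∀ a ∈ family, ¬ ∀ n < 9, a.testBit n = true := by
  decide +kernel

theorem not_cliqueWidth_le : ¬ cliqueWidth (graphS 2) ≤ 3 := by
  intro h
  have : Nonempty (SVertex 2) := ⟨.w₁⟩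
  obtain ⟨e, he⟩ := exists_defines_of_cliqueWidth_le (m := 3) (by exact_mod_cast h)
  have := he.mem_family (lin := False) False.elim (fun T => ∃ a ∈ family, T = maskSet a) ?_ ?_
  · obtain ⟨a, ha, h⟩ := this
    have hall : ∀ n < 9, a.testBit n = true := by
      intro n hn
      obtain ⟨v, rfl⟩ := exists_idx hn
      have : v ∈ maskSet a := h ▸ Set.mem_univ v
      exact this
    exact not_all_testBit a ha hall
  · intro v
    have hb : ∀ n < 9, 2 ^ n ∈ family ∧ ∀ m < 9, (2 ^ n).testBit m = decide (m = n) := by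
      decide
    refine ⟨2 ^ idx v, (hb _ (idx_lt v)).1, ?_⟩
    ext u
    simp only [maskSet, Set.mem_ofPred_eq, (hb _ (idx_lt v)).2 _ (idx_lt u), decide_eq_true_iff,
      Set.mem_singleton_iff, idx_injective.eq_iff]
  · rintro A B ⟨a, ha, rfl⟩ ⟨b, hb, rfl⟩ - - - hu
    rcases le_total a b with hab | hab
    · exact maskSet_union_mem ha hb hab hu
    · rw [Set.union_comm]
      exact maskSet_union_mem hb ha hab hu.symm

end STwo

open CWExpr

/-! ### Proper induced subgraphs of `S_2` -/

namespace STwo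

/-- The graph `S_2` on `Fin 9`, with all edges at `x` removed. -/
def host (x : Fin 9) : SimpleGraph (Fin 9) where
  Adj u v := u ≠ x ∧ v ≠ x ∧ (nbMask u).testBit v = true
  symm := ⟨by
    have : ∀ u v : Fin 9, (nbMask u).testBit v = (nbMask v).testBit u := by decide +kernel
    exact fun u v ⟨h1, h2, h3⟩ => ⟨h2, h1, by rwa [this]⟩⟩
  loopless := ⟨by
    have : ∀ u : Fin 9, (nbMask u).testBit u = false := by decide +kernel
    exact fun u h => by rw [this] at h; exact Bool.noConfusion h.2.2⟩

instance (x : Fin 9) : DecidableRel (host x).Adj := fun u v =>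
  inferInstanceAs (Decidable (u ≠ x ∧ v ≠ x ∧ (nbMask u).testBit v = true))

/-- The relation `SameType` for finite sets. -/
def Same (x : Fin 9) (T : Finset (Fin 9)) (u v : Fin 9) : Prop :=
  ∀ y : Fin 9, y ∉ T → ((host x).Adj u y ↔ (host x).Adj v y)

instance (x : Fin 9) (T : Finset (Fin 9)) (u v : Fin 9) : Decidable (Same x T u v) :=
  inferInstanceAs (Decidable (∀ y : Fin 9, y ∉ T → ((host x).Adj u y ↔ (host x).Adj v y)))

/-- The vertex `y` can share the label of `u` when it is added to `T`. -/
def Compat (x : Fin 9) (T : Finset (Fin 9)) (y u : Fin 9) : Prop :=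
  ¬ (host x).Adj u y ∧ Same x (insert y T) u y ∧
    (∀ v ∈ T, (host x).Adj y v → (host x).Adj u v) ∧
    ∀ v ∈ T, Same x T v u → ¬ (host x).Adj v y ∧ ∀ w ∈ T, (host x).Adj y w → (host x).Adj v w

instance (x : Fin 9) (T : Finset (Fin 9)) (y u : Fin 9) : Decidable (Compat x T y u) := by
  unfold Compat; infer_instance

/-- The vertex `y` can be added to `T`. -/
def Addable (x : Fin 9) (T : Finset (Fin 9)) (y : Fin 9) : Prop :=
  y ∉ T ∧ ((∃ r s : Fin 9, ∀ u ∈ T, Same x T u r ∨ Same x T u s) ∨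
    (∃ r s t : Fin 9, ∀ u ∈ T, Same x T u r ∨ Same x T u s ∨ Same x T u t) ∧
    ∃ u ∈ T, Compat x T y u)

instance (x : Fin 9) (T : Finset (Fin 9)) (y : Fin 9) : Decidable (Addable x T y) := by
  unfold Addable; infer_instance

/-- Two types leave the third label free; with three types the new vertex has to share a label.
Types are counted by means of `r, s, t`, which need not lie in `T`. -/
theorem reach_insert {x y : Fin 9} {T : Finset (Fin 9)} (h : Addable x T y)
    (hT : Reach (host x) True 3 (T : Set (Fin 9))) :
    Reach (host x) True 3 ((insert y T : Finset (Fin 9)) : Set (Fin 9)) := by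
  classical
  rw [Finset.coe_insert]
  have key : ∀ {T : Finset (Fin 9)} {u v : Fin 9}, Same x T u v ↔
      SameType (host x) (T : Set (Fin 9)) u v := by simp [SameType, Same]
  obtain ⟨hy, ⟨r, s, h⟩ | ⟨⟨r, s, t, h⟩, u, hu, h1, h2, h3, h4⟩⟩ := h
  · simp only [key] at h
    refine hT.insert ⟨fun u => if SameType (host x) T u r then 0 else 1, ?_, ?_⟩ y (by simpa)
    · intro u _; dsimp only; split_ifs <;> omega
    · intro u hu v hv huv
      have hu' := h u hu
      have hv' := h v hv
      by_cases a : SameType (host x) T u r <;> by_cases b : SameType (host x) T v r <;>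
        simp only [a, b, if_true, if_false, false_or, zero_ne_one, one_ne_zero] at huv hu' hv'
      · exact a.trans b.symm
      · exact hu'.trans hv'.symm
  · simp only [key] at h h2 h4
    refine hT.insert_compat ⟨fun u => if SameType (host x) T u r then 0 else
      if SameType (host x) T u s then 1 else 2, ?_, ?_⟩ y u (by simpa) hu h1 ?_ h3 h4
    · intro u _; dsimp only; split_ifs <;> omega
    · intro u hu v hv huv
      have hu' := h u hu
      have hv' := h v hv
      by_cases a : SameType (host x) T u r <;> by_cases b : SameType (host x) T v r <;>
        by_cases c : SameType (host x) T u s <;> by_cases d : SameType (host x) T v s <;>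
        simp only [a, b, c, d, if_true, if_false, false_or, zero_ne_one, one_ne_zero,
          OfNat.zero_ne_ofNat, OfNat.ofNat_ne_zero, OfNat.one_ne_ofNat,
          OfNat.ofNat_ne_one] at huv hu' hv' <;>
        first
        | exact a.trans b.symm
        | exact c.trans d.symm
        | exact hu'.trans hv'.symm
    · rwa [Finset.coe_insert] at h2

/-- All vertices of the list can be added, one after the other. -/
def AllAddable (x : Fin 9) : Finset (Fin 9) → List (Fin 9) → Prop
  | T, [] => ∀ y, y ∈ T ∨ y = x
  | T, y :: ys => Addable x T y ∧ AllAddable x (insert y T) ys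

instance (x : Fin 9) : ∀ T ys, Decidable (AllAddable x T ys)
  | T, [] => inferInstanceAs (Decidable (∀ y, y ∈ T ∨ y = x))
  | T, y :: ys =>
    have := instDecidableAllAddable x (insert y T) ys
    inferInstanceAs (Decidable (Addable x T y ∧ AllAddable x (insert y T) ys))

theorem AllAddable.reach {x : Fin 9} : ∀ {T ys}, AllAddable x T ys →
    Reach (host x) True 3 (T : Set (Fin 9)) →
    ∃ T', Reach (host x) True 3 T' ∧ ∀ y, y ≠ x → y ∈ T'
  | _, [], h, hT => ⟨_, hT, fun y hy => (h y).resolve_right hy⟩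
  | _, _ :: _, h, hT => h.2.reach (reach_insert h.1 hT)

/-- Orders in which the vertices other than `x` can be added. -/
def order (x : ℕ) : List (Fin 9) :=
  [[1, 2, 3, 4, 7, 8, 5, 6], [0, 2, 3, 5, 6, 4, 7, 8], [0, 1, 5, 6, 3, 4, 7, 8],
    [0, 1, 6, 5, 2, 4, 7, 8], [0, 1, 2, 3, 5, 6, 7, 8], [0, 2, 3, 1, 6, 4, 7, 8],
    [0, 1, 3, 2, 4, 5, 7, 8], [0, 1, 2, 4, 3, 5, 6, 8], [1, 2, 4, 3, 7, 0, 5, 6]].getD x []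

theorem allAddable_order : ∀ x : Fin 9, AllAddable x {(order x).head!} (order x).tail := by
  decide +kernel

theorem exists_reach (x : Fin 9) :
    ∃ T, Reach (host x) True 3 T ∧ ∀ y, y ≠ x → y ∈ T :=
  (allAddable_order x).reach (by rw [Finset.coe_singleton]; exact Reach.single _)

/-- The deleted vertex stays in `host x` as an isolated one, so a single vertex set serves all nine
cases; subgraphs that lack further vertices embed as well. -/
theorem linearCliqueWidth_induce_le (s : Set (SVertex 2)) (hs : s ≠ Set.univ) :
    linearCliqueWidth ((graphS 2).induce s) ≤ 3 := by
  obtain ⟨x, hx⟩ := (Set.ne_univ_iff_exists_notMem s).1 hs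
  obtain ⟨T, hT, hT'⟩ := exists_reach ⟨idx x, idx_lt x⟩
  have hne : ∀ w : s, (⟨idx w, idx_lt w⟩ : Fin 9) ≠ ⟨idx x, idx_lt x⟩ := fun w hw =>
    hx (idx_injective (Fin.mk.inj_iff.1 hw) ▸ w.2)
  have := linearCliqueWidth_le_of_reach (m := 2) (H := (graphS 2).induce s) hT
    (fun w => ⟨idx w, idx_lt w⟩)
    (fun u v h => Subtype.ext (idx_injective (Fin.mk.inj_iff.1 h)))
    (fun a b => ⟨fun h => ⟨hne a, hne b, (adj_iff _ _).1 h⟩, fun h => (adj_iff _ _).2 h.2.2⟩)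
    (fun w => hT' _ (hne w))
  exact this.trans_eq (by norm_num)

end STwo

open CWExpr

/-! ### Path powers on sets of integers -/

/-- The graph on `ℤ` in which distinct elements of `X` at distance at most `k` are adjacent. -/
def powerGraph (k : ℤ) (X : ℤ → Prop) : SimpleGraph ℤ where
  Adj u v := X u ∧ X v ∧ u ≠ v ∧ u ≤ v + k ∧ v ≤ u + k
  symm := ⟨fun _ _ ⟨h1, h2, h3, h4, h5⟩ => ⟨h2, h1, h3.symm, h5, h4⟩⟩
  loopless := ⟨fun _ h => h.2.2.1 rfl⟩

section PowerGraph

variable {k : ℤ} {X : ℤ → Prop} {T : Set ℤ} {m : ℕ}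

/-- No element of `X` outside of `T` separates `u` and `v`. -/
def Unsplit (k : ℤ) (X : ℤ → Prop) (T : Set ℤ) (u v : ℤ) : Prop :=
  ∀ c, X c → c ∉ T → ¬ (u + k < c ∧ c ≤ v + k) ∧ ¬ (u - k ≤ c ∧ c < v - k)

/-- On the line, an element separates `u < v` either from the right, being close to `v` but beyond
`u + k`, or from the left, being close to `u` but below `v - k`. -/
theorem Unsplit.sameType {u v : ℤ} (h : Unsplit k X T u v) (huv : u < v) (hu : u ∈ T) (hv : v ∈ T)
    (hTX : ∀ c ∈ T, X c) : SameType (powerGraph k X) T u v := by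
  intro c hc
  have hcu : c ≠ u := fun h => hc (h ▸ hu)
  have hcv : c ≠ v := fun h => hc (h ▸ hv)
  by_cases hX : X c
  · obtain ⟨h1, h2⟩ := h c hX hc
    simp only [powerGraph]
    constructor
    · rintro ⟨-, -, h3, h4, h5⟩
      exact ⟨hTX v hv, hX, hcv.symm, by omega, by omega⟩
    · rintro ⟨-, -, h3, h4, h5⟩
      exact ⟨hTX u hu, hX, hcu.symm, by omega, by omega⟩
  · exact ⟨fun h => absurd h.2.1 hX, fun h => absurd h.2.1 hX⟩

/-- The classes are given by a relation so that they can be described by cases; they may overlap,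
and one class is chosen for each element. -/
theorem typesLE_of_rel (hTX : ∀ c ∈ T, X c) (F : ℤ → ℤ → Prop)
    (hF : ∀ u ∈ T, ∃ i : ℤ, 0 ≤ i ∧ i < m ∧ F u i)
    (hF' : ∀ u ∈ T, ∀ v ∈ T, ∀ i, F u i → F v i → u < v → Unsplit k X T u v) :
    TypesLE (powerGraph k X) T m := by
  classical
  choose! f hf0 hfm hf using hF
  refine ⟨fun u => (f u).toNat, fun u hu => ?_, fun u hu v hv huv => ?_⟩
  · have := hf0 u hu
    have := hfm u hu
    dsimp only
    omega
  · have h1 := hf0 u hu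
    have h2 := hf0 v hv
    have heq : f u = f v := by dsimp only at huv; omega
    rcases lt_trichotomy u v with h | h | h
    · exact (hF' u hu v hv _ (hf u hu) (heq ▸ hf v hv) h).sameType h hu hv hTX
    · rw [h]; exact SameType.rfl
    · exact ((hF' v hv u hu _ (hf v hv) (heq ▸ hf u hu) h).sameType h hv hu hTX).symm

/-- Extending a reachable set by at most one vertex. -/
theorem Reach.extend {V : Type} {G : SimpleGraph V} {lin : Prop} {m : ℕ} {T T' : Set V}
    (h : Reach G lin (m + 1) T) (x : V) (hsub : ∀ c ∈ T, c ∈ T')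
    (hx : ∀ c ∈ T', c ∈ T ∨ c = x) (hT : x ∉ T → x ∈ T' → TypesLE G T m) :
    Reach G lin (m + 1) T' := by
  by_cases hxT : x ∈ T
  · rwa [show T' = T from Set.ext fun c => ⟨fun hc => (hx c hc).elim id fun h => h ▸ hxT, hsub c⟩]
  · by_cases hxT' : x ∈ T'
    · rw [show T' = Insert.insert x T from Set.ext fun c =>
        ⟨fun hc => (hx c hc).symm, fun hc => hc.elim (fun h => h ▸ hxT') (hsub c)⟩]
      exact h.insert (hT hxT hxT') x hxT
    · rwa [show T' = T from Set.ext fun c =>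
        ⟨fun hc => (hx c hc).elim id fun h => absurd (h ▸ hc) hxT', hsub c⟩]

end PowerGraph

/-! ### Rows -/

/-- The intervals `[A + q (k + 1) + [r ≤ q], y + q k + [s ≤ q < s']]` for `0 ≤ q < k`. -/
def InRow (k A r y s s' q c : ℤ) : Prop :=
  0 ≤ q ∧ q < k ∧ A + q * k + q ≤ c ∧ (r ≤ q → A + q * k + q + 1 ≤ c) ∧ c ≤ y + q * k + 1 ∧
    (¬ (s ≤ q ∧ q < s') → c ≤ y + q * k)

/-- The set of the elements of `X` that lie in `Z` or in `[1, n]` and in one of the rows. -/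
def rowSet (k n : ℤ) (X Z : ℤ → Prop) (A r y s s' : ℤ) : Set ℤ :=
  {c | X c ∧ (Z c ∨ 1 ≤ c ∧ c ≤ n ∧ ∃ q, InRow k A r y s s' q c)}

section rows

variable {k n : ℤ} {X Z : ℤ → Prop} {A r y s s' : ℤ}

/-- Two elements of a row are not separated by elements of `[1, n]`. -/
theorem rowSet_unsplit (hX : r < k → ∀ c, X c → c ≠ A + r * k + r) (hn : n = k * k + 1)
    (hlast : 1 < A + k ∨ 0 < A + k ∧ r < k) (hk : 0 < k)
    (hA : A ≤ 1) (hr : 0 < r)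
    {u v c q : ℤ} (hu : InRow k A r y s s' q u) (hv : InRow k A r y s s' q v)
    (hv' : ¬ (s ≤ q + 1 ∧ q + 1 < s') → v ≤ y + q * k) (hc : X c)
    (hcT : c ∉ rowSet k n X Z A r y s s') (h1 : 1 ≤ c) (h2 : c ≤ n) :
    ¬ (u + k < c ∧ c ≤ v + k) ∧ ¬ (u - k ≤ c ∧ c < v - k) := by
  have hcX := fun h => hX h c hc
  have key : ∀ p, ¬ InRow k A r y s s' p c := fun p hp => hcT ⟨hc, Or.inr ⟨h1, h2, p, hp⟩⟩
  obtain ⟨a1, a2, a3, a4, a5, a6⟩ := hu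
  obtain ⟨-, -, b3, b4, b5, b6⟩ := hv
  constructor
  -- Separating elements on the right lie in row `q + 1`, which ends `k` further and starts `k + 1`
  -- further. If row `q + 1` is row `r`, it starts one later still, but the skipped position is the
  -- hole. After the last row they would exceed `n` by `hlast`.
  · rintro ⟨h3, h4⟩
    have hmul : (q + 1) * k = q * k + k := by ring
    by_cases hq : q + 1 < k
    · apply key (q + 1)
      refine ⟨by omega, hq, ?_, fun hr => ?_, ?_, fun h => ?_⟩
      · rw [hmul]; omega
      · rw [hmul]
        by_cases hr' : r = q + 1
        · rw [hr', hmul] at hcX; have := hcX hq; omega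
        · have := a4 (by omega); omega
      · rw [hmul]; omega
      · rw [hmul]; have := hv' h; omega
    · have hqk : q = k - 1 := by omega
      have : q * k = k * k - k := by rw [hqk]; ring
      omega
  -- On the left they lie in row `q - 1`. For `q = 0` a separating element of `[1, n]` would belong
  -- to row `0` itself, because `A ≤ 1`.
  · rintro ⟨h3, h4⟩
    have hmul : (q - 1) * k = q * k - k := by ring
    by_cases hq : 1 ≤ q
    · apply key (q - 1)
      refine ⟨by omega, by omega, ?_, fun hr => ?_, ?_, fun h => ?_⟩
      · rw [hmul]; omega
      · rw [hmul]; have := a4 (by omega); omega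
      · rw [hmul]; omega
      · rw [hmul]; omega
    · have hq0 : q = 0 := by omega
      have : q * k = 0 := by rw [hq0]; ring
      apply key 0
      refine ⟨le_rfl, hk, by omega, fun h => by omega, by omega, fun h => by omega⟩

end rows

open CWExpr

/-! ### Adding the elements of a level -/

section levels

variable {κ : ℕ} {k n : ℤ} {X Z : ℤ → Prop} {A r y s s' : ℤ} {lin : Prop}

theorem mem_rowSet_extend_top {c : ℤ} (hc : c ∈ rowSet k n X Z A r y (s + 1) s') :
    c ∈ rowSet k n X Z A r y s s' := by
  obtain ⟨h, h' | ⟨h1, h2, q, a1, a2, a3, a4, a5, a6⟩⟩ := hc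
  · exact ⟨h, Or.inl h'⟩
  · exact ⟨h, Or.inr ⟨h1, h2, q, a1, a2, a3, a4, a5, fun hq => a6 (by omega)⟩⟩

theorem mem_rowSet_of_top {c : ℤ} (hc : c ∈ rowSet k n X Z A r y s s') :
    c ∈ rowSet k n X Z A r y (s + 1) s' ∨ c = y + s * k + 1 := by
  obtain ⟨h, h' | ⟨h1, h2, q, a1, a2, a3, a4, a5, a6⟩⟩ := hc
  · exact Or.inl ⟨h, Or.inl h'⟩
  · by_cases hcs : q = s ∧ c = y + s * k + 1
    · exact Or.inr hcs.2
    · refine Or.inl ⟨h, Or.inr ⟨h1, h2, q, a1, a2, a3, a4, a5, fun hq => ?_⟩⟩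
      by_cases hqs : q = s
      · subst hqs; omega
      · exact a6 (by omega)

theorem mem_rowSet_extend_bot {c : ℤ} (hc : c ∈ rowSet k n X Z A r y s s') :
    c ∈ rowSet k n X Z A r y s (s' + 1) := by
  obtain ⟨h, h' | ⟨h1, h2, q, a1, a2, a3, a4, a5, a6⟩⟩ := hc
  · exact ⟨h, Or.inl h'⟩
  · exact ⟨h, Or.inr ⟨h1, h2, q, a1, a2, a3, a4, a5, fun hq => a6 (by omega)⟩⟩

theorem mem_rowSet_of_bot {c : ℤ} (hc : c ∈ rowSet k n X Z A r y s (s' + 1)) :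
    c ∈ rowSet k n X Z A r y s s' ∨ c = y + s' * k + 1 := by
  obtain ⟨h, h' | ⟨h1, h2, q, a1, a2, a3, a4, a5, a6⟩⟩ := hc
  · exact Or.inl ⟨h, Or.inl h'⟩
  · by_cases hcs : q = s' ∧ c = y + s' * k + 1
    · exact Or.inr hcs.2
    · refine Or.inl ⟨h, Or.inr ⟨h1, h2, q, a1, a2, a3, a4, a5, fun hq => ?_⟩⟩
      by_cases hqs : q = s'
      · subst hqs; omega
      · exact a6 (by omega)

/-- The level can be extended in the rows `q ≥ s`, large `q` first. -/
theorem reach_top (hs : s ≤ k)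
    (h : Reach (powerGraph k X) lin (κ + 1) (rowSet k n X Z A r y k s'))
    (hT : ∀ t, s < t → t ≤ k → TypesLE (powerGraph k X) (rowSet k n X Z A r y t s') κ) :
    Reach (powerGraph k X) lin (κ + 1) (rowSet k n X Z A r y s s') := by
  obtain ⟨j, hj⟩ : ∃ j : ℕ, s = k - j := ⟨(k - s).toNat, by omega⟩
  suffices H : ∀ i : ℕ, i ≤ j →
      Reach (powerGraph k X) lin (κ + 1) (rowSet k n X Z A r y (k - i) s') from
    hj ▸ H j le_rfl
  intro i
  induction i with
  | zero => intro _; simpa using h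
  | succ i ih =>
    intro hi
    have hi' : k - ((i + 1 : ℕ) : ℤ) + 1 = k - i := by push_cast; ring
    refine (ih (by omega)).extend (y + (k - ((i + 1 : ℕ) : ℤ)) * k + 1) (fun c hc => ?_)
      (fun c hc => ?_) fun _ _ => hT _ (by omega) (by omega)
    · rw [← hi'] at hc; exact mem_rowSet_extend_top hc
    · rw [← hi']; exact mem_rowSet_of_top hc

/-- The level can be extended in the rows `q < s'`, small `q` first. -/
theorem reach_bot (hs : 0 ≤ s')
    (h : Reach (powerGraph k X) lin (κ + 1) (rowSet k n X Z A r y 0 0))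
    (hT : ∀ t, 0 ≤ t → t < s' → TypesLE (powerGraph k X) (rowSet k n X Z A r y 0 t) κ) :
    Reach (powerGraph k X) lin (κ + 1) (rowSet k n X Z A r y 0 s') := by
  lift s' to ℕ using hs
  suffices H : ∀ i : ℕ, i ≤ s' →
      Reach (powerGraph k X) lin (κ + 1) (rowSet k n X Z A r y 0 i) from H s' le_rfl
  intro i
  induction i with
  | zero => intro _; simpa using h
  | succ i ih =>
    intro hi
    refine (ih (by omega)).extend (y + i * k + 1) (fun c hc => ?_) (fun c hc => ?_) fun _ _ =>
      hT _ (by omega) (by omega)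
    · push_cast; exact mem_rowSet_extend_bot hc
    · push_cast at hc; exact mem_rowSet_of_bot hc

/-- The set of all rows up to one level. -/
theorem rowSet_eq {y' t t' : ℤ}
    (h : ∀ q, 0 ≤ q → q < k → (y = y' ∧ ((s ≤ q ∧ q < s') ↔ (t ≤ q ∧ q < t')) ∨
      y + 1 = y' ∧ (s ≤ q ∧ q < s') ∧ ¬ (t ≤ q ∧ q < t') ∨
      y' + 1 = y ∧ (t ≤ q ∧ q < t') ∧ ¬ (s ≤ q ∧ q < s'))) :
    rowSet k n X Z A r y s s' = rowSet k n X Z A r y' t t' := by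
  ext c
  refine and_congr_right fun _ => or_congr_right <| and_congr_right fun _ => and_congr_right fun _ =>
    exists_congr fun q => ?_
  unfold InRow
  constructor
  · rintro ⟨a1, a2, a3, a4, a5, a6⟩
    have := h q a1 a2
    refine ⟨a1, a2, a3, a4, ?_, fun hq => ?_⟩ <;> omega
  · rintro ⟨a1, a2, a3, a4, a5, a6⟩
    have := h q a1 a2
    refine ⟨a1, a2, a3, a4, ?_, fun hq => ?_⟩ <;> omega

theorem rowSet_next : rowSet k n X Z A r y 0 (k + 1) = rowSet k n X Z A r (y + 1) k (k + 1) :=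
  rowSet_eq fun q _ _ => by omega

theorem rowSet_next' : rowSet k n X Z A r y 0 k = rowSet k n X Z A r (y + 1) k (k + 1) :=
  rowSet_eq fun q _ _ => by omega

theorem rowSet_start : rowSet k n X Z A r y 0 0 = rowSet k n X Z A r y k (k + 1) :=
  rowSet_eq fun q _ _ => by omega

/-- Several levels can be added, large rows first. -/
theorem reach_levels {y' : ℤ} (hk : 0 ≤ k) (hy : y ≤ y')
    (h : Reach (powerGraph k X) lin (κ + 1) (rowSet k n X Z A r y k (k + 1)))
    (hT : ∀ z, y ≤ z → z < y' → ∀ t, 0 < t → t ≤ k →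
      TypesLE (powerGraph k X) (rowSet k n X Z A r z t (k + 1)) κ) :
    Reach (powerGraph k X) lin (κ + 1) (rowSet k n X Z A r y' k (k + 1)) := by
  obtain ⟨j, hj⟩ : ∃ j : ℕ, y' = y + j := ⟨(y' - y).toNat, by omega⟩
  suffices H : ∀ i : ℕ, i ≤ j →
      Reach (powerGraph k X) lin (κ + 1) (rowSet k n X Z A r (y + i) k (k + 1)) from
    hj ▸ H j le_rfl
  intro i
  induction i with
  | zero => intro _; simpa using h
  | succ i ih =>
    intro hi
    have := reach_top hk (ih (by omega)) fun t h0 ht => hT _ (by omega) (by omega) t h0 ht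
    rw [rowSet_next] at this
    rwa [show y + ((i + 1 : ℕ) : ℤ) = y + i + 1 by push_cast; ring]

end levels

/-! ### The path power with its end vertices -/

/-- The positions of the vertices of `S_k` or `S⁺_k` (with `w⁺` on the left if `pl`, on the right if
`pr`) except for `h`. -/
def position (k n h : ℤ) (pl pr : Prop) (c : ℤ) : Prop :=
  c ≠ h ∧ (1 ≤ c ∧ c ≤ n ∨ c = -1 - k ∨ c = 1 - k ∨ pl ∧ c = -1 ∨ c = n + k ∨ c = n + k + 2 ∨
    pr ∧ c = n + 2)

section position

variable {k n h : ℤ} {pl pr : Prop} {Z : ℤ → Prop} {A r y s s' c : ℤ} {T : Set ℤ}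

theorem position.cases (hc : position k n h pl pr c) :
    1 ≤ c ∧ c ≤ n ∨ c = -1 - k ∨ c = 1 - k ∨ c = -1 ∨ c = n + k ∨ c = n + k + 2 ∨ c = n + 2 :=
  hc.2.imp id <| Or.imp id <| Or.imp id <| Or.imp And.right <| Or.imp id <| Or.imp id And.right

theorem position.left (hc : position k n h pl pr c) (h0 : c ≤ 0) (hn : 0 ≤ n) (hk : 0 < k) :
    c = -1 - k ∨ c = 1 - k ∨ c = -1 := by
  rcases hc.cases with h | h | h | h | h | h | h <;> omega

theorem position.right (hc : position k n h pl pr c) (h0 : n < c) (hn : 0 ≤ n) (hk : 0 < k) :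
    c = n + k ∨ c = n + k + 2 ∨ c = n + 2 := by
  rcases hc.cases with h | h | h | h | h | h | h <;> omega

theorem position.pl_of (hc : position k n h pl pr (-1)) (hn : 0 < n) (hk : 2 < k) : pl := by
  rcases hc.2 with h | h | h | h | h | h | h
  all_goals first | exact h.1 | omega

theorem position.pr_of (hc : position k n h pl pr (n + 2)) (hn : 0 < n) (hk : 2 < k) : pr := by
  rcases hc.2 with h | h | h | h | h | h | h
  all_goals first | exact h.1 | omega

theorem position_mid (h1 : 1 ≤ c) (h2 : c ≤ n) (h3 : c ≠ h) : position k n h pl pr c :=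
  ⟨h3, Or.inl ⟨h1, h2⟩⟩

/-- It suffices to consider one end on the left and two on the right. -/
theorem unsplit_of_position (hk : 2 < k) (hn : 0 < n) {u v : ℤ} (hu : 1 ≤ u)
    (hv : v ≤ n)
    (hmid : ∀ c, position k n h pl pr c → c ∉ T → 1 ≤ c → c ≤ n →
      ¬ (u + k < c ∧ c ≤ v + k) ∧ ¬ (u - k ≤ c ∧ c < v - k))
    (h1 : u = 1 → 1 - k ∈ T ∨ h = 1 - k) (h2 : u ≤ k - 1 → k - 1 < v → -1 ∈ T ∨ ¬ pl)
    (h3 : u + k < n + 2 → n + 2 ≤ v + k → ¬ pr) (h4 : v ≠ n) :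
    Unsplit k (position k n h pl pr) T u v := by
  intro c hc hcT
  have hcne := hc.1
  by_cases hc1 : 1 ≤ c
  · by_cases hcn : c ≤ n
    · exact hmid c hc hcT hc1 hcn
    · refine ⟨?_, by omega⟩
      rcases hc.right (by omega) hn.le (by omega) with rfl | rfl | rfl
      · omega
      · omega
      · exact fun h => h3 (by omega) (by omega) (hc.pr_of hn hk)
  · refine ⟨by omega, ?_⟩
    rcases hc.left (by omega) hn.le (by omega) with rfl | rfl | rfl
    · omega
    · intro h
      rcases h1 (by omega) with h | h
      · exact hcT h
      · exact hcne h.symm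
    · intro h
      rcases h2 (by omega) (by omega) with h | h
      · exact hcT h
      · exact h (hc.pl_of hn hk)

/-- Membership of an element of `[1, n]` in a row set. -/
theorem mem_rowSet_mid (h1 : 1 ≤ c) (h2 : c ≤ n) (h3 : c ≠ h) (q : ℤ)
    (hq : InRow k A r y s s' q c) : c ∈ rowSet k n (position k n h pl pr) Z A r y s s' :=
  ⟨position_mid h1 h2 h3, Or.inr ⟨h1, h2, q, hq⟩⟩

end position

section early

variable {κ : ℕ} {k n h : ℤ} {pl pr : Prop} {Z : ℤ → Prop} {A r y s s' : ℤ} {lin : Prop}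

/-- Few types in the first levels if the end vertices on the left are there. -/
theorem typesLE_early (hκ : (κ : ℤ) = k) (hk : 3 ≤ k) (hn : n = k * k + 1) (hh : h = A + r * k + r)
    (hA : 1 ≤ A + k) (hA' : A ≤ 1) (hr : 0 < r) (hr' : r < k) (hZ : ∀ c, Z c → c ≤ 0)
    (hZ1 : Z (-1 - k)) (hZ2 : Z (1 - k))
    (hZ3 : pl → Z (-1) ∧ A ≤ -1 ∧ 1 ≤ y ∨ ¬ Z (-1) ∧ y + 1 ≤ k - 1 ∧ 0 ≤ A)
    (hy : y + 1 ≤ A + k - 1 ∨ y ≤ A + k - 1 ∧ k ≤ s) :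
    TypesLE (powerGraph k (position k n h pl pr))
      (rowSet k n (position k n h pl pr) Z A r y s (k + 1)) κ := by
  have hkk : 3 * k ≤ k * k := Int.mul_le_mul_of_nonneg_right hk (by omega)
  -- At these levels the hole keeps the last row empty. The other rows take `1, …, k - 1`, and `0`
  -- is left for the ends. The end `1 - k` differs from `-1 - k` only as long as `1` is missing, and
  -- then row `0` has no path element and lends its number. The vertex `-1` shares the type of row
  -- `0`.
  refine typesLE_of_rel (fun c hc => hc.1) (fun u i => u = -1 - k ∧ i = 0 ∨
    u = 1 - k ∧ ((1 ≤ y ∨ 1 ≤ y + 1 ∧ s ≤ 0) ∧ i = 0 ∨ ¬ (1 ≤ y ∨ 1 ≤ y + 1 ∧ s ≤ 0) ∧ i = 1) ∨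
    u = -1 ∧ i = 1 ∨ 1 ≤ u ∧ ∃ q, InRow k A r y s (k + 1) q u ∧ i = q + 1) ?_ ?_
  · rintro u ⟨⟨hu1, hu2⟩, hu⟩
    rcases hu with hu | ⟨h1, h2, q, hq⟩
    · have := hZ u hu
      rcases hu2 with hu2 | hu2 | hu2 | hu2 | hu2 | hu2 | hu2
      · omega
      · exact ⟨0, by omega, by omega, Or.inl ⟨hu2, rfl⟩⟩
      · by_cases hy1 : 1 ≤ y ∨ 1 ≤ y + 1 ∧ s ≤ 0
        · exact ⟨0, by omega, by omega, Or.inr (Or.inl ⟨hu2, Or.inl ⟨hy1, rfl⟩⟩)⟩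
        · exact ⟨1, by omega, by omega, Or.inr (Or.inl ⟨hu2, Or.inr ⟨hy1, rfl⟩⟩)⟩
      · exact ⟨1, by omega, by omega, Or.inr (Or.inr (Or.inl ⟨hu2.2, rfl⟩))⟩
      · omega
      · omega
      · omega
    · refine ⟨q + 1, ?_, ?_, Or.inr (Or.inr (Or.inr ⟨h1, q, hq, rfl⟩))⟩
      · have := hq.1; omega
      · obtain ⟨a1, a2, a3, a4, a5, a6⟩ := hq
        omega
  · rintro u hu v hv i hFu hFv huv
    have hn0 : 0 < n := by omega
    have hum1 : -1 ∈ rowSet k n (position k n h pl pr) Z A r y s (k + 1) →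
        Z (-1) ∧ A ≤ -1 ∧ 1 ≤ y := fun h => by
      have hZu : Z (-1) := h.2.resolve_right fun h => by omega
      exact (hZ3 (h.1.pl_of hn0 hk)).resolve_right fun h => h.1 hZu
    have hZT : ∀ c, position k n h pl pr c → c = -1 - k ∨ c = 1 - k →
        c ∈ rowSet k n (position k n h pl pr) Z A r y s (k + 1) := by
      rintro c hc (rfl | rfl)
      · exact ⟨hc, Or.inl hZ1⟩
      · exact ⟨hc, Or.inl hZ2⟩
    rcases hFv with ⟨rfl, hj⟩ | ⟨rfl, hj⟩ | ⟨rfl, hj⟩ | ⟨hv1, p, hp, hj⟩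
    · exfalso
      rcases hFu with ⟨hu, hi⟩ | ⟨hu, hi⟩ | ⟨hu, hi⟩ | ⟨hu1, q, hq, hi⟩ <;> omega
    · rcases hFu with ⟨rfl, hi⟩ | ⟨hu, hi⟩ | ⟨hu, hi⟩ | ⟨hu1, q, hq, hi⟩
      · rintro c hc hcT
        have h1 : 1 ≤ y ∨ 1 ≤ y + 1 ∧ s ≤ 0 := by
          rcases hj with hj | hj
          · exact hj.1
          · omega
        refine ⟨fun hcc => ?_, fun hcc => ?_⟩
        · have hc1 : c = 1 := by
            rcases hc.cases with h | h | h | h | h | h | h <;> omega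
          subst hc1
          exact hcT (mem_rowSet_mid le_rfl (by omega) hc.1 0 ⟨le_rfl, by omega, by omega,
            fun h => by omega, by omega, fun h => by omega⟩)
        · rcases hc.left (by omega) hn0.le (by omega) with h | h | h <;> omega
      · omega
      · omega
      · omega
    · exfalso
      obtain ⟨-, h1, h2⟩ := hum1 hv
      rcases hFu with ⟨rfl, hi⟩ | ⟨hu, hi⟩ | ⟨hu, hi⟩ | ⟨hu1, q, hq, hi⟩
      · omega
      · rcases hi with hi | hi
        · omega
        · exact hi.1 (Or.inl h2)
      · omega
      · omega
    · have hvn : v ≤ n := (hv.2.resolve_left fun h => by have := hZ v h; omega).2.1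
      obtain ⟨b1, b2, b3, b4, b5, b6⟩ := hp
      have hpk : p ≤ k - 2 := by clear hFu; omega
      have hpk' : p * k ≤ (k - 2) * k := Int.mul_le_mul_of_nonneg_right hpk (by omega)
      rw [show (k - 2) * k = k * k - 2 * k by ring] at hpk'
      rcases hFu with ⟨rfl, hi⟩ | ⟨hu, hi⟩ | ⟨rfl, hi⟩ | ⟨hu1, q, hq, hi⟩
      · omega
      · exfalso
        rcases hi with hi | hi
        · omega
        · have hp0 : p = 0 := by omega
          subst hp0
          omega
      · obtain ⟨hZu, h1, h2⟩ := hum1 hu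
        have hp0 : p = 0 := by omega
        subst hp0
        rintro c hc hcT
        refine ⟨fun hcc => ?_, fun hcc => ?_⟩
        · refine hcT (mem_rowSet_mid (by omega) (by omega) hc.1 1 ⟨by omega, by omega, by omega,
            fun h => ?_, by omega, fun h => by omega⟩)
          have hr1 : r = 1 := by omega
          have := hc.1
          subst hr1
          omega
        · rcases hc.left (by omega) hn0.le (by omega) with rfl | rfl | rfl
          · exact hcT (hZT _ hc (Or.inl rfl))
          · exact hcT (hZT _ hc (Or.inr rfl))
          · omega
      · have hqp : q = p := by omega
        subst hqp
        refine unsplit_of_position hk hn0 hu1 hvn (fun c hc hcT h1 h2 =>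
          rowSet_unsplit (fun _ c hc => hh ▸ hc.1) hn (by omega) (by omega) hA' hr hq
            ⟨b1, b2, b3, b4, b5, b6⟩ (fun h => b6 (by omega)) hc hcT h1 h2) ?_ ?_ ?_ ?_
        · intro _
          by_cases hh' : h = 1 - k
          · exact Or.inr hh'
          · exact Or.inl (hZT _ ⟨Ne.symm hh', Or.inr (Or.inr (Or.inl rfl))⟩ (Or.inr rfl))
        · intro h1 h2
          by_cases hp : pl
          · rcases hZ3 hp with h3 | h3
            · left
              refine ⟨⟨?_, Or.inr (Or.inr (Or.inr (Or.inl ⟨hp, rfl⟩)))⟩, Or.inl h3.1⟩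
              have : 1 * k ≤ r * k := Int.mul_le_mul_of_nonneg_right (by omega) (by omega)
              omega
            · exfalso
              obtain ⟨a1, a2, a3, a4, a5, a6⟩ := hq
              by_cases hq0 : q = 0
              · subst hq0; omega
              · have : 1 * k ≤ q * k := Int.mul_le_mul_of_nonneg_right (by omega) (by omega)
                omega
          · exact Or.inr hp
        · omega
        · omega

end early

open CWExpr

/-! ### Filling from left to right -/

section finish

variable {κ : ℕ} {k n h : ℤ} {pl pr : Prop} {A r y g K σ : ℤ} {lin : Prop}

/-- Few types while the gap after the row `q` is filled. -/
theorem typesLE_gap (hκ : (κ : ℤ) = k) (hk : 3 ≤ k) (hn : n = k * k + 1) (hh : r < k → h = A + r * k + r)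
    (hh1 : h ≠ -1)
    (hlast : 1 < A + k ∨ 0 < A + k ∧ r < k) (hA' : A ≤ 1) (hr : 0 < r) (hy1 : 1 ≤ y)
    (hy2 : y ≤ k + 2) (hσ : 0 ≤ σ)
    (hpr : pr → σ = 1 ∨ y + (k - 1) * k < n + 2 - k ∨ 3 ≤ A + k ∧ r < k)
    (hvn : y + (k - 1) * k < n ∨ A = 1 ∧ r < k)
    (hK : ∀ q c, InRow k A r y k (k + 1) q c → q < K)
    (hY : A + K + σ ≤ y) (hY' : r ≤ K - 2 → A + K + σ + 1 ≤ y)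
    {q : ℤ} (hq0 : 0 ≤ q) (hqk : q + 1 < k) (hqK : q + 1 < K) (hgq : y + q * k ≤ g) (hgq' : g < y + (q + 1) * k)
    (hg : ¬ (A + (q + 1) * k + (q + 1) ≤ g + 1 ∧ (r ≤ q → A + (q + 1) * k + q + 2 ≤ g + 1))) :
    TypesLE (powerGraph k (position k n h pl pr))
      (rowSet k n (position k n h pl pr) (fun c => c ≤ g) A r y k (k + 1)) κ := by
  have hqk1 : (q + 1) * k = q * k + k := by ring
  rw [hqk1] at hgq' hg
  have hkk : 3 * k ≤ k * k := Int.mul_le_mul_of_nonneg_right hk (by omega)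
  have hkk1 : (k - 1) * k = k * k - k := by ring
  rw [hkk1] at hpr hvn
  have hn0 : 0 < n := by omega
  have hq2 : q * k ≤ (k - 2) * k := Int.mul_le_mul_of_nonneg_right (by omega) (by omega)
  rw [show (k - 2) * k = k * k - 2 * k by ring] at hq2
  have hg0 : 1 ≤ g := by
    have : 0 * k ≤ q * k := Int.mul_le_mul_of_nonneg_right hq0 (by omega)
    omega
  -- The gap consists of `g + 1, …, e`; row `q + 1` begins right after `e`, or after the hole at `e
  -- + 1`.
  obtain ⟨e, he⟩ : ∃ e, r ≤ q ∧ e = A + (q * k + k) + q + 1 ∨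
      ¬ r ≤ q ∧ e = A + (q * k + k) + q := by
    by_cases hrq : r ≤ q
    · exact ⟨_, Or.inl ⟨hrq, rfl⟩⟩
    · exact ⟨_, Or.inr ⟨hrq, rfl⟩⟩
  have hge : g + 1 ≤ e := by omega
  have hrow : ∀ p u, InRow k A r y k (k + 1) p u → g < u → q < p ∧
      (n + 2 - k ≤ u → p = k - 1) := by
    rintro p u ⟨a1, a2, a3, a4, a5, a6⟩ hgu
    have a7 := a6 (by omega)
    constructor
    · by_contra hpq
      have : p * k ≤ q * k := Int.mul_le_mul_of_nonneg_right (by omega) (by omega)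
      omega
    · intro hu
      by_contra hpk
      have : p * k ≤ (k - 2) * k := Int.mul_le_mul_of_nonneg_right (by omega) (by omega)
      rw [show (k - 2) * k = k * k - 2 * k by ring] at this
      omega
  -- An element `u ≤ g` is described by how many gap elements it reaches (`a`) and how far it
  -- reaches past the end of row `q + 1` (`b`); the sum is at most `e - (y + q k)`. Each later row
  -- adds one type, and `σ = 1` allows one more for the neighbours of `n + 2`. The hypotheses `hY`
  -- and `hY'` bound the total by `k`.
  refine typesLE_of_rel (fun c hc => hc.1) (fun u i => (u ≤ g ∧ ∃ a b, i = a + b ∧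
      (a = 0 ∧ u + k ≤ g ∨ a = u + k - g ∧ g < u + k ∧ u + k ≤ e ∨ a = e - g ∧ e < u + k) ∧
      (b = 0 ∧ u + k ≤ y + q * k + k ∨ b = u + k - (y + q * k + k) ∧ y + q * k + k < u + k)) ∨
    g < u ∧ ∃ p, InRow k A r y k (k + 1) p u ∧
      (u < n + 2 - k ∧ i = e - (y + q * k) + (p - q) ∨
        n + 2 - k ≤ u ∧ i = e - (y + q * k) + (p - q) + σ)) ?_ ?_
  · rintro u ⟨huX, hu⟩
    by_cases hug : u ≤ g
    · obtain ⟨a, ha⟩ : ∃ a : ℤ, a = 0 ∧ u + k ≤ g ∨ a = u + k - g ∧ g < u + k ∧ u + k ≤ e ∨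
          a = e - g ∧ e < u + k := by
        rcases le_or_gt (u + k) g with h | h
        · exact ⟨0, Or.inl ⟨rfl, h⟩⟩
        · rcases le_or_gt (u + k) e with h' | h'
          · exact ⟨_, Or.inr (Or.inl ⟨rfl, h, h'⟩)⟩
          · exact ⟨_, Or.inr (Or.inr ⟨rfl, h'⟩)⟩
      obtain ⟨b, hb⟩ : ∃ b : ℤ, b = 0 ∧ u + k ≤ y + q * k + k ∨
          b = u + k - (y + q * k + k) ∧ y + q * k + k < u + k := by
        rcases le_or_gt (u + k) (y + q * k + k) with h | h
        · exact ⟨0, Or.inl ⟨rfl, h⟩⟩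
        · exact ⟨_, Or.inr ⟨rfl, h⟩⟩
      exact ⟨a + b, by omega, by omega, Or.inl ⟨hug, a, b, rfl, ha, hb⟩⟩
    · obtain ⟨h1, h2, p, hp⟩ := hu.resolve_left hug
      have hpK := hK p u hp
      obtain ⟨hqp, hpm⟩ := hrow p u hp (by omega)
      by_cases hum : u < n + 2 - k
      · exact ⟨e - (y + q * k) + (p - q), by omega, by omega,
          Or.inr ⟨by omega, p, hp, Or.inl ⟨hum, rfl⟩⟩⟩
      · exact ⟨e - (y + q * k) + (p - q) + σ, by omega, by omega,
          Or.inr ⟨by omega, p, hp, Or.inr ⟨by omega, rfl⟩⟩⟩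
  · rintro u hu v hv i hFu hFv huv
    rcases hFv with ⟨hvg, a', b', e', ha', hb'⟩ | ⟨hvg, p, hp, hip⟩
    · rcases hFu with ⟨hug, a, b, e1, ha, hb⟩ | ⟨hug, -⟩
      · intro c hc hcT
        have hcg : g < c := by
          by_contra hcg
          exact hcT ⟨hc, Or.inl (by omega)⟩
        refine ⟨fun ⟨h1, h2⟩ => ?_, by omega⟩
        have hrow' : ¬ (e < c ∧ c ≤ y + q * k + k) := by
          rintro ⟨h3, h4⟩
          refine hcT ⟨hc, Or.inr ⟨by omega, ?_, q + 1, by omega, hqk, ?_, fun h5 => ?_, ?_,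
            fun h6 => ?_⟩⟩
          · have : (q + 1 + 1) * k ≤ k * k := Int.mul_le_mul_of_nonneg_right hqk (by omega)
            rw [show (q + 1 + 1) * k = q * k + 2 * k by ring] at this
            by_contra hcn
            rcases hc.right (by omega) hn0.le (by omega) with h | h | h <;> omega
          · rw [hqk1]; omega
          · rw [hqk1]
            by_cases hrq : r = q + 1
            · have := hh (by omega)
              rw [hrq, hqk1] at this
              have := hc.1
              omega
            · omega
          · rw [hqk1]; omega
          · rw [hqk1]; omega
        clear hrow hK
        omega
      · omega
    · have hvn' : v ≤ n := (hv.2.resolve_left (by omega)).2.1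
      rcases hFu with ⟨hug, a, b, e1, ha, hb⟩ | ⟨hug, p', hp', hip'⟩
      · exfalso
        have := (hrow p v hp hvg).1
        clear hrow hK
        omega
      · have h1 := hrow p v hp hvg
        have h2 := hrow p' u hp' hug
        have hpp : p' = p := by
          have h3 := hp.2.1
          have h4 := hp'.2.1
          clear hrow hK
          rcases hip with hip | hip <;> rcases hip' with hip' | hip' <;> omega
        subst hpp
        have hpb : p' * k ≤ (k - 1) * k := Int.mul_le_mul_of_nonneg_right
          (by have := hp.2.1; omega) (by omega)
        have hlastrow : p' = k - 1 → p' * k = k * k - k := fun h => by rw [h]; ring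
        refine unsplit_of_position (by omega) hn0 (by omega) hvn' (fun c hc hcT h3 h4 =>
          rowSet_unsplit (fun hrk c hc => hh hrk ▸ hc.1) hn hlast (by omega) hA' hr hp' hp
            (fun _ => hp.2.2.2.2.2 (by have := hp.2.1; omega)) hc hcT h3 h4) (fun h => by omega) ?_ ?_ ?_
        · intro _ _
          by_cases hpl : pl
          · exact Or.inl ⟨⟨hh1.symm, Or.inr (Or.inr (Or.inr (Or.inl ⟨hpl, rfl⟩)))⟩,
              Or.inl (by omega)⟩
          · exact Or.inr hpl
        · intro h3 h4 hp1
          have h5 := hlastrow (h1.2 (by omega))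
          obtain ⟨c1, c2, c3, c4, c5, c6⟩ := hp'
          obtain ⟨d1, d2, d3, d4, d5, d6⟩ := hp
          have d7 := d6 (by omega)
          have h6 := h1.2 (by omega)
          clear hrow hK
          rcases hpr hp1 with h | h | ⟨h, h'⟩
          · omega
          · omega
          · have := c4 (by omega)
            omega
        · intro hvn2
          have h6 := h1.2 (by omega)
          have h5 := hlastrow h6
          obtain ⟨c1, c2, c3, c4, c5, c6⟩ := hp'
          obtain ⟨d1, d2, d3, d4, d5, d6⟩ := hp
          have d7 := d6 (by omega)
          clear hrow hK
          rcases hvn with h | ⟨h, h'⟩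
          · omega
          · have := c4 (by omega)
            omega

/-- Few types when everything up to `g` is there. -/
theorem typesLE_prefix (hκ : (κ : ℤ) = k) (hk : 3 ≤ k) (hn : n = k * k + 1)
    (hg : n - k + 1 ≤ g ∨ g ≤ n - k ∧ g < h ∧ h ≤ g + k)
    (T : Set ℤ) (hT : ∀ c, c ∈ T ↔ position k n h pl pr c ∧ c ≤ g) :
    TypesLE (powerGraph k (position k n h pl pr)) T κ := by
  -- Before `n`, the missing path elements in reach are counted by `a`, and `n + 2` by `b`. The hole
  -- is counted although it separates nothing; `d` corrects this where a value is needed, for `g ≤ n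
  -- - k`. From `n` on, only the three right ends can separate.
  refine typesLE_of_rel (fun c hc => ((hT c).1 hc).1) (fun u i =>
    (g < n → ∃ a b d, i = a + b - d ∧
      (a = 0 ∧ u + k ≤ g ∨ a = u + k - g ∧ g < u + k ∧ u + k ≤ n ∨ a = n - g ∧ n < u + k) ∧
      (b = 0 ∧ u + k < n + 2 ∨ b = 1 ∧ n + 2 ≤ u + k) ∧
      (d = 1 ∧ g ≤ n - k ∧ h ≤ u + k ∨ d = 0 ∧ ¬ (g ≤ n - k ∧ h ≤ u + k))) ∧
    (n ≤ g → ∃ a b d, i = a + b + d ∧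
      (a = 0 ∧ ¬ (g < n + 2 ∧ n + 2 ≤ u + k) ∨ a = 1 ∧ g < n + 2 ∧ n + 2 ≤ u + k) ∧
      (b = 0 ∧ ¬ (g < n + k ∧ n + k ≤ u + k) ∨ b = 1 ∧ g < n + k ∧ n + k ≤ u + k) ∧
      (d = 0 ∧ ¬ (g < n + k + 2 ∧ n + k + 2 ≤ u + k) ∨
        d = 1 ∧ g < n + k + 2 ∧ n + k + 2 ≤ u + k))) ?_ ?_
  · intro u hu
    obtain ⟨huX, hug⟩ := (hT u).1 hu
    have hn0 : 9 ≤ n := by nlinarith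
    by_cases hgn : g < n
    · have h1 : ∃ a : ℤ, a = 0 ∧ u + k ≤ g ∨ a = u + k - g ∧ g < u + k ∧ u + k ≤ n ∨
          a = n - g ∧ n < u + k := by
        rcases le_or_gt (u + k) g with h | h
        · exact ⟨0, by omega⟩
        · rcases le_or_gt (u + k) n with h' | h'
          · exact ⟨u + k - g, by omega⟩
          · exact ⟨n - g, by omega⟩
      obtain ⟨a, ha⟩ := h1
      obtain ⟨b, hb⟩ : ∃ b : ℤ, b = 0 ∧ u + k < n + 2 ∨ b = 1 ∧ n + 2 ≤ u + k := by
        by_cases h : u + k < n + 2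
        · exact ⟨0, by omega⟩
        · exact ⟨1, by omega⟩
      obtain ⟨d, hd⟩ : ∃ d : ℤ, d = 1 ∧ g ≤ n - k ∧ h ≤ u + k ∨
          d = 0 ∧ ¬ (g ≤ n - k ∧ h ≤ u + k) := by
        by_cases h : g ≤ n - k ∧ h ≤ u + k
        · exact ⟨1, by omega⟩
        · exact ⟨0, by omega⟩
      refine ⟨a + b - d, by omega, by omega, fun _ => ⟨a, b, d, rfl, ha, hb, hd⟩,
        fun h => by omega⟩
    · obtain ⟨a, ha⟩ : ∃ a : ℤ, a = 0 ∧ ¬ (g < n + 2 ∧ n + 2 ≤ u + k) ∨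
          a = 1 ∧ g < n + 2 ∧ n + 2 ≤ u + k := by
        by_cases h : g < n + 2 ∧ n + 2 ≤ u + k
        · exact ⟨1, by omega⟩
        · exact ⟨0, by omega⟩
      obtain ⟨b, hb⟩ : ∃ a : ℤ, a = 0 ∧ ¬ (g < n + k ∧ n + k ≤ u + k) ∨
          a = 1 ∧ g < n + k ∧ n + k ≤ u + k := by
        by_cases h : g < n + k ∧ n + k ≤ u + k
        · exact ⟨1, by omega⟩
        · exact ⟨0, by omega⟩
      obtain ⟨d, hd⟩ : ∃ a : ℤ, a = 0 ∧ ¬ (g < n + k + 2 ∧ n + k + 2 ≤ u + k) ∨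
          a = 1 ∧ g < n + k + 2 ∧ n + k + 2 ≤ u + k := by
        by_cases h : g < n + k + 2 ∧ n + k + 2 ≤ u + k
        · exact ⟨1, by omega⟩
        · exact ⟨0, by omega⟩
      have hu' := huX.cases
      refine ⟨a + b + d, by omega, ?_, fun h => by omega, fun _ => ⟨a, b, d, rfl, ha, hb, hd⟩⟩
      clear hT hu
      omega
  · intro u hu v hv i hFu hFv huv c hc hcT
    have hug := ((hT u).1 hu).2
    have hvg := ((hT v).1 hv).2
    have hcg : g < c := by
      by_contra hcg
      exact hcT ((hT c).2 ⟨hc, by omega⟩)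
    refine ⟨fun ⟨h1, h2⟩ => ?_, by omega⟩
    have hc' := hc.cases
    have hch := hc.1
    have hn0 : 9 ≤ n := by nlinarith
    clear hT hu hv hcT
    by_cases hgn : g < n
    · obtain ⟨a, b, d, e, ha, hb, hd⟩ := hFu.1 hgn
      obtain ⟨a', b', d', e', ha', hb', hd'⟩ := hFv.1 hgn
      clear hFu hFv
      omega
    · obtain ⟨a, b, d, e, ha, hb, hd⟩ := hFu.2 (by omega)
      obtain ⟨a', b', d', e', ha', hb', hd'⟩ := hFv.2 (by omega)
      clear hFu hFv
      omega

/-- Once the rows are long enough, everything else can be filled in from left to right. -/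
theorem reach_finish (hκ : (κ : ℤ) = k) (hk : 3 ≤ k) (hn : n = k * k + 1)
    (hh : r < k → h = A + r * k + r) (hh1 : h ≠ -1)
    (hlast : 1 < A + k ∨ 0 < A + k ∧ r < k) (hA' : A ≤ 1) (hr : 0 < r) (hy1 : 1 ≤ y)
    (hy2 : y ≤ k + 2) (hσ : 0 ≤ σ)
    (hpr : pr → σ = 1 ∨ y + (k - 1) * k < n + 2 - k ∨ 3 ≤ A + k ∧ r < k)
    (hvn : y + (k - 1) * k < n ∨ A = 1 ∧ r < k)
    (hK : ∀ q c, InRow k A r y k (k + 1) q c → q < K) (hKk : K ≤ k)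
    (hY : A + K + σ ≤ y) (hY' : r ≤ K - 2 → A + K + σ + 1 ≤ y)
    (hlong : n - k + 1 ≤ y + (K - 1) * k ∨ n - k < h ∧ h ≤ y + (K - 1) * k + k ∧ h ≤ n)
    (hreach : Reach (powerGraph k (position k n h pl pr)) lin (κ + 1)
      (rowSet k n (position k n h pl pr) (fun c => c ≤ 0) A r y k (k + 1))) :
    Reach (powerGraph k (position k n h pl pr)) lin (κ + 1)
      {c | position k n h pl pr c} := by
  have hkk : 3 * k ≤ k * k := Int.mul_le_mul_of_nonneg_right hk (by omega)
  suffices H : ∀ i : ℕ, Reach (powerGraph k (position k n h pl pr)) lin (κ + 1)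
      (rowSet k n (position k n h pl pr) (fun c => c ≤ y + i) A r y k (k + 1)) by
    refine (H (n + k + 2).toNat).extend 0 (fun c hc => hc.1) (fun c hc => Or.inl ⟨hc, Or.inl ?_⟩)
      fun h0 h1 => ?_
    · dsimp only
      rcases hc.cases with h | h | h | h | h | h | h <;> omega
    · have := h1.cases
      omega
  intro i
  induction i with
  | zero =>
    refine hreach.extend 0 (fun c hc => ⟨hc.1, ?_⟩) (fun c hc => Or.inl ⟨hc.1, ?_⟩) fun h0 h1 => ?_
    · exact hc.2.imp (fun h => by dsimp only at h ⊢; omega) id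
    · rcases hc.2 with h | h
      · by_cases hc0 : c ≤ 0
        · exact Or.inl hc0
        · have hcn := hc.1.cases
          have : 0 * k = 0 := zero_mul k
          refine Or.inr ⟨by omega, ?_, 0, le_rfl, by omega, by omega, fun h => by omega, by omega,
            fun h => by omega⟩
          omega
      · exact Or.inr h
    · have := h1.1.cases
      omega
  | succ i ih =>
    refine ih.extend (y + i + 1) (fun c hc => ⟨hc.1, ?_⟩) (fun c hc => ?_) fun h0 h1 => ?_
    · exact hc.2.imp (fun h => by push_cast; dsimp only at h ⊢; omega) id
    · by_cases hci : c = y + i + 1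
      · exact Or.inr hci
      · refine Or.inl ⟨hc.1, hc.2.imp (fun h => ?_) id⟩
        push_cast at h
        dsimp only at h ⊢
        omega
    -- The element to be added lies beyond the end of row `q` and not beyond that of row `q + 1`.
    -- For `q + 1 < K` the gap count applies; afterwards all rows have been passed and a prefix is
    -- present.
    · obtain ⟨q, hq⟩ : ∃ q : ℤ, q = i / k := ⟨_, rfl⟩
      have hq1 : q * k ≤ i := by rw [hq]; exact Int.ediv_mul_le _ (by omega)
      have hq2 : (i : ℤ) < (q + 1) * k := by rw [hq]; exact Int.lt_ediv_add_one_mul_self _ (by omega)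
      have hq0 : 0 ≤ q := by rw [hq]; exact Int.ediv_nonneg (by omega) (by omega)
      by_cases hqK : q + 1 < K
      · refine typesLE_gap hκ hk hn hh hh1 hlast hA' hr hy1 hy2 hσ hpr hvn hK hY hY' hq0
          (by omega) hqK (by omega) (by omega) fun ⟨h3, h4⟩ => h0 ⟨h1.1, Or.inr ⟨by omega, ?_,
            q + 1, by omega, by omega, by omega, fun h5 => ?_, by omega, fun h6 => by omega⟩⟩
        · have : (q + 1 + 1) * k ≤ k * k := Int.mul_le_mul_of_nonneg_right (by omega) (by omega)
          rw [show (q + 1 + 1) * k = (q + 1) * k + k by ring] at this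
          by_contra hcn
          rcases h1.1.right (by omega) (by omega) (by omega) with h | h | h <;> omega
        · by_cases hrq : r = q + 1
          · have h6 := hh (by omega)
            rw [hrq] at h6
            have := h1.1.1
            omega
          · omega
      · have hKq : (K - 1) * k ≤ q * k := Int.mul_le_mul_of_nonneg_right (by omega) (by omega)
        refine typesLE_prefix (h := h) (g := y + i) hκ hk hn ?_ _ fun c =>
          ⟨fun hc => ⟨hc.1, ?_⟩, fun hc => ⟨hc.1, Or.inl hc.2⟩⟩
        · omega
        · rcases hc.2 with h | ⟨h2, h3, p, hp⟩
          · exact h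
          · have := hK p c hp
            have hpq : p * k ≤ (K - 1) * k := Int.mul_le_mul_of_nonneg_right (by omega) (by omega)
            obtain ⟨a1, a2, a3, a4, a5, a6⟩ := hp
            have := a6 (by omega)
            omega

end finish

open CWExpr

/-! ### The last levels -/

section late

variable {κ : ℕ} {k n h : ℤ} {pl pr : Prop} {A r y s s' : ℤ} {lin : Prop}

/-- A pair of left elements, or of elements up to `w`, is not separated if everything up to `w + k`
is there. -/
theorem unsplit_of_dead {T : Set ℤ} {u v : ℤ}
    (hT : ∀ c, position k n h pl pr c → c ≤ 0 ∨ c ≤ v - k ∨ 1 ≤ c ∧ c ≤ v + k → c ∈ T) :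
    Unsplit k (position k n h pl pr) T u v := by
  intro c hc hcT
  refine ⟨fun hcc => ?_, fun hcc => ?_⟩
  · by_cases h1 : 1 ≤ c
    · exact hcT (hT c hc (Or.inr (Or.inr ⟨h1, hcc.2⟩)))
    · exact hcT (hT c hc (Or.inl (by omega)))
  · exact hcT (hT c hc (Or.inr (Or.inl (by omega))))

/-- Few types while the row `0` is completed. -/
theorem typesLE_bottom (hκ : (κ : ℤ) = k) (hk : 3 ≤ k) (hn : n = k * k + 1)
    (hh : h = A + r * k + r) (hh1 : h ≠ -1) (hA : 1 ≤ A + k) (hA' : A ≤ 1) (hr : 0 < r)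
    (hr' : r < k) (hs0 : 0 < s') (hs : s' < k) (hy : y = A + k - 1) :
    TypesLE (powerGraph k (position k n h pl pr))
      (rowSet k n (position k n h pl pr) (fun c => c ≤ 0) A r y 0 s') κ := by
  have hkk : 3 * k ≤ k * k := Int.mul_le_mul_of_nonneg_right hk (by omega)
  have hn0 : 0 < n := by omega
  -- The last row is still empty, so `k - 1` is free for the newest element, the top of row `s' -
  -- 1`, whose neighbour at distance `k` on the right is not there yet. The ends share `0` with row
  -- `0`.
  refine typesLE_of_rel (fun c hc => hc.1) (fun u i => u ≤ 0 ∧ i = 0 ∨ 1 ≤ u ∧ u ≤ n ∧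
    ∃ q, InRow k A r y 0 s' q u ∧ q ≤ k - 2 ∧ (q + 1 = s' ∧ u = y + q * k + 1 ∧ i = k - 1 ∨
      ¬ (q + 1 = s' ∧ u = y + q * k + 1) ∧ i = q)) ?_ ?_
  · rintro u ⟨huX, hu⟩
    rcases hu with hu | ⟨h1, h2, q, hq⟩
    · exact ⟨0, le_rfl, by omega, Or.inl ⟨hu, rfl⟩⟩
    · have hqk : q ≤ k - 2 := by
        obtain ⟨a1, a2, a3, a4, a5, a6⟩ := hq
        omega
      by_cases hd : q + 1 = s' ∧ u = y + q * k + 1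
      · exact ⟨k - 1, by omega, by omega, Or.inr ⟨h1, h2, q, hq, hqk, Or.inl ⟨hd.1, hd.2, rfl⟩⟩⟩
      · exact ⟨q, hq.1, by omega, Or.inr ⟨h1, h2, q, hq, hqk, Or.inr ⟨hd, rfl⟩⟩⟩
  · rintro u hu v hv i hFu hFv huv
    have hfull : ∀ c, position k n h pl pr c → c ≤ y + k + 1 → (s' = 1 → c ≤ y + k) →
        c ∈ rowSet k n (position k n h pl pr) (fun c => c ≤ 0) A r y 0 s' := by
      clear hFu hFv
      intro c hc h1 h2
      refine ⟨hc, ?_⟩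
      by_cases hc0 : c ≤ 0
      · exact Or.inl hc0
      · refine Or.inr ⟨by omega, by omega, ?_⟩
        by_cases hcy : c ≤ y + 1
        · have : 0 * k = 0 := zero_mul k
          exact ⟨0, le_rfl, by omega, by omega, fun h => by omega, by omega, fun h => by omega⟩
        · have : 1 * k = k := one_mul k
          refine ⟨1, by omega, by omega, by omega, fun h => ?_, by omega, fun h => by omega⟩
          have hr1 : r = 1 := by omega
          have := hc.1
          rw [hr1] at hh
          omega
    rcases hFv with ⟨hv0, hj⟩ | ⟨hv1, hvn, p, hp, hpk, hj⟩
    · refine unsplit_of_dead fun c hc hcc => hfull c hc ?_ ?_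
      · have := hv.1.left hv0 hn0.le (by omega); omega
      · have := hv.1.left hv0 hn0.le (by omega); omega
    · rcases hFu with ⟨hu0, hi⟩ | ⟨hu1, hun, q, hq, hqk, hi⟩
      · have hp0 : p = 0 := by omega
        subst hp0
        obtain ⟨a1, a2, a3, a4, a5, a6⟩ := hp
        refine unsplit_of_dead fun c hc hcc => hfull c hc ?_ ?_ <;> omega
      · have hqp : q = p := by
          rcases hi with hi | hi <;> rcases hj with hj | hj <;> omega
        subst hqp
        have hqk' : q * k ≤ (k - 2) * k := Int.mul_le_mul_of_nonneg_right hqk (by omega)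
        rw [show (k - 2) * k = k * k - 2 * k by ring] at hqk'
        have hpb := hp.2.2.2.2.1
        refine unsplit_of_position hk hn0 hu1 hvn (fun c hc hcT h1 h2 =>
          rowSet_unsplit (fun _ c hc => hh ▸ hc.1) hn (by omega) (by omega) hA' hr hq hp
            (fun h => ?_) hc hcT h1 h2) (fun _ => ?_) (fun _ _ => ?_) (by omega) (by omega)
        · by_cases hqs : q + 1 = s'
          · omega
          · exact hp.2.2.2.2.2 (by omega)
        · by_cases hh' : h = 1 - k
          · exact Or.inr hh'
          · exact Or.inl (hfull _ ⟨Ne.symm hh', Or.inr (Or.inr (Or.inl rfl))⟩ (by omega) (by omega))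
        · by_cases hpl : pl
          · exact Or.inl (hfull _ ⟨hh1.symm, Or.inr (Or.inr (Or.inr (Or.inl ⟨hpl, rfl⟩)))⟩ (by omega)
              (by omega))
          · exact Or.inr hpl

/-- Few types after the row `0` is completed. -/
theorem typesLE_top (hκ : (κ : ℤ) = k) (hk : 3 ≤ k) (hn : n = k * k + 1)
    (hh : r < k → h = A + r * k + r) (hh1 : h ≠ -1) (hA : 1 < A + k ∨ 0 < A + k ∧ r < k) (hA' : A ≤ 1)
    (hr : 0 < r) (hA0 : A ≤ -1 ∨ A = 1 ∧ r < k ∨ A = 0 ∧ k ≤ s)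
    (hpr : pr → A + k ≤ 1 ∨ 3 ≤ A + k ∧ r < k ∨ A + k = 2 ∧ k ≤ s) (hs : 0 < s) (hy : y = A + k) :
    TypesLE (powerGraph k (position k n h pl pr))
      (rowSet k n (position k n h pl pr) (fun c => c ≤ 0) A r y s (k + 1)) κ := by
  have hkk : 3 * k ≤ k * k := Int.mul_le_mul_of_nonneg_right hk (by omega)
  have hn0 : 0 < n := by omega
  -- Everything up to `y + k` is present, so the elements up to `y = A + k` have no outside
  -- neighbours and share `0`; the rows from `1` on take their own numbers.
  refine typesLE_of_rel (fun c hc => hc.1) (fun u i => u ≤ A + k ∧ i = 0 ∨ A + k < u ∧ u ≤ n ∧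
    ∃ q, InRow k A r y s (k + 1) q u ∧ 1 ≤ q ∧ i = q) ?_ ?_
  · rintro u ⟨huX, hu⟩
    by_cases huA : u ≤ A + k
    · exact ⟨0, le_rfl, by omega, Or.inl ⟨huA, rfl⟩⟩
    · rcases hu with hu | ⟨h1, h2, q, hq⟩
      · omega
      · refine ⟨q, hq.1, by have := hq.2.1; omega, Or.inr ⟨by omega, h2, q, hq, ?_, rfl⟩⟩
        obtain ⟨a1, a2, a3, a4, a5, a6⟩ := hq
        by_contra hq1
        have hq0 : q = 0 := by omega
        subst hq0
        have := a6 (by omega)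
        omega
  · rintro u hu v hv i hFu hFv huv
    have hfull : ∀ c, position k n h pl pr c → c ≤ y + k →
        c ∈ rowSet k n (position k n h pl pr) (fun c => c ≤ 0) A r y s (k + 1) := by
      clear hFu hFv
      intro c hc h1
      refine ⟨hc, ?_⟩
      by_cases hc0 : c ≤ 0
      · exact Or.inl hc0
      · refine Or.inr ⟨by omega, by omega, ?_⟩
        by_cases hcy : c ≤ y
        · have : 0 * k = 0 := zero_mul k
          exact ⟨0, le_rfl, by omega, by omega, fun h => by omega, by omega, fun h => by omega⟩
        · have : 1 * k = k := one_mul k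
          refine ⟨1, by omega, by omega, by omega, fun h => ?_, by omega, fun h => by omega⟩
          have hr1 : r = 1 := by omega
          have := hc.1
          rw [hr1] at hh
          omega
    rcases hFv with ⟨hv0, hj⟩ | ⟨hv1, hvn, q, hq, hq1, hj⟩
    · clear hFu
      exact unsplit_of_dead fun c hc hcc => hfull c hc (by omega)
    · rcases hFu with ⟨hu0, hi⟩ | ⟨hu1, hun, p, hp, hp1, hi⟩
      · omega
      · have hqp : p = q := by omega
        subst hqp
        have hcase : p ≤ k - 2 ∧ p * k ≤ k * k - 2 * k ∨ p = k - 1 ∧ p * k = k * k - k := by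
          have := hp.2.1
          by_cases hpk : p ≤ k - 2
          · have hqk' : p * k ≤ (k - 2) * k := Int.mul_le_mul_of_nonneg_right hpk (by omega)
            rw [show (k - 2) * k = k * k - 2 * k by ring] at hqk'
            exact Or.inl ⟨hpk, hqk'⟩
          · have hpk' : p = k - 1 := by omega
            exact Or.inr ⟨hpk', by rw [hpk']; ring⟩
        refine unsplit_of_position hk hn0 (by omega) hvn (fun c hc hcT h1 h2 =>
          rowSet_unsplit (fun hrk c hc => hh hrk ▸ hc.1) hn hA (by omega) hA' hr hp hq
            (fun h => ?_) hc hcT h1 h2) (fun _ => by omega) (fun _ _ => ?_) (fun h3 h4 hp1 => ?_) ?_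
        · have := hq.2.1
          exact hq.2.2.2.2.2 (by omega)
        · by_cases hpl : pl
          · exact Or.inl (hfull _ ⟨hh1.symm, Or.inr (Or.inr (Or.inr (Or.inl ⟨hpl, rfl⟩)))⟩ (by omega))
          · exact Or.inr hpl
        · have h5 := hpr hp1
          obtain ⟨a1, a2, a3, a4, a5, a6⟩ := hp
          obtain ⟨b1, b2, b3, b4, b5, b6⟩ := hq
          clear hpr hfull
          omega
        · obtain ⟨a1, a2, a3, a4, a5, a6⟩ := hp
          obtain ⟨b1, b2, b3, b4, b5, b6⟩ := hq
          clear hpr hfull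
          omega

end late

open CWExpr

/-! ### Building path powers with a hole -/

section strategies

variable {κ : ℕ} {k n h : ℤ} {pl pr : Prop} {A r y s s' : ℤ} {lin : Prop}

theorem typesLE_singleton {V : Type} {G : SimpleGraph V} {m : ℕ} (hm : 0 < m) (v : V) :
    TypesLE G {v} m :=
  ⟨fun _ => 0, fun _ _ => hm, by
    rintro u rfl w hw -
    rw [Set.mem_singleton_iff.1 hw]
    exact SameType.rfl⟩

/-- At level `A - 1` all rows are empty, so that only the two ends `-1 - k` and `1 - k` have to be
created. -/
theorem reach_ends (hκ : (κ : ℤ) = k) (hk : 3 ≤ k) (hh1 : 1 ≤ h) (Z : ℤ → Prop) (hZ : ∀ c, position k n h pl pr c → (Z c ↔ c = -1 - k ∨ c = 1 - k)) :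
    Reach (powerGraph k (position k n h pl pr)) lin (κ + 1)
      (rowSet k n (position k n h pl pr) Z A r (A - 1) k (k + 1)) := by
  have hempty : ∀ q c, ¬ InRow k A r (A - 1) k (k + 1) q c := by
    rintro q c ⟨a1, a2, a3, a4, a5, a6⟩
    have := a6 (by omega)
    omega
  have h1 : position k n h pl pr (-1 - k) := ⟨by omega, Or.inr (Or.inl rfl)⟩
  have h2 : position k n h pl pr (1 - k) := ⟨by omega, Or.inr (Or.inr (Or.inl rfl))⟩
  refine (Reach.single (-1 - k)).extend (1 - k) ?_ ?_ fun _ _ =>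
    typesLE_singleton (by omega) _
  · rintro c rfl
    exact ⟨h1, Or.inl ((hZ _ h1).2 (Or.inl rfl))⟩
  · rintro c ⟨hc, hc' | ⟨-, -, q, hq⟩⟩
    · exact (hZ c hc).1 hc'
    · exact absurd hq (hempty q c)

/-- The levels `A + k - 1` and `A + k` can be reached if row `0` and the ends are there. -/
theorem reach_bottom_level (hκ : (κ : ℤ) = k) (hk : 3 ≤ k) (hn : n = k * k + 1)
    (hh : h = A + r * k + r) (hh1 : h ≠ -1) (hA : 1 ≤ A + k) (hA' : A ≤ 1) (hr : 0 < r)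
    (hr' : r < k) (hpl : pl → A ≤ -1 ∧ 2 ≤ A + k)
    (hreach : Reach (powerGraph k (position k n h pl pr)) lin (κ + 1)
      (rowSet k n (position k n h pl pr) (fun c => c ≤ 0) A r (A + k - 1) k (k + 1))) :
    Reach (powerGraph k (position k n h pl pr)) lin (κ + 1)
      (rowSet k n (position k n h pl pr) (fun c => c ≤ 0) A r (A + k) k (k + 1)) := by
  have := reach_bot (s' := k) (by omega) (by rwa [rowSet_start]) fun t ht0 htk => by
    rcases eq_or_lt_of_le ht0 with rfl | ht
    · rw [rowSet_start]
      exact typesLE_early hκ hk hn hh hA hA' hr hr' (fun c hc => hc) (by omega) (by omega)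
        (fun hp => Or.inl ⟨by omega, (hpl hp).1, by have := hpl hp; omega⟩) (Or.inr (by omega))
    · exact typesLE_bottom hκ hk hn hh hh1 hA hA' hr hr' ht htk rfl
  rw [rowSet_next'] at this
  rwa [show A + k - 1 + 1 = A + k by ring] at this

/-- One more level, up to `A + k + 1`, is exactly what `reach_finish` requires for `K = k` and `σ =
0`. -/
theorem reach_next_level (hκ : (κ : ℤ) = k) (hk : 3 ≤ k) (hn : n = k * k + 1)
    (hh : h = A + r * k + r) (hh1 : h ≠ -1) (hA : 1 ≤ A + k) (hA' : A ≤ 1) (hr : 0 < r)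
    (hr' : r < k) (hA0 : A ≠ 0) (hpr : pr → A + k ≠ 2)
    (hreach : Reach (powerGraph k (position k n h pl pr)) lin (κ + 1)
      (rowSet k n (position k n h pl pr) (fun c => c ≤ 0) A r (A + k) k (k + 1))) :
    Reach (powerGraph k (position k n h pl pr)) lin (κ + 1) {c | position k n h pl pr c} := by
  have hkk : 3 * k ≤ k * k := Int.mul_le_mul_of_nonneg_right hk (by omega)
  have hkk1 : (k - 1) * k = k * k - k := by ring
  have := reach_top (s := 0) (by omega) hreach fun t ht0 htk =>
    typesLE_top hκ hk hn (fun _ => hh) hh1 (by omega) hA' hr (by omega)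
      (fun hp => by have := hpr hp; omega) ht0 rfl
  rw [rowSet_next] at this
  refine reach_finish (K := k) (σ := 0) hκ hk hn (fun _ => hh) hh1 (by omega) hA' hr (by omega)
    (by omega) le_rfl (fun hp => ?_) ?_ (fun q c hq => hq.2.1) le_rfl (by omega) (by omega) ?_ this
  · have := hpr hp; omega
  · omega
  · omega

/-- A hole after a first row with `A + k` elements. -/
theorem reach_right (hκ : (κ : ℤ) = k) (hk : 3 ≤ k) (hn : n = k * k + 1)
    (hh : h = A + r * k + r) (hA : 1 ≤ A + k) (hA' : A ≤ 1) (hr : 0 < r)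
    (hr' : r < k) (hA0 : A ≠ 0) (hA2 : A + k ≠ 2) (hpl : ¬ pl) :
    Reach (powerGraph k (position k n h pl pr)) lin (κ + 1) {c | position k n h pl pr c} := by
  have hkk : 3 * k ≤ k * k := Int.mul_le_mul_of_nonneg_right hk (by omega)
  have hh1 : 1 ≤ h := by
    have : 1 * k ≤ r * k := Int.mul_le_mul_of_nonneg_right (by omega) (by omega)
    omega
  have h0 := reach_ends (n := n) (r := r) (A := A) (pl := pl) (pr := pr) (lin := lin) hκ hk hh1 (fun c => c ≤ 0)
    fun c hc => ⟨fun hc0 => by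
      rcases hc.left hc0 (by omega) (by omega) with h | h | h
      · exact Or.inl h
      · exact Or.inr h
      · subst h
        exact absurd (hc.pl_of (by omega) (by omega)) hpl, fun h => by omega⟩
  have h1 := reach_levels (y' := A + k - 1) (by omega) (by omega) h0 fun z hz hz' t ht0 htk =>
    typesLE_early hκ hk hn hh hA hA' hr hr' (fun c hc => hc) (by omega) (by omega)
      (fun hp => absurd hp hpl) (Or.inl (by omega))
  exact reach_next_level hκ hk hn hh (by omega) hA hA' hr hr' hA0 (fun _ => hA2)
    (reach_bottom_level hκ hk hn hh (by omega) hA hA' hr hr' (fun hp => absurd hp hpl) h1)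

end strategies

open CWExpr

/-! ### Late insertion of the left ends, and holes close to the ends of the path -/

section strategies

variable {κ : ℕ} {k n h : ℤ} {pl pr : Prop} {A r y s s' : ℤ} {lin : Prop} {X Z Z' : ℤ → Prop}

/-- The left set is extended by at most one element. -/
theorem reach_add (x : ℤ)
    (hreach : Reach (powerGraph k X) lin (κ + 1) (rowSet k n X Z A r y s s'))
    (hZ : ∀ c, X c → (Z' c ↔ Z c ∨ c = x))
    (hT : X x → TypesLE (powerGraph k X) (rowSet k n X Z A r y s s') κ) :
    Reach (powerGraph k X) lin (κ + 1) (rowSet k n X Z' A r y s s') := by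
  refine hreach.extend x ?_ ?_ fun _ hx => hT hx.1
  · rintro c ⟨hc, h1 | h2⟩
    · exact ⟨hc, Or.inl ((hZ c hc).2 (Or.inl h1))⟩
    · exact ⟨hc, Or.inr h2⟩
  · rintro c ⟨hc, h1 | h2⟩
    · exact ((hZ c hc).1 h1).imp (fun h => ⟨hc, Or.inl h⟩) id
    · exact Or.inl ⟨hc, Or.inr h2⟩

theorem Reach.extend_nonempty {V : Type} {G : SimpleGraph V} {lin : Prop} {m : ℕ} {T T' : Set V}
    (h : T.Nonempty → Reach G lin (m + 1) T) (x : V) (hsub : ∀ c ∈ T, c ∈ T')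
    (hx : ∀ c ∈ T', c ∈ T ∨ c = x) (hT : x ∉ T → x ∈ T' → TypesLE G T m) (hne : T'.Nonempty) :
    Reach G lin (m + 1) T' := by
  rcases T.eq_empty_or_nonempty with hT0 | hT0
  · obtain ⟨c, hc⟩ := hne
    have : T' = {x} := by
      ext d
      refine ⟨fun hd => (hx d hd).resolve_left fun h => by rw [hT0] at h; exact h, ?_⟩
      rintro rfl
      rcases hx c hc with h | rfl
      · rw [hT0] at h; exact h.elim
      · exact hc
    rw [this]
    exact Reach.single x
  · exact (h hT0).extend x hsub hx hT

/-- Several levels can be added, beginning with the empty set. -/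
theorem reach_levels_of_empty {y' : ℤ} (hk : 0 ≤ k) (hy : A - 1 ≤ y')
    (h : (rowSet k n X Z A r (A - 1) k (k + 1)).Nonempty →
      Reach (powerGraph k X) lin (κ + 1) (rowSet k n X Z A r (A - 1) k (k + 1)))
    (hT : ∀ z, A - 1 ≤ z → z < y' → ∀ t, 0 < t → t ≤ k →
      TypesLE (powerGraph k X) (rowSet k n X Z A r z t (k + 1)) κ)
    (hne : (rowSet k n X Z A r y' k (k + 1)).Nonempty) :
    Reach (powerGraph k X) lin (κ + 1) (rowSet k n X Z A r y' k (k + 1)) := by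
  obtain ⟨j, hj⟩ : ∃ j : ℕ, y' = A - 1 + j := ⟨(y' - (A - 1)).toNat, by omega⟩
  suffices H : ∀ i : ℕ, i ≤ j → (rowSet k n X Z A r (A - 1 + i) k (k + 1)).Nonempty →
      Reach (powerGraph k X) lin (κ + 1) (rowSet k n X Z A r (A - 1 + i) k (k + 1)) by
    rw [hj] at hne ⊢
    exact H j le_rfl hne
  intro i
  induction i with
  | zero => intro _; simpa using h
  | succ i ih =>
    intro hi
    rw [show A - 1 + ((i + 1 : ℕ) : ℤ) = A - 1 + i + 1 by push_cast; ring, ← rowSet_next]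
    obtain ⟨K, rfl⟩ : ∃ K : ℕ, k = K := ⟨k.toNat, by omega⟩
    suffices H : ∀ l : ℕ, l ≤ K → (rowSet K n X Z A r (A - 1 + i) (K - l) (K + 1)).Nonempty →
        Reach (powerGraph K X) lin (κ + 1) (rowSet K n X Z A r (A - 1 + i) (K - l) (K + 1)) by
      have := H K le_rfl
      rwa [sub_self] at this
    intro l
    induction l with
    | zero => intro _; simpa using ih (by omega)
    | succ l ihl =>
      intro hl
      have hi' : (K : ℤ) - ((l + 1 : ℕ) : ℤ) + 1 = K - l := by push_cast; ring
      refine Reach.extend_nonempty (ihl (by omega))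
        (A - 1 + i + (K - ((l + 1 : ℕ) : ℤ)) * K + 1) (fun c hc => ?_)
        (fun c hc => ?_) fun _ _ => hT _ (by omega) (by omega) _ (by omega) (by omega)
      · rw [← hi'] at hc; exact mem_rowSet_extend_top hc
      · rw [← hi']; exact mem_rowSet_of_top hc

theorem reach_bot_of {s₀ : ℤ} (hs : s₀ ≤ s')
    (h : Reach (powerGraph k X) lin (κ + 1) (rowSet k n X Z A r y 0 s₀))
    (hT : ∀ t, s₀ ≤ t → t < s' → y + t * k + 1 ∉ rowSet k n X Z A r y 0 t →
      TypesLE (powerGraph k X) (rowSet k n X Z A r y 0 t) κ) :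
    Reach (powerGraph k X) lin (κ + 1) (rowSet k n X Z A r y 0 s') := by
  obtain ⟨j, rfl⟩ : ∃ j : ℕ, s' = s₀ + j := ⟨(s' - s₀).toNat, by omega⟩
  suffices H : ∀ i : ℕ, i ≤ j →
      Reach (powerGraph k X) lin (κ + 1) (rowSet k n X Z A r y 0 (s₀ + i)) from H j le_rfl
  intro i
  induction i with
  | zero => intro _; simpa using h
  | succ i ih =>
    intro hi
    rw [show s₀ + ((i + 1 : ℕ) : ℤ) = s₀ + i + 1 by push_cast; ring]
    refine (ih (by omega)).extend (y + (s₀ + i) * k + 1) (fun c hc => ?_) (fun c hc => ?_) fun h _ =>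
      hT _ (by omega) (by omega) h
    · exact mem_rowSet_extend_bot hc
    · exact mem_rowSet_of_bot hc

/-- Two elements of a row are not separated. -/
theorem InRow.unsplit {u v q : ℤ} (hu : InRow k A r y s (k + 1) q u)
    (hv : InRow k A r y s (k + 1) q v) (hk : 3 ≤ k) (hn : n = k * k + 1)
    (hh : r < k → h = A + r * k + r) (hlast : 1 < A + k ∨ 0 < A + k ∧ r < k) (hA' : A ≤ 1)
    (hr : 0 < r) (hu1 : 1 ≤ u) (hvn : v < n)
    (h1 : u = 1 → 1 - k ∈ rowSet k n (position k n h pl pr) Z A r y s (k + 1) ∨ h = 1 - k)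
    (h2 : u ≤ k - 1 → k - 1 < v →
      -1 ∈ rowSet k n (position k n h pl pr) Z A r y s (k + 1) ∨ ¬ pl)
    (h3 : u + k < n + 2 → n + 2 ≤ v + k → ¬ pr) :
    Unsplit k (position k n h pl pr) (rowSet k n (position k n h pl pr) Z A r y s (k + 1)) u v :=
  unsplit_of_position (by omega) (by have := mul_self_nonneg k; omega) hu1 hvn.le (fun c hc hcT h4 h5 =>
    rowSet_unsplit (fun hrk c hc => hh hrk ▸ hc.1) hn hlast (by omega) hA' hr hu hv
      (fun _ => hv.2.2.2.2.2 (by have := hv.2.1; omega)) hc hcT h4 h5) h1 h2 h3 hvn.ne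

theorem mem_rowSet_first {c : ℤ} (hc : c ∈ rowSet k n X Z A r (A - 1) k (k + 1)) : Z c := by
  obtain ⟨-, h | ⟨-, -, q, a1, a2, a3, a4, a5, a6⟩⟩ := hc
  · exact h
  · have := a6 (by omega)
    omega

theorem mul_le_last {q : ℤ} (hk : 0 ≤ k) (hq : q < k) : q * k ≤ k * k - k := by
  have : q * k ≤ (k - 1) * k := Int.mul_le_mul_of_nonneg_right (by omega) hk
  rwa [show (k - 1) * k = k * k - k by ring] at this

theorem le_mul_of_lt {p q : ℤ} (hk : 0 ≤ k) (hq : p ≤ q) : p * k ≤ q * k :=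
  Int.mul_le_mul_of_nonneg_right hq hk

/-- The hole is the last but two element of `[1, n]`. -/
theorem reach_hole_near_end (hκ : (κ : ℤ) = k) (hk : 3 ≤ k) (hn : n = k * k + 1)
    (hh : h = k * k - 1) :
    Reach (powerGraph k (position k n h pl pr)) lin (κ + 1) {c | position k n h pl pr c} := by
  have hkk : 3 * k ≤ k * k := Int.mul_le_mul_of_nonneg_right hk (by omega)
  have hkk1 : (k - 1) * k = k * k - k := by ring
  have hkk2 : (k - 1 - 1) * k = k * k - 2 * k := by ring
  have hh' : h = 0 + (k - 1) * k + (k - 1) := by rw [hkk1]; omega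
  have hearly : ∀ z, z + 1 ≤ k - 1 → ∀ t, TypesLE (powerGraph k (position k n h pl pr))
      (rowSet k n (position k n h pl pr) (fun c => c ≤ 0 ∧ c ≠ -1) 0 (k - 1) z t (k + 1)) κ :=
    fun z hz t => typesLE_early hκ hk hn hh' (by omega) (by omega) (by omega) (by omega)
      (fun c hc => hc.1) (by omega) (by omega) (fun hp => Or.inr ⟨by omega, hz, le_rfl⟩)
      (Or.inl (by omega))
  have h0 := reach_ends (n := n) (r := k - 1) (A := 0) (pl := pl) (pr := pr) (lin := lin) hκ hk
    (by omega : 1 ≤ h) (fun c => c ≤ 0 ∧ c ≠ -1)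
    fun c hc => ⟨fun hc0 => by have := hc.left hc0.1 (by omega) (by omega); omega, fun h => by omega⟩
  have h1 := reach_levels (y' := k - 1) (by omega) (by omega) h0 fun z hz hz' t ht0 htk =>
    hearly z (by omega) t
  -- At level `k - 1` row `0` contains all path neighbours `1, …, k - 1` of `-1`, so this is the
  -- time to add it.
  have h2 := reach_add (Z' := fun c => c ≤ 0) (-1) h1 (fun c hc => by omega) fun _ => by
    have := hearly (k - 2) (by omega) 0
    rwa [rowSet_next, show k - 2 + 1 = k - 1 by ring] at this
  -- The last row is still empty, hence `K = k - 1`. The hole lies exactly `k` after the end of row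
  -- `k - 2`, which is the second case of `hlong`.
  refine reach_finish (K := k - 1) (σ := 0) hκ hk hn (fun _ => hh') (by omega) (by omega) (by omega)
    (by omega) (by omega) (by omega) le_rfl (fun hp => ?_) ?_ (fun q c hq => ?_) (by omega) (by omega)
    (by omega) ?_ h2
  · omega
  · omega
  · obtain ⟨a1, a2, a3, a4, a5, a6⟩ := hq
    have := a6 (by omega)
    by_contra hqk
    have := a4 (by omega)
    omega
  · rw [hkk2]; omega

/-! ### Building without the ends -/

/-- On the left only `1 - k` and `-1` can separate path elements. The first distinguishes just `1`,
but one of the two is the hole; the second cuts after `k - 1`, where the class `0` ends. An element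
`k` of row `0` is also one of row `1`. -/
theorem typesLE_no_ends (hκ : (κ : ℤ) = k) (hk : 3 ≤ k) (hn : n = k * k + 1)
    (hh : h = 1 ∨ h = 1 - k) (hr : k ≤ r) (hs : y < k ∧ 0 < s ∨ y = k ∧ k ≤ s) (hpr : ¬ pr) :
    TypesLE (powerGraph k (position k n h pl pr))
      (rowSet k n (position k n h pl pr) (fun _ => False) (-1) r y s (k + 1)) κ := by
  have hkk : 3 * k ≤ k * k := Int.mul_le_mul_of_nonneg_right hk (by omega)
  have hn0 : 0 < n := by omega
  have hbound : ∀ q u, InRow k (-1) r y s (k + 1) q u → u < n ∧ (q = 0 ∧ u ≤ k ∨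
      1 ≤ q ∧ k ≤ u) ∧ (q = 0 → k ≤ u → InRow k (-1) r y s (k + 1) 1 u) := by
    rintro q u ⟨a1, a2, a3, a4, a5, a6⟩
    have h1 := mul_le_last (k := k) (by omega) a2
    refine ⟨by omega, ?_, fun hq hu => ?_⟩
    · rcases eq_or_lt_of_le a1 with h0 | h0
      · rw [← h0, zero_mul] at a5 a6
        omega
      · have := le_mul_of_lt (k := k) (by omega) (by omega : 1 ≤ q)
        omega
    · rw [hq, zero_mul] at a5 a6
      have : 1 * k = k := one_mul k
      exact ⟨by omega, by omega, by omega, by omega, by omega, by omega⟩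
  refine typesLE_of_rel (fun c hc => hc.1) (fun u i => u ≤ k - 1 ∧ i = 0 ∨
    k ≤ u ∧ InRow k (-1) r y s (k + 1) i u ∧ 1 ≤ i) ?_ ?_
  · rintro u ⟨huX, hu | ⟨h1, h2, q, hq⟩⟩
    · exact hu.elim
    · by_cases huk : u ≤ k - 1
      · exact ⟨0, le_rfl, by omega, Or.inl ⟨huk, rfl⟩⟩
      · obtain ⟨-, h4, h5⟩ := hbound q u hq
        rcases h4 with h4 | h4
        · exact ⟨1, by omega, by omega, Or.inr ⟨by omega, h5 h4.1 (by omega), le_rfl⟩⟩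
        · exact ⟨q, by omega, by have := hq.2.1; omega, Or.inr ⟨by omega, hq, h4.1⟩⟩
  · rintro u ⟨huX, hu | ⟨hu1, hu2, q, hq⟩⟩ v ⟨hvX, hv | ⟨hv1, hv2, p, hp⟩⟩ i hFu hFv huv
    · exact hu.elim
    · exact hu.elim
    · exact hv.elim
    · have hh1 : u = 1 → h = 1 - k := fun h1 => by
        have := huX.1
        omega
      rcases hFv with ⟨hvk, hi⟩ | ⟨hvk, hvi, hi⟩
      · have hq0 : q = 0 := by have := hbound q u hq; omega
        have hp0 : p = 0 := by have := hbound p v hp; omega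
        subst hq0 hp0
        exact hq.unsplit hp hk hn (by omega) (by omega) (by omega) (by omega) hu1 (by omega)
          (fun h => Or.inr (hh1 h)) (by omega) (fun _ _ => hpr)
      · rcases hFu with ⟨huk, hi'⟩ | ⟨huk, hui, hi'⟩
        · omega
        · exact hui.unsplit hvi hk hn (by omega) (by omega) (by omega) (by omega) hu1
            (hbound i v hvi).1 (by omega) (by omega) (fun _ _ => hpr)

/-- At level `k` the first three rows cover `[1, 3k]`. With `-1` present, nothing outside separates
elements of `[1, 2k]`, so these form one type and leave a number for the ends. -/
theorem typesLE_some_ends (hκ : (κ : ℤ) = k) (hk : 3 ≤ k) (hn : n = k * k + 1)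
    (hh : h = 1 ∨ h = 1 - k) (hr : k ≤ r) (hpr : ¬ pr) (hZ1 : Z (-1))
    (hZ : ∀ c, Z c → c = -1 ∨ c = -1 - k) :
    TypesLE (powerGraph k (position k n h pl pr))
      (rowSet k n (position k n h pl pr) Z (-1) r k k (k + 1)) κ := by
  have hkk : 3 * k ≤ k * k := Int.mul_le_mul_of_nonneg_right hk (by omega)
  have hn0 : 0 < n := by omega
  have hfull : ∀ c, position k n h pl pr c → 1 ≤ c → c ≤ 3 * k →
      c ∈ rowSet k n (position k n h pl pr) Z (-1) r k k (k + 1) := by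
    intro c hc h1 h2
    refine ⟨hc, Or.inr ⟨h1, by omega, ?_⟩⟩
    have h01 : 0 * k = 0 := zero_mul k
    have h02 : 1 * k = k := one_mul k
    rcases le_or_gt c k with h3 | h3
    · exact ⟨0, by omega, by omega, by omega, by omega, by omega, by omega⟩
    rcases le_or_gt c (2 * k) with h4 | h4
    · exact ⟨1, by omega, by omega, by omega, by omega, by omega, by omega⟩
    · exact ⟨2, by omega, by omega, by omega, by omega, by omega, by omega⟩
  refine typesLE_of_rel (fun c hc => hc.1) (fun u i => u ≤ 0 ∧ i = 0 ∨ 1 ≤ u ∧ u ≤ 2 * k ∧ i = 1 ∨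
    2 * k < u ∧ u < n ∧ InRow k (-1) r k k (k + 1) i u ∧ 2 ≤ i) ?_ ?_
  · rintro u ⟨huX, hu | ⟨h1, h2, q, hq⟩⟩
    · have := hZ u hu
      exact ⟨0, le_rfl, by omega, Or.inl ⟨by omega, rfl⟩⟩
    · by_cases huk : u ≤ 2 * k
      · exact ⟨1, by omega, by omega, Or.inr (Or.inl ⟨h1, huk, rfl⟩)⟩
      · have hq' := hq
        obtain ⟨a1, a2, a3, a4, a5, a6⟩ := hq
        have h1 := mul_le_last (k := k) (by omega) a2
        have h6 := a6 (by omega)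
        have hq2 : 2 ≤ q := by
          by_contra hq2
          have := le_mul_of_lt (k := k) (by omega) (by omega : q ≤ 1)
          omega
        exact ⟨q, a1, by omega, Or.inr (Or.inr ⟨by omega, by omega, hq', hq2⟩)⟩
  · rintro u hu v hv i hFu hFv huv
    rcases hFv with ⟨hv0, hi⟩ | ⟨hv1, hv2, hi⟩ | ⟨hv1, hv2, hv3, hi⟩
    · have hZu : ∀ w ∈ rowSet k n (position k n h pl pr) Z (-1) r k k (k + 1), w ≤ 0 →
          w = -1 ∨ w = -1 - k := fun w hw hw0 => hw.2.elim (hZ w) fun h => by omega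
      have h1 := hZu u hu (by omega)
      have h2 := hZu v hv hv0
      intro c hc hcT
      refine ⟨fun h => hcT ?_, fun h => ?_⟩
      · refine hfull c hc ?_ (by omega)
        by_contra hc0
        have := hc.left (by omega) hn0.le (by omega)
        omega
      · have := hc.left (by omega) hn0.le (by omega)
        omega
    · have hu1 : 1 ≤ u := by omega
      have hu1' := hu.1.1
      clear hFu
      intro c hc hcT
      have hc' : c ≤ 0 ∨ 3 * k < c := by
        by_contra hcc
        exact hcT (hfull c hc (by omega) (by omega))
      refine ⟨fun h => by omega, fun h => ?_⟩
      have h3 := hc.left (by omega) hn0.le (by omega)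
      have h4 := hc.1
      have h5 : c ≠ -1 := by
        rintro rfl
        exact hcT ⟨hc, Or.inl hZ1⟩
      omega
    · rcases hFu with ⟨hu0, hi⟩ | ⟨hu1, hu2, hi⟩ | ⟨hu1, hu2, hu3, hi⟩
      · omega
      · omega
      · exact hu3.unsplit hv3 hk hn (by omega) (by omega) (by omega) (by omega) (by omega) hv2
          (by omega) (by omega) (fun _ _ => hpr)

/-- The hole is the first element of `[1, n]` or its neighbour on the left. -/
theorem reach_hole_first (hκ : (κ : ℤ) = k) (hk : 3 ≤ k) (hn : n = k * k + 1)
    (hh : h = 1 ∨ h = 1 - k) (hpr : ¬ pr) :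
    Reach (powerGraph k (position k n h pl pr)) lin (κ + 1) {c | position k n h pl pr c} := by
  have hkk : 3 * k ≤ k * k := Int.mul_le_mul_of_nonneg_right hk (by omega)
  have hkk1 : (k - 1) * k = k * k - k := by ring
  have h1 := reach_levels_of_empty (A := -1) (κ := κ) (n := n) (r := k) (lin := lin) (y' := k)
    (X := position k n h pl pr) (Z := fun _ => False) (by omega) (by omega)
    (fun ⟨c, hc⟩ => (mem_rowSet_first hc).elim)
    (fun z hz hz' t ht htk => typesLE_no_ends hκ hk hn hh le_rfl (Or.inl ⟨hz', ht⟩) hpr)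
    ⟨k, mem_rowSet_mid (by omega) (by omega) (by omega) 0
      ⟨by omega, by omega, by omega, by omega, by omega, by omega⟩⟩
  have h2 := reach_add (Z' := fun c => c = -1) (-1) h1 (fun c hc => by simp) fun _ =>
    typesLE_no_ends hκ hk hn hh le_rfl (Or.inr ⟨rfl, le_rfl⟩) hpr
  have h3 := reach_add (Z' := fun c => c = -1 ∨ c = -1 - k) (-1 - k) h2 (fun c hc => Iff.rfl) fun _ =>
    typesLE_some_ends hκ hk hn hh le_rfl hpr (by omega) (by omega)
  have h4 := reach_add (Z' := fun c => c ≤ 0) (1 - k) h3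
    (fun c hc => ⟨fun h => by have := hc.left h (by omega) (by omega); omega, fun h => by omega⟩)
    fun _ => typesLE_some_ends hκ hk hn hh le_rfl hpr (by omega) (by omega)
  exact reach_finish (K := k) (σ := 0) hκ hk hn (by omega) (by omega) (by omega) (by omega)
    (by omega) (by omega) (by omega) le_rfl (fun hp => absurd hp hpr) (by omega)
    (fun q c hq => hq.2.1) le_rfl (by omega) (by omega) (by omega) h4

end strategies

open CWExpr

section strategies

variable {κ : ℕ} {k n h : ℤ} {pl pr : Prop} {A r y s s' : ℤ} {lin : Prop} {X Z Z' : ℤ → Prop}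

/-! ### A hole congruent to `3`, with `w⁺` on the left -/

theorem InRow.bounds_of_hole (hk : 3 ≤ k) (hr' : r < k) (hs : y ≤ 0 ∧ 0 < s ∨ y = 1 ∧ k ≤ s)
    {q u : ℤ} (hq : InRow k (2 - k) r y s (k + 1) q u) :
    q ≤ k - 2 ∧ (q = 0 ∧ u ≤ 1 ∨ q = 1 ∧ 3 ≤ u ∨ 2 ≤ q ∧ k + 4 ≤ u) ∧ u ≤ k * k - k := by
  obtain ⟨a1, a2, a3, a4, a5, a6⟩ := hq
  have h1 := mul_le_last (k := k) (by omega) a2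
  have h0 : q ≤ k - 2 := by
    by_contra hq
    have hq1 : q = k - 1 := by omega
    have : q * k = k * k - k := by rw [hq1]; ring
    have := a4 (by omega)
    omega
  have h2 := mul_le_last (k := k) (q := q + 1) (by omega) (by omega)
  have h3 : (q + 1) * k = q * k + k := by ring
  refine ⟨h0, ?_, by omega⟩
  rcases eq_or_lt_of_le a1 with h0 | h0
  · rw [← h0, zero_mul] at a5 a6
    omega
  · rcases eq_or_lt_of_le (by omega : 1 ≤ q) with h0 | h0
    · rw [← h0, one_mul] at a3 a5 a6
      omega
    · have := le_mul_of_lt (k := k) (by omega) (by omega : 2 ≤ q)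
      omega

/-- As long as `-1` is missing, it splits row `1` between `k - 1` and `k`. The additional type gets
the number `k - 1`, which is free because the hole keeps the last row empty. -/
theorem typesLE_hole_no_ends (hκ : (κ : ℤ) = k) (hk : 3 ≤ k) (hn : n = k * k + 1)
    (hh : h = 2 - k + r * k + r) (hr : 0 < r) (hr' : r < k) (hs : y ≤ 0 ∧ 0 < s ∨ y = 1 ∧ k ≤ s)
    (hpr : ¬ pr) :
    TypesLE (powerGraph k (position k n h pl pr))
      (rowSet k n (position k n h pl pr) (fun _ => False) (2 - k) r y s (k + 1)) κ := by
  refine typesLE_of_rel (fun c hc => hc.1) (fun u i => u ≤ 1 ∧ i = 0 ∨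
    ∃ q, InRow k (2 - k) r y s (k + 1) q u ∧ 1 ≤ q ∧ (q = 1 ∧ u ≤ k - 1 ∧ i = 1 ∨
      q = 1 ∧ k ≤ u ∧ i = k - 1 ∨ 2 ≤ q ∧ i = q)) ?_ ?_
  · rintro u ⟨huX, hu | ⟨h1, h2, q, hq⟩⟩
    · exact hu.elim
    · obtain ⟨h3, h4 | h4 | h4, h5⟩ := hq.bounds_of_hole hk hr' hs
      · exact ⟨0, le_rfl, by omega, Or.inl ⟨h4.2, rfl⟩⟩
      · by_cases huk : u ≤ k - 1
        · exact ⟨1, by omega, by omega, Or.inr ⟨q, hq, by omega, Or.inl ⟨h4.1, huk, rfl⟩⟩⟩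
        · exact ⟨k - 1, by omega, by omega, Or.inr ⟨q, hq, by omega,
            Or.inr (Or.inl ⟨h4.1, by omega, rfl⟩)⟩⟩
      · exact ⟨q, by omega, by omega, Or.inr ⟨q, hq, by omega, Or.inr (Or.inr ⟨h4.1, rfl⟩)⟩⟩
  · rintro u hu v hv i hFu hFv huv
    have hu1 : 1 ≤ u := hu.2.elim False.elim fun h => h.1
    clear hu hv
    rcases hFu with ⟨hu0, hi⟩ | ⟨q, hq, hq1, hi⟩ <;> rcases hFv with ⟨hv0, hj⟩ | ⟨p, hp, hp1, hj⟩
    · omega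
    · have := hp.bounds_of_hole hk hr' hs
      omega
    · have := hq.bounds_of_hole hk hr' hs
      omega
    · have h1 := hq.bounds_of_hole hk hr' hs
      have h2 := hp.bounds_of_hole hk hr' hs
      have hqp : q = p := by omega
      subst hqp
      exact hq.unsplit hp hk hn (fun _ => hh) (by omega) (by omega) (by omega) hu1 (by omega)
        (by omega) (by omega) (fun _ _ => hpr)

/-- Before `-1 - k` enters, `-1` is alone in class `0`. Afterwards `-1` and `1` have the same
outside neighbours and share the free number `k - 1`, and class `0` passes to `-1 - k`. -/
theorem typesLE_hole_some_ends (hκ : (κ : ℤ) = k) (hk : 3 ≤ k) (hn : n = k * k + 1)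
    (hh : h = 2 - k + r * k + r) (hr : 0 < r) (hr' : r < k) (hpr : ¬ pr) (hpl : pl)
    (hZ1 : Z (-1)) (hZ : ∀ c, Z c → c = -1 ∨ c = -1 - k) :
    TypesLE (powerGraph k (position k n h pl pr))
      (rowSet k n (position k n h pl pr) Z (2 - k) r 1 k (k + 1)) κ := by
  have hkk : 3 * k ≤ k * k := Int.mul_le_mul_of_nonneg_right hk (by omega)
  have hn0 : 0 < n := by omega
  have hh1 : 1 ≤ h := by
    have := le_mul_of_lt (k := k) (by omega) (by omega : 1 ≤ r)
    omega
  have hZ0 : ∀ u ∈ rowSet k n (position k n h pl pr) Z (2 - k) r 1 k (k + 1), u ≤ 0 →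
      u = -1 ∨ u = -1 - k := fun u hu hu0 => hu.2.elim (hZ u) fun h => by omega
  have hs : (1 : ℤ) ≤ 0 ∧ 0 < k ∨ (1 : ℤ) = 1 ∧ k ≤ k := by omega
  refine typesLE_of_rel (fun c hc => hc.1) (fun u i => (u = -1 ∧ ¬ Z (-1 - k) ∨ u = -1 - k) ∧ i = 0 ∨
    (u = -1 ∧ Z (-1 - k) ∨ u = 1) ∧ i = k - 1 ∨
    InRow k (2 - k) r 1 k (k + 1) i u ∧ 1 ≤ i) ?_ ?_
  · rintro u ⟨huX, hu | ⟨h1, h2, q, hq⟩⟩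
    · by_cases hZk : Z (-1 - k)
      · rcases hZ u hu with h | h
        · exact ⟨k - 1, by omega, by omega, Or.inr (Or.inl ⟨Or.inl ⟨h, hZk⟩, rfl⟩)⟩
        · exact ⟨0, by omega, by omega, Or.inl ⟨Or.inr h, rfl⟩⟩
      · rcases hZ u hu with h | h
        · exact ⟨0, by omega, by omega, Or.inl ⟨Or.inl ⟨h, hZk⟩, rfl⟩⟩
        · exact absurd (h ▸ hu) hZk
    · have h3 := hq.bounds_of_hole hk hr' hs
      by_cases huk : u = 1
      · exact ⟨k - 1, by omega, by omega, Or.inr (Or.inl ⟨Or.inr huk, rfl⟩)⟩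
      · exact ⟨q, by omega, by omega, Or.inr (Or.inr ⟨hq, by omega⟩)⟩
  · rintro u hu v hv i hFu hFv huv
    have hm : -1 ∈ rowSet k n (position k n h pl pr) Z (2 - k) r 1 k (k + 1) :=
      ⟨⟨by omega, Or.inr (Or.inr (Or.inr (Or.inl ⟨hpl, rfl⟩)))⟩, Or.inl hZ1⟩
    rcases hFu with ⟨hu0, hi⟩ | ⟨hu1, hi⟩ | ⟨hur, hi⟩
    · rcases hFv with ⟨hv0, hj⟩ | ⟨hv1, hj⟩ | ⟨hvr, hj⟩
      · exfalso
        rcases hu0 with hu0 | hu0 <;> rcases hv0 with hv0 | hv0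
        · omega
        · omega
        · exact hv0.2 (hu.2.elim (fun h => hu0 ▸ h) fun h => by omega)
        · omega
      · omega
      · omega
    · rcases hFv with ⟨hv0, hj⟩ | ⟨hv1, hj⟩ | ⟨hvr, hj⟩
      · omega
      · have hu2 : u = -1 := by omega
        have hv2 : v = 1 := by omega
        have hZk : Z (-1 - k) := (hu1.resolve_right (by omega)).2
        subst hu2 hv2
        intro c hc hcT
        refine ⟨fun h => hcT ?_, fun h => ?_⟩
        · have := hc.1
          refine mem_rowSet_mid (by omega) (by omega) hc.1 1 ⟨by omega, by omega, by omega,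
            fun h => ?_, by omega, by omega⟩
          have hr1 : r = 1 := by omega
          subst hr1
          omega
        · have h3 := hc.left (by omega) hn0.le (by omega)
          have h4 : c = -1 - k := by omega
          subst h4
          exact hcT ⟨hc, Or.inl hZk⟩
      · have := hvr.bounds_of_hole hk hr' hs
        omega
    · rcases hFv with ⟨hv0, hj⟩ | ⟨hv1, hj⟩ | ⟨hvr, hj⟩
      · omega
      · have := hur.bounds_of_hole hk hr' hs
        omega
      · have h1 := hur.bounds_of_hole hk hr' hs
        have h2 := hvr.bounds_of_hole hk hr' hs
        exact hur.unsplit hvr hk hn (fun _ => hh) (by omega) (by omega) (by omega) (by omega) (by omega)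
          (by omega) (fun _ _ => Or.inl hm) (fun _ _ => hpr)

/-- The path is started without its ends. At level `1`, where row `0` has the single path element
`1`, the vertices `w⁺`, `w_1` and `w_2` enter in this order, and the general strategy continues from
there. -/
theorem reach_left_hole (hκ : (κ : ℤ) = k) (hk : 3 ≤ k) (hn : n = k * k + 1)
    (hh : h = 2 - k + r * k + r) (hr : 0 < r) (hr' : r < k) (hpr : ¬ pr) (hpl : pl) :
    Reach (powerGraph k (position k n h pl pr)) lin (κ + 1) {c | position k n h pl pr c} := by
  have hkk : 3 * k ≤ k * k := Int.mul_le_mul_of_nonneg_right hk (by omega)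
  have hh1 : 3 ≤ h := by
    have := le_mul_of_lt (k := k) (by omega) (by omega : 1 ≤ r)
    omega
  have h1 := reach_levels_of_empty (A := 2 - k) (κ := κ) (n := n) (r := r) (lin := lin) (y' := 1)
    (X := position k n h pl pr) (Z := fun _ => False) (by omega) (by omega)
    (fun ⟨c, hc⟩ => (mem_rowSet_first hc).elim)
    (fun z hz hz' t ht htk => typesLE_hole_no_ends hκ hk hn hh hr hr'
      (Or.inl ⟨by omega, ht⟩) hpr)
    ⟨1, mem_rowSet_mid (by omega) (by omega) (by omega) 0
      ⟨by omega, by omega, by omega, by omega, by omega, by omega⟩⟩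
  have h2 := reach_add (Z' := fun c => c = -1) (-1) h1 (fun c hc => by simp) fun _ =>
    typesLE_hole_no_ends hκ hk hn hh hr hr' (Or.inr ⟨rfl, le_rfl⟩) hpr
  have h3 := reach_add (Z' := fun c => c = -1 ∨ c = -1 - k) (-1 - k) h2 (fun c hc => Iff.rfl) fun _ =>
    typesLE_hole_some_ends hκ hk hn hh hr hr' hpr hpl rfl (fun c hc => Or.inl hc)
  have h4 := reach_add (Z' := fun c => c ≤ 0) (1 - k) h3
    (fun c hc => ⟨fun h => by have := hc.left h (by omega) (by omega); omega, fun h => by omega⟩)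
    fun _ => typesLE_hole_some_ends hκ hk hn hh hr hr' hpr hpl (Or.inl rfl) (fun c hc => hc)
  refine reach_next_level hκ hk hn hh (by omega) (by omega) (by omega) hr hr' (by omega)
    (fun hp => absurd hp hpr) (reach_bottom_level hκ hk hn hh (by omega) (by omega) (by omega) hr hr'
      (fun _ => by omega) ?_)
  rwa [show 2 - k + k - 1 = 1 by ring]

/-! ### Without the outermost element -/

theorem InRow.bounds_of_no_hole (hk : 3 ≤ k) (hs : y ≤ 1 ∧ 0 < s ∨ y = 2 ∧ k ≤ s)
    {q u : ℤ} (hq : InRow k (2 - k) r y s (k + 1) q u) :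
    (q = 0 ∧ u ≤ y ∨ 1 ≤ q ∧ 3 ≤ u) ∧ u ≤ k * k - k + 2 := by
  obtain ⟨a1, a2, a3, a4, a5, a6⟩ := hq
  have h1 := mul_le_last (k := k) (by omega) a2
  refine ⟨?_, by omega⟩
  rcases eq_or_lt_of_le a1 with h0 | h0
  · rw [← h0, zero_mul] at a5 a6
    omega
  · have := le_mul_of_lt (k := k) (by omega) (by omega : 1 ≤ q)
    omega

/-- The bound is `k` while the levels are filled, and `k + 1` at level `2`, where `2` is a type of
its own. -/
theorem typesLE_no_outermost {m : ℕ} (hκ : (m : ℤ) = k ∨ (m : ℤ) = k + 1) (hk : 3 ≤ k)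
    (hn : n = k * k + 1) (hh : h = -1 - k) (hr : k ≤ r)
    (hs : y ≤ 1 ∧ 0 < s ∨ y = 2 ∧ k ≤ s ∧ (m : ℤ) = k + 1) :
    TypesLE (powerGraph k (position k n h pl pr))
      (rowSet k n (position k n h pl pr) (fun c => c = -1) (2 - k) r y s (k + 1)) m := by
  have hkk : 3 * k ≤ k * k := Int.mul_le_mul_of_nonneg_right hk (by omega)
  have hn0 : 0 < n := by omega
  have hs' : y ≤ 1 ∧ 0 < s ∨ y = 2 ∧ k ≤ s := by omega
  refine typesLE_of_rel (fun c hc => hc.1) (fun u i => (u = -1 ∨ u = 1) ∧ i = 0 ∨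
    u = 2 ∧ y = 2 ∧ i = k ∨ InRow k (2 - k) r y s (k + 1) i u ∧ 1 ≤ i) ?_ ?_
  · rintro u ⟨huX, hu | ⟨h1, h2, q, hq⟩⟩
    · exact ⟨0, by omega, by omega, Or.inl ⟨Or.inl hu, rfl⟩⟩
    · have h3 := hq.bounds_of_no_hole hk hs'
      by_cases hu1 : u = 1
      · exact ⟨0, by omega, by omega, Or.inl ⟨Or.inr hu1, rfl⟩⟩
      by_cases hu2 : u = 2
      · exact ⟨k, by omega, by omega, Or.inr (Or.inl ⟨hu2, by omega, rfl⟩)⟩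
      · have := hq.2.1
        exact ⟨q, by omega, by omega, Or.inr (Or.inr ⟨hq, by omega⟩)⟩
  · rintro u hu v hv i hFu hFv huv
    rcases hFv with ⟨hv0, hj⟩ | ⟨hv1, hvy, hj⟩ | ⟨hvr, hj⟩
    · rcases hFu with ⟨hu0, hi⟩ | ⟨hu1, huy, hi⟩ | ⟨hur, hi⟩
      · have hu2 : u = -1 := by omega
        have hv2 : v = 1 := by omega
        subst hu2 hv2
        obtain ⟨-, h0 | ⟨-, -, q, hq⟩⟩ := hv
        · omega
        have h1 := hq.bounds_of_no_hole hk hs'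
        intro c hc hcT
        refine ⟨fun h => hcT ?_, fun h => ?_⟩
        · exact mem_rowSet_mid (by omega) (by omega) hc.1 1 ⟨by omega, by omega, by omega, by omega,
            by omega, by omega⟩
        · have h3 := hc.left (by omega) hn0.le (by omega)
          have h4 := hc.1
          omega
      · omega
      · omega
    · rcases hFu with ⟨hu0, hi⟩ | ⟨hu1, huy, hi⟩ | ⟨hur, hi⟩
      · omega
      · omega
      · have := hur.2.1
        omega
    · have h1 := hvr.bounds_of_no_hole hk hs'
      rcases hFu with ⟨hu0, hi⟩ | ⟨hu1, huy, hi⟩ | ⟨hur, hi⟩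
      · omega
      · have := hvr.2.1
        omega
      · have h2 := hur.bounds_of_no_hole hk hs'
        refine hur.unsplit hvr hk hn (by omega) (by omega) (by omega) (by omega) (by omega)
          (by omega) (by omega) (fun _ _ => ?_) (by omega)
        by_cases hpl : pl
        · exact Or.inl ⟨⟨by omega, Or.inr (Or.inr (Or.inr (Or.inl ⟨hpl, rfl⟩)))⟩, Or.inl rfl⟩
        · exact Or.inr hpl

/-- At level `2` possibly all `k + 1` labels are in use, so `1 - k` has to share one. As `w_1` is
the hole, neither `1 - k` nor `2` has a neighbour that is still missing; they are not adjacent, and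
every neighbour of `1 - k` in the set, `1` or `-1`, is a neighbour of `2`. Hence `insert_compat`
applies. -/
theorem reach_no_outermost (hκ : (κ : ℤ) = k) (hk : 3 ≤ k) (hn : n = k * k + 1) (hh : h = -1 - k) :
    Reach (powerGraph k (position k n h pl pr)) lin (κ + 1) {c | position k n h pl pr c} := by
  have hkk : 3 * k ≤ k * k := Int.mul_le_mul_of_nonneg_right hk (by omega)
  have hkk1 : (k - 1) * k = k * k - k := by ring
  have hn0 : 0 < n := by omega
  have h1 := reach_levels_of_empty (A := 2 - k) (κ := κ) (n := n) (r := k) (lin := lin) (y' := 2)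
    (X := position k n h pl pr) (Z := fun c => c = -1) (by omega) (by omega)
    (fun ⟨c, hc⟩ => by
      rw [show rowSet k n (position k n h pl pr) (fun c => c = -1) (2 - k) k (2 - k - 1) k (k + 1) = {-1}
        from Set.Subset.antisymm (fun d hd => mem_rowSet_first hd) (by
          rintro d rfl
          rw [mem_rowSet_first (Z := fun c => c = -1) hc] at hc
          exact hc)]
      exact Reach.single _)
    (fun z hz hz' t ht htk => typesLE_no_outermost (Or.inl hκ) hk hn hh le_rfl
      (Or.inl ⟨by omega, ht⟩))
    ⟨1, mem_rowSet_mid (by omega) (by omega) (by omega) 0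
      ⟨by omega, by omega, by omega, by omega, by omega, by omega⟩⟩
  have hfull : ∀ c, position k n h pl pr c → 1 ≤ c → c ≤ k + 2 →
      c ∈ rowSet k n (position k n h pl pr) (fun c => c = -1) (2 - k) k 2 k (k + 1) := by
    intro c hc hc1 hc2
    by_cases hc3 : c ≤ 2
    · exact mem_rowSet_mid hc1 (by omega) hc.1 0
        ⟨by omega, by omega, by omega, by omega, by omega, by omega⟩
    · exact mem_rowSet_mid hc1 (by omega) hc.1 1
        ⟨by omega, by omega, by omega, by omega, by omega, by omega⟩
  have hX : position k n h pl pr (1 - k) := ⟨by omega, Or.inr (Or.inr (Or.inl rfl))⟩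
  have hx : 1 - k ∉ rowSet k n (position k n h pl pr) (fun c => c = -1) (2 - k) k 2 k (k + 1) := by
    rintro ⟨-, h | h⟩ <;> omega
  have hm : pl → -1 ∈ rowSet k n (position k n h pl pr) (fun c => c = -1) (2 - k) k 2 k (k + 1) :=
    fun hp => ⟨⟨by omega, Or.inr (Or.inr (Or.inr (Or.inl ⟨hp, rfl⟩)))⟩, Or.inl rfl⟩
  have h2mem := hfull 2 (position_mid (by omega) (by omega) (by omega)) (by omega) (by omega)
  have hadj : ∀ w, (powerGraph k (position k n h pl pr)).Adj (1 - k) w →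
      w ∈ rowSet k n (position k n h pl pr) (fun c => c = -1) (2 - k) k 2 k (k + 1) ∧
        (w = 1 ∨ w = -1) := by
    rintro w ⟨-, hw, h3, h4, h5⟩
    by_cases hw1 : 1 ≤ w
    · exact ⟨hfull w hw hw1 (by omega), by omega⟩
    · have := hw.left (by omega) hn0.le (by omega)
      have := hw.1
      have hw2 : w = -1 := by omega
      subst hw2
      exact ⟨hm (hw.pl_of hn0 (by omega)), Or.inr rfl⟩
  -- Sharing the label requires that no other element has the type of `2`. Elements up to `1` are
  -- near `1 - k`; an element of a row `q ≥ 1` is near `q (k + 1) + 2`, the missing position before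
  -- row `q + 1`.
  have hdead : ∀ v ∈ rowSet k n (position k n h pl pr) (fun c => c = -1) (2 - k) k 2 k (k + 1),
      SameType (powerGraph k (position k n h pl pr))
        (rowSet k n (position k n h pl pr) (fun c => c = -1) (2 - k) k 2 k (k + 1)) v 2 → v = 2 := by
    intro v hv hvt
    by_contra hv2
    have hkey : ∀ c, position k n h pl pr c → c ∉ rowSet k n (position k n h pl pr)
        (fun c => c = -1) (2 - k) k 2 k (k + 1) → ¬ (v ≤ c + k ∧ c ≤ v + k) := by
      intro c hc hcT ⟨h3, h4⟩
      have h5 := (hvt c hcT).1 ⟨hv.1, hc, fun h => hcT (h ▸ hv), h3, h4⟩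
      obtain ⟨-, -, h6, h7, h8⟩ := h5
      by_cases hc1 : 1 ≤ c
      · exact hcT (hfull c hc hc1 (by omega))
      · have := hc.left (by omega) hn0.le (by omega)
        have := hc.1
        have hc2 : c = -1 := by omega
        subst hc2
        exact hcT (hm (hc.pl_of hn0 (by omega)))
    have hv' := hv
    obtain ⟨hvX, hv0 | ⟨hv1, hvn, q, hq⟩⟩ := hv
    · exact hkey (1 - k) hX hx (by omega)
    · have hb := hq.bounds_of_no_hole hk (Or.inr ⟨rfl, le_rfl⟩)
      have hqk := hq.2.1
      by_cases hv3 : v ≤ 2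
      · exact hkey (1 - k) hX hx (by omega)
      · obtain ⟨a1, a2, a3, a4, a5, a6⟩ := hq
        have h6 := a6 (by omega)
        have hb3 : 1 ≤ q := by omega
        have h7 := mul_le_last (k := k) (by omega) a2
        refine hkey (q * k + q + 2) (position_mid (by omega) (by omega) (by omega)) ?_ (by omega)
        rintro ⟨-, h | ⟨-, -, p, b1, b2, b3, b4, b5, b6⟩⟩
        · omega
        · have b7 := b6 (by omega)
          rcases lt_trichotomy p q with h | h | h
          · have := le_mul_of_lt (k := k) (by omega) (by omega : p + 1 ≤ q)
            rw [show (p + 1) * k = p * k + k by ring] at this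
            omega
          · subst h; omega
          · have := le_mul_of_lt (k := k) (by omega) (by omega : q + 1 ≤ p)
            rw [show (q + 1) * k = q * k + k by ring] at this
            omega
  have h2 := h1.insert_compat (typesLE_no_outermost (m := κ + 1)
    (Or.inr (by push_cast; omega)) hk hn hh le_rfl (Or.inr ⟨rfl, le_rfl, by push_cast; omega⟩))
    (1 - k) 2 hx h2mem (fun ⟨_, _, _, h4, h5⟩ => by omega)
    (fun c hc => by
      have hcT := fun h => hc (Or.inr h)
      refine ⟨fun ⟨_, hcX, h3, h4, h5⟩ => (hcT ?_).elim, fun h => absurd (hadj c h).1 hcT⟩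
      by_cases hc1 : 1 ≤ c
      · exact hfull c hcX hc1 (by omega)
      · have := hcX.left (by omega) hn0.le (by omega)
        have := hcX.1
        have hc2 : c = -1 := by omega
        subst hc2
        exact hm (hcX.pl_of hn0 (by omega)))
    (fun v hv h => by
      obtain ⟨h3, h4⟩ := hadj v h
      exact ⟨h2mem.1, hv.1, by omega, by omega, by omega⟩)
    (fun v hv hvt => by
      obtain rfl := hdead v hv hvt
      refine ⟨fun ⟨_, _, _, h4, h5⟩ => by omega, fun w hw h => ?_⟩
      obtain ⟨h3, h4⟩ := hadj w h
      exact ⟨h2mem.1, hw.1, by omega, by omega, by omega⟩)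
  refine reach_finish (K := k) (σ := 0) (A := 2 - k) (r := k) (y := 2) hκ hk hn (by omega) (by omega)
    (by omega) (by omega) (by omega) (by omega) (by omega) le_rfl (fun hp => by omega) (by omega)
    (fun q c hq => hq.2.1) le_rfl (by omega) (by omega) (by omega) ?_
  convert h2 using 1
  ext c
  constructor
  · rintro ⟨hc, hc0 | hc0⟩
    · have := hc.1
      rcases hc.left hc0 hn0.le (by omega) with h | h | h
      · omega
      · exact Or.inl h
      · exact Or.inr ⟨hc, Or.inl h⟩
    · exact Or.inr ⟨hc, Or.inr hc0⟩
  · rintro (rfl | ⟨hc, rfl | hc0⟩)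
    · exact ⟨hX, Or.inl (by omega)⟩
    · exact ⟨hc, Or.inl (by omega)⟩
    · exact ⟨hc, Or.inr hc0⟩

end strategies

open CWExpr

section strategies

variable {κ : ℕ} {k n h : ℤ} {pl pr : Prop} {A r y s s' : ℤ} {lin : Prop} {X Z Z' : ℤ → Prop}

/-! ### A hole congruent to `0`, with `w⁺` on the right -/

/-- Rows `2, …, k - 1` take the numbers `1, …, k - 2`, and the finished prefix takes `0`. So `k - 1`
remains: for row `1` while it is unfinished, then for the newest element at the top of row `s' - 1`.
-/
theorem typesLE_third_level (hκ : (κ : ℤ) = k) (hk : 3 ≤ k) (hn : n = k * k + 1)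
    (hh : h = 2 - k + r * k + r) (hr : 2 ≤ r) (hr' : r < k) (hs : 1 ≤ s') (hs' : s' < k)
    (hpl : ¬ pl) :
    TypesLE (powerGraph k (position k n h pl pr))
      (rowSet k n (position k n h pl pr) (fun c => c ≤ 0) (2 - k) r 2 0 s') κ := by
  have hkk : 3 * k ≤ k * k := Int.mul_le_mul_of_nonneg_right hk (by omega)
  have hn0 : 0 < n := by omega
  have hfull : ∀ c, position k n h pl pr c → (c ≤ k + 2 ∨ 2 ≤ s' ∧ c ≤ 2 * k + 2 ∨
      3 ≤ s' ∧ c ≤ 2 * k + 3) →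
      c ∈ rowSet k n (position k n h pl pr) (fun c => c ≤ 0) (2 - k) r 2 0 s' := by
    intro c hc hc'
    by_cases hc0 : c ≤ 0
    · exact ⟨hc, Or.inl hc0⟩
    by_cases hc1 : c ≤ 2
    · exact mem_rowSet_mid (by omega) (by omega) hc.1 0
        ⟨by omega, by omega, by omega, by omega, by omega, by omega⟩
    by_cases hc2 : c ≤ k + 3
    · exact mem_rowSet_mid (by omega) (by omega) hc.1 1
        ⟨by omega, by omega, by omega, by omega, by omega, by omega⟩
    · refine mem_rowSet_mid (by omega) (by omega) hc.1 2
        ⟨by omega, by omega, by omega, fun hr2 => ?_, by omega, by omega⟩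
      have hr2' : r = 2 := by omega
      subst hr2'
      have := hc.1
      omega
  refine typesLE_of_rel (fun c hc => hc.1) (fun u i =>
    (u ≤ 2 ∨ 2 ≤ s' ∧ u ≤ k + 2 ∨ 3 ≤ s' ∧ u ≤ k + 3) ∧ i = 0 ∨
    (s' = 1 ∧ 3 ≤ u ∧ u ≤ k + 2 ∨ 2 ≤ s' ∧ u = 2 + (s' - 1) * k + 1) ∧ i = k - 1 ∨
    k + 3 < u ∧ 1 ≤ i ∧ InRow k (2 - k) r 2 0 s' (i + 1) u ∧
      (s' = i + 2 → u ≤ 2 + (i + 1) * k)) ?_ ?_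
  · rintro u ⟨huX, hu | ⟨h1, h2, q, hq⟩⟩
    · exact ⟨0, le_rfl, by omega, Or.inl ⟨by omega, rfl⟩⟩
    · by_cases hu1 : u ≤ 2 ∨ 2 ≤ s' ∧ u ≤ k + 2 ∨ 3 ≤ s' ∧ u ≤ k + 3
      · exact ⟨0, le_rfl, by omega, Or.inl ⟨hu1, rfl⟩⟩
      by_cases hu2 : s' = 1 ∧ 3 ≤ u ∧ u ≤ k + 2 ∨ 2 ≤ s' ∧ u = 2 + (s' - 1) * k + 1
      · exact ⟨k - 1, by omega, by omega, Or.inr (Or.inl ⟨hu2, rfl⟩)⟩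
      · have hq' := hq
        obtain ⟨a1, a2, a3, a4, a5, a6⟩ := hq
        have hq2 : 2 ≤ q := by
          by_contra hq2
          rcases eq_or_lt_of_le a1 with h0 | h0
          · rw [← h0, zero_mul] at a5 a6
            omega
          · have h0 : q = 1 := by omega
            rw [h0, one_mul] at a5 a6
            by_cases hs2 : s' = 2
            · have : (s' - 1) * k = k := by rw [hs2]; ring
              omega
            · omega
        have h3 := le_mul_of_lt (k := k) (by omega) hq2
        refine ⟨q - 1, by omega, by omega, Or.inr (Or.inr ⟨by omega, by omega, ?_, fun hs2 => ?_⟩)⟩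
        · rwa [sub_add_cancel]
        · rw [sub_add_cancel]
          rw [hs2, show q - 1 + 2 - 1 = q by ring] at hu2
          omega
  · rintro u hu v hv i hFu hFv huv
    rcases hFv with ⟨hv0, hj⟩ | ⟨hv1, hj⟩ | ⟨hv1, hj1, hvr, hj⟩
    · clear hFu
      exact unsplit_of_dead fun c hc hcc => hfull c hc (by omega)
    · rcases hFu with ⟨hu0, hi⟩ | ⟨hu1, hi⟩ | ⟨hu1, hi1, hur, hi⟩
      · omega
      · obtain ⟨hs1, hu3, hu4⟩ : s' = 1 ∧ 3 ≤ u ∧ u ≤ k + 2 := by omega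
        have hrow : ∀ w, 3 ≤ w → w ≤ k + 2 → InRow k (2 - k) r 2 0 s' 1 w := fun w h1 h2 =>
          ⟨by omega, by omega, by omega, by omega, by omega, by omega⟩
        exact unsplit_of_position (by omega) hn0 (by omega) (by omega) (fun c hc hcT h4 h5 =>
          rowSet_unsplit (fun _ c hc => hh ▸ hc.1) hn (by omega) (by omega) (by omega) (by omega)
            (hrow u hu3 hu4) (hrow v (by omega) (by omega)) (fun _ => by omega) hc hcT h4 h5)
          (by omega) (fun _ _ => Or.inr hpl) (by omega) (by omega)
      · have := hur.2.1
        omega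
    · rcases hFu with ⟨hu0, hi⟩ | ⟨hu1, hi⟩ | ⟨hu1, hi1, hur, hi⟩
      · omega
      · have := hvr.2.1
        omega
      · have h1 := mul_le_last (k := k) (by omega) hvr.2.1
        have h2 : i + 2 = k ∨ (i + 2) * k ≤ k * k - k := by
          by_cases h : i + 2 = k
          · exact Or.inl h
          · exact Or.inr (mul_le_last (by omega) (by have := hvr.2.1; omega))
        rw [show (i + 2) * k = (i + 1) * k + k by ring] at h2
        have h3 := hvr.2.2.2.2.1
        have h4 := hvr.2.2.2.2.2
        have h5 : i + 1 + 1 = i + 2 := by ring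
        exact unsplit_of_position (by omega) hn0 (by omega) (by omega) (fun c hc hcT h4 h5 =>
          rowSet_unsplit (fun _ c hc => hh ▸ hc.1) hn (by omega) (by omega) (by omega) (by omega)
            hur hvr (fun _ => by omega) hc hcT h4 h5)
          (by omega) (fun _ _ => Or.inr hpl) (by omega) (by omega)

/-- The prefix up to `k + 3` is finished and has class `0`, and rows from `2` on are shifted down by
one. This leaves `k - 1` for the elements of the last row that are neighbours of `n + 2`. -/
theorem typesLE_fourth_level (hκ : (κ : ℤ) = k) (hk : 4 ≤ k) (hn : n = k * k + 1)
    (hh : h = 2 - k + r * k + r) (hr : 2 ≤ r) (hr' : r < k) (_hs : 1 ≤ s) (hpl : ¬ pl) :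
    TypesLE (powerGraph k (position k n h pl pr))
      (rowSet k n (position k n h pl pr) (fun c => c ≤ 0) (2 - k) r 3 s (k + 1)) κ := by
  have hkk : 4 * k ≤ k * k := Int.mul_le_mul_of_nonneg_right hk (by omega)
  have hn0 : 0 < n := by omega
  have hfull : ∀ c, position k n h pl pr c → c ≤ 2 * k + 3 →
      c ∈ rowSet k n (position k n h pl pr) (fun c => c ≤ 0) (2 - k) r 3 s (k + 1) := by
    intro c hc hc'
    by_cases hc0 : c ≤ 0
    · exact ⟨hc, Or.inl hc0⟩
    by_cases hc1 : c ≤ 2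
    · exact mem_rowSet_mid (by omega) (by omega) hc.1 0
        ⟨by omega, by omega, by omega, by omega, by omega, by omega⟩
    by_cases hc2 : c ≤ k + 3
    · exact mem_rowSet_mid (by omega) (by omega) hc.1 1
        ⟨by omega, by omega, by omega, by omega, by omega, by omega⟩
    · refine mem_rowSet_mid (by omega) (by omega) hc.1 2
        ⟨by omega, by omega, by omega, fun hr2 => ?_, by omega, by omega⟩
      have hr2' : r = 2 := by omega
      subst hr2'
      have := hc.1
      omega
  refine typesLE_of_rel (fun c hc => hc.1) (fun u i => u ≤ k + 3 ∧ i = 0 ∨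
    k + 3 < u ∧ u < n ∧ ∃ q, InRow k (2 - k) r 3 s (k + 1) q u ∧ 2 ≤ q ∧ (u < n + 2 - k ∧ i = q - 1 ∨
      n + 2 - k ≤ u ∧ q = k - 1 ∧ i = k - 1)) ?_ ?_
  · rintro u ⟨huX, hu | ⟨h1, h2, q, hq⟩⟩
    · exact ⟨0, le_rfl, by omega, Or.inl ⟨by omega, rfl⟩⟩
    · by_cases huk : u ≤ k + 3
      · exact ⟨0, le_rfl, by omega, Or.inl ⟨huk, rfl⟩⟩
      · obtain ⟨p, hp, hp2⟩ : ∃ p, InRow k (2 - k) r 3 s (k + 1) p u ∧ 2 ≤ p := by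
          by_cases hq2 : 2 ≤ q
          · exact ⟨q, hq, hq2⟩
          · obtain ⟨a1, a2, a3, a4, a5, a6⟩ := hq
            have h3 := le_mul_of_lt (k := k) (by omega) (by omega : q ≤ 1)
            refine ⟨2, ⟨by omega, by omega, by omega, fun hr2 => ?_, by omega, by omega⟩, le_rfl⟩
            have hr2' : r = 2 := by omega
            subst hr2'
            have := huX.1
            omega
        have hp' := hp
        obtain ⟨a1, a2, a3, a4, a5, a6⟩ := hp
        have h3 := mul_le_last (k := k) (by omega) a2
        by_cases hun : u < n + 2 - k
        · exact ⟨p - 1, by omega, by omega, Or.inr ⟨by omega, by omega, p, hp', hp2,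
            Or.inl ⟨hun, rfl⟩⟩⟩
        · refine ⟨k - 1, by omega, by omega, Or.inr ⟨by omega, by omega, p, hp', hp2,
            Or.inr ⟨by omega, ?_, rfl⟩⟩⟩
          by_contra hpk
          have := mul_le_last (k := k) (q := p + 1) (by omega) (by omega)
          rw [show (p + 1) * k = p * k + k by ring] at this
          omega
  · rintro u hu v hv i hFu hFv huv
    rcases hFv with ⟨hv0, hj⟩ | ⟨hv1, hvn, p, hp, hp2, hj⟩
    · clear hFu
      exact unsplit_of_dead fun c hc hcc => hfull c hc (by omega)
    · rcases hFu with ⟨hu0, hi⟩ | ⟨hu1, hun, q, hq, hq2, hi⟩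
      · have := hp.2.1
        omega
      · have hpk := hp.2.1
        have hqk := hq.2.1
        have hqp : q = p := by omega
        subst hqp
        exact hq.unsplit hp (by omega) hn (fun _ => hh) (by omega) (by omega) (by omega) (by omega) hvn
          (by omega) (fun _ _ => Or.inr hpl) (by omega)

/-- With `A + k = 2` the vertex `n + 2` would split the last row at the level that
`reach_next_level` fills from the top. So this level is filled from the bottom, and `reach_finish`
is used with `σ = 1`. This asks for level `4`; for `k = 3` level `3` is enough, as `r ≤ K - 2`
fails. -/
theorem reach_right_hole (hκ : (κ : ℤ) = k) (hk : 3 ≤ k) (hn : n = k * k + 1)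
    (hh : h = 2 - k + r * k + r) (hr : 2 ≤ r) (hr' : r < k) (hpl : ¬ pl) :
    Reach (powerGraph k (position k n h pl pr)) lin (κ + 1) {c | position k n h pl pr c} := by
  have hkk : 3 * k ≤ k * k := Int.mul_le_mul_of_nonneg_right hk (by omega)
  have hkk1 : (k - 1) * k = k * k - k := by ring
  have hh1 : 4 ≤ h := by
    have := le_mul_of_lt (k := k) (by omega) hr
    omega
  have h0 := reach_ends (n := n) (r := r) (A := 2 - k) (pl := pl) (pr := pr) (lin := lin) hκ hk
    (by omega : 1 ≤ h) (fun c => c ≤ 0) fun c hc => ⟨fun hc0 => by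
      rcases hc.left hc0 (by omega) (by omega) with h | h | h
      · exact Or.inl h
      · exact Or.inr h
      · subst h
        exact absurd (hc.pl_of (by omega) (by omega)) hpl, fun h => by omega⟩
  have h1 := reach_levels (y' := 2 - k + k - 1) (by omega) (by omega) h0 fun z hz hz' t ht0 htk =>
    typesLE_early hκ hk hn hh (by omega) (by omega) (by omega) hr' (fun c hc => hc) (by omega) (by omega)
      (fun hp => absurd hp hpl) (Or.inl (by omega))
  have h2 := reach_bottom_level hκ hk hn hh (by omega) (by omega) (by omega) (by omega) hr'
    (fun hp => absurd hp hpl) h1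
  rw [show 2 - k + k = 2 by ring, ← rowSet_start] at h2
  have h3 := reach_bot_of (s' := k) (by omega) h2 fun t ht0 htk hx => by
    refine typesLE_third_level hκ hk hn hh hr hr' ?_ htk hpl
    by_contra ht
    have ht : t = 0 := by omega
    subst ht
    exact hx (mem_rowSet_mid (by omega) (by omega) (by omega) 1
      ⟨by omega, by omega, by omega, by omega, by omega, by omega⟩)
  rw [rowSet_next', show (2 : ℤ) + 1 = 3 by ring] at h3
  rcases eq_or_lt_of_le hk with hk3 | hk3
  · refine reach_finish (K := k) (σ := 1) hκ hk hn (fun _ => hh) (by omega) (by omega) (by omega)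
      (by omega) (by omega) (by omega) (by omega) (fun _ => Or.inl rfl) (by omega)
      (fun q c hq => hq.2.1) le_rfl (by omega) (by omega) (by omega) h3
  · have h4 := reach_top (s := 0) (by omega) h3 fun t ht htk =>
      typesLE_fourth_level hκ hk3 hn hh hr hr' ht hpl
    rw [rowSet_next, show (3 : ℤ) + 1 = 4 by ring] at h4
    exact reach_finish (K := k) (σ := 1) hκ hk hn (fun _ => hh) (by omega) (by omega) (by omega)
      (by omega) (by omega) (by omega) (by omega) (fun _ => Or.inl rfl) (by omega)
      (fun q c hq => hq.2.1) le_rfl (by omega) (by omega) (by omega) h4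

/-! ### Without the last element or its neighbour on the right -/

/-- No edge leaves `T'`, so all its elements have the same type and the transported expression may
end with a single label. -/
theorem Reach.comap {V W : Type} {G : SimpleGraph V} {H : SimpleGraph W} {m : ℕ} {T : Set V}
    {T' : Set W} (h : Reach G lin m T) (hm : 0 < m) (i : W → V) (hi : Function.Injective i)
    (hT : ∀ a, i a ∈ T ↔ a ∈ T') (hne : T'.Nonempty)
    (hadj : ∀ a ∈ T', ∀ b ∈ T', (H.Adj a b ↔ G.Adj (i a) (i b)))
    (hsep : ∀ a ∈ T', ∀ b, b ∉ T' → ¬ H.Adj a b) : Reach H lin m T' := by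
  obtain ⟨w, hw⟩ := hne
  obtain ⟨e, h1, h2, h3, h4, h5⟩ := h (fun _ => ⟨0, hm⟩) fun _ _ _ _ _ => rfl
  obtain ⟨e', a1, a2, a3, a4, a5⟩ := e.exists_restrict i hi h1 ⟨w, h3 ▸ (hT w).2 hw⟩
  refine Reach.of_builds hm (l := fun _ => ⟨0, hm⟩) ⟨e', a1, fun hl => a2 (h2 hl), ?_, fun u v => ?_,
    fun v a => ?_⟩ fun u hu v hv _ c hc =>
      ⟨fun hcu => (hsep u hu c hc hcu).elim, fun hcv => (hsep v hv c hc hcv).elim⟩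
  · ext x
    rw [a3, h3, hT]
  · rw [a5, h4]
    constructor
    · rintro ⟨b1, b2, b3⟩
      rw [hT] at b1 b2
      exact ⟨b1, b2, (hadj u b1 v b2).2 b3⟩
    · rintro ⟨b1, b2, b3⟩
      exact ⟨(hT u).2 b1, (hT v).2 b2, (hadj u b1 v b2).1 b3⟩
  · rw [a4, h5, hT]

/-- Without `n` or `n + k`, nothing connects the left part with the right ends. Reflected, the left
part is an induced subgraph of a path power with `w⁺` on the right and without the outermost left
vertex, which `reach_no_outermost` builds. The remaining right ends are added last. -/
theorem reach_separated_end (hκ : (κ : ℤ) = k) (hk : 3 ≤ k) (hn : n = k * k + 1)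
    (hh : h = n ∨ h = n + k) (hpl : pl) (hpr : ¬ pr) :
    Reach (powerGraph k (position k n h pl pr)) lin (κ + 1) {c | position k n h pl pr c} := by
  have hkk : 3 * k ≤ k * k := Int.mul_le_mul_of_nonneg_right hk (by omega)
  have hpos : ∀ c, c ≤ n → c ≠ h →
      (position k n (-1 - k) False True (n + 1 - c) ↔ position k n h pl pr c) := by
    intro c h1 h2
    unfold position
    have hp : pl ∧ c = -1 ↔ c = -1 := and_iff_right hpl
    have hp' : pr ∧ c = n + 2 ↔ False := iff_false_intro fun h => hpr h.1
    rw [hp, hp']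
    simp only [false_and, true_and, false_or, or_false]
    omega
  have h1 : Reach (powerGraph k (position k n h pl pr)) lin (κ + 1)
      {c | position k n h pl pr c ∧ c ≤ n} := by
    -- Whatever does not belong to the left part is sent injectively to integers that are not
    -- positions.
    refine (reach_no_outermost (n := n) (pl := False) (pr := True) hκ hk hn rfl).comap
      (Nat.succ_pos κ) (fun c => if c ≤ n ∧ c ≠ h then n + 1 - c else -c - k - 5) ?_ ?_ ⟨2, ?_, ?_⟩ ?_ ?_
    · intro a b hab
      dsimp only at hab
      split_ifs at hab <;> omega
    · intro a
      by_cases ha : a ≤ n ∧ a ≠ h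
      · simp only [if_pos ha, Set.mem_ofPred_eq, hpos a ha.1 ha.2]
        exact ⟨fun h => ⟨h, ha.1⟩, fun h => h.1⟩
      · simp only [if_neg ha, Set.mem_ofPred_eq]
        constructor
        · intro hc
          have := hc.left (by omega) (by omega) (by omega)
          omega
        · rintro ⟨hc, hc'⟩
          exact absurd ⟨hc', hc.1⟩ ha
    · exact position_mid (by omega) (by omega) (by omega)
    · omega
    · rintro a ⟨ha, ha'⟩ b ⟨hb, hb'⟩
      have h3 := (hpos a ha' ha.1).2 ha
      have h4 := (hpos b hb' hb.1).2 hb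
      simp only [if_pos (And.intro ha' ha.1), if_pos (And.intro hb' hb.1), powerGraph]
      constructor
      · rintro ⟨_, _, h5⟩
        exact ⟨h3, h4, by omega⟩
      · rintro ⟨_, _, h5⟩
        exact ⟨ha, hb, by omega⟩
    · rintro a ⟨ha, ha'⟩ b hb' ⟨-, hb, h5⟩
      have h6 : ¬ b ≤ n := fun h => hb' ⟨hb, h⟩
      have h7 := hb.right (by omega) (by omega) (by omega)
      have h8 := hb.1
      have h9 := ha.1
      have h10 : b ≠ n + 2 := by
        rintro rfl
        exact hpr (hb.pr_of (by omega) (by omega))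
      omega
  have h2 : Reach (powerGraph k (position k n h pl pr)) lin (κ + 1)
      {c | position k n h pl pr c ∧ c ≤ n + k} := by
    refine h1.extend (n + k) (fun c hc => ⟨hc.1, by have := hc.2; omega⟩) ?_ fun _ _ => ?_
    · rintro c ⟨hc, hc'⟩
      by_cases hcn : c ≤ n
      · exact Or.inl ⟨hc, hcn⟩
      · have h7 := hc.right (by omega) (by omega) (by omega)
        have h10 : c ≠ n + 2 := by
          rintro rfl
          exact hpr (hc.pr_of (by omega) (by omega))
        omega
    · refine typesLE_of_rel (fun c hc => hc.1) (fun u i => i = 0) (fun u hu => ⟨0, by omega, by omega, rfl⟩)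
        fun u hu v hv i _ _ huv c hc hcT => ?_
      have h6 : ¬ c ≤ n := fun h => hcT ⟨hc, h⟩
      have h7 := hc.right (by omega) (by omega) (by omega)
      have h8 := hc.1
      have h9 := hv.1.1
      have h9' := hv.2
      have h10 : c ≠ n + 2 := by
        rintro rfl
        exact hpr (hc.pr_of (by omega) (by omega))
      omega
  refine h2.extend (n + k + 2) (fun c hc => hc.1) ?_ fun _ _ => ?_
  · intro c hc
    by_cases hcn : c ≤ n + k
    · exact Or.inl ⟨hc, hcn⟩
    · have h7 := hc.right (by omega) (by omega) (by omega)
      omega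
  · refine typesLE_of_rel (fun c hc => hc.1) (fun u i => u ≤ n ∧ i = 0 ∨ n < u ∧ i = 1) (fun u hu => ?_) ?_
    · by_cases hun : u ≤ n
      · exact ⟨0, by omega, by omega, Or.inl ⟨hun, rfl⟩⟩
      · exact ⟨1, by omega, by omega, Or.inr ⟨by omega, rfl⟩⟩
    · rintro u hu v hv i hFu hFv huv c hc hcT
      have h6 : ¬ c ≤ n + k := fun h => hcT ⟨hc, h⟩
      have h7 := hc.right (by omega) (by omega) (by omega)
      have h11 : ∀ w, position k n h pl pr w → n < w → w ≤ n + k → w = n + k := by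
        intro w hw h1 h2
        have h7 := hw.right (by omega) (by omega) (by omega)
        have h10 : w ≠ n + 2 := by
          rintro rfl
          exact hpr (hw.pr_of (by omega) (by omega))
        omega
      have h12 := h11 u hu.1
      have h13 := h11 v hv.1
      have h14 := hu.2
      have h15 := hv.2
      omega

end strategies

open CWExpr

/-! ### Building the path power with ends, without a hole -/

section nonlinear

variable {κ : ℕ} {k n : ℤ} {lin : Prop}

/-- The initial segments of `[m (k + 1) + 3, (m + 1) (k + 1)]` with `x` or `x + 1` elements. -/
def combSet (k x s : ℤ) : Set ℤ :=
  {c | ∃ m, 0 ≤ m ∧ m ≤ k - 2 ∧ m * k + m + 3 ≤ c ∧ c ≤ m * k + m + 3 + x ∧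
    (s ≤ m → c ≤ m * k + m + 2 + x)}

/-- The segments `[m (k + 1) + 3, (m + 1) (k + 1)]`, with `m (k + 1) + 2` if `j ≤ m`. -/
def fillSet (k j : ℤ) : Set ℤ :=
  {c | ∃ m, 0 ≤ m ∧ m ≤ k - 2 ∧ m * k + m + 2 ≤ c ∧ c ≤ m * k + m + k + 1 ∧
    (m < j → m * k + m + 3 ≤ c)}

/-- The set of all elements from `2` on but the `m (k + 1) + 1` with `m ≤ j`. -/
def cutSet (k : ℤ) (X : ℤ → Prop) (j : ℤ) : Set ℤ :=
  {c | X c ∧ 2 ≤ c ∧ ∀ m, 1 ≤ m → m ≤ j → c ≠ m * k + m + 1}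

theorem exists_block (hk : 0 ≤ k) (c : ℤ) : ∃ m, m * k + m + 1 ≤ c ∧ c ≤ m * k + m + k + 1 := by
  refine ⟨(c - 1) / (k + 1), ?_⟩
  have h1 := Int.emod_add_mul_ediv (c - 1) (k + 1)
  have h2 := Int.emod_nonneg (c - 1) (by omega : k + 1 ≠ 0)
  have h3 := Int.emod_lt_of_pos (c - 1) (by omega : 0 < k + 1)
  rw [show (k + 1) * ((c - 1) / (k + 1)) = (c - 1) / (k + 1) * k + (c - 1) / (k + 1) by ring] at h1
  omega

theorem block_compare (hk : 0 ≤ k) (m p : ℤ) :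
    p < m ∧ p * k + k ≤ m * k ∨ p = m ∧ p * k = m * k ∨ m < p ∧ m * k + k ≤ p * k := by
  rcases lt_trichotomy p m with h | h | h
  · refine Or.inl ⟨h, ?_⟩
    have := le_mul_of_lt hk (by omega : p + 1 ≤ m)
    linarith
  · exact Or.inr (Or.inl ⟨h, by rw [h]⟩)
  · refine Or.inr (Or.inr ⟨h, ?_⟩)
    have := le_mul_of_lt hk (by omega : m + 1 ≤ p)
    linarith

theorem sameType_of_iff {X : ℤ → Prop} {T : Set ℤ} (hTX : ∀ c ∈ T, X c) {u v : ℤ} (hu : u ∈ T)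
    (hv : v ∈ T)
    (h : ∀ c, X c → c ∉ T → (u ≤ c + k ∧ c ≤ u + k ↔ v ≤ c + k ∧ c ≤ v + k)) :
    SameType (powerGraph k X) T u v := by
  intro c hc
  have hcu : u ≠ c := fun h => hc (h ▸ hu)
  have hcv : v ≠ c := fun h => hc (h ▸ hv)
  exact ⟨fun ⟨_, h2, _, h3⟩ => ⟨hTX v hv, h2, hcv, (h c h2 hc).1 h3⟩,
    fun ⟨_, h2, _, h3⟩ => ⟨hTX u hu, h2, hcu, (h c h2 hc).2 h3⟩⟩

theorem position_iff (hn : n = k * k + 1) (hk : 3 ≤ k) (c : ℤ) :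
    position k n 0 False False c ↔
      1 ≤ c ∧ c ≤ n ∨ c = -1 - k ∨ c = 1 - k ∨ c = n + k ∨ c = n + k + 2 := by
  have hkk : 3 * k ≤ k * k := Int.mul_le_mul_of_nonneg_right hk (by omega)
  unfold position
  simp only [false_and, false_or, or_false]
  omega

theorem typesLE_combSet (hκ : (κ : ℤ) = k) (hk : 3 ≤ k) (hn : n = k * k + 1) {x s : ℤ}
    (hx' : x ≤ k - 2) :
    TypesLE (powerGraph k (position k n 0 False False)) (combSet k x s) κ := by
  have hkk2 : (k - 2) * k = k * k - 2 * k := by ring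
  have hb : ∀ m, 0 ≤ m → m ≤ k - 2 → 0 ≤ m * k ∧ m * k ≤ k * k - 2 * k := fun m h1 h2 =>
    ⟨mul_nonneg h1 (by omega), hkk2 ▸ le_mul_of_lt (by omega) h2⟩
  refine typesLE_of_rel ?_ (fun u i => 0 ≤ i ∧ i ≤ k - 2 ∧ i * k + i + 3 ≤ u ∧
    u ≤ i * k + i + 3 + x ∧ (s ≤ i → u ≤ i * k + i + 2 + x)) ?_ ?_
  · rintro c ⟨m, h1, h2, h3, h4, -⟩
    rw [position_iff hn hk]
    have := hb m h1 h2
    omega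
  · rintro u ⟨m, h1, h2, h3⟩
    exact ⟨m, h1, by omega, h1, h2, h3⟩
  · rintro u hu v hv i ⟨h1, h2, h3, h4, h5⟩ ⟨-, -, h6, h7, h8⟩ huv c hc hcT
    rw [position_iff hn hk] at hc
    have hbi := hb i h1 h2
    have hi1 : (i + 1) * k = i * k + k := by ring
    have hi2 : (i - 1) * k = i * k - k := by ring
    constructor
    · rintro ⟨h9, h10⟩
      by_cases hik : i + 1 ≤ k - 2
      · exact hcT ⟨i + 1, by omega, hik, by omega, by omega, by omega⟩
      · have : i = k - 2 := by omega
        rw [this] at h3 h4 h5 h6 h7 h8 hbi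
        omega
    · rintro ⟨h9, h10⟩
      by_cases hik : 0 ≤ i - 1
      · exact hcT ⟨i - 1, by omega, by omega, by omega, by omega, by omega⟩
      · have : i = 0 := by omega
        rw [this] at h3 h4 h5 h6 h7 h8 hbi
        omega

theorem reach_combSet (hκ : (κ : ℤ) = k) (hk : 3 ≤ k) (hn : n = k * k + 1) :
    Reach (powerGraph k (position k n 0 False False)) lin (κ + 1) (combSet k (k - 1) 0) := by
  have key : ∀ i : ℕ, i ≤ k - 1 → (combSet k i 0).Nonempty →
      Reach (powerGraph k (position k n 0 False False)) lin (κ + 1) (combSet k i 0) := by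
    intro i
    induction i with
    | zero =>
      rintro _ ⟨c, m, h1, h2, h3, h4, h5⟩
      have := h5 h1
      push_cast at this
      omega
    | succ i ih =>
      intro hi
      push_cast at hi
      have hstep : ∀ j : ℕ, j ≤ k - 1 → (combSet k i j).Nonempty →
          Reach (powerGraph k (position k n 0 False False)) lin (κ + 1) (combSet k i j) := by
        intro j
        induction j with
        | zero => intro _; simpa using ih (by omega)
        | succ j ihj =>
          intro hj
          push_cast at hj
          refine Reach.extend_nonempty (ihj (by omega)) (j * k + j + 3 + i) ?_ ?_ fun _ _ =>
            typesLE_combSet hκ hk hn (by omega)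
          · rintro c ⟨m, h1, h2, h3, h4, h5⟩
            exact ⟨m, h1, h2, h3, h4, fun h => h5 (by omega)⟩
          · rintro c ⟨m, h1, h2, h3, h4, h5⟩
            by_cases hm : m = j ∧ c = j * k + j + 3 + i
            · exact Or.inr hm.2
            · refine Or.inl ⟨m, h1, h2, h3, h4, fun h => ?_⟩
              rcases eq_or_lt_of_le h with h | h
              · rw [← h] at h4 h3 ⊢
                omega
              · exact h5 (by push_cast; omega)
      have h := hstep (k - 1).toNat (by omega)
      rw [show (((k - 1).toNat : ℕ) : ℤ) = k - 1 by omega] at h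
      have heq : combSet k ((i + 1 : ℕ) : ℤ) 0 = combSet k i (k - 1) := by
        ext c
        constructor
        · rintro ⟨m, h1, h2, h3, h4, h5⟩
          have := h5 h1
          push_cast at this
          exact ⟨m, h1, h2, h3, by omega, by omega⟩
        · rintro ⟨m, h1, h2, h3, h4, h5⟩
          push_cast
          exact ⟨m, h1, h2, h3, by omega, by omega⟩
      rw [heq]
      exact h
  have := key (k - 1).toNat (by omega)
  rw [show (((k - 1).toNat : ℕ) : ℤ) = k - 1 by omega] at this
  exact this ⟨3, 0, by omega, by omega, by omega, by omega, by omega⟩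

/-- The segments play the role of rows. The element before the last segment, `n - k - 1`, needs the
additional class `k - 1`: unlike the rest of that segment it does not reach `n`. -/
theorem typesLE_fillSet (hκ : (κ : ℤ) = k) (hk : 3 ≤ k) (hn : n = k * k + 1) {j : ℤ} :
    TypesLE (powerGraph k (position k n 0 False False)) (fillSet k j) κ := by
  have hkk2 : (k - 2) * k = k * k - 2 * k := by ring
  have hb : ∀ m, 0 ≤ m → m ≤ k - 2 → 0 ≤ m * k ∧ m * k ≤ k * k - 2 * k := fun m h1 h2 =>
    ⟨mul_nonneg h1 (by omega), hkk2 ▸ le_mul_of_lt (by omega) h2⟩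
  refine typesLE_of_rel ?_ (fun u i => (0 ≤ i ∧ i ≤ k - 2 ∧ i * k + i + 2 ≤ u ∧
    u ≤ i * k + i + k + 1 ∧ (i < j → i * k + i + 3 ≤ u)) ∧ (i = k - 2 → i * k + i + 3 ≤ u) ∨
    u = k * k - 2 * k + k ∧ i = k - 1) ?_ ?_
  · rintro c ⟨m, h1, h2, h3, h4, -⟩
    rw [position_iff hn hk]
    have := hb m h1 h2
    omega
  · rintro u ⟨m, h1, h2, h3, h4, h5⟩
    by_cases hu : m = k - 2 ∧ u = m * k + m + 2
    · refine ⟨k - 1, by omega, by omega, Or.inr ⟨?_, rfl⟩⟩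
      rw [hu.1] at hu
      omega
    · exact ⟨m, h1, by omega, Or.inl ⟨⟨h1, h2, h3, h4, h5⟩, by omega⟩⟩
  · rintro u hu v hv i hFu hFv huv c hc hcT
    rcases hFu with ⟨⟨h1, h2, h3, h4, h5⟩, h6⟩ | ⟨h1, h2⟩
    · rcases hFv with ⟨⟨h1', h2', h3', h4', h5'⟩, h6'⟩ | ⟨h1', h2'⟩
      · rw [position_iff hn hk] at hc
        have hbi := hb i h1 h2
        have hi1 : (i + 1) * k = i * k + k := by ring
        have hi2 : (i - 1) * k = i * k - k := by ring
        constructor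
        · rintro ⟨h9, h10⟩
          by_cases hik : i + 1 ≤ k - 2
          · exact hcT ⟨i + 1, by omega, hik, by omega, by omega, by omega⟩
          · have : i = k - 2 := by omega
            rw [this] at h3 h4 h5 h6 h3' h4' h5' h6' hbi
            omega
        · rintro ⟨h9, h10⟩
          by_cases hik : 0 ≤ i - 1
          · exact hcT ⟨i - 1, by omega, by omega, by omega, by omega, by omega⟩
          · have : i = 0 := by omega
            rw [this] at h3 h4 h5 h6 h3' h4' h5' h6' hbi
            omega
      · omega
    · rcases hFv with ⟨⟨h1', h2', h3', h4', h5'⟩, h6'⟩ | ⟨h1', h2'⟩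
      · omega
      · omega

theorem reach_fillSet (hκ : (κ : ℤ) = k) (hk : 3 ≤ k) (hn : n = k * k + 1) :
    Reach (powerGraph k (position k n 0 False False)) lin (κ + 1) (fillSet k 0) := by
  suffices H : ∀ i : ℕ, i ≤ k - 1 →
      Reach (powerGraph k (position k n 0 False False)) lin (κ + 1) (fillSet k (k - 1 - i)) by
    have := H (k - 1).toNat (by omega)
    rwa [show k - 1 - (((k - 1).toNat : ℕ) : ℤ) = 0 by omega] at this
  intro i
  induction i with
  | zero =>
    intro _
    convert reach_combSet (lin := lin) hκ hk hn using 1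
    ext c
    constructor
    · rintro ⟨m, h1, h2, h3, h4, h5⟩
      have := h5 (by push_cast; omega)
      exact ⟨m, h1, h2, by omega, by omega, by omega⟩
    · rintro ⟨m, h1, h2, h3, h4, h5⟩
      have := h5 h1
      exact ⟨m, h1, h2, by omega, by omega, by omega⟩
  | succ i ih =>
    intro hi
    push_cast at hi ⊢
    refine (ih (by omega)).extend ((k - 1 - (i + 1)) * k + (k - 1 - (i + 1)) + 2) ?_ ?_ fun _ _ =>
      typesLE_fillSet hκ hk hn
    · rintro c ⟨m, h1, h2, h3, h4, h5⟩
      exact ⟨m, h1, h2, h3, h4, fun h => h5 (by omega)⟩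
    · rintro c ⟨m, h1, h2, h3, h4, h5⟩
      by_cases hm : m = k - 1 - (i + 1) ∧ c = m * k + m + 2
      · rw [hm.1] at hm
        exact Or.inr hm.2
      · exact Or.inl ⟨m, h1, h2, h3, h4, fun h => by omega⟩

/-- A cut element `p (k + 1) + 1` is adjacent to the whole block `[m (k + 1) + 2, (m + 1)(k + 1)]`
if `p` is `m` or `m + 1`, and to nothing in it otherwise. The left ends are too far from elements
greater than `1`. -/
theorem cutSet_unsplit (hk : 3 ≤ k) {u v m : ℤ}
    (hu : m * k + m + 2 ≤ u) (hv : v ≤ m * k + m + k + 1) (hu2 : 2 ≤ u) (hm : 0 ≤ m)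
    {c : ℤ} (hc : c = 1 ∨ c = -1 - k ∨ c = 1 - k ∨ ∃ p, c = p * k + p + 1) :
    ¬ (u + k < c ∧ c ≤ v + k) ∧ ¬ (u - k ≤ c ∧ c < v - k) := by
  have h0 : 0 ≤ m * k := mul_nonneg hm (by omega)
  rcases hc with hc | hc | hc | ⟨p, rfl⟩
  · constructor
    · omega
    · rintro ⟨h1, h2⟩
      rcases eq_or_lt_of_le hm with h | h
      · rw [← h] at hu hv; omega
      · rcases eq_or_lt_of_le (by omega : 1 ≤ m) with h' | h'
        · rw [← h'] at hu hv; omega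
        · have := le_mul_of_lt (k := k) (by omega) (by omega : 2 ≤ m)
          omega
  · omega
  · omega
  · have h1 := block_compare (k := k) (by omega) m p
    have h2 := block_compare (k := k) (by omega) (m + 1) p
    have h3 := block_compare (k := k) (by omega) (m - 1) p
    rw [show (m + 1) * k = m * k + k by ring] at h2
    rw [show (m - 1) * k = m * k - k by ring] at h3
    omega

/-- Beyond block `j` no neighbour is missing, so the blocks `0, …, j` and the remainder give `j + 2`
types. -/
theorem typesLE_cutSet (hκ : (κ : ℤ) = k) (hk : 3 ≤ k) (hn : n = k * k + 1) {j : ℤ} (hj : 0 ≤ j)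
    (hj' : j ≤ k - 3) :
    TypesLE (powerGraph k (position k n 0 False False))
      (cutSet k (position k n 0 False False) j) κ := by
  have hb : j * k ≤ (k - 3) * k := le_mul_of_lt (by omega) hj'
  rw [show (k - 3) * k = k * k - 3 * k by ring] at hb
  refine typesLE_of_rel (fun c hc => hc.1) (fun u i => 0 ≤ i ∧ i ≤ j ∧ i * k + i + 2 ≤ u ∧
    u ≤ i * k + i + k + 1 ∨ j * k + j + k + 1 < u ∧ i = j + 1) ?_ ?_
  · rintro u ⟨huX, hu2, hu⟩
    by_cases huj : j * k + j + k + 1 < u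
    · exact ⟨j + 1, by omega, by omega, Or.inr ⟨huj, rfl⟩⟩
    · obtain ⟨m, h1, h2⟩ := exists_block (k := k) (by omega) u
      have hmj : m ≤ j := by
        have := block_compare (k := k) (by omega) j m
        omega
      have hm0 : 0 ≤ m := by
        have := block_compare (k := k) (by omega) 0 m
        omega
      have hm1 : u ≠ m * k + m + 1 := by
        rcases eq_or_lt_of_le hm0 with h | h
        · rw [← h]; omega
        · exact hu m (by omega) hmj
      exact ⟨m, hm0, by omega, Or.inl ⟨hm0, hmj, by omega, h2⟩⟩
  · rintro u hu v hv i hFu hFv huv c hc hcT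
    have hc' : c ≤ 1 ∨ ∃ p, 1 ≤ p ∧ p ≤ j ∧ c = p * k + p + 1 := by
      by_contra hcc
      push Not at hcc
      exact hcT ⟨hc, by omega, hcc.2⟩
    have hc'' : c ≤ j * k + j + 1 := by
      rcases hc' with hc' | ⟨p, h1, h2, rfl⟩
      · have := mul_nonneg hj (by omega : 0 ≤ k)
        omega
      · have := le_mul_of_lt (k := k) (by omega) h2
        omega
    rw [position_iff hn hk] at hc
    rcases hFu with ⟨h1, h2, h3, h4⟩ | ⟨h1, h2⟩ <;> rcases hFv with ⟨h1', h2', h3', h4'⟩ | ⟨h1', h2'⟩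
    · have h5 : i * k ≤ j * k := le_mul_of_lt (by omega) h2
      refine cutSet_unsplit hk h3 h4' hu.2.1 h1 ?_
      rcases hc' with hc' | ⟨p, -, -, hp⟩
      · omega
      · exact Or.inr (Or.inr (Or.inr ⟨p, hp⟩))
    · omega
    · omega
    · have := mul_nonneg hj (by omega : 0 ≤ k)
      omega

/-- The elements of the segments are not separated by the gaps. -/
theorem sameType_cutSet_diff (hk : 3 ≤ k) (hn : n = k * k + 1) {u v : ℤ}
    (hu : u ∈ {c | c ∈ cutSet k (position k n 0 False False) (k - 3) ∧ c ≠ n - 1})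
    (hv : v ∈ {c | c ∈ cutSet k (position k n 0 False False) (k - 3) ∧ c ≠ n - 1})
    (h : (∃ i, i * k + i + 1 ≤ u ∧ u ≤ i * k + i + k + 1 ∧ i * k + i + 1 ≤ v ∧
        v ≤ i * k + i + k + 1 ∧ u < n - k - 2 ∧ v < n - k - 2) ∨
      (u = n - k - 2 ∨ n < u) ∧ (v = n - k - 2 ∨ n < v) ∨
      n - k - 1 ≤ u ∧ u ≤ n ∧ n - k - 1 ≤ v ∧ v ≤ n) :
    SameType (powerGraph k (position k n 0 False False))
      {c | c ∈ cutSet k (position k n 0 False False) (k - 3) ∧ c ≠ n - 1} u v := by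
  have hkk : 3 * k ≤ k * k := Int.mul_le_mul_of_nonneg_right hk (by omega)
  have hkk3 : (k - 3) * k = k * k - 3 * k := by ring
  refine sameType_of_iff (fun c hc => hc.1.1) hu hv fun c hc hcT => ?_
  have hc' : c ≤ 1 ∨ c = n - 1 ∨ ∃ p, 1 ≤ p ∧ p ≤ k - 3 ∧ c = p * k + p + 1 := by
    by_contra hcc
    push Not at hcc
    exact hcT ⟨⟨hc, by omega, hcc.2.2⟩, hcc.2.1⟩
  have hc'' : c = n - 1 ∨ c ≤ n - 2 * k - 3 := by
    rcases hc' with hc' | hc' | ⟨p, h1, h2, rfl⟩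
    · omega
    · exact Or.inl hc'
    · have := le_mul_of_lt (k := k) (by omega) h2
      omega
  rw [position_iff hn hk] at hc
  have hun := hu.2
  have hvn := hv.2
  have hu2 := hu.1.2.1
  have hv2 := hv.1.2.1
  have hu3 := hu.1.2.2
  have hv3 := hv.1.2.2
  have huX := hu.1.1
  have hvX := hv.1.1
  rw [position_iff hn hk] at huX hvX
  rcases h with ⟨i, h1, h2, h3, h4, h5, h6⟩ | h | h
  · have hi0 : 0 ≤ i := by
      have := block_compare (k := k) (by omega) 0 i
      omega
    have hi1 : i ≤ k - 3 := by
      have := block_compare (k := k) (by omega) (k - 3) i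
      omega
    have hui : u ≠ i * k + i + 1 := by
      rcases eq_or_lt_of_le hi0 with h | h
      · rw [← h]; omega
      · exact hu3 i (by omega) hi1
    have hvi : v ≠ i * k + i + 1 := by
      rcases eq_or_lt_of_le hi0 with h | h
      · rw [← h]; omega
      · exact hv3 i (by omega) hi1
    clear hu3 hv3
    by_cases hcn : c = n - 1
    · omega
    have hc3 : c = 1 ∨ c = -1 - k ∨ c = 1 - k ∨ ∃ p, c = p * k + p + 1 := by
      rcases hc' with hc' | hc' | ⟨p, -, -, hp⟩
      · omega
      · omega
      · exact Or.inr (Or.inr (Or.inr ⟨p, hp⟩))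
    rcases le_total u v with huv | huv
    · have := cutSet_unsplit hk (by omega : i * k + i + 2 ≤ u) h4 hu2 hi0 hc3
      clear hc' hc3
      omega
    · have := cutSet_unsplit hk (by omega : i * k + i + 2 ≤ v) h2 hv2 hi0 hc3
      clear hc' hc3
      omega
  · clear hc' hu3 hv3
    omega
  · clear hc' hu3 hv3
    omega

theorem typesLE_cutSet_diff (hκ : (κ : ℤ) = k) (hk : 3 ≤ k) (hn : n = k * k + 1) :
    TypesLE (powerGraph k (position k n 0 False False))
      {c | c ∈ cutSet k (position k n 0 False False) (k - 3) ∧ c ≠ n - 1} κ := by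
  have hkk : 3 * k ≤ k * k := Int.mul_le_mul_of_nonneg_right hk (by omega)
  have hkk3 : (k - 3) * k = k * k - 3 * k := by ring
  have hF : ∀ u ∈ {c | c ∈ cutSet k (position k n 0 False False) (k - 3) ∧ c ≠ n - 1},
      ∃ i : ℤ, 0 ≤ i ∧ i < k ∧ (i * k + i + 1 ≤ u ∧ u ≤ i * k + i + k + 1 ∧ i ≤ k - 3 ∧ u < n - k - 2 ∨
        i = k - 2 ∧ (u = n - k - 2 ∨ n < u) ∨ n - k - 1 ≤ u ∧ u ≤ n ∧ i = k - 1) := by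
    rintro u ⟨⟨huX, hu2, hu⟩, hun⟩
    clear hu
    by_cases huj : n - k - 2 ≤ u
    · by_cases hu1 : u = n - k - 2 ∨ n < u
      · exact ⟨k - 2, by omega, by omega, Or.inr (Or.inl ⟨rfl, hu1⟩)⟩
      · exact ⟨k - 1, by omega, by omega, Or.inr (Or.inr ⟨by omega, by omega, rfl⟩)⟩
    · obtain ⟨m, h1, h2⟩ := exists_block (k := k) (by omega) u
      have hmj : m ≤ k - 3 := by
        have := block_compare (k := k) (by omega) (k - 3) m
        omega
      have hm0 : 0 ≤ m := by
        have := block_compare (k := k) (by omega) 0 m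
        omega
      exact ⟨m, hm0, by omega, Or.inl ⟨h1, h2, hmj, by omega⟩⟩
  choose! f hf0 hfk hf using hF
  refine ⟨fun u => (f u).toNat, fun u hu => ?_, fun u hu v hv huv => ?_⟩
  · have := hf0 u hu
    have := hfk u hu
    dsimp only
    omega
  · have h1 := hf0 u hu
    have h2 := hf0 v hv
    have huv' : f u = f v := by dsimp only at huv; omega
    have h3 := hf u hu
    have h4 := hf v hv
    refine sameType_cutSet_diff hk hn hu hv ?_
    rw [huv'] at h3
    by_cases hfk' : f v ≤ k - 3
    · exact Or.inl ⟨f v, by omega⟩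
    · exact Or.inr (by omega)

set_option maxHeartbeats 1000000 in
/-- A path power with ends can be built with `k + 1` labels if it has no `w⁺`. -/
theorem reach_no_plus (hκ : (κ : ℤ) = k) (hk : 3 ≤ k) (hn : n = k * k + 1) :
    Reach (powerGraph k (position k n 0 False False)) False (κ + 1)
      {c | position k n 0 False False c} := by
  have hkk : 3 * k ≤ k * k := Int.mul_le_mul_of_nonneg_right hk (by omega)
  have hkk3 : (k - 3) * k = k * k - 3 * k := by ring
  have hkk2 : (k - 2) * k = k * k - 2 * k := by ring
  have hX := position_iff hn hk
  -- the left part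
  have hT : Reach (powerGraph k (position k n 0 False False)) False (κ + 1)
      {c | c ∈ cutSet k (position k n 0 False False) (k - 3) ∧ c ≤ n - 2} := by
    refine (reach_fillSet hκ hk hn).extend (n - k - 2) ?_ ?_ fun _ _ => typesLE_fillSet hκ hk hn
    · rintro c ⟨m, h1, h2, h3, h4, h5⟩
      have h6 : 0 ≤ m * k := mul_nonneg h1 (by omega)
      have h7 : m * k ≤ (k - 2) * k := le_mul_of_lt (by omega) h2
      refine ⟨⟨(hX c).2 (by omega), by omega, fun p h8 h9 => ?_⟩, by omega⟩
      have := block_compare (k := k) (by omega) m p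
      omega
    · rintro c ⟨⟨hc, hc2, hc3⟩, hcn⟩
      by_cases hcx : c = n - k - 2
      · exact Or.inr hcx
      · obtain ⟨m, h1, h2⟩ := exists_block (k := k) (by omega) c
        have h3 := block_compare (k := k) (by omega) 0 m
        have h4 := block_compare (k := k) (by omega) (k - 2) m
        have h5 : c ≠ m * k + m + 1 := by
          by_cases hm : 1 ≤ m ∧ m ≤ k - 3
          · exact hc3 m hm.1 hm.2
          · omega
        exact Or.inl ⟨m, by omega, by omega, by omega, by omega, by omega⟩
  -- the right part
  have hD : Reach (powerGraph k (position k n 0 False False)) False (κ + 1)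
      {c | c = n ∨ c = n + k ∨ c = n + k + 2} := by
    have h1 : Reach (powerGraph k (position k n 0 False False)) False (κ + 1)
        {c | c = n + k ∨ c = n + k + 2} := by
      refine (Reach.single (n + k)).extend (n + k + 2) ?_ (fun c hc => hc) fun _ _ =>
        typesLE_singleton (by omega) _
      rintro c rfl
      exact Or.inl rfl
    refine h1.extend n (fun c hc => Or.inr hc) (fun c hc => hc.symm) fun _ _ => ?_
    refine typesLE_of_rel ?_ (fun u i => u = n + k + i * 2) ?_ ?_
    · rintro c (rfl | rfl) <;> exact (hX _).2 (by omega)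
    · rintro c (rfl | rfl)
      · exact ⟨0, by omega, by omega, by omega⟩
      · exact ⟨1, by omega, by omega, by omega⟩
    · rintro u - v - i hFu hFv huv
      omega
  have hU : Reach (powerGraph k (position k n 0 False False)) False (κ + 1)
      {c | c ∈ cutSet k (position k n 0 False False) (k - 3) ∧ c ≠ n - 1} := by
    classical
    have hset : {c | c ∈ cutSet k (position k n 0 False False) (k - 3) ∧ c ≤ n - 2} ∪
        {c | c = n ∨ c = n + k ∨ c = n + k + 2} =
        {c | c ∈ cutSet k (position k n 0 False False) (k - 3) ∧ c ≠ n - 1} := by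
      ext c
      constructor
      · rintro (⟨hc, hcn⟩ | hc)
        · exact ⟨hc, by omega⟩
        · have hc' : n ≤ c := by rcases hc with rfl | rfl | rfl <;> omega
          refine ⟨⟨(hX c).2 (by rcases hc with rfl | rfl | rfl <;> omega), by omega,
            fun p h1 h2 => ?_⟩, by omega⟩
          have := le_mul_of_lt (k := k) (by omega) h2
          omega
      · rintro ⟨hc, hcn⟩
        have := (hX c).1 hc.1
        by_cases hcn' : c ≤ n - 2
        · exact Or.inl ⟨hc, hcn'⟩
        · exact Or.inr (by have := hc.2.1; change c = n ∨ _; omega)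
    obtain ⟨b, hb⟩ : ∃ b : ℤ → ℤ, ∀ c, b c * k + b c + 1 ≤ c ∧ c ≤ b c * k + b c + k + 1 :=
      ⟨_, fun c => (exists_block (k := k) (by omega) c).choose_spec⟩
    -- The union omits `n - 1`. The elements `n - k - 2, n + k, n + k + 2` are finished and share
    -- the label `k - 2`. The elements `n - k - 1` and `n` share `k - 1`: of their outside
    -- neighbours only `n - 1` remains, and both are adjacent to all of `n - k, …, n - 2`, which get
    -- `k`. Thus joining `k - 1` and `k` creates the edges at `n` and no wrong ones.
    obtain ⟨f, hf⟩ : ∃ f : ℤ → ℤ, ∀ c, c < n - k - 2 ∧ f c = b c ∨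
        (c = n - k - 2 ∨ n < c) ∧ f c = k - 2 ∨ (c = n - k - 1 ∨ c = n) ∧ f c = k - 1 ∨
        n - k - 1 < c ∧ c < n ∧ f c = k := by
      refine ⟨fun c => if c < n - k - 2 then b c else if c = n - k - 2 ∨ n < c then k - 2 else
        if c = n - k - 1 ∨ c = n then k - 1 else k, fun c => ?_⟩
      dsimp only
      split_ifs <;> omega
    have hbb : ∀ c, 2 ≤ c → c < n - k - 2 → 0 ≤ b c ∧ b c ≤ k - 3 := by
      intro c h1 h2
      have h3 := block_compare (k := k) (by omega) 0 (b c)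
      have h4 := block_compare (k := k) (by omega) (k - 3) (b c)
      have h5 := hb c
      omega
    have hfb : ∀ c, 2 ≤ c → 0 ≤ f c ∧ f c ≤ k := by
      intro c h1
      have h2 := hf c
      have h3 := hbb c h1
      omega
    let l : ℤ → Fin (κ + 1) := fun c =>
      if h : 2 ≤ c then ⟨(f c).toNat, by have := hfb c h; omega⟩ else ⟨0, by omega⟩
    have hl : ∀ u, 2 ≤ u → ∀ v, 2 ≤ v → l u = l v → f u = f v := by
      intro u hu v hv huv
      simp only [l, dif_pos hu, dif_pos hv, Fin.mk.injEq] at huv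
      have := hfb u hu
      have := hfb v hv
      omega
    have hl' : ∀ u, 2 ≤ u → ∀ v, 2 ≤ v → f u = f v → l u = l v := by
      intro u hu v hv huv
      simp only [l, dif_pos hu, dif_pos hv, huv]
    have h2U : ∀ c ∈ {c | c ∈ cutSet k (position k n 0 False False) (k - 3) ∧ c ≤ n - 2} ∪
        {c | c = n ∨ c = n + k ∨ c = n + k + 2}, 2 ≤ c := by
      intro c hc
      rw [hset] at hc
      exact hc.1.2.1
    rw [← hset]
    refine Reach.of_builds (Nat.succ_pos κ) (l := l) (CWExpr.Builds.unite (hT l ?_) (hD l ?_) ?_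
      False.elim ?_) ?_
    · suffices H : ∀ u ∈ {c | c ∈ cutSet k (position k n 0 False False) (k - 3) ∧ c ≤ n - 2},
          ∀ v ∈ {c | c ∈ cutSet k (position k n 0 False False) (k - 3) ∧ c ≤ n - 2}, u < v →
          SameType (powerGraph k (position k n 0 False False))
            {c | c ∈ cutSet k (position k n 0 False False) (k - 3) ∧ c ≤ n - 2} u v → f u = f v by
        intro u hu v hv huv
        refine hl' u hu.1.2.1 v hv.1.2.1 ?_
        rcases lt_trichotomy u v with h | h | h
        · exact H u hu v hv h huv
        · rw [h]
        · exact (H v hv u hu h huv.symm).symm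
      rintro u hu v hv huv hsame
      by_contra hne
      have key : ∀ c, position k n 0 False False c →
          ¬ (c ∈ cutSet k (position k n 0 False False) (k - 3) ∧ c ≤ n - 2) →
          (u ≤ c + k ∧ c ≤ u + k ↔ v ≤ c + k ∧ c ≤ v + k) := by
        intro c hc hcT
        have h1 : u ≠ c := fun h => hcT (h ▸ hu)
        have h2 : v ≠ c := fun h => hcT (h ▸ hv)
        have h3 := hsame c hcT
        exact ⟨fun h => (h3.1 ⟨hu.1.1, hc, h1, h⟩).2.2.2, fun h => (h3.2 ⟨hv.1.1, hc, h2, h⟩).2.2.2⟩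
      have hun := hu.2
      have hvn := hv.2
      have hu2 := hu.1.2.1
      have hfu := hf u
      have hfv := hf v
      by_cases hu1 : u < n - k - 2
      · have h1 := hbb u hu2 hu1
        have h2 := hb u
        have h3 := hb v
        have h4 : b u * k + b u + k + 1 < v := by
          by_contra h4
          have h5 := block_compare (k := k) (by omega) (b u) (b v)
          have h6 := le_mul_of_lt (k := k) (by omega) h1.2
          omega
        have h5 := mul_nonneg h1.1 (by omega : 0 ≤ k)
        have h6 := key (b u * k + b u + 1) ((hX _).2 (by omega)) fun h => by
          by_cases hb0 : 1 ≤ b u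
          · exact h.1.2.2 (b u) hb0 h1.2 rfl
          · have : b u = 0 := by omega
            have := h.1.2.1
            simp_all
        clear key
        omega
      · by_cases hu3 : u = n - k - 2
        · have h6 := key (n - 1) ((hX _).2 (by omega)) (by omega)
          clear key
          omega
        · have h6 := key n ((hX _).2 (by omega)) (by omega)
          clear key
          omega
    · intro u hu v hv huv
      refine hl' u (h2U u (Or.inr hu)) v (h2U v (Or.inr hv)) ?_
      have hfu := hf u
      have hfv := hf v
      have h1 := huv (n - 1) (by change ¬ (_ ∨ _); omega)
      have h2 : ∀ w, (w = n ∨ w = n + k ∨ w = n + k + 2) →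
          ((powerGraph k (position k n 0 False False)).Adj w (n - 1) ↔ w = n) := by
        intro w hw
        refine ⟨fun h => by have := h.2.2; omega, fun h => ?_⟩
        exact ⟨(hX _).2 (by omega), (hX _).2 (by omega), by omega⟩
      rw [h2 u hu, h2 v hv] at h1
      change u = n ∨ _ at hu
      change v = n ∨ _ at hv
      omega
    · refine Set.disjoint_left.2 fun c hc hc' => ?_
      have := hc.2
      change c = n ∨ _ at hc'
      omega
    · rintro a ha b' hb' ⟨-, -, h3⟩ a' ha' b'' hb'' h4 h5
      have ha2 := h2U a (Or.inl ha)
      have ha2' := h2U a' ha'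
      have hb2 := h2U b' (Or.inr hb')
      have hb2' := h2U b'' hb''
      have h6 := hl a' ha2' a ha2 h4
      have h7 := hl b'' hb2' b' hb2 h5
      have h8 := ha.2
      have hb'n : b' = n := by
        change b' = n ∨ _ at hb'
        omega
      have hfb : f b' = k - 1 := by
        have := hf b'
        omega
      have hfa : f a = k := by
        have := hf a
        have := hbb a ha2
        omega
      have ha'n : n - k - 1 < a' ∧ a' < n := by
        have := hf a'
        have := hbb a' ha2'
        omega
      have hb''n : b'' = n - k - 1 ∨ b'' = n := by
        have := hf b''
        have := hbb b'' hb2'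
        omega
      exact ⟨(hX _).2 (by omega), (hX _).2 (by omega), by omega⟩
    · intro u hu v hv huv
      have hfuv := hl u (h2U u hu) v (h2U v hv) huv
      have h2u := h2U u hu
      have h2v := h2U v hv
      rw [hset] at hu hv ⊢
      refine sameType_cutSet_diff hk hn hu hv ?_
      have hfu := hf u
      have hfv := hf v
      have h1 := hbb u h2u
      have h2 := hbb v h2v
      by_cases hfk' : f v ≤ k - 3
      · have h3 := hb u
        have h4 := hb v
        have h5 : b u = b v := by omega
        rw [h5] at h3
        exact Or.inl ⟨b v, by omega⟩
      · have hun := hu.2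
        have hvn := hv.2
        exact Or.inr (by omega)
  -- The cut elements are restored from right to left, so that everything to the right is finished.
  have hC : ∀ i : ℕ, i ≤ k - 3 → Reach (powerGraph k (position k n 0 False False)) False (κ + 1)
      (cutSet k (position k n 0 False False) (k - 3 - i)) := by
    intro i
    induction i with
    | zero =>
      intro _
      refine hU.extend (n - 1) (fun c hc => by simpa using hc.1) (fun c hc => ?_) fun _ _ =>
        typesLE_cutSet_diff hκ hk hn
      by_cases hcn : c = n - 1
      · exact Or.inr hcn
      · exact Or.inl ⟨by simpa using hc, hcn⟩
    | succ i ih =>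
      intro hi
      push_cast at hi ⊢
      refine (ih (by omega)).extend ((k - 3 - i) * k + (k - 3 - i) + 1) ?_ ?_ fun _ _ =>
        typesLE_cutSet hκ hk hn (by omega) (by omega)
      · rintro c ⟨h1, h2, h3⟩
        exact ⟨h1, h2, fun m hm hm' => h3 m hm (by omega)⟩
      · rintro c ⟨h1, h2, h3⟩
        by_cases hcx : c = (k - 3 - i) * k + (k - 3 - i) + 1
        · exact Or.inr hcx
        · refine Or.inl ⟨h1, h2, fun m hm hm' => ?_⟩
          rcases eq_or_lt_of_le hm' with h | h
          · rwa [h]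
          · exact h3 m hm (by omega)
  have h0 := hC (k - 3).toNat (by omega)
  rw [show k - 3 - (((k - 3).toNat : ℕ) : ℤ) = 0 by omega] at h0
  have h1 : Reach (powerGraph k (position k n 0 False False)) False (κ + 1)
      {c | position k n 0 False False c ∧ 1 ≤ c} := by
    refine h0.extend 1 (fun c hc => ⟨hc.1, by have := hc.2.1; omega⟩) (fun c hc => ?_) fun _ _ =>
      typesLE_cutSet hκ hk hn le_rfl (by omega)
    by_cases hc1 : c = 1
    · exact Or.inr hc1
    · exact Or.inl ⟨hc.1, by have := hc.2; omega, fun m h1 h2 => by omega⟩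
  have h2 : Reach (powerGraph k (position k n 0 False False)) False (κ + 1)
      {c | position k n 0 False False c ∧ 1 - k ≤ c} := by
    refine h1.extend (1 - k) (fun c hc => ⟨hc.1, by have := hc.2; omega⟩) (fun c hc => ?_) fun _ _ => ?_
    · have h3 := (hX c).1 hc.1
      have h4 := hc.2
      by_cases hc1 : 1 ≤ c
      · exact Or.inl ⟨hc.1, hc1⟩
      · omega
    · refine typesLE_of_rel (fun c hc => hc.1) (fun u i => u = 1 ∧ i = 0 ∨ u ≠ 1 ∧ i = 1) ?_ ?_
      · intro u _
        by_cases hu : u = 1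
        · exact ⟨0, by omega, by omega, Or.inl ⟨hu, rfl⟩⟩
        · exact ⟨1, by omega, by omega, Or.inr ⟨hu, rfl⟩⟩
      · rintro u ⟨hu, hu1⟩ v ⟨hv, hv1⟩ i hFu hFv huv c hc hcT
        have : ¬ 1 ≤ c := fun h => hcT ⟨hc, h⟩
        have := (hX c).1 hc
        omega
  refine h2.extend (-1 - k) (fun c hc => hc.1) (fun c hc => ?_) fun _ _ => ?_
  · have h3 := (hX c).1 hc
    by_cases hc1 : 1 - k ≤ c
    · exact Or.inl ⟨hc, hc1⟩
    · omega
  · refine typesLE_of_rel (fun c hc => hc.1) (fun u i => u ≤ 0 ∧ i = 0 ∨ 1 ≤ u ∧ i = 1) ?_ ?_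
    · intro u _
      by_cases hu : u ≤ 0
      · exact ⟨0, by omega, by omega, Or.inl ⟨hu, rfl⟩⟩
      · exact ⟨1, by omega, by omega, Or.inr ⟨by omega, rfl⟩⟩
    · rintro u ⟨hu, hu1⟩ v ⟨hv, hv1⟩ i hFu hFv huv c hc hcT
      have h3 : ¬ 1 - k ≤ c := fun h => hcT ⟨hc, h⟩
      have := (hX c).1 hc
      have := (hX u).1 hu
      have := (hX v).1 hv
      omega

end nonlinear

open CWExpr

/-! ### The vertices as integers, and the upper bounds for `k ≥ 3` -/

namespace SVertex

variable {k : ℕ}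

theorem sSize_eq (hk : 1 ≤ k) : ((sSize k : ℕ) : ℤ) = (k : ℤ) * k + 1 := by
  obtain ⟨j, rfl⟩ : ∃ j, k = j + 1 := ⟨k - 1, by omega⟩
  simp only [sSize]
  push_cast [Nat.add_sub_cancel]
  ring

/-- The position on the line of a vertex of `S⁺_k`. -/
def place (k : ℕ) : Option (SVertex k) → ℤ
  | none => -1
  | some (v i) => i + 1
  | some w₁ => -1 - k
  | some w₂ => 1 - k
  | some w₃ => k * k + 1 + k
  | some w₄ => k * k + 1 + k + 2

theorem place_injective (hk : 3 ≤ k) : Function.Injective (place k) := by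
  have hkk : (3 : ℤ) * k ≤ k * k := Int.mul_le_mul_of_nonneg_right (by omega) (by omega)
  have hs := sSize_eq (by omega : 1 ≤ k)
  rintro (_ | i | _ | _ | _ | _) (_ | j | _ | _ | _ | _) hij <;> simp only [place] at hij <;>
    first
      | rfl
      | (have hi := i.2; have hj := j.2; have : i = j := Fin.ext (by omega); rw [this])
      | (have hi := i.2; omega)
      | (have hj := j.2; omega)
      | omega

/-- The distance is `2` within the pairs `w_1, w_2` and `w_3, w_4`, and exactly `k` from `w_2` to
`v_1` and from `v_n` to `w_3`; this leaves every unwanted pair more than `k` apart. -/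
theorem adj_iff_place (hk : 3 ≤ k) (a b : SVertex k) : (graphS k).Adj a b ↔
    place k (some a) ≠ place k (some b) ∧ place k (some a) ≤ place k (some b) + k ∧
      place k (some b) ≤ place k (some a) + k := by
  have hkk : (3 : ℤ) * k ≤ k * k := Int.mul_le_mul_of_nonneg_right (by omega) (by omega)
  have hs := sSize_eq (by omega : 1 ≤ k)
  have hvw₁ : ∀ i : Fin (sSize k), (graphS k).Adj (v i) w₁ ↔ False := fun i => iff_false_intro (adj_v_w₁ i)
  have hvw₄ : ∀ i : Fin (sSize k), (graphS k).Adj (v i) w₄ ↔ False := fun i => iff_false_intro (adj_v_w₄ i)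
  rcases a with i | _ | _ | _ | _ <;> rcases b with j | _ | _ | _ | _ <;> simp only [place]
  · rw [adj_v_v]; omega
  · have := i.2; rw [hvw₁, false_iff]; omega
  · have := i.2; rw [adj_v_w₂]; omega
  · have := i.2; rw [adj_v_w₃]; omega
  · have := i.2; rw [hvw₄, false_iff]; omega
  · have := j.2; rw [SimpleGraph.adj_comm, hvw₁, false_iff]; omega
  · simp
  · simp only [adj_w₁_w₂, true_iff]; omega
  · simp only [not_adj_w₁_w₃, false_iff]; omega
  · simp only [not_adj_w₁_w₄, false_iff]; omega
  · have := j.2; rw [SimpleGraph.adj_comm, adj_v_w₂]; omega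
  · rw [SimpleGraph.adj_comm]; simp only [adj_w₁_w₂, true_iff]; omega
  · simp
  · simp only [not_adj_w₂_w₃, false_iff]; omega
  · simp only [not_adj_w₂_w₄, false_iff]; omega
  · have := j.2; rw [SimpleGraph.adj_comm, adj_v_w₃]; omega
  · rw [SimpleGraph.adj_comm]; simp only [not_adj_w₁_w₃, false_iff]; omega
  · rw [SimpleGraph.adj_comm]; simp only [not_adj_w₂_w₃, false_iff]; omega
  · simp
  · simp only [adj_w₃_w₄, true_iff]; omega
  · have := j.2; rw [SimpleGraph.adj_comm, hvw₄, false_iff]; omega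
  · rw [SimpleGraph.adj_comm]; simp only [not_adj_w₁_w₄, false_iff]; omega
  · rw [SimpleGraph.adj_comm]; simp only [not_adj_w₂_w₄, false_iff]; omega
  · rw [SimpleGraph.adj_comm]; simp only [adj_w₃_w₄, true_iff]; omega
  · simp

theorem graphSPlus_adj_some (a b : SVertex k) :
    (graphSPlus k).Adj (some a) (some b) ↔ (graphS k).Adj a b := by
  simp only [graphSPlus, SimpleGraph.fromRel_adj, ne_eq, Option.some.injEq]
  constructor
  · rintro ⟨-, h | h⟩
    · exact h
    · exact h.symm
  · exact fun h => ⟨h.ne, Or.inl h⟩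

theorem graphSPlus_adj_none (a : SVertex k) :
    (graphSPlus k).Adj none (some a) ↔ a ∈ plusNbhd k := by
  simp [graphSPlus, SimpleGraph.fromRel_adj]

theorem adj_none_iff_place (hk : 3 ≤ k) (a : SVertex k) : (graphSPlus k).Adj none (some a) ↔
    place k (some a) ≤ -1 + k ∧ -1 ≤ place k (some a) + k := by
  have hkk : (3 : ℤ) * k ≤ k * k := Int.mul_le_mul_of_nonneg_right (by omega) (by omega)
  rw [graphSPlus_adj_none]
  rcases a with i | _ | _ | _ | _ <;> simp only [place, plusNbhd, Set.mem_union, Set.mem_insert_iff,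
    Set.mem_singleton_iff, Set.mem_ofPred_eq]
  · constructor
    · rintro ((h | h) | ⟨j, h1, h2⟩)
      · cases h
      · cases h
      · cases h2; omega
    · intro h
      exact Or.inr ⟨i, by omega, rfl⟩
  all_goals simp
  all_goals omega

theorem plus_adj_iff_place (hk : 3 ≤ k) (a b : Option (SVertex k)) : (graphSPlus k).Adj a b ↔
    place k a ≠ place k b ∧ place k a ≤ place k b + k ∧ place k b ≤ place k a + k := by
  have hne : ∀ a : SVertex k, place k none ≠ place k (some a) := fun a h => by
    cases place_injective hk h
  rcases a with _ | a <;> rcases b with _ | b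
  · simp
  · rw [adj_none_iff_place hk]
    have := hne b
    have h0 : place k none = -1 := rfl
    rw [h0] at this ⊢
    omega
  · rw [SimpleGraph.adj_comm, adj_none_iff_place hk]
    have := hne a
    have h0 : place k none = -1 := rfl
    rw [h0] at this ⊢
    omega
  · rw [graphSPlus_adj_some, adj_iff_place hk]

/-- Without any vertex but `w⁺`, the graph `S⁺_k` is an induced subgraph of a path power with few
labels. -/
theorem exists_place (hk : 3 ≤ k) (x : SVertex k) : ∃ (X : ℤ → Prop) (i : Option (SVertex k) → ℤ),
    Reach (powerGraph k X) True (k + 1) {c | X c} ∧ (∀ a b, (i a = i b ↔ place k a = place k b) ∧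
      (i a ≤ i b + k ∧ i b ≤ i a + k ↔ place k a ≤ place k b + k ∧ place k b ≤ place k a + k)) ∧
      ∀ a, a ≠ some x → X (i a) := by
  have hkk : (3 : ℤ) * k ≤ k * k := Int.mul_le_mul_of_nonneg_right (by omega) (by omega)
  have hs := sSize_eq (by omega : 1 ≤ k)
  have hk' : (3 : ℤ) ≤ k := by omega
  have left : Reach (powerGraph k (position k (k * k + 1) (place k (some x)) True False)) True (k + 1)
      {c | position k (k * k + 1) (place k (some x)) True False c} →
      ∃ (X : ℤ → Prop) (i : Option (SVertex k) → ℤ),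
    Reach (powerGraph k X) True (k + 1) {c | X c} ∧ (∀ a b, (i a = i b ↔ place k a = place k b) ∧
      (i a ≤ i b + k ∧ i b ≤ i a + k ↔ place k a ≤ place k b + k ∧ place k b ≤ place k a + k)) ∧
      ∀ a, a ≠ some x → X (i a) := by
    intro h
    refine ⟨_, place k, h, fun a b => ⟨Iff.rfl, Iff.rfl⟩, fun a ha =>
      ⟨fun h => ha (place_injective hk h), ?_⟩⟩
    rcases a with _ | i | _ | _ | _ | _ <;>
      simp only [place, true_and, false_and, or_false]
    · simp
    · have := i.2; omega
    all_goals first | omega | simp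
  have right : Reach (powerGraph k (position k (k * k + 1) (k * k + 2 - place k (some x)) False True))
      True (k + 1) {c | position k (k * k + 1) (k * k + 2 - place k (some x)) False True c} →
      ∃ (X : ℤ → Prop) (i : Option (SVertex k) → ℤ),
    Reach (powerGraph k X) True (k + 1) {c | X c} ∧ (∀ a b, (i a = i b ↔ place k a = place k b) ∧
      (i a ≤ i b + k ∧ i b ≤ i a + k ↔ place k a ≤ place k b + k ∧ place k b ≤ place k a + k)) ∧
      ∀ a, a ≠ some x → X (i a) := by
    intro h
    refine ⟨_, fun a => k * k + 2 - place k a, h, fun a b => by dsimp only; constructor <;> constructor <;> intro _ <;> omega, fun a ha =>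
      ⟨fun h => ha (place_injective hk (by dsimp only at h; omega)), ?_⟩⟩
    rcases a with _ | i | _ | _ | _ | _ <;>
      simp only [place, true_and, false_and, false_or]
    · omega
    · have := i.2; omega
    all_goals omega
  rcases x with i | _ | _ | _ | _
  · have hi := i.2
    simp only [place] at left right
    obtain ⟨p, hp⟩ : ∃ p : ℤ, p = (i : ℤ) + 1 := ⟨_, rfl⟩
    rw [← hp] at left right
    by_cases h1 : p = 1
    · exact left (reach_hole_first rfl hk' rfl (Or.inl h1) id)
    by_cases hn : p = k * k + 1
    · exact left (reach_separated_end rfl hk' rfl (Or.inl hn) trivial id)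
    -- Applied to `p + 1`, the block satisfies `d (k + 1) ≤ p ≤ d (k + 1) + k`. After reflection the
    -- residue `p - d (k + 1)` determines `A` in `reach_right` modulo `k + 1`; the residues `0` and
    -- `3` would give the excluded values `A = 2 - k` and `A = 0` and need their own strategies.
    obtain ⟨d, hd1, hd2⟩ := exists_block (k := (k : ℤ)) (by omega) (p + 1)
    have hd0 := block_compare (k := (k : ℤ)) (by omega) 0 d
    have hdk := block_compare (k := (k : ℤ)) (by omega) (k - 1) d
    have hdk2 := block_compare (k := (k : ℤ)) (by omega) (k - 2) d
    rw [show ((k : ℤ) - 1) * k = k * k - k by ring] at hdk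
    rw [show ((k : ℤ) - 2) * k = k * k - 2 * k by ring] at hdk2
    by_cases hres0 : p = d * k + d
    · by_cases hdk1 : d = k - 1
      · exact left (reach_hole_near_end rfl hk' rfl (by omega))
      · refine right (reach_right_hole (r := k - d) rfl hk' rfl ?_ (by omega) (by omega) id)
        rw [show ((k : ℤ) - d) * k = k * k - d * k by ring]
        omega
    by_cases hres3 : p = d * k + d + 3
    · refine left (reach_left_hole (r := d + 1) rfl hk' rfl ?_ (by omega) (by omega) id trivial)
      rw [show (d + 1) * (k : ℤ) = d * k + k by ring]
      omega
    by_cases hres1 : p = d * k + d + 1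
    · refine right (reach_right (A := 1 - k) (r := k - d) rfl hk' rfl ?_ (by omega) (by omega) (by omega)
        (by omega) (by omega) (by omega) id)
      rw [show ((k : ℤ) - d) * k = k * k - d * k by ring]
      omega
    · refine right (reach_right (A := 3 - (p - (d * k + d))) (r := k - 1 - d) rfl hk' rfl ?_ (by omega)
        (by omega) (by omega) (by omega) (by omega) (by omega) id)
      rw [show ((k : ℤ) - 1 - d) * k = k * k - k - d * k by ring]
      omega
  · exact left (reach_no_outermost rfl hk' rfl rfl)
  · exact left (reach_hole_first rfl hk' rfl (Or.inr rfl) id)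
  · exact left (reach_separated_end rfl hk' rfl (Or.inr rfl) trivial id)
  · refine right (reach_no_outermost rfl hk' rfl ?_)
    simp only [place]
    ring

/-- Induced subgraphs of `S⁺_k` without some vertex of `S_k` have linear clique-width at most
`k + 1`. -/
theorem linearCliqueWidth_le_of_notMem (hk : 3 ≤ k) (x : SVertex k) {W : Type} (H : SimpleGraph W)
    (f : W → Option (SVertex k)) (hf : Function.Injective f)
    (hH : ∀ a b, H.Adj a b ↔ (graphSPlus k).Adj (f a) (f b)) (hx : ∀ w, f w ≠ some x) :
    linearCliqueWidth H ≤ (k : ℕ∞) + 1 := by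
  obtain ⟨X, i, hX, hi, hix⟩ := exists_place hk x
  refine linearCliqueWidth_le_of_reach hX (fun w => i (f w)) (fun a b hab =>
    hf (place_injective hk ((hi _ _).1.1 hab))) (fun a b => ?_) fun w => hix _ (hx w)
  rw [hH, plus_adj_iff_place hk, Ne, ← (hi _ _).1, ← (hi _ _).2]
  exact ⟨fun h => ⟨hix _ (hx a), hix _ (hx b), h⟩, fun h => h.2.2⟩

theorem linearCliqueWidth_induce_le (hk : 3 ≤ k) (s : Set (SVertex k)) (hs : s ≠ Set.univ) :
    linearCliqueWidth ((graphS k).induce s) ≤ (k : ℕ∞) + 1 := by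
  obtain ⟨x, hx⟩ := (Set.ne_univ_iff_exists_notMem s).1 hs
  exact linearCliqueWidth_le_of_notMem hk x _ (fun w : s => some (w : SVertex k))
    ((Option.some_injective _).comp Subtype.val_injective)
    (fun a b => (graphSPlus_adj_some _ _).symm) fun w hw => hx (Option.some_injective _ hw ▸ w.2)

theorem cliqueWidth_plus_induce_le (hk : 3 ≤ k) (s : Set (Option (SVertex k))) (hs : s ≠ Set.univ) :
    cliqueWidth ((graphSPlus k).induce s) ≤ (k : ℕ∞) + 1 := by
  obtain ⟨x, hx⟩ := (Set.ne_univ_iff_exists_notMem s).1 hs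
  rcases x with _ | x
  · have hpos : ∀ w : s, position k (k * k + 1) 0 False False (place k w) := by
      rintro ⟨_ | i | _ | _ | _ | _, hw⟩
      · exact absurd hw hx
      all_goals rw [position_iff rfl (by omega)]; simp only [place]
      · have := i.2
        have := sSize_eq (by omega : 1 ≤ k)
        omega
      all_goals first | omega | simp
    refine cliqueWidth_le_of_reach (reach_no_plus rfl (by omega) rfl) (fun w : s => place k w)
      ((place_injective hk).comp Subtype.val_injective) (fun a b => ?_) hpos
    rw [SimpleGraph.comap_adj, Function.Embedding.subtype_apply, Function.Embedding.subtype_apply,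
      plus_adj_iff_place hk]
    exact ⟨fun h => ⟨hpos a, hpos b, h⟩, fun h => h.2.2⟩
  · exact (cliqueWidth_le_linearCliqueWidth _).trans (linearCliqueWidth_le_of_notMem hk x _
      (fun w : s => (w : Option (SVertex k))) Subtype.val_injective (fun a b => Iff.rfl)
      fun w hw => hx (hw ▸ w.2))

end SVertex

/-! ### Sets of integers and the types of their elements -/

namespace Line

/-- The integers `u` and `v` have the same elements of `Q` at distance at most `k`. -/
def Same (k : ℤ) (Q : Set ℤ) (u v : ℤ) : Prop :=
  ∀ x ∈ Q, (u - k ≤ x ∧ x ≤ u + k) ↔ (v - k ≤ x ∧ x ≤ v + k)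

/-- There are `m` elements of `A` between `a` and `b` of pairwise different types. -/
def Indep (k : ℤ) (A Q : Set ℤ) (m a b : ℤ) : Prop :=
  ∃ s : Finset ℤ, (s.card : ℤ) = m ∧ (∀ u ∈ s, u ∈ A ∧ a ≤ u ∧ u ≤ b) ∧
    ∀ u ∈ s, ∀ v ∈ s, Same k Q u v → u = v

/-- Every window of `k + 1` consecutive numbers between `1` and `n` meets `A`. -/
def Meets (k n : ℤ) (A : Set ℤ) : Prop :=
  ∀ a, 1 ≤ a → a + k ≤ n → ∃ p ∈ A, a ≤ p ∧ p ≤ a + k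

/-- Different elements of `A` of the same type are at distance at most `j`. -/
def Span (k : ℤ) (A Q : Set ℤ) (j : ℤ) : Prop :=
  ∀ u ∈ A, ∀ v ∈ A, u < v → Same k Q u v → v - u ≤ j

/-- The set `A` is a part of the path power, with complement `Q`. -/
structure Core (k n : ℤ) (A Q : Set ℤ) : Prop where
  hk : 3 ≤ k
  hn : n = k * k + 1
  sub : ∀ p ∈ A, 1 ≤ p ∧ p ≤ n
  cover : ∀ p, 1 ≤ p → p ≤ n → (p ∈ A ↔ p ∉ Q)

/-- Moreover, both end marks are in `Q`. -/
structure Part (k n : ℤ) (A Q : Set ℤ) : Prop extends Core k n A Q where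
  left : 1 - k ∈ Q
  right : n + k ∈ Q

/-- The reflected set. -/
def mir (n : ℤ) (A : Set ℤ) : Set ℤ := {x | n + 1 - x ∈ A}

/-- The end of row `i`. -/
def row (k i : ℤ) : ℤ := i * (k + 1)

variable {k n m a b u v w x i j : ℤ} {A Q : Set ℤ}

theorem row_succ (k i : ℤ) : row k (i + 1) = row k i + k + 1 := by unfold row; ring

theorem row_pred (k i : ℤ) : row k (i - 1) = row k i - k - 1 := by unfold row; ring

theorem row_zero (k : ℤ) : row k 0 = 0 := by unfold row; ring

theorem row_sub (k i j : ℤ) : row k (i - j) = row k i - row k j := by unfold row; ring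

theorem row_one (k : ℤ) : row k 1 = k + 1 := by unfold row; ring

theorem row_le (hk : 0 ≤ k) (h : i ≤ j) : row k i ≤ row k j := by
  unfold row; exact mul_le_mul_of_nonneg_right h (by omega)

theorem row_lt (hk : 0 ≤ k) (h : i < j) : row k i + k + 1 ≤ row k j := by
  rw [← row_succ]; exact row_le hk h

theorem Core.row_last (h : Core k n A Q) : row k (k - 1) = n - 2 := by
  rw [h.hn]; unfold row; ring

theorem Core.le_n (h : Core k n A Q) : 3 * k + 1 ≤ n := by
  have := mul_le_mul_of_nonneg_right h.hk (by have := h.hk; omega : 0 ≤ k)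
  rw [h.hn]; omega

theorem Same.rfl : Same k Q u u := fun _ _ => Iff.rfl

theorem Same.symm (h : Same k Q u v) : Same k Q v u := fun x hx => (h x hx).symm

theorem Same.trans (h : Same k Q u v) (h' : Same k Q v w) : Same k Q u w :=
  fun x hx => (h x hx).trans (h' x hx)

theorem Same.mono {Q' : Set ℤ} (hQ : Q' ⊆ Q) (h : Same k Q u v) : Same k Q' u v :=
  fun x hx => h x (hQ hx)

/-- The bound on `w - u` excludes an element that is close to `v` but to neither `u` nor `w`. -/
theorem Same.convex (h : Same k Q u w) (huv : u ≤ v) (hvw : v ≤ w) (hd : w ≤ u + 2 * k) :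
    Same k Q u v := by
  intro x hx
  have := h x hx
  omega

theorem Same.convex' (h : Same k Q u w) (huv : u ≤ v) (hvw : v ≤ w) (hd : w ≤ u + 2 * k) :
    Same k Q v w := (h.convex huv hvw hd).symm.trans h

theorem Core.mem_left (hp : Core k n A Q) (h : Same k Q u v) (h1 : u - k ≤ x) (h2 : x ≤ u + k)
    (h3 : x < v - k) (h4 : 1 ≤ x) (h5 : x ≤ n) : x ∈ A := by
  by_contra hx
  have hQ : x ∈ Q := by
    by_contra hQ
    exact hx ((hp.cover x h4 h5).2 hQ)
  have := h x hQ
  omega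

theorem Core.mem_right (hp : Core k n A Q) (h : Same k Q u v) (h1 : v - k ≤ x) (h2 : x ≤ v + k)
    (h3 : u + k < x) (h4 : 1 ≤ x) (h5 : x ≤ n) : x ∈ A := by
  by_contra hx
  have hQ : x ∈ Q := by
    by_contra hQ
    exact hx ((hp.cover x h4 h5).2 hQ)
  have := h x hQ
  omega

theorem Core.notMem (hp : Core k n A Q) (h : x ∈ A) : x ∉ Q :=
  (hp.cover x (hp.sub x h).1 (hp.sub x h).2).1 h

theorem Core.mem_or (hp : Core k n A Q) (h1 : 1 ≤ x) (h2 : x ≤ n) : x ∈ A ∨ x ∈ Q := by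
  by_cases h : x ∈ Q
  · exact Or.inr h
  · exact Or.inl ((hp.cover x h1 h2).2 h)

theorem not_same_of_left (hx : x ∈ Q) (h1 : u - k ≤ x) (h2 : x ≤ u + k) (h3 : x < v - k) :
    ¬ Same k Q u v := fun h => by have := h x hx; omega

theorem not_same_of_right (hx : x ∈ Q) (h1 : v - k ≤ x) (h2 : x ≤ v + k) (h3 : u + k < x) :
    ¬ Same k Q u v := fun h => by have := h x hx; omega

theorem Part.not_same_one (hp : Part k n A Q) (hv : 1 < v) : ¬ Same k Q 1 v :=
  not_same_of_left hp.left (by omega) (by have := hp.hk; omega) (by omega)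

theorem Part.not_same_n (hp : Part k n A Q) (hv : v < n) : ¬ Same k Q v n :=
  not_same_of_right hp.right (by have := hp.hk; omega) (by omega) (by omega)

theorem Indep.mono {a' b' : ℤ} (h : Indep k A Q m a b) (ha : a' ≤ a) (hb : b ≤ b') :
    Indep k A Q m a' b' := by
  obtain ⟨s, hs, hs', h⟩ := h
  exact ⟨s, hs, fun u hu => ⟨(hs' u hu).1, by have := hs' u hu; omega, by have := hs' u hu; omega⟩, h⟩

theorem Indep.insert {a' b' e : ℤ} (h : Indep k A Q m a b) (ha : a' ≤ a) (hb : b ≤ b') (he : e ∈ A)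
    (hae : a' ≤ e) (heb : e ≤ b') (hne : ∀ u ∈ A, a ≤ u → u ≤ b → ¬ Same k Q e u) :
    Indep k A Q (m + 1) a' b' := by
  classical
  obtain ⟨s, hs, hs', h⟩ := h
  have hes : e ∉ s := fun hes => hne e he (hs' e hes).2.1 (hs' e hes).2.2 Same.rfl
  refine ⟨Insert.insert e s, by rw [Finset.card_insert_of_notMem hes]; push_cast; omega, ?_, ?_⟩
  · intro u hu
    rcases Finset.mem_insert.1 hu with rfl | hu
    · exact ⟨he, hae, heb⟩
    · exact ⟨(hs' u hu).1, by have := hs' u hu; omega, by have := hs' u hu; omega⟩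
  · intro u hu v hv huv
    rcases Finset.mem_insert.1 hu with hu' | hu' <;> rcases Finset.mem_insert.1 hv with hv' | hv'
    · rw [hu', hv']
    · rw [hu'] at huv
      exact absurd huv (hne v (hs' v hv').1 (hs' v hv').2.1 (hs' v hv').2.2)
    · rw [hv'] at huv
      exact absurd huv.symm (hne u (hs' u hu').1 (hs' u hu').2.1 (hs' u hu').2.2)
    · exact h u hu' v hv' huv

theorem indep_zero (k : ℤ) (A Q : Set ℤ) (a b : ℤ) : Indep k A Q 0 a b := ⟨∅, by simp⟩

theorem indep_one (hu : u ∈ A) : Indep k A Q 1 u u :=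
  ⟨{u}, by simp, by simpa using hu, by simp⟩

theorem indep_two (hu : u ∈ A) (hv : v ∈ A) (huv : u < v) (h : ¬ Same k Q u v) :
    Indep k A Q 2 u v :=
  (indep_one hv).insert (by omega) le_rfl hu le_rfl (by omega) fun w _ h1 h2 => by
    obtain rfl : w = v := by omega
    exact h

theorem indep_three (hu : u ∈ A) (hv : v ∈ A) (hw : w ∈ A) (huv : u < v) (hvw : v < w)
    (h1 : ¬ Same k Q u v) (h2 : ¬ Same k Q v w) (h3 : ¬ Same k Q u w) : Indep k A Q 3 u w := by
  classical
  refine ⟨{u, v, w}, ?_, ?_, ?_⟩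
  · rw [Finset.card_eq_three.2 ⟨u, v, w, by omega, by omega, by omega, rfl⟩]; norm_num
  · intro x hx
    simp only [Finset.mem_insert, Finset.mem_singleton] at hx
    rcases hx with rfl | rfl | rfl
    · exact ⟨hu, by omega, by omega⟩
    · exact ⟨hv, by omega, by omega⟩
    · exact ⟨hw, by omega, by omega⟩
  · intro x hx y hy hxy
    simp only [Finset.mem_insert, Finset.mem_singleton] at hx hy
    rcases hx with rfl | rfl | rfl <;> rcases hy with rfl | rfl | rfl <;>
      first | rfl | exact absurd hxy ‹_› | exact absurd hxy.symm ‹_›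

theorem Indep.union {m' c : ℤ} (h : Indep k A Q m a b) (h' : Indep k A Q m' (b + 1) c) (hab : a ≤ b + 1)
    (hbc : b ≤ c) (hne : ∀ u ∈ A, ∀ v ∈ A, a ≤ u → u ≤ b → b < v → v ≤ c → ¬ Same k Q u v) :
    Indep k A Q (m + m') a c := by
  classical
  obtain ⟨s, hs, hs1, hs2⟩ := h
  obtain ⟨s', hs', hs1', hs2'⟩ := h'
  have hd : Disjoint s s' := Finset.disjoint_left.2 fun x hx hx' => by
    have := hs1 x hx; have := hs1' x hx'; omega
  refine ⟨s ∪ s', by rw [Finset.card_union_of_disjoint hd]; push_cast; omega, fun u hu => ?_,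
    fun u hu v hv huv => ?_⟩
  · rcases Finset.mem_union.1 hu with hu | hu
    · exact ⟨(hs1 u hu).1, by have := hs1 u hu; omega, by have := hs1 u hu; omega⟩
    · exact ⟨(hs1' u hu).1, by have := hs1' u hu; omega, by have := hs1' u hu; omega⟩
  · rcases Finset.mem_union.1 hu with hu | hu <;> rcases Finset.mem_union.1 hv with hv | hv
    · exact hs2 u hu v hv huv
    · exact absurd huv (hne u (hs1 u hu).1 v (hs1' v hv).1 (hs1 u hu).2.1 (hs1 u hu).2.2
        (by have := hs1' v hv; omega) (hs1' v hv).2.2)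
    · exact absurd huv.symm (hne v (hs1 v hv).1 u (hs1' u hu).1 (hs1 v hv).2.1 (hs1 v hv).2.2
        (by have := hs1' u hu; omega) (hs1' u hu).2.2)
    · exact hs2' u hu v hv huv

theorem exists_least (h : ∃ p ∈ A, a ≤ p ∧ p ≤ b) :
    ∃ e ∈ A, a ≤ e ∧ e ≤ b ∧ ∀ p ∈ A, a ≤ p → e ≤ p := by
  obtain ⟨e, ⟨he, hae⟩, hmin⟩ := Int.exists_least_of_bdd (P := fun z => z ∈ A ∧ a ≤ z)
    ⟨a, fun z hz => hz.2⟩ (h.imp fun p hp => ⟨hp.1, hp.2.1⟩)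
  obtain ⟨p, hp, hap, hpb⟩ := h
  exact ⟨e, he, hae, (hmin p ⟨hp, hap⟩).trans hpb, fun q hq haq => hmin q ⟨hq, haq⟩⟩

theorem exists_greatest (h : ∃ p ∈ A, a ≤ p ∧ p ≤ b) :
    ∃ e ∈ A, a ≤ e ∧ e ≤ b ∧ ∀ p ∈ A, p ≤ b → p ≤ e := by
  obtain ⟨e, ⟨he, hae⟩, hmax⟩ := Int.exists_greatest_of_bdd (P := fun z => z ∈ A ∧ z ≤ b)
    ⟨b, fun z hz => hz.2⟩ (h.imp fun p hp => ⟨hp.1, hp.2.2⟩)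
  obtain ⟨p, hp, hap, hpb⟩ := h
  exact ⟨e, he, hap.trans (hmax p ⟨hp, hpb⟩), hae, fun q hq hqb => hmax q ⟨hq, hqb⟩⟩

/-- Let `e` be the first element of `A` in the window before `a`. If `e` had the type of some `u ≥
a`, then `a - k - 1`, close to `e` but not to `u`, could not be in `Q`. So it would be `e` itself,
and `u` would be further away than `Span` permits. -/
theorem Core.grow_left (hp : Core k n A Q) (hs : Span k A Q k) (hm : Meets k n A)
    (h : Indep k A Q m a b) (ha : 1 ≤ a - k - 1) (han : a - 1 ≤ n) (hab : a ≤ b + 1) :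
    Indep k A Q (m + 1) (a - k - 1) b := by
  obtain ⟨e, he, hae, hea, hmin⟩ := exists_least (b := a - 1) (by
    obtain ⟨p, hp, h1, h2⟩ := hm (a - k - 1) ha (by omega)
    exact ⟨p, hp, h1, by omega⟩)
  refine h.insert (by have := hp.hk; omega) le_rfl he hae (by omega) fun u hu hau _ hS => ?_
  have h1 := hs e he u hu (by omega) hS
  have h2 := hp.mem_left hS (x := a - k - 1) (by omega) (by have := hp.hk; omega) (by omega) ha
    (by have := hp.hk; omega)
  have := hmin _ h2 le_rfl
  omega

theorem Core.grow_right (hp : Core k n A Q) (hs : Span k A Q k) (hm : Meets k n A)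
    (h : Indep k A Q m a b) (hb : 1 ≤ b + 1) (hbn : b + k + 1 ≤ n) (hab : a ≤ b + 1) :
    Indep k A Q (m + 1) a (b + k + 1) := by
  obtain ⟨e, he, hae, hea, hmax⟩ := exists_greatest (a := b + 1) (b := b + k + 1) (by
    obtain ⟨p, hp, h1, h2⟩ := hm (b + 1) hb (by omega)
    exact ⟨p, hp, h1, by omega⟩)
  refine h.insert le_rfl (by have := hp.hk; omega) he (by omega) (by omega) fun u hu hau hub hS => ?_
  have h1 := hs u hu e he (by omega) hS.symm
  have h2 := hp.mem_right hS.symm (x := b + k + 1) (by have := hp.hk; omega) (by omega) (by omega)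
    (by have := hp.hk; omega) hbn
  have := hmax _ h2 le_rfl
  omega

/-- Every full row to the left or to the right contributes a new type. -/
theorem Core.grow (hp : Core k n A Q) (hs : Span k A Q k) (hm : Meets k n A)
    (h : Indep k A Q m a b) (hi : 0 ≤ i) (hj : 0 ≤ j) (ha : 1 ≤ a - row k i) (han : a - 1 ≤ n)
    (_hb : 1 ≤ b + 1) (hbn : b + row k j ≤ n) (hab : a ≤ b + 1) :
    Indep k A Q (m + i + j) (a - row k i) (b + row k j) := by
  have hk := hp.hk
  obtain ⟨i, rfl⟩ := Int.eq_ofNat_of_zero_le hi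
  obtain ⟨j, rfl⟩ := Int.eq_ofNat_of_zero_le hj
  have hL : ∀ i : ℕ, 1 ≤ a - row k i → Indep k A Q (m + i) (a - row k i) b := by
    intro i
    induction i with
    | zero => intro _; simpa [row_zero] using h
    | succ i ih =>
      intro hi
      push_cast at hi ⊢
      rw [row_succ] at hi ⊢
      have h0 := row_le (by omega : 0 ≤ k) (by omega : (0 : ℤ) ≤ i)
      rw [row_zero] at h0
      have := hp.grow_left hs hm (ih (by omega)) (by omega) (by omega) (by omega)
      rw [← add_assoc, show a - (row k i + k + 1) = a - row k i - k - 1 by ring]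
      exact this
  have h0 := row_le (by omega : 0 ≤ k) (by omega : (0 : ℤ) ≤ i)
  rw [row_zero] at h0
  clear hj hi
  induction j with
  | zero => simpa [row_zero] using hL i ha
  | succ j ih =>
    push_cast at hbn ⊢
    rw [row_succ] at hbn ⊢
    have h0' := row_le (by omega : 0 ≤ k) (by omega : (0 : ℤ) ≤ j)
    rw [row_zero] at h0'
    have := hp.grow_right hs hm (ih (by omega)) (by omega) (by omega) (by omega)
    rw [← add_assoc, show b + (row k j + k + 1) = b + row k j + k + 1 by ring]
    exact this

theorem Core.grow_all (hp : Core k n A Q) (hs : Span k A Q k) (hm : Meets k n A)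
    (h : Indep k A Q m a b) (hi : 0 ≤ i) (hj : 0 ≤ j) (ha : 1 ≤ a - row k i) (han : a - 1 ≤ n)
    (hb : 1 ≤ b + 1) (hbn : b + row k j ≤ n) (hab : a ≤ b + 1) :
    Indep k A Q (m + i + j) 1 n :=
  (hp.grow hs hm h hi hj ha han hb hbn hab).mono (by omega) (by omega)

/-- In a set without full windows, elements of the same type are close. -/
theorem Core.span (hp : Core k n A Q) (hQ : Meets k n Q) : Span k A Q (k - 1) := by
  intro u hu v hv huv hS
  by_contra hd
  have hk := hp.hk
  have hn := hp.le_n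
  have hu' := hp.sub u hu
  have hv' := hp.sub v hv
  have key : ∀ c, 1 ≤ c → c + k ≤ n → (∀ x, c ≤ x → x ≤ c + k → x ∈ A) → False := by
    intro c h1 h2 h
    obtain ⟨p, hpQ, h3, h4⟩ := hQ c h1 h2
    exact hp.notMem (h p h3 h4) hpQ
  -- What is close to only one of `u` and `v` has to be in `A`. At distance at least `k` this yields
  -- a full window that ends in `u`, or one that starts in `v`, or, if `u` and `v` are near the two
  -- ends of the path, the first window.
  by_cases h1 : k + 1 ≤ u
  · refine key (u - k) (by omega) (by omega) fun x hx hx' => ?_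
    by_cases hxu : x = u
    · exact hxu ▸ hu
    exact hp.mem_left hS hx (by omega) (by omega) (by omega) (by omega)
  by_cases h2 : v + k ≤ n
  · refine key v (by omega) (by omega) fun x hx hx' => ?_
    by_cases hxv : x = v
    · exact hxv ▸ hv
    exact hp.mem_right hS (by omega) (by omega) (by omega) (by omega) (by omega)
  · exact key 1 (by omega) (by omega) fun x hx hx' =>
      hp.mem_left hS (by omega) (by omega) (by omega) hx (by omega)

theorem Span.mono {j' : ℤ} (h : Span k A Q j) (hj : j ≤ j') : Span k A Q j' :=
  fun u hu v hv huv hS => (h u hu v hv huv hS).trans hj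

/-! Reflection -/

theorem mem_mir : x ∈ mir n A ↔ n + 1 - x ∈ A := Iff.rfl

theorem mir_mir (n : ℤ) (A : Set ℤ) : mir n (mir n A) = A := by
  ext x; simp [mem_mir]

theorem same_mir : Same k (mir n Q) u v ↔ Same k Q (n + 1 - u) (n + 1 - v) := by
  constructor
  · intro h x hx
    have := h (n + 1 - x) (by rw [mem_mir]; simpa using hx)
    omega
  · intro h x hx
    have := h (n + 1 - x) hx
    omega

theorem Indep.mir (h : Indep k A Q m a b) (n : ℤ) :
    Indep k (mir n A) (mir n Q) m (n + 1 - b) (n + 1 - a) := by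
  classical
  obtain ⟨s, hs, hs1, hs2⟩ := h
  refine ⟨s.image fun x => n + 1 - x, ?_, ?_, ?_⟩
  · rw [Finset.card_image_of_injective _ fun x y h => by simpa using h, hs]
  · intro u hu
    obtain ⟨x, hx, rfl⟩ := Finset.mem_image.1 hu
    have := hs1 x hx
    refine ⟨?_, by omega, by omega⟩
    rw [mem_mir]; simpa using this.1
  · intro u hu v hv huv
    obtain ⟨x, hx, rfl⟩ := Finset.mem_image.1 hu
    obtain ⟨y, hy, rfl⟩ := Finset.mem_image.1 hv
    rw [same_mir] at huv
    simp only [sub_sub_cancel] at huv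
    rw [hs2 x hx y hy huv]

theorem Indep.of_mir (h : Indep k (Line.mir n A) (Line.mir n Q) m 1 n) : Indep k A Q m 1 n := by
  have := h.mir n
  rw [mir_mir, mir_mir] at this
  simpa using this

theorem Core.mir (hp : Core k n A Q) : Core k n (mir n A) (mir n Q) where
  hk := hp.hk
  hn := hp.hn
  sub p h := by have := hp.sub _ h; omega
  cover p h1 h2 := hp.cover _ (by omega) (by omega)

theorem Part.mir (hp : Part k n A Q) : Part k n (mir n A) (mir n Q) where
  toCore := hp.toCore.mir
  left := by rw [mem_mir]; convert hp.right using 1; ring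
  right := by rw [mem_mir]; convert hp.left using 1; ring

theorem Meets.mir (h : Meets k n A) : Meets k n (mir n A) := by
  intro a ha han
  obtain ⟨p, hp, h1, h2⟩ := h (n + 1 - a - k) (by omega) (by omega)
  exact ⟨n + 1 - p, by rw [mem_mir]; simpa using hp, by omega, by omega⟩

end Line

/-! ### Completing a full window by one element -/

namespace Line

variable {k n m a b u v w x i j : ℤ} {A Q : Set ℤ}

theorem exists_row (hk : 0 ≤ k) (y : ℤ) : ∃ j, row k j ≤ y ∧ y ≤ row k j + k := by
  refine ⟨y / (k + 1), ?_, ?_⟩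
  · unfold row; exact Int.ediv_mul_le _ (by omega)
  · unfold row
    have := Int.lt_ediv_add_one_mul_self y (show 0 < k + 1 by omega)
    rw [add_mul] at this
    omega

theorem indep_of_fun (g : ℤ → ℤ) (hm : 0 ≤ m)
    (h : ∀ i, 0 ≤ i → i < m → g i ∈ A ∧ a ≤ g i ∧ g i ≤ b)
    (h' : ∀ i j, 0 ≤ i → i < j → j < m → ¬ Same k Q (g i) (g j)) : Indep k A Q m a b := by
  classical
  have key : ∀ i ∈ Finset.Ico 0 m, ∀ j ∈ Finset.Ico 0 m, Same k Q (g i) (g j) → i = j := by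
    intro i hi j hj hS
    rw [Finset.mem_Ico] at hi hj
    by_contra hij
    rcases lt_or_gt_of_ne hij with hij | hij
    · exact h' i j hi.1 hij hj.2 hS
    · exact h' j i hj.1 hij hi.2 hS.symm
  refine ⟨(Finset.Ico 0 m).image g, ?_, ?_, ?_⟩
  · rw [Finset.card_image_of_injOn, Int.card_Ico]
    · omega
    · intro i hi j hj hij
      exact key i (by exact_mod_cast hi) j (by exact_mod_cast hj) (hij ▸ Same.rfl)
  · intro u hu
    obtain ⟨i, hi, rfl⟩ := Finset.mem_image.1 hu
    rw [Finset.mem_Ico] at hi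
    exact h i hi.1 hi.2
  · intro u hu v hv huv
    obtain ⟨i, hi, rfl⟩ := Finset.mem_image.1 hu
    obtain ⟨j, hj, rfl⟩ := Finset.mem_image.1 hv
    rw [key i hi j hj huv]

/-- The set `A` has few types and no full window, but all elements of a window except for `x`. -/
structure Near (k n : ℤ) (A Q : Set ℤ) (x : ℤ) : Prop where
  part : Part k n A Q
  meetsA : Meets k n A
  meetsQ : Meets k n Q
  mem : x ∈ Q
  one_le : 1 ≤ x
  le_n : x ≤ n
  few : ∀ m, Indep k A Q m 1 n → m ≤ k
  window : ∃ a, 1 ≤ a ∧ a + k ≤ n ∧ ∀ p, a ≤ p → p ≤ a + k → p ∈ insert x A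

namespace Near

theorem mir (h : Near k n A Q x) : Near k n (mir n A) (mir n Q) (n + 1 - x) where
  part := h.part.mir
  meetsA := h.meetsA.mir
  meetsQ := h.meetsQ.mir
  mem := by rw [mem_mir]; simpa using h.mem
  one_le := by have := h.le_n; omega
  le_n := by have := h.one_le; omega
  few m hm := h.few m hm.of_mir
  window := by
    obtain ⟨a, h1, h2, h3⟩ := h.window
    refine ⟨n + 1 - a - k, by omega, by omega, fun p hp hp' => ?_⟩
    rcases h3 (n + 1 - p) (by omega) (by omega) with h | h
    · exact Or.inl (by omega)
    · exact Or.inr h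

theorem partT (h : Near k n A Q x) : Part k n (insert x A) (Q \ {x}) where
  hk := h.part.hk
  hn := h.part.hn
  sub p hp := by
    rcases hp with rfl | hp
    · exact ⟨h.one_le, h.le_n⟩
    · exact h.part.sub p hp
  cover p h1 h2 := by
    have := h.part.cover p h1 h2
    simp only [Set.mem_insert_iff, Set.mem_sdiff, Set.mem_singleton_iff]
    tauto
  left := ⟨h.part.left, by have := h.one_le; have := h.part.hk; simp only [Set.mem_singleton_iff]; omega⟩
  right := ⟨h.part.right, by have := h.le_n; have := h.part.hk; simp only [Set.mem_singleton_iff]; omega⟩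

theorem meetsT (h : Near k n A Q x) : Meets k n (insert x A) := fun a h1 h2 =>
  (h.meetsA a h1 h2).imp fun _ hp => ⟨Or.inr hp.1, hp.2⟩

theorem spanA (h : Near k n A Q x) : Span k A Q k := (h.part.span h.meetsQ).mono (by omega)

theorem mem_window (h : Near k n A Q x) (h1 : 1 ≤ a) (h2 : a + k ≤ n)
    (h3 : ∀ p, a ≤ p → p ≤ a + k → p ∈ insert x A) : a ≤ x ∧ x ≤ a + k := by
  obtain ⟨p, hp, hp1, hp2⟩ := h.meetsQ a h1 h2
  rcases h3 p hp1 hp2 with rfl | h'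
  · exact ⟨hp1, hp2⟩
  · exact absurd hp (h.part.notMem h')

theorem indep_mir (h : Indep k (insert (n + 1 - x) (Line.mir n A)) (Line.mir n Q \ {n + 1 - x}) m 1 n) :
    Indep k (insert x A) (Q \ {x}) m 1 n := by
  refine Indep.of_mir ?_
  convert h using 1
  · ext p
    simp only [mem_mir, Set.mem_insert_iff]
    exact or_congr_left (by omega)
  · ext p
    simp only [mem_mir, Set.mem_sdiff, Set.mem_singleton_iff]
    exact and_congr_right fun _ => not_congr (by omega)

/-- Without `1`, the element `row k j + 2` has exactly `j` windows on its left and `k - 1 - j`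
disjoint ones on its right. Each contributes a type; with the element itself and `1` this makes `k +
1`. -/
theorem row_notMem (h : Near k n A Q x) (h1 : 1 ∈ A) (hj : 0 ≤ j) (hjk : j ≤ k - 1) :
    row k j + 2 ∉ A := by
  intro hc
  have hk := h.part.hk
  have hl := h.part.row_last
  have hj0 := row_le (by omega : 0 ≤ k) hj
  rw [row_zero] at hj0
  have hjl := row_le (by omega : 0 ≤ k) hjk
  have e1 := h.part.grow h.spanA h.meetsA (indep_one hc) hj le_rfl (by omega) (by omega) (by omega)
    (by rw [row_zero]; omega) (by omega)
  have e2 := e1.insert (a' := 1) (b' := row k j + 2) (by omega) (by rw [row_zero]; omega) h1 le_rfl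
    (by omega) fun u _ hu _ => h.part.not_same_one (by omega)
  have hr : row k (k - 1 - j) = row k (k - 1) - row k j := row_sub _ _ _
  have e3 := h.part.grow_all h.spanA h.meetsA e2 (i := 0) (j := k - 1 - j) le_rfl (by omega)
    (by rw [row_zero]; omega) (by omega) (by omega) (by omega) (by omega)
  have := h.few _ e3
  omega

/-- The full window contains some `row k j + 2`, which by `row_notMem` can only be `x`. All the
other `row k i + 2` are in `Q`, and they separate `1`, `x` and one element of `A` for each `i = 1,
…, k - 1`. -/
theorem indep_of_one_mem (h : Near k n A Q x) (h1 : 1 ∈ A) :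
    Indep k (insert x A) (Q \ {x}) (k + 1) 1 n := by
  have hk := h.part.hk
  have hk0 : 0 ≤ k := by omega
  have hl := h.part.row_last
  have hpT := h.partT
  obtain ⟨a, ha1, han, ha⟩ := h.window
  obtain ⟨j, hj1, hj2⟩ := exists_row hk0 (a + k - 2)
  have hj0 : 0 ≤ j := by
    by_contra hj
    have := row_lt hk0 (by omega : j < 0)
    rw [row_zero] at this
    omega
  have hjk : j ≤ k - 1 := by
    by_contra hj
    have := row_lt hk0 (by omega : k - 1 < j)
    omega
  have hxj : x = row k j + 2 := by
    rcases ha (row k j + 2) (by omega) (by omega) with h' | h'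
    · exact h'.symm
    · exact absurd h' (h.row_notMem h1 hj0 hjk)
  have hq : ∀ i, 0 ≤ i → i ≤ k - 1 → i ≠ j → row k i + 2 ∈ Q \ {x} := by
    intro i h0 h2 hij
    have hi0 := row_le hk0 h0
    rw [row_zero] at hi0
    have hil := row_le hk0 h2
    refine ⟨(h.part.mem_or (by omega) (by omega)).resolve_left (h.row_notMem h1 h0 h2), ?_⟩
    simp only [Set.mem_singleton_iff]
    rcases lt_or_gt_of_ne hij with hij | hij
    · have := row_lt hk0 hij; omega
    · have := row_lt hk0 hij; omega
  have hy : ∀ i, 1 ≤ i → i ≤ k - 1 → ∃ y ∈ A, row k i - k + 2 ≤ y ∧ y ≤ row k i + 1 := by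
    intro i h0 h2
    have hi0 := row_le hk0 h0
    rw [row_one] at hi0
    have hil := row_le hk0 h2
    obtain ⟨p, hp, hp1, hp2⟩ := h.meetsA (row k i - k + 2) (by omega) (by omega)
    refine ⟨p, hp, hp1, ?_⟩
    by_contra hp3
    exact h.row_notMem h1 (by omega) h2 (by convert hp using 1; omega)
  choose! Y hYA hY1 hY2 using hy
  refine indep_of_fun (fun i => if i = 0 then 1 else if i = k then x else Y i) (by omega) ?_ ?_
  · intro i h0 h2
    have : (if i = 0 then 1 else if i = k then x else Y i) ∈ insert x A := by
      split_ifs with h3 h4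
      · exact Or.inr h1
      · exact Or.inl rfl
      · exact Or.inr (hYA i (by omega) (by omega))
    exact ⟨this, hpT.sub _ this⟩
  · intro i i' h0 hii h2
    have hi'0 : i' ≠ 0 := by omega
    have hik : i ≠ k := by omega
    simp only [hi'0, hik, if_false]
    by_cases hi0 : i = 0
    · simp only [hi0, if_true]
      refine hpT.not_same_one ?_
      split_ifs with h3
      · have : x ≠ 1 := fun h' => h.part.notMem h1 (h' ▸ h.mem)
        have := h.one_le
        omega
      · have := hY1 i' (by omega) (by omega)
        have hi1 := row_le hk0 (by omega : 1 ≤ i')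
        rw [row_one] at hi1
        omega
    simp only [hi0, if_false]
    have hYi1 := hY1 i (by omega) (by omega)
    have hYi2 := hY2 i (by omega) (by omega)
    have hrp := row_pred k i
    split_ifs with h3
    · by_cases hij : i ≤ j
      · have := row_le hk0 hij
        exact not_same_of_left (hq (i - 1) (by omega) (by omega) (by omega)) (by omega) (by omega)
          (by omega)
      · have := row_lt hk0 (by omega : j < i)
        exact fun hS => not_same_of_right (hq i (by omega) (by omega) (by omega)) (by omega)
          (by omega) (by omega) hS.symm
    · have hYi1' := hY1 i' (by omega) (by omega)
      have hYi2' := hY2 i' (by omega) (by omega)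
      have := row_lt hk0 hii
      by_cases hij : i - 1 = j
      · exact not_same_of_right (hq i' (by omega) (by omega) (by omega)) (by omega) (by omega)
          (by omega)
      · exact not_same_of_left (hq (i - 1) (by omega) (by omega) hij) (by omega) (by omega) (by omega)

theorem indep_of_n_mem (h : Near k n A Q x) (h1 : n ∈ A) :
    Indep k (insert x A) (Q \ {x}) (k + 1) 1 n :=
  indep_mir (h.mir.indep_of_one_mem (by rw [mem_mir]; simpa using h1))

end Near

/-- Moreover, the completed set has few types. -/
structure Tight (k n : ℤ) (A Q : Set ℤ) (x : ℤ) : Prop extends Near k n A Q x where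
  fewT : ∀ m, Indep k (insert x A) (Q \ {x}) m 1 n → m ≤ k

namespace Tight

theorem one_notMem (h : Tight k n A Q x) : 1 ∉ A := fun h1 => by
  have := h.fewT _ (h.indep_of_one_mem h1); omega

theorem n_notMem (h : Tight k n A Q x) : n ∉ A := fun h1 => by
  have := h.fewT _ (h.indep_of_n_mem h1); omega

/-- If `u < v` had the same type at a larger distance, there would be full windows ending in `u` and
starting in `v`, or an end of the path would be in the set. Every full window contains `x`, so `v ≤
x ≤ u`. -/
theorem spanT (h : Tight k n A Q x) : Span k (insert x A) (Q \ {x}) k := by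
  intro u hu v hv huv hS
  by_contra hd
  have hk := h.part.hk
  have hpT := h.partT
  have hu' := hpT.sub u hu
  have hv' := hpT.sub v hv
  have hxu : x ≤ u := by
    by_cases hku : k + 1 ≤ u
    · refine (h.mem_window (a := u - k) (by omega) (by omega) fun p hp hp' => ?_).2.trans (by omega)
      by_cases hpu : p = u
      · exact hpu ▸ hu
      · exact hpT.mem_left hS hp (by omega) (by omega) (by omega) (by omega)
    · have h1 : (1 : ℤ) ∈ insert x A := by
        by_cases hu1 : u = 1
        · exact hu1 ▸ hu
        · exact hpT.mem_left hS (by omega) (by omega) (by omega) le_rfl (by omega)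
      rcases h1 with h1 | h1
      · omega
      · exact absurd h1 (h.one_notMem)
  have hvx : v ≤ x := by
    by_cases hkv : v + k ≤ n
    · refine (h.mem_window (a := v) (by omega) (by omega) fun p hp hp' => ?_).1
      by_cases hpv : p = v
      · exact hpv ▸ hv
      · exact hpT.mem_right hS (by omega) hp' (by omega) (by omega) (by omega)
    · have h1 : n ∈ insert x A := by
        by_cases hvn : v = n
        · exact hvn ▸ hv
        · exact hpT.mem_right hS (by omega) (by omega) (by omega) (by omega) le_rfl
      rcases h1 with h1 | h1
      · omega
      · exact absurd h1 (h.n_notMem)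
  omega

/-- There is room for `i` windows to the left of the pair and for `k - 1 - i` to the right. Two
types in the pair would give `k + 1` in total. -/
theorem pair_same (h : Tight k n A Q x) (h0 : 0 ≤ i) (hik : i ≤ k - 1) (h1 : row k i + 1 ∈ insert x A)
    (h2 : row k i + 2 ∈ insert x A) : Same k (Q \ {x}) (row k i + 1) (row k i + 2) := by
  by_contra hS
  have hk := h.part.hk
  have hl := h.part.row_last
  have hr : row k (k - 1 - i) = row k (k - 1) - row k i := row_sub _ _ _
  have hi0 := row_le (by omega : 0 ≤ k) h0
  rw [row_zero] at hi0
  have hil := row_le (by omega : 0 ≤ k) hik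
  have := h.fewT _ (h.partT.grow_all (h.spanT) h.meetsT (indep_two h1 h2 (by omega) hS) (i := i)
    (j := k - 1 - i) h0 (by omega) (by omega) (by omega) (by omega) (by omega) (by omega))
  omega

/-- At most two types occur between `row k (j - 1) + 2` and `row k j + 1`. -/
theorem two_types (h : Tight k n A Q x) (h1 : 1 ≤ j) (hjk : j ≤ k - 1) (hu : u ∈ insert x A) (hv : v ∈ insert x A)
    (hw : w ∈ insert x A) (hju : row k j - k + 1 ≤ u) (huv : u < v) (hvw : v < w)
    (hwj : w ≤ row k j + 1) (s1 : ¬ Same k (Q \ {x}) u v) (s2 : ¬ Same k (Q \ {x}) v w) :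
    Same k (Q \ {x}) u w := by
  by_contra s3
  have hk := h.part.hk
  have hl := h.part.row_last
  have hr : row k (k - 1 - j) = row k (k - 1) - row k j := row_sub _ _ _
  have hr' := row_pred k j
  have hj0 := row_le (by omega : 0 ≤ k) h1
  rw [row_one] at hj0
  have hjl := row_le (by omega : 0 ≤ k) hjk
  have := h.fewT _ (h.partT.grow_all (h.spanT) h.meetsT
    ((indep_three hu hv hw huv hvw s1 s2 s3).mono (a' := row k j - k + 1) (b' := row k j + 1)
      hju hwj) (i := j - 1) (j := k - 1 - j) (by omega) (by omega) (by omega) (by omega) (by omega)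
      (by omega) (by omega))
  omega

theorem pair_ne_zero (h : Tight k n A Q x) (h1 : row k i + 1 ∈ insert x A) (h0 : 0 ≤ i) (hik : i ≤ k - 1)
    (h2 : row k i + 2 ∈ insert x A) : i ≠ 0 := by
  rintro rfl
  have := h.pair_same h0 hik h1 h2
  rw [row_zero] at this
  exact h.partT.not_same_one (by norm_num) this

theorem pair_ne_last (h : Tight k n A Q x) (h1 : row k i + 1 ∈ insert x A) (h0 : 0 ≤ i) (hik : i ≤ k - 1)
    (h2 : row k i + 2 ∈ insert x A) : i ≠ k - 1 := by
  rintro rfl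
  have hl := h.part.row_last
  have := h.pair_same h0 hik h1 h2
  rw [show row k (k - 1) + 2 = n by omega] at this
  exact h.partT.not_same_n (by omega) this

theorem pair_left (h : Tight k n A Q x) (h1 : row k i + 1 ∈ insert x A) (h0 : 0 ≤ i) (hik : i ≤ k - 1)
    (h2 : row k i + 2 ∈ insert x A) : row k i + 1 - k ∈ insert x A := by
  have hk := h.part.hk
  have hl := h.part.row_last
  have hil := row_le (by omega : 0 ≤ k) hik
  have hi0 := row_le (by omega : 0 ≤ k) (by have := h.pair_ne_zero h1 h0 hik h2; omega : 1 ≤ i)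
  rw [row_one] at hi0
  exact h.partT.mem_left (h.pair_same h0 hik h1 h2) le_rfl (by omega) (by omega) (by omega)
    (by omega)

theorem pair_right (h : Tight k n A Q x) (h1 : row k i + 1 ∈ insert x A) (h0 : 0 ≤ i) (hik : i ≤ k - 1)
    (h2 : row k i + 2 ∈ insert x A) : row k i + 2 + k ∈ insert x A := by
  have hk := h.part.hk
  have hl := h.part.row_last
  have hi0 := row_le (by omega : 0 ≤ k) h0
  rw [row_zero] at hi0
  have hil := row_lt (by omega : 0 ≤ k)
    (by have := h.pair_ne_last h1 h0 hik h2; omega : i < k - 1)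
  exact h.partT.mem_right (h.pair_same h0 hik h1 h2) (by omega) le_rfl (by omega) (by omega)
    (by omega)

/-- Some window contains a pair, or is adjacent to a pair. -/
theorem exists_pair (h : Tight k n A Q x) : ∃ i a, 0 ≤ i ∧ i ≤ k - 1 ∧ row k i + 1 ∈ insert x A ∧
    row k i + 2 ∈ insert x A ∧ (∀ p, a ≤ p → p ≤ a + k → p ∈ insert x A) ∧ 1 ≤ a ∧ a + k ≤ n ∧
    (a ≤ row k i + 1 ∧ row k i + 2 ≤ a + k ∨ a = row k i + 2 ∨ a = row k i + 1 - k) := by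
  have hk := h.part.hk
  have hk0 : 0 ≤ k := by omega
  have hl := h.part.row_last
  obtain ⟨a, ha1, han, ha⟩ := h.window
  obtain ⟨j, hj1, hj2⟩ := exists_row hk0 (a + k - 2)
  have hj0 : 0 ≤ j := by
    by_contra hj
    have := row_lt hk0 (by omega : j < 0)
    rw [row_zero] at this
    omega
  have hjk : j ≤ k - 1 := by
    by_contra hj
    have := row_lt hk0 (by omega : k - 1 < j)
    omega
  have hjr := row_le hk0 hj0
  rw [row_zero] at hjr
  by_cases hja : a ≤ row k j + 1
  · exact ⟨j, a, hj0, hjk, ha _ hja (by omega), ha _ (by omega) (by omega), ha, ha1, han,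
      Or.inl ⟨hja, by omega⟩⟩
  have haj : a = row k j + 2 := by omega
  have hs := row_succ k j
  have hjk' : j + 1 ≤ k - 1 := by
    by_contra hj
    obtain rfl : j = k - 1 := by omega
    omega
  have hjl := row_le hk0 hjk'
  -- The window is now precisely the segment from `row k j + 2` to `row k (j + 1) + 1`. It has at
  -- most two types, so its first two or its last two elements have the same type, and this puts the
  -- missing member of the pair at the opposite end into the set.
  by_cases hS1 : Same k (Q \ {x}) (row k j + 2) (row k j + 3)
  · refine ⟨j + 1, a, by omega, hjk', ha _ (by omega) (by omega), ?_, ha, ha1, han,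
      Or.inr (Or.inr (by omega))⟩
    exact h.partT.mem_right hS1 (by omega) (by omega) (by omega) (by omega) (by omega)
  by_cases hS2 : Same k (Q \ {x}) (row k (j + 1)) (row k (j + 1) + 1)
  · refine ⟨j, a, by omega, hjk, ?_, ha _ (by omega) (by omega), ha, ha1, han,
      Or.inr (Or.inl (by omega))⟩
    exact h.partT.mem_left hS2 (by omega) (by omega) (by omega) (by omega) (by omega)
  have hS3 : ¬ Same k (Q \ {x}) (row k j + 3) (row k (j + 1) + 1) := fun hS =>
    hS2 (hS.convex' (by omega) (by omega) (by omega))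
  have := h.two_types (j := j + 1) (by omega) hjk' (ha (row k j + 2) (by omega) (by omega))
    (ha (row k j + 3) (by omega) (by omega)) (ha (row k (j + 1) + 1) (by omega) (by omega))
    (by omega) (by omega) (by omega) (by omega) hS1 hS3
  exact absurd (this.convex (by omega) (by omega) (by omega)) hS1

end Tight

end Line

/-! ### The change of type in each segment near a completed window -/

namespace Line

variable {k n m a b u v w x i j l r : ℤ} {A Q : Set ℤ} {e s : ℤ → ℤ}

/-- The structure of the types of the completed set near the window: in the rows strictly between
`l` and `r` the type changes exactly once, after `e j` and before `s j`. -/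
structure Block (k n : ℤ) (A Q : Set ℤ) (x l r : ℤ) (e s : ℤ → ℤ) : Prop extends Tight k n A Q x where
  zero_le : 0 ≤ l
  lt : l + 2 ≤ r
  le : r ≤ k - 1
  left_notMem : row k l + 1 ∉ insert x A
  right_notMem : row k r + 2 ∉ insert x A
  first_mem : ∀ j, l < j → j ≤ r → row k j - k + 1 ∈ insert x A
  last_mem : ∀ j, l < j → j ≤ r → row k j + 1 ∈ insert x A
  e_mem : ∀ j, l < j → j ≤ r → e j ∈ insert x A
  s_mem : ∀ j, l < j → j ≤ r → s j ∈ insert x A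
  le_e : ∀ j, l < j → j ≤ r → row k j - k + 1 ≤ e j
  e_lt_s : ∀ j, l < j → j ≤ r → e j < s j
  s_le : ∀ j, l < j → j ≤ r → s j ≤ row k j + 1
  same_e : ∀ j, l < j → j ≤ r → Same k (Q \ {x}) (row k j - k + 1) (e j)
  same_s : ∀ j, l < j → j ≤ r → Same k (Q \ {x}) (s j) (row k j + 1)
  not_same : ∀ j, l < j → j ≤ r → ¬ Same k (Q \ {x}) (row k j - k + 1) (row k j + 1)
  gap : ∀ j, l < j → j ≤ r → ∀ p, e j < p → p < s j → p ∉ insert x A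

/-- The bounds `l` and `r` are the nearest incomplete pairs on both sides of a complete one. In
between, a pair has one type by `pair_same`, so consecutive segments are linked. The ends of a
segment have different types, by `spanT` or, next to `l`, because `row k l + 1` is missing; by
`two_types` there is exactly one change in between. -/
theorem Tight.exists_block (h : Tight k n A Q x) : ∃ l r e s, Block k n A Q x l r e s ∧
    ∃ i a, l < i ∧ i < r ∧ row k i + 1 ∈ insert x A ∧ row k i + 2 ∈ insert x A ∧
    (∀ p, a ≤ p → p ≤ a + k → p ∈ insert x A) ∧ 1 ≤ a ∧ a + k ≤ n ∧
    (a ≤ row k i + 1 ∧ row k i + 2 ≤ a + k ∨ a = row k i + 2 ∨ a = row k i + 1 - k) := by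
  obtain ⟨i, a, hi0, hik, hi1, hi2, hw⟩ := h.exists_pair
  have hk := h.part.hk
  have hk0 : 0 ≤ k := by omega
  have hlast := h.part.row_last
  set T := insert x A with hT
  let N : Set ℤ := {j | ¬ (row k j + 1 ∈ T ∧ row k j + 2 ∈ T)}
  have hiN : i ∉ N := fun hN => hN ⟨hi1, hi2⟩
  obtain ⟨l, hlN, hl0, hli, hlmax⟩ := exists_greatest (A := N) (a := 0) (b := i) ⟨0, fun hN =>
    h.pair_ne_zero hN.1 le_rfl (by omega) hN.2 rfl, le_rfl, hi0⟩
  obtain ⟨r, hrN, hir, hrk, hrmin⟩ := exists_least (A := N) (a := i) (b := k - 1) ⟨k - 1, fun hN =>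
    h.pair_ne_last hN.1 (by omega) le_rfl hN.2 rfl, hik, le_rfl⟩
  have hli' : l < i := lt_of_le_of_ne hli fun h' => hiN (h' ▸ hlN)
  have hir' : i < r := lt_of_le_of_ne hir fun h' => hiN (h' ▸ hrN)
  have both : ∀ j, l < j → j < r → row k j + 1 ∈ T ∧ row k j + 2 ∈ T := by
    intro j hlj hjr
    by_contra hj
    rcases le_total j i with hji | hij
    · have := hlmax j hj hji; omega
    · have := hrmin j hj hij; omega
  have hl2 : row k l + 2 ∈ T := by
    have hb := both (l + 1) (by omega) (by omega)
    have := h.pair_left hb.1 (by omega) (by omega) hb.2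
    rwa [row_succ, show row k l + k + 1 + 1 - k = row k l + 2 by ring] at this
  have hr1 : row k r + 1 ∈ T := by
    have hb := both (r - 1) (by omega) (by omega)
    have := h.pair_right hb.1 (by omega) (by omega) hb.2
    rwa [row_pred, show row k r - k - 1 + 2 + k = row k r + 1 by ring] at this
  have hl1 : row k l + 1 ∉ T := fun h' => hlN ⟨h', hl2⟩
  have hr2 : row k r + 2 ∉ T := fun h' => hrN ⟨hr1, h'⟩
  have hfirst : ∀ j, l < j → j ≤ r → row k j - k + 1 ∈ T := by
    intro j hlj hjr
    have hrp := row_pred k j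
    have : row k (j - 1) + 2 ∈ T := by
      by_cases hj : j - 1 = l
      · rw [hj]; exact hl2
      · exact (both _ (by omega) (by omega)).2
    convert this using 1
    omega
  have hlast' : ∀ j, l < j → j ≤ r → row k j + 1 ∈ T := by
    intro j hlj hjr
    by_cases hj : j = r
    · rw [hj]; exact hr1
    · exact (both _ (by omega) (by omega)).1
  have hns : ∀ j, l < j → j ≤ r → ¬ Same k (Q \ {x}) (row k j - k + 1) (row k j + 1) := by
    intro j hlj hjr hS
    have hrp := row_pred k j
    have hj0 := row_le hk0 (by omega : 1 ≤ j)
    rw [row_one] at hj0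
    have hjl := row_le hk0 (by omega : j ≤ k - 1)
    by_cases hj : j - 1 = l
    · refine hl1 ?_
      rw [← hj]
      exact h.partT.mem_left hS (by omega) (by omega) (by omega) (by omega) (by omega)
    · have hb := both (j - 1) (by omega) (by omega)
      have hps := h.pair_same (by omega) (by omega) hb.1 hb.2
      rw [show row k (j - 1) + 2 = row k j - k + 1 by omega] at hps
      have := h.spanT _ hb.1 _ (hlast' j hlj hjr) (by omega) (hps.trans hS)
      omega
  have hes : ∀ j, l < j → j ≤ r → ∃ e s, e ∈ T ∧ s ∈ T ∧ row k j - k + 1 ≤ e ∧ e < s ∧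
      s ≤ row k j + 1 ∧ Same k (Q \ {x}) (row k j - k + 1) e ∧ Same k (Q \ {x}) s (row k j + 1) ∧
      ∀ p, e < p → p < s → p ∉ T := by
    intro j hlj hjr
    obtain ⟨e, ⟨heT, heS⟩, hle, hel, hemax⟩ := exists_greatest
      (A := {p | p ∈ T ∧ Same k (Q \ {x}) (row k j - k + 1) p}) (a := row k j - k + 1)
      (b := row k j + 1) ⟨row k j - k + 1, ⟨hfirst j hlj hjr, Same.rfl⟩, le_rfl, by omega⟩
    have he' : e ≠ row k j + 1 := fun h' => hns j hlj hjr (h' ▸ heS)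
    obtain ⟨s, hsT, hes, hsl, hsmin⟩ := exists_least (A := T) (a := e + 1)
      (b := row k j + 1) ⟨row k j + 1, hlast' j hlj hjr, by omega, le_rfl⟩
    have hsS : ¬ Same k (Q \ {x}) (row k j - k + 1) s := fun hS => by
      have := hemax s ⟨hsT, hS⟩ hsl; omega
    refine ⟨e, s, heT, hsT, hle, by omega, hsl, heS, ?_, fun p hp1 hp2 hpT => by
      have := hsmin p hpT (by omega); omega⟩
    by_contra hS
    have hs' : s ≠ row k j + 1 := fun h' => hS (h' ▸ Same.rfl)
    exact hns j hlj hjr (h.two_types (by omega) (by omega) (hfirst j hlj hjr) hsT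
      (hlast' j hlj hjr) le_rfl (by omega) (by omega) le_rfl hsS hS)
  choose! e s h1 h2 h3 h4 h5 h6 h7 h8 using hes
  exact ⟨l, r, e, s, ⟨h, hl0, by omega, hrk, hl1, hr2, hfirst, hlast', h1, h2, h3, h4, h5, h6, h7,
    hns, h8⟩, i, a, hli', hir', hi1, hi2, hw⟩

namespace Block

theorem row_bounds (h : Block k n A Q x l r e s) (h1 : l < j) (h2 : j ≤ r) :
    k + 1 ≤ row k j ∧ row k j ≤ n - 2 := by
  have hk := h.part.hk
  have := h.zero_le
  have := h.le
  have hj0 := row_le (by omega : 0 ≤ k) (by omega : 1 ≤ j)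
  rw [row_one] at hj0
  have hjl := row_le (by omega : 0 ≤ k) (by omega : j ≤ k - 1)
  rw [h.part.row_last] at hjl
  exact ⟨hj0, hjl⟩

/-- An earlier change is impossible, because the missing `row k l + 1` would separate `s (l + 1)`
from the end of its segment. -/
theorem s_first (h : Block k n A Q x l r e s) : s (l + 1) = row k (l + 1) + 1 := by
  have hlt := h.lt
  have h1 := h.s_le (l + 1) (by omega) (by omega)
  by_contra hne
  have := h.row_bounds (j := l + 1) (by omega) (by omega)
  have h2 := h.le_e (l + 1) (by omega) (by omega)
  have h3 := h.e_lt_s (l + 1) (by omega) (by omega)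
  have hs := row_succ k l
  refine h.left_notMem (h.partT.mem_left (h.same_s (l + 1) (by omega) (by omega)) ?_ ?_ ?_ ?_ ?_) <;>
    omega

theorem e_last (h : Block k n A Q x l r e s) : e r = row k r - k + 1 := by
  have hlt := h.lt
  have h1 := h.le_e r (by omega) (by omega)
  by_contra hne
  have := h.row_bounds (j := r) (by omega) (by omega)
  have h2 := h.s_le r (by omega) (by omega)
  have h3 := h.e_lt_s r (by omega) (by omega)
  refine h.right_notMem (h.partT.mem_right (h.same_e r (by omega) (by omega)) ?_ ?_ ?_ ?_ ?_) <;>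
    omega

/-- Where the types change between two adjacent elements there is a window. -/
theorem window_of_gap (h : Block k n A Q x l r e s) (h1 : l < j) (h2 : j ≤ r) (hj : e j + 1 = s j) :
    s j - k ≤ x ∧ x ≤ s j + k - 1 := by
  have hk := h.part.hk
  have hk0 : 0 ≤ k := by omega
  have hlt := h.lt
  have hrk := h.le
  have hl0 := h.zero_le
  have hb := h.row_bounds h1 h2
  have hle := h.le_e j h1 h2
  have hsl := h.s_le j h1 h2
  have hlast := h.part.row_last
  have hse := h.same_e j h1 h2
  have hss := h.same_s j h1 h2
  by_cases hR : ∀ p, s j ≤ p → p ≤ row k j + 1 → p ∈ insert x A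
  · have hn : s j + k - 1 ≤ n := by
      by_cases hjr : j = r
      · subst hjr; have := h.e_last; omega
      · have := row_lt hk0 (by omega : j < k - 1); omega
    have := h.mem_window (a := s j - 1) (by omega) (by omega) fun p hp hp' => ?_
    · omega
    by_cases hp1 : p = e j
    · exact hp1 ▸ h.e_mem j h1 h2
    by_cases hp2 : p ≤ row k j + 1
    · exact hR p (by omega) hp2
    · exact h.partT.mem_right hse (by omega) (by omega) (by omega) (by omega) (by omega)
  by_cases hL : ∀ p, row k j - k + 1 ≤ p → p ≤ e j → p ∈ insert x A
  · have hn : 1 ≤ s j - k := by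
      by_cases hjl : j = l + 1
      · subst hjl
        have := h.s_first
        omega
      · have := row_lt hk0 (by omega : 1 < j); rw [row_one] at this; omega
    have := h.mem_window (a := s j - k) hn (by omega) fun p hp hp' => ?_
    · omega
    by_cases hp1 : p = s j
    · exact hp1 ▸ h.s_mem j h1 h2
    by_cases hp2 : row k j - k + 1 ≤ p
    · exact hL p hp2 (by omega)
    · exact h.partT.mem_left hss (by omega) (by omega) (by omega) (by omega) (by omega)
  exfalso
  push Not at hR hL
  obtain ⟨y', hy1', hy2', hyT'⟩ := hR
  obtain ⟨y, hy1, hy2, hyT⟩ := hL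
  have hys' : y' ≠ s j := fun h' => hyT' (h' ▸ h.s_mem j h1 h2)
  have hye : y ≠ e j := fun h' => hyT (h' ▸ h.e_mem j h1 h2)
  have hyl' : y' ≠ row k j + 1 := fun h' => hyT' (h' ▸ h.last_mem j h1 h2)
  have hyf : y ≠ row k j - k + 1 := fun h' => hyT (h' ▸ h.first_mem j h1 h2)
  -- Elements missing on both sides of the change in segment `j` confine the change in the next
  -- segment to an interval around `s j + k + 1`; but this element is in the set, since it is close
  -- to the end of segment `j` and not to `s j`. For `j = r` the previous segment serves instead.
  by_cases hjr : j < r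
  · have h1' : l < j + 1 := by omega
    have h2' : j + 1 ≤ r := by omega
    have hs := row_succ k j
    have hb' := h.row_bounds h1' h2'
    have hle' := h.le_e _ h1' h2'
    have hsl' := h.s_le _ h1' h2'
    have e1 : e (j + 1) ≤ y + k := by
      by_contra hc
      exact hyT (h.partT.mem_left (h.same_e _ h1' h2') (by omega) (by omega) (by omega) (by omega)
        (by omega))
    have e2 : y' + k + 1 ≤ s (j + 1) := by
      by_contra hc
      have := h.e_lt_s _ h1' h2'
      exact hyT' (h.partT.mem_left (h.same_s _ h1' h2') (by omega) (by omega) (by omega) (by omega)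
        (by omega))
    exact h.gap _ h1' h2' (s j + k + 1) (by omega) (by omega)
      (h.partT.mem_right hss (by omega) (by omega) (by omega) (by omega) (by omega))
  · have h1' : l < j - 1 := by omega
    have h2' : j - 1 ≤ r := by omega
    have hs := row_pred k j
    have hb' := h.row_bounds h1' h2'
    have hle' := h.le_e _ h1' h2'
    have hsl' := h.s_le _ h1' h2'
    have hes' := h.e_lt_s _ h1' h2'
    have e1 : y' - k ≤ s (j - 1) := by
      by_contra hc
      exact hyT' (h.partT.mem_right (h.same_s _ h1' h2') (by omega) (by omega) (by omega) (by omega)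
        (by omega))
    have e2 : e (j - 1) ≤ y - k - 1 := by
      by_contra hc
      exact hyT (h.partT.mem_right (h.same_e _ h1' h2') (by omega) (by omega) (by omega) (by omega)
        (by omega))
    exact h.gap _ h1' h2' (e j - k - 1) (by omega) (by omega)
      (h.partT.mem_left hse (by omega) (by omega) (by omega) (by omega) (by omega))

/-- Three types of `A` in one row are impossible. -/
theorem no_three (h : Block k n A Q x l r e s) (h1 : l < j) (h2 : j ≤ r) (hu : u ∈ insert x A)
    (hv : v ∈ insert x A) (hw : w ∈ insert x A) (hx : x < row k j - k + 1 ∨ row k j + 1 < x)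
    (hju : row k j - k + 1 ≤ u) (huv : u < v) (hvw : v < w) (hwj : w ≤ row k j + 1)
    (s1 : ¬ Same k Q u v) (s2 : ¬ Same k Q v w) (s3 : ¬ Same k Q u w) : False := by
  have hk := h.part.hk
  have hb := h.row_bounds h1 h2
  have hl := h.part.row_last
  have hr : row k (k - 1 - j) = row k (k - 1) - row k j := row_sub _ _ _
  have hr' := row_pred k j
  have := h.zero_le
  have := h.le
  have hA : ∀ p ∈ insert x A, row k j - k + 1 ≤ p → p ≤ row k j + 1 → p ∈ A := by
    intro p hp h1 h2
    rcases hp with hp | hp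
    · omega
    · exact hp
  have := h.few _ (h.part.grow_all h.spanA h.meetsA
    ((indep_three (hA u hu (by omega) (by omega)) (hA v hv (by omega) (by omega))
      (hA w hw (by omega) (by omega)) huv hvw s1 s2 s3).mono
      (a' := row k j - k + 1) (b' := row k j + 1) hju hwj) (i := j - 1) (j := k - 1 - j)
      (by omega) (by omega) (by omega) (by omega) (by omega) (by omega) (by omega))
  omega

/-- By `window_of_gap` the element `x` is close to the change. If `x` were in a neighbouring
segment, then `x`, missing from `A`, would produce a third type of `A` within segment `j`. -/
theorem eq_of_gap (h : Block k n A Q x l r e s) (h1 : l < j) (h2 : j ≤ r) (hj : e j + 1 = s j)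
    {p : ℤ} (hp1 : row k p - k + 1 ≤ x) (hp2 : x ≤ row k p + 1) : j = p := by
  have hk := h.part.hk
  have hk0 : 0 ≤ k := by omega
  have hw := h.window_of_gap h1 h2 hj
  have hle := h.le_e j h1 h2
  have hsl := h.s_le j h1 h2
  have hsub : Q \ {x} ⊆ Q := Set.sdiff_subset
  have hns : ¬ Same k Q (row k j - k + 1) (row k j + 1) := fun hS =>
    h.not_same j h1 h2 (hS.mono hsub)
  by_contra hne
  rcases lt_or_gt_of_ne hne with hjp | hpj
  · by_cases hjp' : j + 1 = p
    · subst hjp'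
      have hs := row_succ k j
      refine h.no_three h1 h2 (h.first_mem j h1 h2) (h.e_mem j h1 h2) (h.last_mem j h1 h2)
        (Or.inr (by omega)) le_rfl (by omega) (by omega) le_rfl
        (not_same_of_right h.mem (by omega) (by omega) (by omega)) (fun hS => ?_) hns
      exact h.not_same j h1 h2 ((h.same_e j h1 h2).trans (hS.mono hsub))
    · have := row_lt hk0 (by omega : j + 1 < p)
      rw [row_succ] at this
      omega
  · by_cases hjp' : j = p + 1
    · subst hjp'
      have hs := row_succ k p
      refine h.no_three h1 h2 (h.first_mem _ h1 h2) (h.s_mem _ h1 h2) (h.last_mem _ h1 h2)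
        (Or.inl (by omega)) le_rfl (by omega) (by omega) le_rfl (fun hS => ?_)
        (not_same_of_left h.mem (by omega) (by omega) (by omega)) hns
      exact h.not_same _ h1 h2 ((hS.mono hsub).trans (h.same_s _ h1 h2))
    · have := row_lt hk0 (by omega : p + 1 < j)
      rw [row_succ] at this
      omega

end Block

/-- A set that lacks one element of a window has more types than the path power has rows, or its
completion has. -/
theorem Tight.false (h : Tight k n A Q x) : False := by
  obtain ⟨l, r, e, s, hB, i, a, hli, hir, hi1, hi2, ha, ha1, han, hia⟩ := h.exists_block
  have hk := h.part.hk
  have hk0 : 0 ≤ k := by omega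
  have hl0 := hB.zero_le
  have hrk := hB.le
  have hbi := hB.row_bounds hli hir.le
  have hbi' := hB.row_bounds (j := i + 1) (by omega) (by omega)
  have hs := row_succ k i
  have hfull : ∀ j, l < j → j ≤ r → ∀ p, p ∈ insert x A → e j < p → p ≤ s j → p = s j := by
    intro j h1 h2 p hp h3 h4
    by_contra hne
    exact hB.gap j h1 h2 p h3 (by omega) hp
  -- The window touches a complete pair. If it covers neither the change in segment `i` nor the one
  -- in segment `i + 1`, then it has a single type throughout, so `a - 1` is in the set; by `spanT`
  -- it cannot have that type too, and the change is between `a - 1` and `a`.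
  have hex : ∃ j, l < j ∧ j ≤ r ∧ e j + 1 = s j := by
    have l1 := hB.le_e i hli hir.le
    have l2 := hB.e_lt_s i hli hir.le
    have l3 := hB.s_le i hli hir.le
    have r1 := hB.le_e (i + 1) (by omega) (by omega)
    have r2 := hB.e_lt_s (i + 1) (by omega) (by omega)
    have r3 := hB.s_le (i + 1) (by omega) (by omega)
    by_cases c1 : a < s i ∧ s i ≤ a + k + 1
    · refine ⟨i, hli, hir.le, ?_⟩
      by_contra hne
      exact hB.gap i hli hir.le (s i - 1) (by omega) (by omega) (ha _ (by omega) (by omega))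
    by_cases c2 : e (i + 1) < a + k ∧ a ≤ e (i + 1) + 1
    · refine ⟨i + 1, by omega, by omega, ?_⟩
      by_contra hne
      exact hB.gap (i + 1) (by omega) (by omega) (e (i + 1) + 1) (by omega) (by omega)
        (ha _ (by omega) (by omega))
    have c3 : s i ≤ a ∧ a + k ≤ e (i + 1) ∧ a ≤ row k i + 1 ∧ row k i + 2 ≤ a + k := by omega
    have S1 : Same k (Q \ {x}) a (row k i + 1) :=
      (hB.same_s i hli hir.le).convex' c3.1 c3.2.2.1 (by omega)
    have S2 := h.pair_same (by omega) (by omega) hi1 hi2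
    have S3 : Same k (Q \ {x}) (row k i + 2) (a + k) := by
      have := hB.same_e (i + 1) (by omega) (by omega)
      rw [show row k (i + 1) - k + 1 = row k i + 2 by omega] at this
      exact this.convex c3.2.2.2 c3.2.1 (by omega)
    have S4 := (S1.trans S2).trans S3
    have hm : a - 1 ∈ insert x A :=
      h.partT.mem_left S4 (by omega) (by omega) (by omega) (by omega) (by omega)
    refine ⟨i, hli, hir.le, ?_⟩
    have hsa : s i = a := by
      by_contra hne
      have S5 : Same k (Q \ {x}) (a - 1) (row k i + 1) :=
        (hB.same_s i hli hir.le).convex' (by omega) (by omega) (by omega)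
      have := h.spanT _ hm _ (ha (a + k) (by omega) le_rfl) (by omega) ((S5.trans S2).trans S3)
      omega
    by_contra hne
    exact hB.gap i hli hir.le (a - 1) (by omega) (by omega) hm
  obtain ⟨j0, h1, h2, h3⟩ := hex
  obtain ⟨c, ⟨hc1, hc2, hc3⟩, -, -, hcmin⟩ := exists_least
    (A := {j | l < j ∧ j ≤ r ∧ e j + 1 = s j}) (a := l) (b := r) ⟨j0, ⟨h1, h2, h3⟩, by omega, h2⟩
  obtain ⟨d, ⟨hd1, hd2, hd3⟩, -, -, hdmax⟩ := exists_greatest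
    (A := {j | l < j ∧ j ≤ r ∧ e j + 1 = s j}) (a := l) (b := r) ⟨j0, ⟨h1, h2, h3⟩, by omega, h2⟩
  obtain ⟨q, hq1, hq2⟩ := exists_row hk0 (x - 2)
  have hqs := row_succ k q
  have e1 := hB.eq_of_gap hc1 hc2 hc3 (p := q + 1) (by omega) (by omega)
  have e2 := hB.eq_of_gap hd1 hd2 hd3 (p := q + 1) (by omega) (by omega)
  have hcd : c = d := e1.trans e2.symm
  clear e1 e2 hq1 hq2 hqs
  -- In the segments before `c` the elements `e` and `s` are not adjacent. Then, relative to its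
  -- segment, `s` moves to the left by at most one per step, since a larger move would put `s - 1`
  -- of the earlier segment into the set.
  have hS : ∀ t : ℕ, l + 1 + t ≤ c → row k (l + 1 + t) + 1 - t ≤ s (l + 1 + t) := by
    intro t
    induction t with
    | zero => intro _; have := hB.s_first; simp only [Nat.cast_zero, add_zero, sub_zero]; omega
    | succ t ih =>
      intro ht
      push_cast at ht ⊢
      have ih := ih (by omega)
      rw [← add_assoc] at ht ⊢
      have j1 : l < l + 1 + t := by omega
      have j2 : l + 1 + t + 1 ≤ r := by omega
      have hs := row_succ k (l + 1 + t)
      have hb := hB.row_bounds j1 (by omega)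
      have hb' := hB.row_bounds (j := l + 1 + t + 1) (by omega) j2
      have g1 := hB.e_lt_s _ j1 (by omega)
      have g2 := hB.le_e _ j1 (by omega)
      have g3 := hB.s_le _ j1 (by omega)
      have g4 := hB.s_le _ (by omega : l < l + 1 + t + 1) j2
      have g5 := hB.le_e _ (by omega : l < l + 1 + t + 1) j2
      have g6 := hB.e_lt_s _ (by omega : l < l + 1 + t + 1) j2
      have hne : e (l + 1 + t) + 1 ≠ s (l + 1 + t) := fun h' => by
        have := hcmin _ ⟨j1, by omega, h'⟩ (by omega); omega
      by_contra hc
      exact hB.gap _ j1 (by omega) (s (l + 1 + t) - 1) (by omega) (by omega)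
        (h.partT.mem_left (hB.same_s _ (by omega : l < l + 1 + t + 1) j2) (by omega) (by omega)
          (by omega) (by omega) (by omega))
  -- Symmetrically, `e` moves to the right by at most one per step, starting from segment `r`.
  have hE : ∀ t : ℕ, d ≤ r - t → e (r - t) ≤ row k (r - t) - k + 1 + t := by
    intro t
    induction t with
    | zero => intro _; have := hB.e_last; simp only [Nat.cast_zero, add_zero, sub_zero]; omega
    | succ t ih =>
      intro ht
      push_cast at ht ⊢
      have ih := ih (by omega)
      rw [← sub_sub] at ht ⊢
      have j1 : r - t ≤ r := by omega
      have j2 : l < r - t - 1 := by omega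
      have hs := row_pred k (r - t)
      have hb := hB.row_bounds (by omega : l < r - t) j1
      have hb' := hB.row_bounds j2 (by omega)
      have g1 := hB.e_lt_s _ (by omega : l < r - t) j1
      have g2 := hB.le_e _ (by omega : l < r - t) j1
      have g3 := hB.s_le _ (by omega : l < r - t) j1
      have g4 := hB.s_le _ j2 (by omega)
      have g5 := hB.le_e _ j2 (by omega)
      have g6 := hB.e_lt_s _ j2 (by omega)
      have hne : e (r - t) + 1 ≠ s (r - t) := fun h' => by
        have := hdmax _ ⟨by omega, j1, h'⟩ j1; omega
      by_contra hc
      exact hB.gap _ (by omega : l < r - t) j1 (e (r - t) + 1) (by omega) (by omega)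
        (h.partT.mem_right (hB.same_e _ j2 (by omega)) (by omega) (by omega)
          (by omega) (by omega) (by omega))
  -- The two movements comprise `r - l - 1 ≤ k - 2` steps, so in segment `c = d` the distance from
  -- `e` to `s` is at least `2`, while it should be `1`.
  have f1 := hS (c - l - 1).toNat (by omega)
  have f2 := hE (r - d).toNat (by omega)
  rw [Int.toNat_of_nonneg (by omega)] at f1 f2
  rw [show l + 1 + (c - l - 1) = c by ring] at f1
  rw [show r - (r - d) = d by ring] at f2
  subst hcd
  omega

end Line

/-! ### Uniting two sets without full windows -/

namespace Line

variable {k n m a b q u v w x y z i j : ℤ} {A B C D Q : Set ℤ}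

theorem mir_union (n : ℤ) (A B : Set ℤ) : mir n (A ∪ B) = mir n A ∪ mir n B := rfl

theorem exists_column (hk : 0 ≤ k) (e a : ℤ) : ∃ y, a ≤ y ∧ y ≤ a + k ∧ k + 1 ∣ y - e := by
  refine ⟨a + (e - a) % (k + 1), ?_, ?_, ?_⟩
  · have := Int.emod_nonneg (e - a) (by omega : k + 1 ≠ 0); omega
  · have := Int.emod_lt_of_pos (e - a) (by omega : 0 < k + 1); omega
  · have := Int.dvd_self_sub_emod (x := e - a) (m := k + 1)
    rw [← dvd_neg] at this
    rwa [show a + (e - a) % (k + 1) - e = -(e - a - (e - a) % (k + 1)) by ring]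

theorem eq_of_column (h : k + 1 ∣ u - v) (h1 : a ≤ u) (h2 : u ≤ a + k) (h3 : a ≤ v)
    (h4 : v ≤ a + k) : u = v := by
  have := Int.eq_zero_of_abs_lt_dvd h (abs_lt.2 ⟨by omega, by omega⟩)
  omega

/-- The last element of a column before a window without elements. -/
theorem exists_last (hk : 0 ≤ k) (hw : w ∈ D) (hwq : w < q)
    (hJ : ∀ p, q ≤ p → p ≤ q + k → p ∉ D) :
    ∃ e ∈ D, w ≤ e ∧ e < q ∧ k + 1 ∣ e - w ∧ e + k + 1 ∉ D ∧
      ∀ y ∈ D, y < q → k + 1 ∣ y - w → y ≤ e := by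
  obtain ⟨e, ⟨he, hd, heq⟩, hwe, -, hmax⟩ := exists_greatest (b := q)
    (A := {e | e ∈ D ∧ k + 1 ∣ e - w ∧ e < q}) (a := w) ⟨w, ⟨hw, by simp, hwq⟩, le_rfl, hwq.le⟩
  refine ⟨e, he, hwe, heq, hd, fun h => ?_, fun y hy hyq hyw => hmax y ⟨hy, hyw, hyq⟩ hyq.le⟩
  by_cases h' : e + k + 1 < q
  · have hd' := dvd_add hd (dvd_refl (k + 1))
    have := hmax (e + k + 1) ⟨h, by rwa [show e + k + 1 - w = e - w + (k + 1) by ring], h'⟩ h'.le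
    omega
  · exact hJ _ (by omega) (by omega) h

theorem exists_first (hk : 0 ≤ k) (hw : w ∈ D) (hwq : q + k < w)
    (hJ : ∀ p, q ≤ p → p ≤ q + k → p ∉ D) :
    ∃ e ∈ D, e ≤ w ∧ q + k < e ∧ k + 1 ∣ e - w ∧ e - k - 1 ∉ D := by
  obtain ⟨e, he, h1, h2, h3, h4, -⟩ := exists_last (D := mir (-1) D) (w := -w) (q := -q - k) hk
    (by rw [mem_mir]; simpa using hw) (by omega) (fun p hp hp' => by
      rw [mem_mir]; exact hJ _ (by omega) (by omega))
  rw [mem_mir] at he h4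
  refine ⟨_, he, by omega, by omega, ?_, ?_⟩
  · rw [← dvd_neg]
    rwa [show -(-1 + 1 - e - w) = e - -w by ring]
  · rwa [show -1 + 1 - (e + k + 1) = -1 + 1 - e - k - 1 by ring] at h4

/-- Every column of a window contains a representative next to a window without elements,
and the representatives have different types. -/
theorem Core.reps (hp : Core k n D Q) (hQ : Meets k n Q) (hq : 1 ≤ q) (hqn : q + k ≤ n)
    (hJ : ∀ p, q ≤ p → p ≤ q + k → p ∉ D) (a : ℤ) (s : Finset ℤ)
    (hs : ∀ w ∈ s, w ∈ D ∧ a ≤ w ∧ w ≤ a + k) :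
    ∃ r : Finset ℤ, r.card = s.card ∧
      (∀ e ∈ r, e ∈ D ∧ ∃ w ∈ s, w ≤ e ∧ e < q ∨ q + k < e ∧ e ≤ w) ∧
      ∀ u ∈ r, ∀ v ∈ r, Same k Q u v → u = v := by
  classical
  have hk := hp.hk
  have hspan := hp.span hQ
  -- Within its residue class modulo `k + 1`, move from `w` towards the missed window. The last
  -- element of `D` on the way is followed, `k + 1` further, by an element of `Q`.
  have hrep : ∀ w ∈ s, ∃ e ∈ D, k + 1 ∣ e - w ∧
      (w ≤ e ∧ e < q ∧ e + k + 1 ∈ Q ∨ q + k < e ∧ e ≤ w ∧ e - k - 1 ∈ Q) := by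
    intro w hw
    obtain ⟨hwD, -, -⟩ := hs w hw
    have hwn := hp.sub w hwD
    rcases lt_or_ge w q with hwq | hwq
    · obtain ⟨e, he, h1, h2, h3, h4, -⟩ := exists_last (by omega) hwD hwq hJ
      exact ⟨e, he, h3, Or.inl ⟨h1, h2, (hp.mem_or (by omega) (by omega)).resolve_left h4⟩⟩
    · have : q + k < w := by
        by_contra h
        exact hJ w hwq (by omega) hwD
      obtain ⟨e, he, h1, h2, h3, h4⟩ := exists_first (by omega) hwD this hJ
      exact ⟨e, he, h3, Or.inr ⟨h2, h1, (hp.mem_or (by omega) (by omega)).resolve_left h4⟩⟩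
  choose! ρ hρD hρc hρ using hrep
  -- By `span`, elements of the same type are less than `k` apart, and at this distance the element
  -- of `Q` next to one of them separates them.
  have key : ∀ w ∈ s, ∀ w' ∈ s, ρ w < ρ w' → ¬ Same k Q (ρ w) (ρ w') := by
    intro w hw w' hw' hlt hS
    have hd := hspan _ (hρD w hw) _ (hρD w' hw') hlt hS
    rcases hρ w hw with ⟨-, h1, h2⟩ | ⟨h1, -, -⟩
    · exact not_same_of_right h2 (by omega) (by omega) (by omega) hS
    · rcases hρ w' hw' with ⟨-, h3, -⟩ | ⟨-, -, h3⟩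
      · omega
      · exact not_same_of_left h3 (by omega) (by omega) (by omega) hS
  have inj : ∀ w ∈ s, ∀ w' ∈ s, ρ w = ρ w' → w = w' := by
    intro w hw w' hw' h
    have h1 := dvd_sub (hρc w' hw') (hρc w hw)
    rw [h, sub_sub_sub_cancel_left] at h1
    exact eq_of_column h1 (hs w hw).2.1 (hs w hw).2.2 (hs w' hw').2.1 (hs w' hw').2.2
  refine ⟨s.image ρ, Finset.card_image_of_injOn fun w hw w' hw' h => inj w hw w' hw' h, ?_, ?_⟩
  · intro e he
    obtain ⟨w, hw, rfl⟩ := Finset.mem_image.1 he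
    refine ⟨hρD w hw, w, hw, ?_⟩
    rcases hρ w hw with ⟨h1, h2, -⟩ | ⟨h1, h2, -⟩
    · exact Or.inl ⟨h1, h2⟩
    · exact Or.inr ⟨h1, h2⟩
  · intro u hu v hv hS
    obtain ⟨w, hw, rfl⟩ := Finset.mem_image.1 hu
    obtain ⟨w', hw', rfl⟩ := Finset.mem_image.1 hv
    rcases lt_trichotomy (ρ w) (ρ w') with h | h | h
    · exact absurd hS (key w hw w' hw' h)
    · exact h
    · exact absurd hS.symm (key w' hw' w hw h)

/-- A set with a window and a missed window has many types. -/
theorem Core.indep_of_windows_left (hp : Core k n D Q) (ha : 1 ≤ a)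
    (haD : ∀ p, a ≤ p → p ≤ a + k → p ∈ D) (hqn : q + k ≤ n)
    (hJ : ∀ p, q ≤ p → p ≤ q + k → p ∉ D) (haq : a < q) : Indep k D Q (k + 1) 1 n := by
  have hk := hp.hk
  have haq' : a + k < q := by
    by_contra h
    exact hJ q le_rfl (by omega) (haD q haq.le (by omega))
  have hrep : ∀ w, a ≤ w → w ≤ a + k → ∃ e ∈ D, w ≤ e ∧ e < q ∧ k + 1 ∣ e - w ∧ e + k + 1 ∉ D ∧
      ∀ y ∈ D, y < q → k + 1 ∣ y - w → y ≤ e := fun w h1 h2 =>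
    exists_last (by omega) (haD w h1 h2) (by omega) hJ
  choose! ρ h1 h2 h3 h4 h5 h6 using hrep
  have key : ∀ w, a ≤ w → w ≤ a + k → ∀ w', a ≤ w' → w' ≤ a + k → ρ w < ρ w' →
      ¬ Same k Q (ρ w) (ρ w') := by
    intro w hw hwa w' hw' hwa' hlt hS
    have e1 := h2 w hw hwa
    have e2 := h3 w' hw' hwa'
    by_cases hd : ρ w' ≤ ρ w + 2 * k + 1
    · exact not_same_of_right ((hp.mem_or (by omega) (by omega)).resolve_left (h5 w hw hwa))
        (by omega) (by omega) (by omega) hS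
    -- Here no bound on the distance is known. Two representatives far apart are separated by an
    -- element of the column of `w` near the second one: it is not in `D`, because `ρ w` was the
    -- last in its column.
    obtain ⟨y, hy1, hy2, hy3⟩ := exists_column (by omega : 0 ≤ k) w (ρ w')
    by_cases hyD : y ∈ D
    · have hyq : y < q := by
        by_contra h
        exact hJ y (by omega) (by omega) hyD
      have := h6 w hw hwa y hyD hyq hy3
      omega
    · exact not_same_of_right ((hp.mem_or (by omega) (by omega)).resolve_left hyD)
        (by omega) (by omega) (by omega) hS
  refine indep_of_fun (fun i => ρ (a + i)) (by omega) (fun i hi hik => ?_) fun i j hi hij hj hS => ?_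
  · exact ⟨h1 _ (by omega) (by omega), hp.sub _ (h1 _ (by omega) (by omega))⟩
  · rcases lt_trichotomy (ρ (a + i)) (ρ (a + j)) with h | h | h
    · exact key _ (by omega) (by omega) _ (by omega) (by omega) h hS
    · have e1 := dvd_sub (h4 (a + j) (by omega) (by omega)) (h4 (a + i) (by omega) (by omega))
      rw [h, sub_sub_sub_cancel_left] at e1
      have := eq_of_column (a := a) e1 (by omega) (by omega) (by omega) (by omega)
      omega
    · exact key _ (by omega) (by omega) _ (by omega) (by omega) h hS.symm

theorem Core.indep_of_windows (hp : Core k n D Q) (ha : 1 ≤ a) (han : a + k ≤ n)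
    (haD : ∀ p, a ≤ p → p ≤ a + k → p ∈ D) (hq : 1 ≤ q) (hqn : q + k ≤ n)
    (hJ : ∀ p, q ≤ p → p ≤ q + k → p ∉ D) : Indep k D Q (k + 1) 1 n := by
  have hk := hp.hk
  rcases lt_trichotomy a q with h | h | h
  · exact hp.indep_of_windows_left ha haD hqn hJ h
  · exact absurd (haD a le_rfl (by omega)) (hJ a (by omega) (by omega))
  · exact (hp.mir.indep_of_windows_left (a := n + 1 - a - k) (q := n + 1 - q - k) (by omega)
      (fun p h1 h2 => haD _ (by omega) (by omega)) (by omega)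
      (fun p h1 h2 => hJ _ (by omega) (by omega)) (by omega)).of_mir

/-- Two disjoint sets without full windows whose union has one. -/
structure Split (k n : ℤ) (A B C : Set ℤ) : Prop where
  hk : 3 ≤ k
  hn : n = k * k + 1
  subA : ∀ p ∈ A, 1 ≤ p ∧ p ≤ n
  subB : ∀ p ∈ B, 1 ≤ p ∧ p ≤ n
  cover : ∀ p, 1 ≤ p → p ≤ n → p ∈ A ∨ p ∈ B ∨ p ∈ C
  AB : ∀ p ∈ A, p ∉ B
  AC : ∀ p ∈ A, p ∉ C
  BC : ∀ p ∈ B, p ∉ C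
  meetsA : Meets k n (B ∪ C)
  meetsB : Meets k n (A ∪ C)
  window : ∃ a, 1 ≤ a ∧ a + k ≤ n ∧ ∀ p, a ≤ p → p ≤ a + k → p ∈ A ∪ B

namespace Split

theorem symm (h : Split k n A B C) : Split k n B A C where
  hk := h.hk
  hn := h.hn
  subA := h.subB
  subB := h.subA
  cover p h1 h2 := by have := h.cover p h1 h2; tauto
  AB p h1 h2 := h.AB p h2 h1
  AC := h.BC
  BC := h.AC
  meetsA := h.meetsB
  meetsB := h.meetsA
  window := by rw [Set.union_comm]; exact h.window

theorem mir (h : Split k n A B C) : Split k n (mir n A) (mir n B) (mir n C) where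
  hk := h.hk
  hn := h.hn
  subA p hp := by have := h.subA _ hp; omega
  subB p hp := by have := h.subB _ hp; omega
  cover p h1 h2 := h.cover _ (by omega) (by omega)
  AB p := h.AB _
  AC p := h.AC _
  BC p := h.BC _
  meetsA := h.meetsA.mir
  meetsB := h.meetsB.mir
  window := by
    obtain ⟨a, h1, h2, h3⟩ := h.window
    exact ⟨n + 1 - a - k, by omega, by omega, fun p h4 h5 => h3 _ (by omega) (by omega)⟩

theorem coreA (h : Split k n A B C) : Core k n A (B ∪ C) where
  hk := h.hk
  hn := h.hn
  sub := h.subA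
  cover p h1 h2 := by
    have := h.cover p h1 h2
    have := h.AB p
    have := h.AC p
    rw [Set.mem_union]
    tauto

theorem coreB (h : Split k n A B C) : Core k n B (A ∪ C) := h.symm.coreA

theorem coreT (h : Split k n A B C) : Core k n (A ∪ B) C where
  hk := h.hk
  hn := h.hn
  sub p hp := hp.elim (h.subA p) (h.subB p)
  cover p h1 h2 := by
    have := h.cover p h1 h2
    have := h.AC p
    have := h.BC p
    rw [Set.mem_union]
    tauto

/-- If both sets miss a window, then there are `k + 1` representatives. -/
theorem exists_reps (h : Split k n A B C) (hq : 1 ≤ q) (hqn : q + k ≤ n)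
    (hJ : ∀ p, q ≤ p → p ≤ q + k → p ∉ A) (hB : ¬ Meets k n B)
    (haT : ∀ p, a ≤ p → p ≤ a + k → p ∈ A ∪ B) :
    ∃ (m' : ℤ) (r : Finset ℤ), Indep k B (A ∪ C) m' 1 n ∧ k + 1 ≤ r.card + m' ∧
      (∀ e ∈ r, e ∈ A ∧ ∃ w, a ≤ w ∧ w ≤ a + k ∧ (w ≤ e ∧ e < q ∨ q + k < e ∧ e ≤ w)) ∧
      ∀ u ∈ r, ∀ v ∈ r, Same k (B ∪ C) u v → u = v := by
  classical
  unfold Meets at hB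
  push Not at hB
  obtain ⟨q', hq', hqn', hJ'⟩ := hB
  obtain ⟨r, hr, hr1, hr2⟩ := h.coreA.reps h.meetsA hq hqn hJ a
    ((Finset.Icc a (a + k)).filter (· ∈ A))
    (fun w hw => by rw [Finset.mem_filter, Finset.mem_Icc] at hw; exact ⟨hw.2, hw.1⟩)
  obtain ⟨r', hr', hr1', hr2'⟩ := h.coreB.reps h.meetsB hq' hqn'
    (fun p h1 h2 hp => by have := hJ' p hp h1; omega) a ((Finset.Icc a (a + k)).filter (· ∉ A))
    (fun w hw => by
      rw [Finset.mem_filter, Finset.mem_Icc] at hw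
      exact ⟨(haT w hw.1.1 hw.1.2).resolve_left hw.2, hw.1⟩)
  refine ⟨r'.card, r, ⟨r', rfl, fun u hu => ⟨(hr1' u hu).1, h.subB u (hr1' u hu).1⟩, hr2'⟩, ?_,
    fun e he => ⟨(hr1 e he).1, ?_⟩, hr2⟩
  -- The `k + 1` elements of the full window are divided between the two sets, and each has its own
  -- representative.
  · have := Finset.card_filter_add_card_filter_not (s := Finset.Icc a (a + k)) (· ∈ A)
    rw [← hr, ← hr', Int.card_Icc] at this
    have hk := h.hk
    omega
  · obtain ⟨-, w, hw, hwe⟩ := hr1 e he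
    rw [Finset.mem_filter, Finset.mem_Icc] at hw
    exact ⟨w, hw.1.1, hw.1.2, hwe⟩

/-- If both sets miss a window, then they have together at least `k + 1` types. -/
theorem exists_indep (h : Split k n A B C) (hA : ¬ Meets k n A) (hB : ¬ Meets k n B) :
    ∃ m m', Indep k A (B ∪ C) m 1 n ∧ Indep k B (A ∪ C) m' 1 n ∧ k + 1 ≤ m + m' := by
  unfold Meets at hA
  push Not at hA
  obtain ⟨q, hq, hqn, hJ⟩ := hA
  obtain ⟨a, ha, han, haT⟩ := h.window
  obtain ⟨m', r, h1, h2, h3, h4⟩ := h.exists_reps hq hqn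
    (fun p h1 h2 hp => by have := hJ p hp h1; omega) hB haT
  exact ⟨r.card, m', ⟨r, rfl, fun u hu => ⟨(h3 u hu).1, h.subA u (h3 u hu).1⟩, h4⟩, h1, h2⟩

/-- Next to such an element there is room for `i` windows on the left and `k - 1 - i` on the right,
each with a new type. -/
theorem indep_of_pair (h : Split k n A B C) (hA : Meets k n A) (h0 : 0 ≤ i) (hik : i ≤ k - 1)
    (hy : y = row k i + 1 ∨ y = row k i + 2) (hyA : y ∈ A) : Indep k A (B ∪ C) k 1 n := by
  have hk := h.hk
  have hl := h.coreA.row_last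
  have hr : row k (k - 1 - i) = row k (k - 1) - row k i := row_sub _ _ _
  have hi0 := row_le (by omega : 0 ≤ k) h0
  have hil := row_le (by omega : 0 ≤ k) hik
  rw [row_zero] at hi0
  have := h.coreA.grow_all ((h.coreA.span h.meetsA).mono (by omega)) hA (indep_one hyA) (i := i)
    (j := k - 1 - i) h0 (by omega) (by omega) (by omega) (by omega) (by omega) (by omega)
  rwa [show 1 + i + (k - 1 - i) = k by ring] at this

theorem indep_of_meets (h : Split k n A B C) (hA : Meets k n A) :
    Indep k A (B ∪ C) (k - 1) 1 n := by
  have hk := h.hk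
  have hl := h.coreA.row_last
  have hn := h.coreA.le_n
  have := h.coreA.grow_all ((h.coreA.span h.meetsA).mono (by omega)) hA (indep_zero k A (B ∪ C) 1 0)
    (i := 0) (j := k - 1) le_rfl (by omega) (by rw [row_zero]; omega) (by omega) (by omega)
    (by omega) (by omega)
  rwa [show 0 + 0 + (k - 1) = k - 1 by ring] at this

/-- If `u < v` had the same type, then `u - k` or `v + k` would be in `B` as well. With only one
type in `B` this contradicts the bound `k - 1` on distances. -/
theorem eq_of_one_type (h : Split k n A B C) (hB : ∀ m, Indep k B (A ∪ C) m 1 n → m ≤ 1)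
    (hu : u ∈ B) (hv : v ∈ B) : u = v := by
  have hk := h.hk
  have hn := h.coreA.le_n
  have hs := h.coreB.span h.meetsB
  have same : ∀ u ∈ B, ∀ v ∈ B, u < v → Same k (A ∪ C) u v := by
    intro u hu v hv huv
    by_contra hS
    have h1 := h.subB u hu
    have h2 := h.subB v hv
    have := hB _ ((indep_two hu hv huv hS).mono h1.1 h2.2)
    omega
  suffices H : ∀ u ∈ B, ∀ v ∈ B, u < v → False by
    rcases lt_trichotomy u v with h | h | h
    · exact (H u hu v hv h).elim
    · exact h
    · exact (H v hv u hu h).elim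
  intro u hu v hv huv
  have hS := same u hu v hv huv
  have hd := hs u hu v hv huv hS
  have hu' := h.subB u hu
  have hv' := h.subB v hv
  by_cases h1 : k + 1 ≤ u
  · have hx := h.coreB.mem_left hS (x := u - k) le_rfl (by omega) (by omega) (by omega) (by omega)
    have := hs _ hx v hv (by omega) (same _ hx v hv (by omega))
    omega
  · have hx := h.coreB.mem_right hS (x := v + k) (by omega) le_rfl (by omega) (by omega) (by omega)
    have := hs u hu _ hx (by omega) (same u hu _ hx (by omega))
    omega

/-- A window contains two elements next to the ends of the rows. -/
theorem exists_pair_of_window (hk : 3 ≤ k) (hn : n = k * k + 1) (ha : 1 ≤ a) (han : a + k ≤ n) :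
    ∃ j y z, 0 ≤ j ∧ a ≤ y ∧ z ≤ a + k ∧ (y = row k j + 1 ∧ z = row k j + 2 ∧ j ≤ k - 1 ∨
      y = row k j + 2 ∧ z = row k (j + 1) + 1 ∧ j + 1 ≤ k - 1) := by
  have hk0 : 0 ≤ k := by omega
  have hl : row k (k - 1) = n - 2 := by rw [hn]; unfold row; ring
  obtain ⟨j, hj1, hj2⟩ := exists_row hk0 (a + k - 2)
  have hj0 : 0 ≤ j := by
    by_contra hj
    have := row_lt hk0 (by omega : j < 0)
    rw [row_zero] at this
    omega
  have hjk : j ≤ k - 1 := by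
    by_contra hj
    have := row_lt hk0 (by omega : k - 1 < j)
    omega
  have hs := row_succ k j
  by_cases hja : a ≤ row k j + 1
  · exact ⟨j, _, _, hj0, hja, by omega, Or.inl ⟨rfl, rfl, hjk⟩⟩
  · refine ⟨j, _, _, hj0, (by omega : a ≤ row k j + 2), (by omega : row k (j + 1) + 1 ≤ a + k),
      Or.inr ⟨rfl, rfl, ?_⟩⟩
    by_contra hj
    obtain rfl : j = k - 1 := by omega
    omega

/-- The sets have together at least `k + 1` types. -/
theorem false_of_cost (h : Split k n A B C) (hcost : ∀ m m', Indep k A (B ∪ C) m 1 n →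
    Indep k B (A ∪ C) m' 1 n → m + m' ≤ k) : False := by
  have hk := h.hk
  -- Suppose that `A` meets every window. An element of `A` next to the end of a row would give `A`
  -- already `k` types, and `B` is not empty. So the two such elements of the full window belong to
  -- `B`; but `A` has at least `k - 1` types, which leaves one for `B`, and `B` would be a
  -- singleton.
  have main : ∀ A B, Split k n A B C → (∀ m m', Indep k A (B ∪ C) m 1 n →
      Indep k B (A ∪ C) m' 1 n → m + m' ≤ k) → ¬ Meets k n A := by
    intro A B h hcost hA
    obtain ⟨a, ha, han, haT⟩ := h.window
    obtain ⟨j, y, z, hj0, hay, hza, hyz⟩ := exists_pair_of_window h.hk h.hn ha han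
    have hs := row_succ k j
    have hB : ∀ i w, 0 ≤ i → i ≤ k - 1 → (w = row k i + 1 ∨ w = row k i + 2) → a ≤ w → w ≤ a + k →
        w ∈ B := by
      intro i w h0 hi hw h1 h2
      rcases haT w h1 h2 with hwA | hwB
      · exfalso
        have hBz : ∀ b ∈ B, False := fun b hb => by
          have := hcost k 1 (h.indep_of_pair hA h0 hi hw hwA)
            ((indep_one hb).mono (h.subB b hb).1 (h.subB b hb).2)
          omega
        obtain ⟨p, hp, h3, h4⟩ := h.meetsA a ha han
        rcases hp with hp | hp
        · exact hBz p hp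
        · rcases haT p h3 h4 with hp' | hp'
          · exact h.AC p hp' hp
          · exact hBz p hp'
      · exact hwB
    have hyB : y ∈ B := by
      rcases hyz with ⟨h1, h2, h3⟩ | ⟨h1, h2, h3⟩
      · exact hB j y hj0 h3 (Or.inl h1) hay (by omega)
      · exact hB j y hj0 (by omega) (Or.inr h1) hay (by omega)
    have hzB : z ∈ B := by
      rcases hyz with ⟨h1, h2, h3⟩ | ⟨h1, h2, h3⟩
      · exact hB j z hj0 h3 (Or.inr h2) (by omega) hza
      · exact hB (j + 1) z (by omega) h3 (Or.inl h2) (by omega) hza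
    have := h.eq_of_one_type (fun m hm => by
      have := hcost _ m (h.indep_of_meets hA) hm
      omega) hyB hzB
    omega
  obtain ⟨m, m', h1, h2, h3⟩ := h.exists_indep (main A B h hcost)
    (main B A h.symm fun m m' h1 h2 => by have := hcost m' m h2 h1; omega)
  have := hcost m m' h1 h2
  omega

end Split

end Line

/-! ### Possible unions that complete a window: the union has `k + 1` types -/

namespace Line

variable {k n m a b q u v w x y z i j d β γ : ℤ} {A B C D Q T : Set ℤ}

/-- Every element of `T` has a neighbour in `C`. -/
def Alive (k : ℤ) (T C : Set ℤ) : Prop := ∀ z ∈ T, ∃ c ∈ C, z - k ≤ c ∧ c ≤ z + k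

/-- A union that is possible with `k + 1` labels. -/
structure Joined (k n : ℤ) (A B C : Set ℤ) : Prop extends Split k n A B C where
  left : 1 - k ∈ C
  right : n + k ∈ C
  cost : ∀ m m', Indep k A (B ∪ C) m 1 n → Indep k B (A ∪ C) m' 1 n → m + m' ≤ k + 1

namespace Joined

theorem symm (h : Joined k n A B C) : Joined k n B A C where
  toSplit := h.toSplit.symm
  left := h.left
  right := h.right
  cost m m' h1 h2 := by have := h.cost m' m h2 h1; omega

theorem mir (h : Joined k n A B C) : Joined k n (mir n A) (mir n B) (mir n C) where
  toSplit := h.toSplit.mir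
  left := by rw [mem_mir]; convert h.right using 1; ring
  right := by rw [mem_mir]; convert h.left using 1; ring
  cost m m' h1 h2 := h.cost m m' h1.of_mir h2.of_mir

theorem partA (h : Joined k n A B C) : Part k n A (B ∪ C) where
  toCore := h.coreA
  left := Or.inr h.left
  right := Or.inr h.right

theorem partT (h : Joined k n A B C) : Part k n (A ∪ B) C where
  toCore := h.coreT
  left := h.left
  right := h.right

/-- Every element has the type of a representative. -/
theorem exists_rep (h : Joined k n A B C) (hq : 1 ≤ q) (hqn : q + k ≤ n)
    (hJ : ∀ p, q ≤ p → p ≤ q + k → p ∉ A) (hB : ¬ Meets k n B)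
    (haT : ∀ p, a ≤ p → p ≤ a + k → p ∈ A ∪ B) (hd : d ∈ A) :
    ∃ e ∈ A, Same k (B ∪ C) d e ∧
      ∃ w, a ≤ w ∧ w ≤ a + k ∧ (w ≤ e ∧ e < q ∨ q + k < e ∧ e ≤ w) := by
  classical
  obtain ⟨m', r, h1, h2, h3, h4⟩ := h.exists_reps hq hqn hJ hB haT
  by_contra hne
  have hne' : ∀ e ∈ r, ¬ Same k (B ∪ C) d e := fun e he hS =>
    hne ⟨e, (h3 e he).1, hS, (h3 e he).2⟩
  have hdr : d ∉ r := fun hdr => hne' d hdr Same.rfl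
  -- Together with the types of `B`, the representatives exhaust the `k + 1` labels, so there is no
  -- room for another type.
  have : Indep k A (B ∪ C) (r.card + 1) 1 n := by
    refine ⟨insert d r, by rw [Finset.card_insert_of_notMem hdr]; push_cast; omega, ?_, ?_⟩
    · intro u hu
      rcases Finset.mem_insert.1 hu with rfl | hu
      · exact ⟨hd, h.subA _ hd⟩
      · exact ⟨(h3 u hu).1, h.subA _ (h3 u hu).1⟩
    · intro u hu v hv huv
      rcases Finset.mem_insert.1 hu with hu' | hu' <;> rcases Finset.mem_insert.1 hv with hv' | hv'
      · rw [hu', hv']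
      · rw [hu'] at huv
        exact absurd huv (hne' v hv')
      · rw [hv'] at huv
        exact absurd huv.symm (hne' u hu')
      · exact h4 u hu' v hv' huv
  have := h.cost _ _ this h1
  omega

/-- If `z` had no neighbour in `C`, then `[z, z + k]` would be a full window, and `z - k` or `1`
would be in the union, to the left of it. By `exists_rep` that element has the type of one at or
beyond `z`: too far from `z - k`, and `1 - k` separates `1` from everything further right. -/
theorem not_dead_left (h : Joined k n A B C) (hq : 1 ≤ q) (hqn : q + k ≤ n)
    (hJ : ∀ p, q ≤ p → p ≤ q + k → p ∉ A ∪ B) (hz : z ∈ A ∪ B) (hzq : z < q) :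
    ∃ c ∈ C, z - k ≤ c ∧ c ≤ z + k := by
  by_contra hdead
  push Not at hdead
  have hk := h.hk
  have hz1 := h.coreT.sub z hz
  have hqC : q ∈ C := (h.coreT.mem_or hq (by omega)).resolve_left (hJ q le_rfl (by omega))
  have hzk : z + k < q := by
    have := hdead q hqC (by omega)
    omega
  have hzT : ∀ p, 1 ≤ p → z - k ≤ p → p ≤ z + k → p ∈ A ∪ B := fun p h1 h2 h3 =>
    (h.coreT.mem_or h1 (by omega)).resolve_right fun hp => by have := hdead p hp h2; omega
  have key : ∀ A B, Joined k n A B C → (∀ p, q ≤ p → p ≤ q + k → p ∉ A ∪ B) →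
      (∀ p, z ≤ p → p ≤ z + k → p ∈ A ∪ B) →
      ∀ d ∈ A, d < z → (d = z - k ∨ d = 1) → False := by
    intro A B h hJ hzT d hd hdz hd'
    obtain ⟨e, he, hS, w, hw1, hw2, hwe⟩ := h.exists_rep hq hqn
      (fun p h1 h2 hp => hJ p h1 h2 (Or.inl hp))
      (fun hm => by
        obtain ⟨p, hp, h1, h2⟩ := hm q hq hqn
        exact hJ p h1 h2 (Or.inr hp)) hzT hd
    rcases hd' with rfl | rfl
    · have := h.coreA.span h.meetsA _ hd e he (by omega) hS
      omega
    · exact h.partA.not_same_one (by omega) hS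
  have hJ' : ∀ p, q ≤ p → p ≤ q + k → p ∉ B ∪ A := by rwa [Set.union_comm]
  have hzne : z ≠ 1 := by
    rintro rfl
    have := hdead _ h.left (by omega)
    omega
  obtain ⟨d, hd, hdz, hd'⟩ : ∃ d ∈ A ∪ B, d < z ∧ (d = z - k ∨ d = 1) := by
    by_cases h1 : 1 ≤ z - k
    · exact ⟨_, hzT _ h1 le_rfl (by omega), by omega, Or.inl rfl⟩
    · exact ⟨_, hzT 1 le_rfl (by omega) (by omega), by omega, Or.inr rfl⟩
  rcases hd with hd | hd
  · exact key A B h hJ (fun p h1 h2 => hzT p (by omega) (by omega) h2) d hd hdz hd'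
  · exact key B A h.symm hJ'
      (fun p h1 h2 => by rw [Set.union_comm]; exact hzT p (by omega) (by omega) h2) d hd hdz hd'

/-- If a window lies outside, then there are many types, and every element has a neighbour
outside. -/
theorem of_not_meets (h : Joined k n A B C) (hT : ¬ Meets k n (A ∪ B)) :
    Indep k (A ∪ B) C (k + 1) 1 n ∧ Alive k (A ∪ B) C := by
  have hk := h.hk
  unfold Meets at hT
  push Not at hT
  obtain ⟨q, hq, hqn, hJ⟩ := hT
  have hJ' : ∀ p, q ≤ p → p ≤ q + k → p ∉ A ∪ B := fun p h1 h2 hp => by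
    have := hJ p hp h1; omega
  obtain ⟨a, ha, han, haT⟩ := h.window
  refine ⟨h.coreT.indep_of_windows ha han haT hq hqn hJ', fun z hz => ?_⟩
  rcases lt_trichotomy z q with hzq | hzq | hzq
  · exact h.not_dead_left hq hqn hJ' hz hzq
  · exact absurd hz (hJ' z (by omega) (by omega))
  · have hzq' : q + k < z := by
      by_contra hc
      exact hJ' z (by omega) (by omega) hz
    obtain ⟨c, hc, h1, h2⟩ := h.mir.not_dead_left (q := n + 1 - q - k) (z := n + 1 - z) (by omega)
      (by omega) (fun p h1 h2 hp => hJ' (n + 1 - p) (by omega) (by omega) hp)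
      (by rw [← mir_union, mem_mir]; simpa using hz) (by omega)
    exact ⟨_, hc, by omega, by omega⟩

/-- If `a > k + 1`, some element `d ≤ k + 1` of `A`, say, has the type of a representative at or
beyond `a`. This puts `a - k - 1` into `A`, whose own representative is more than `k` away. -/
theorem window_le (h : Joined k n A B C) (hA : ¬ Meets k n A) (hB : ¬ Meets k n B)
    (hT : Meets k n (A ∪ B)) (haT : ∀ p, a ≤ p → p ≤ a + k → p ∈ A ∪ B) : a ≤ k + 1 := by
  by_contra ha
  have hk := h.hk
  have hn := h.coreT.le_n
  have key : ∀ A B, Joined k n A B C → ¬ Meets k n A → ¬ Meets k n B →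
      (∀ p, a ≤ p → p ≤ a + k → p ∈ A ∪ B) → ∀ d ∈ A, d ≤ k + 1 → False := by
    intro A B h hA hB haT d hd hdk
    unfold Meets at hA
    push Not at hA
    obtain ⟨q, hq, hqn, hJ⟩ := hA
    have hJ' : ∀ p, q ≤ p → p ≤ q + k → p ∉ A := fun p h1 h2 hp => by
      have := hJ p hp h1; omega
    have hspan := h.coreA.span h.meetsA
    have hd1 := h.subA d hd
    have hdq : d < q := by
      by_contra hc
      exact hJ' d (by omega) (by omega) hd
    obtain ⟨e, he, hS, w, hw1, hw2, hwe⟩ := h.exists_rep hq hqn hJ' hB haT hd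
    have hde := hspan d hd e he (by omega) hS
    have hx := h.coreA.mem_left hS (x := a - k - 1) (by omega) (by omega) (by omega) (by omega)
      (by omega)
    obtain ⟨e', he', hS', w', hw1', hw2', hwe'⟩ := h.exists_rep hq hqn hJ' hB haT hx
    have := hspan _ hx e' he' (by omega) hS'
    omega
  obtain ⟨d, hd, h1, h2⟩ := hT 1 le_rfl (by omega)
  rcases hd with hd | hd
  · exact key A B h hA hB haT d hd (by omega)
  · exact key B A h.symm hB hA (by rwa [Set.union_comm]) d hd (by omega)

/-- The representative of `2` could only be `4`. Then `7`, close to `4` but not to `2`, would be in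
`A`, although it lies in the window that `A` misses. -/
theorem two_notMem (h : Joined 3 10 A B C) (hA : ¬ Meets 3 10 A) (hB : ¬ Meets 3 10 B)
    (haT : ∀ p, 4 ≤ p → p ≤ 4 + 3 → p ∈ A ∪ B) : 2 ∉ A := by
  intro h2
  unfold Meets at hA
  push Not at hA
  obtain ⟨q, hq, hqn, hJ⟩ := hA
  have hJ' : ∀ p, q ≤ p → p ≤ q + 3 → p ∉ A := fun p h1 h2 hp => by
    have := hJ p hp h1; omega
  have hq2 : 3 ≤ q := by
    by_contra hc
    exact hJ' 2 (by omega) (by omega) h2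
  obtain ⟨e, he, hS, w, hw1, hw2, hwe⟩ := h.exists_rep hq hqn hJ' hB haT h2
  have hde := h.coreA.span h.meetsA 2 h2 e he (by omega) hS
  obtain rfl : e = 4 := by omega
  exact hJ' 7 (by omega) (by omega) (h.coreA.mem_right hS (by omega) (by omega) (by omega)
    (by omega) (by omega))

/-- Every full window starts between `n - 2k` and `k + 1`, by `window_le` and its mirror image. So
`n ≤ 3k + 1`, that is `k = 3` and `n = 10`, with the window `[4, 7]`. The elements `2, 3, 8` of `C`
separate its four elements. -/
theorem of_meets_union (h : Joined k n A B C) (hA : ¬ Meets k n A) (hB : ¬ Meets k n B)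
    (hT : Meets k n (A ∪ B)) : Indep k (A ∪ B) C (k + 1) 1 n ∧ Alive k (A ∪ B) C := by
  obtain ⟨a, ha, han, haT⟩ := h.window
  have bound : ∀ a, 1 ≤ a → a + k ≤ n → (∀ p, a ≤ p → p ≤ a + k → p ∈ A ∪ B) →
      a ≤ k + 1 ∧ n - 2 * k ≤ a := by
    intro a ha han haT
    refine ⟨h.window_le hA hB hT haT, ?_⟩
    have := h.mir.window_le (a := n + 1 - a - k) (fun hm => hA ?_) (fun hm => hB ?_)
      (by rw [← mir_union]; exact hT.mir) (fun p h1 h2 => haT (n + 1 - p) (by omega) (by omega))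
    · omega
    · have := hm.mir; rwa [mir_mir] at this
    · have := hm.mir; rwa [mir_mir] at this
  have hb := bound a ha han haT
  have hk := h.hk
  have hn := h.hn
  have hk3 : k = 3 := by
    by_contra hk3
    have := mul_le_mul_of_nonneg_right (by omega : 4 ≤ k) (by omega : 0 ≤ k)
    omega
  obtain rfl := hk3
  obtain rfl : n = 10 := by omega
  obtain rfl : a = 4 := by omega
  have h3 : 3 ∈ C := (h.coreT.mem_or (by norm_num) (by norm_num)).resolve_left fun h3 => by
    have := bound 3 (by norm_num) (by norm_num) fun p hp hp' => by
      by_cases hp3 : p = 3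
      · exact hp3 ▸ h3
      · exact haT p (by omega) (by omega)
    omega
  have h8 : 8 ∈ C := (h.coreT.mem_or (by norm_num) (by norm_num)).resolve_left fun h8 => by
    have := bound 5 (by norm_num) (by norm_num) fun p hp hp' => by
      by_cases hp8 : p = 8
      · exact hp8 ▸ h8
      · exact haT p (by omega) (by omega)
    omega
  have h2 : 2 ∈ C := (h.coreT.mem_or (by norm_num) (by norm_num)).resolve_left fun h2 => by
    rcases h2 with h2 | h2
    · exact h.two_notMem hA hB haT h2
    · exact h.symm.two_notMem hB hA (by rwa [Set.union_comm]) h2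
  refine ⟨indep_of_fun (fun i => 4 + i) (by norm_num)
    (fun i hi hi' => ⟨haT _ (by omega) (by omega), by omega, by omega⟩) fun i j hi hij hj hS => ?_,
    fun z hz => ?_⟩
  · have := hS 2 h2
    have := hS 3 h3
    have := hS 8 h8
    omega
  · have hz1 := h.coreT.sub z hz
    have hzC : ∀ c ∈ C, z ≠ c := fun c hc hzc => by
      rcases hz with hz | hz
      · exact h.AC z hz (hzc ▸ hc)
      · exact h.BC z hz (hzc ▸ hc)
    have := hzC 2 h2
    have := hzC 3 h3
    have := hzC 8 h8
    by_cases z1 : z = 1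
    · exact ⟨_, h.left, by omega, by omega⟩
    by_cases z6 : z ≤ 6
    · exact ⟨_, h3, by omega, by omega⟩
    · exact ⟨_, h8, by omega, by omega⟩

end Joined

end Line

/-! ### Possible unions in which one operand meets every window -/

namespace Line

variable {k n m a b q u v w x y z i j d β γ : ℤ} {A B C D Q T : Set ℤ}

/-- The elements next to the ends of the rows. -/
def Border (k y : ℤ) : Prop := ∃ i, 0 ≤ i ∧ i ≤ k - 1 ∧ (y = row k i + 1 ∨ y = row k i + 2)

namespace Joined

/-- Border elements of the same type could only be `row k i + 1` and `row k i + 2`. The elements `k`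
before and `k` after the pair would then also be in `B`, and there would be three types. -/
theorem not_same_border (h : Joined k n A B C)
    (hB : ∀ m, Indep k B (A ∪ C) m 1 n → m ≤ 2) (hu : u ∈ B) (hv : v ∈ B) (hu' : Border k u)
    (hv' : Border k v) (huv : u < v) : ¬ Same k (A ∪ C) u v := by
  intro hS
  have hk := h.hk
  have hk0 : 0 ≤ k := by omega
  have hl := h.coreA.row_last
  have hspan := h.coreB.span h.meetsB
  have hd := hspan u hu v hv huv hS
  obtain ⟨i, hi0, hik, hiu⟩ := hu'
  obtain ⟨j, hj0, hjk, hjv⟩ := hv'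
  have hij : i = j := by
    rcases lt_trichotomy i j with hij | hij | hij
    · have := row_lt hk0 hij; omega
    · exact hij
    · have := row_lt hk0 hij; omega
  obtain rfl := hij
  obtain rfl : u = row k i + 1 := by omega
  obtain rfl : v = row k i + 2 := by omega
  have hi : i ≠ 0 := by
    rintro rfl
    rw [row_zero] at hS
    exact h.symm.partA.not_same_one (by omega) hS
  have hi' : i ≠ k - 1 := by
    rintro rfl
    rw [show row k (k - 1) + 2 = n by omega] at hS
    exact h.symm.partA.not_same_n (by omega) hS
  have h1 := row_le hk0 (by omega : 1 ≤ i)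
  rw [row_one] at h1
  have h2 := row_lt hk0 (by omega : i < k - 1)
  have hx := h.coreB.mem_left hS (x := row k i + 1 - k) le_rfl (by omega) (by omega) (by omega)
    (by omega)
  have hy := h.coreB.mem_right hS (x := row k i + 2 + k) (by omega) le_rfl (by omega) (by omega)
    (by omega)
  have := hB _ ((indep_three hx hu hy (by omega) (by omega)
    (fun hS => by have := hspan _ hx _ hu (by omega) hS; omega)
    (fun hS => by have := hspan _ hu _ hy (by omega) hS; omega)
    (fun hS => by have := hspan _ hx _ hy (by omega) hS; omega)).mono (a' := 1) (b' := n) (by omega)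
    (by omega))
  omega

/-- As `A` has at least `k - 1` types, `B` has at most two, hence at most two border elements; these
are the border elements `β, γ` of the full window, and all the others are in `C`. They separate `β`,
`γ` and one element `Y i` of `A` from each row. For a neighbour outside, note that `[z - k, z + k]`
always contains a third border element or an end mark. -/
theorem of_border (h : Joined k n A B C) (hA : Meets k n A) (hAb : ∀ y, Border k y → y ∉ A) :
    Indep k (A ∪ B) C (k + 1) 1 n ∧ Alive k (A ∪ B) C := by
  have hk := h.hk
  have hk0 : 0 ≤ k := by omega
  have hl := h.coreA.row_last
  have hB2 : ∀ m, Indep k B (A ∪ C) m 1 n → m ≤ 2 := fun m hm => by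
    have := h.cost _ m (h.indep_of_meets hA) hm
    omega
  have three : ∀ u ∈ B, ∀ v ∈ B, ∀ w ∈ B, Border k u → Border k v → Border k w → u < v → v < w →
      False := by
    intro u hu v hv w hw bu bv bw huv hvw
    have h1 := h.subB u hu
    have h2 := h.subB w hw
    have := hB2 _ ((indep_three hu hv hw huv hvw (h.not_same_border hB2 hu hv bu bv huv)
      (h.not_same_border hB2 hv hw bv bw hvw)
      (h.not_same_border hB2 hu hw bu bw (huv.trans hvw))).mono h1.1 h2.2)
    omega
  have hbn : ∀ y, Border k y → 1 ≤ y ∧ y ≤ n := by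
    rintro y ⟨i, h0, h1, h2⟩
    have h3 := row_le hk0 h0
    have h4 := row_le hk0 h1
    rw [row_zero] at h3
    omega
  obtain ⟨a, ha, han, haT⟩ := h.window
  obtain ⟨j, β, γ, hj0, hay, hza, hyz⟩ := Split.exists_pair_of_window h.hk h.hn ha han
  have hs := row_succ k j
  have bβ : Border k β := ⟨j, hj0, by omega, by omega⟩
  have bγ : Border k γ := by
    rcases hyz with h | h
    · exact ⟨j, hj0, by omega, by omega⟩
    · exact ⟨j + 1, by omega, by omega, by omega⟩
  have hβ : β ∈ B := (haT β hay (by omega)).resolve_left (hAb β bβ)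
  have hγ : γ ∈ B := (haT γ (by omega) hza).resolve_left (hAb γ bγ)
  have hβγ : β < γ := by omega
  have hC : ∀ y, Border k y → y ≠ β → y ≠ γ → y ∈ C := by
    intro y by' h1 h2
    rcases h.cover y (hbn y by').1 (hbn y by').2 with hy | hy | hy
    · exact absurd hy (hAb y by')
    · exfalso
      rcases lt_or_gt_of_ne h1 with h1 | h1
      · exact three y hy β hβ γ hγ by' bβ bγ h1 hβγ
      rcases lt_or_gt_of_ne h2 with h2 | h2
      · exact three β hβ y hy γ hγ bβ by' bγ h1 h2
      · exact three β hβ γ hγ y hy bβ bγ by' hβγ h2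
    · exact hy
  have hY : ∀ i, 1 ≤ i → i ≤ k - 1 → ∃ y ∈ A, row k i - k + 2 ≤ y ∧ y ≤ row k i := by
    intro i h1 h2
    have h3 := row_le hk0 h1
    have h4 := row_le hk0 h2
    rw [row_one] at h3
    have h5 := row_pred k i
    obtain ⟨y, hy, h6, h7⟩ := hA (row k i - k + 1) (by omega) (by omega)
    have n1 : y ≠ row k (i - 1) + 2 := fun e => hAb y ⟨i - 1, by omega, by omega, Or.inr e⟩ hy
    have n2 : y ≠ row k i + 1 := fun e => hAb y ⟨i, by omega, by omega, Or.inl e⟩ hy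
    exact ⟨y, hy, by omega, by omega⟩
  choose! Y hYA hY1 hY2 using hY
  have low : ∀ i, 1 ≤ i → i ≤ k - 1 → row k i + 2 ≠ β → row k i + 2 ≠ γ → row k i + 2 ∈ C :=
    fun i h1 h2 => hC _ ⟨i, by omega, h2, Or.inr rfl⟩
  have high : ∀ i, 1 ≤ i → i ≤ k - 1 → row k (i - 1) + 1 ≠ β → row k (i - 1) + 1 ≠ γ →
      row k (i - 1) + 1 ∈ C := fun i h1 h2 => hC _ ⟨i - 1, by omega, by omega, Or.inl rfl⟩
  have rows : ∀ i, i < j ∧ row k i + k + 1 ≤ row k j ∨ i = j ∨ i = j + 1 ∨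
      j + 1 < i ∧ row k (j + 1) + k + 1 ≤ row k i := by
    intro i
    rcases lt_trichotomy i j with hij | hij | hij
    · exact Or.inl ⟨hij, row_lt hk0 hij⟩
    · exact Or.inr (Or.inl hij)
    · rcases eq_or_lt_of_le (by omega : j + 1 ≤ i) with hij | hij
      · exact Or.inr (Or.inr (Or.inl hij.symm))
      · exact Or.inr (Or.inr (Or.inr ⟨hij, row_lt hk0 hij⟩))
  have hYβ : ∀ i, 1 ≤ i → i ≤ k - 1 → ¬ Same k C β (Y i) := by
    intro i h1 h2 hS
    have h3 := hY1 i h1 h2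
    have h4 := hY2 i h1 h2
    have h5 := row_pred k i
    have h6 := low i h1 h2
    have h7 := high i h1 h2
    rcases rows i with hi | rfl | rfl | hi
    · have := hS _ (h7 (by omega) (by omega)); omega
    · have := hS _ (h7 (by omega) (by omega)); omega
    · have := hS _ (h6 (by omega) (by omega)); omega
    · have := hS _ (h6 (by omega) (by omega)); omega
  have hYγ : ∀ i, 1 ≤ i → i ≤ k - 1 → ¬ Same k C (Y i) γ := by
    intro i h1 h2 hS
    have h3 := hY1 i h1 h2
    have h4 := hY2 i h1 h2
    have h5 := row_pred k i
    have h6 := low i h1 h2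
    have h7 := high i h1 h2
    rcases rows i with hi | rfl | rfl | hi
    · have := hS _ (h7 (by omega) (by omega)); omega
    · have := hS _ (h7 (by omega) (by omega)); omega
    · rcases hyz with hc | hc
      · have := hS _ (h6 (by omega) (by omega)); omega
      · have := hS _ (h7 (by omega) (by omega)); omega
    · have := hS _ (h6 (by omega) (by omega)); omega
  have hYY : ∀ i i', 1 ≤ i → i < i' → i' ≤ k - 1 → ¬ Same k C (Y i) (Y i') := by
    intro i i' h1 h2 h3 hS
    have e1 := hY1 i h1 (by omega)
    have e2 := hY2 i h1 (by omega)
    have e3 := hY1 i' (by omega) h3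
    have e4 := hY2 i' (by omega) h3
    have e5 := row_pred k i
    have e6 := row_lt hk0 h2
    have e7 := high i h1 (by omega)
    have e8 := low i' (by omega) h3
    have e9 := row_le hk0 (by omega : i ≤ i' - 1)
    have e10 := row_pred k i'
    by_cases hc : row k (i - 1) + 1 ≠ β ∧ row k (i - 1) + 1 ≠ γ
    · have := hS _ (e7 hc.1 hc.2); omega
    · have := hS _ (e8 (by omega) (by omega)); omega
  have hββ : ¬ Same k C β γ := by
    intro hS
    rcases hyz with ⟨hc1, hc2, hc3⟩ | hc
    · by_cases hj : j = 0
      · obtain rfl := hj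
        rw [row_zero] at hc1 hc2
        rw [hc1] at hS
        exact h.partT.not_same_one (by omega) hS
      · have e5 := row_pred k j
        have := hS _ (hC (row k (j - 1) + 2) ⟨j - 1, by omega, by omega, Or.inr rfl⟩ (by omega)
          (by omega))
        omega
    · have := hS _ (hC (row k j + 1) ⟨j, by omega, by omega, Or.inl rfl⟩ (by omega) (by omega))
      omega
  refine ⟨indep_of_fun (fun i => if i = 0 then β else if i = k then γ else Y i) (by omega) ?_ ?_,
    fun z hz => ?_⟩
  · intro i hi hik
    have : (if i = 0 then β else if i = k then γ else Y i) ∈ A ∪ B := by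
      split_ifs with h3 h4
      · exact Or.inr hβ
      · exact Or.inr hγ
      · exact Or.inl (hYA i (by omega) (by omega))
    exact ⟨this, h.coreT.sub _ this⟩
  · intro i i' h0 hii h2
    have hi'0 : i' ≠ 0 := by omega
    have hik : i ≠ k := by omega
    simp only [hi'0, hik, if_false]
    split_ifs with h3 h4
    · exact hββ
    · exact hYβ i' (by omega) (by omega)
    · exact hYγ i (by omega) (by omega)
    · exact hYY i i' (by omega) hii (by omega)
  · by_contra hdead
    push Not at hdead
    have hz1 := h.coreT.sub z hz
    have hzβγ : ∀ y, Border k y → z - k ≤ y → y ≤ z + k → y = β ∨ y = γ := by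
      intro y by' h1 h2
      by_contra hc
      push Not at hc
      have := hdead y (hC y by' hc.1 hc.2) h1
      omega
    have z1 : z ≠ 1 := by
      rintro rfl
      have := hdead _ h.left (by omega)
      omega
    have zn : z ≠ n := by
      rintro rfl
      have := hdead _ h.right (by omega)
      omega
    obtain ⟨t, ht1, ht2⟩ := exists_row hk0 z
    have ht0 : 0 ≤ t := by
      by_contra hc
      have := row_lt hk0 (by omega : t < 0)
      rw [row_zero] at this
      omega
    have htk : t ≤ k - 1 := by
      by_contra hc
      have := row_lt hk0 (by omega : k - 1 < t)
      omega
    have c1 := hzβγ (row k t + 1) ⟨t, ht0, htk, Or.inl rfl⟩ (by omega) (by omega)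
    have c2 := hzβγ (row k t + 2) ⟨t, ht0, htk, Or.inr rfl⟩ (by omega) (by omega)
    by_cases hzt : z ≤ row k t + 1
    · have t0 : t ≠ 0 := by
        rintro rfl
        rw [row_zero] at hzt
        omega
      have := row_pred k t
      have c3 := hzβγ (row k (t - 1) + 2) ⟨t - 1, by omega, by omega, Or.inr rfl⟩ (by omega)
        (by omega)
      omega
    · have tk : t ≠ k - 1 := by
        rintro rfl
        have := row_le hk0 (le_refl (k - 1))
        omega
      have := row_succ k t
      have c3 := hzβγ (row k (t + 1) + 1) ⟨t + 1, by omega, by omega, Or.inl rfl⟩ (by omega)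
        (by omega)
      omega

/-- If one set meets every window and has many types, then the other set has one element. -/
theorem of_meets (h : Joined k n A B C) (hA : Meets k n A) (hAy : ∃ y ∈ A, Border k y) :
    Indep k (A ∪ B) C (k + 1) 1 n ∧ ∃ x, A ∪ B = insert x A ∧ B = {x} ∧ Near k n A (insert x C) x := by
  have hk := h.hk
  obtain ⟨y, hyA, i, h0, h1, h2⟩ := hAy
  have hAk := h.indep_of_pair hA h0 h1 h2 hyA
  have hB1 : ∀ m, Indep k B (A ∪ C) m 1 n → m ≤ 1 := fun m hm => by
    have := h.cost _ m hAk hm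
    omega
  obtain ⟨a, ha, han, haT⟩ := h.window
  obtain ⟨x, hx⟩ : ∃ x, x ∈ B := by
    obtain ⟨p, hp, h3, h4⟩ := h.meetsA a ha han
    rcases hp with hp | hp
    · exact ⟨p, hp⟩
    · exact ⟨p, (haT p h3 h4).resolve_left fun hpA => h.AC p hpA hp⟩
  have hBx : B = {x} := Set.eq_singleton_iff_unique_mem.2 ⟨hx, fun u hu => h.eq_of_one_type hB1 hu hx⟩
  have hT : A ∪ B = insert x A := by rw [hBx, Set.union_comm, Set.singleton_union]
  have hQ : B ∪ C = insert x C := by rw [hBx, Set.singleton_union]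
  have hx' := h.subB x hx
  have hnear : Near k n A (insert x C) x := by
    refine ⟨hQ ▸ h.partA, hA, hQ ▸ h.meetsA, Or.inl rfl, hx'.1, hx'.2, fun m hm => ?_,
      ⟨a, ha, han, fun p h1 h2 => hT ▸ haT p h1 h2⟩⟩
    rw [← hQ] at hm
    have := h.cost _ 1 hm ((indep_one hx).mono hx'.1 hx'.2)
    omega
  refine ⟨?_, x, hT, hBx, hnear⟩
  by_contra hind
  have hxC : insert x C \ {x} = C := by
    ext p
    have := h.BC p
    rw [hBx] at this
    simp only [Set.mem_sdiff, Set.mem_insert_iff, Set.mem_singleton_iff] at this ⊢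
    tauto
  -- If the union had at most `k` types, then `x` would complete a window without creating a type,
  -- which is the tight situation.
  refine Tight.false (x := x) (A := A) (Q := insert x C) ⟨hnear, fun m hm => ?_⟩
  rw [hxC, ← hT] at hm
  by_contra hmk
  obtain ⟨s, hs, hs1, hs2⟩ := hm
  obtain ⟨t, ht, htc⟩ := Finset.exists_subset_card_eq (s := s) (n := (k + 1).toNat) (by omega)
  exact hind ⟨t, by omega, fun u hu => hs1 u (ht hu), fun u hu v hv => hs2 u (ht hu) v (ht hv)⟩

/-- The union has many types, and every element has a neighbour outside, except when one element is
added to a set of few types. -/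
theorem main (h : Joined k n A B C) : Indep k (A ∪ B) C (k + 1) 1 n ∧ (Alive k (A ∪ B) C ∨
    ∃ D x, A ∪ B = insert x D ∧ Near k n D (insert x C) x) := by
  have key : ∀ A B, Joined k n A B C → Meets k n A → Indep k (A ∪ B) C (k + 1) 1 n ∧
      (Alive k (A ∪ B) C ∨ ∃ D x, A ∪ B = insert x D ∧ Near k n D (insert x C) x) := by
    intro A B h hA
    by_cases hAy : ∃ y ∈ A, Border k y
    · obtain ⟨h1, x, h2, -, h3⟩ := h.of_meets hA hAy
      exact ⟨h1, Or.inr ⟨A, x, h2, h3⟩⟩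
    · push Not at hAy
      have := h.of_border hA fun y by' hy => hAy y hy by'
      exact ⟨this.1, Or.inl this.2⟩
  by_cases hA : Meets k n A
  · exact key A B h hA
  by_cases hB : Meets k n B
  · have := key B A h.symm hB
    rwa [Set.union_comm] at this
  by_cases hT : Meets k n (A ∪ B)
  · have := h.of_meets_union hA hB hT
    exact ⟨this.1, Or.inl this.2⟩
  · have := h.of_not_meets hT
    exact ⟨this.1, Or.inl this.2⟩

end Joined

end Line

/-! ### Unions on the line -/

namespace Line

variable {k n m a b q u v w x y z i j d : ℤ} {A B C D Q T X S : Set ℤ} {M : ℕ}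
  {l : ℤ → Fin M} {J : Fin M → Fin M → Prop}

/-- The positions of the vertices of `S_k` or `S⁺_k`. -/
structure Board (k n : ℤ) (X : Set ℤ) : Prop where
  hk : 3 ≤ k
  hn : n = k * k + 1
  path : ∀ p, 1 ≤ p → p ≤ n → p ∈ X
  left : 1 - k ∈ X
  left' : -1 - k ∈ X
  right : n + k ∈ X
  right' : n + k + 2 ∈ X
  cases : ∀ p ∈ X, (1 ≤ p ∧ p ≤ n) ∨ p = -1 - k ∨ p = 1 - k ∨ p = -1 ∨ p = n + k ∨ p = n + k + 2

/-- The sets `A` and `B` can be united with the labels `l` and the edges `J` between labels. -/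
structure Uni (k : ℤ) (X A B : Set ℤ) (l : ℤ → Fin M) (J : Fin M → Fin M → Prop) : Prop where
  subA : A ⊆ X
  subB : B ⊆ X
  disj : ∀ p ∈ A, p ∉ B
  irr : ∀ c, ¬ J c c
  comm : ∀ c d, J c d → J d c
  out : ∀ u ∈ A ∪ B, ∀ v ∈ A ∪ B, l u = l v → Same k (X \ (A ∪ B)) u v
  inn : ∀ u ∈ A ∪ B, ∀ v ∈ A ∪ B, J (l u) (l v) → u ≠ v ∧ u - k ≤ v ∧ v ≤ u + k
  cross : ∀ u ∈ A, ∀ v ∈ B, u - k ≤ v → v ≤ u + k → J (l u) (l v)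

theorem Board.le_n (h : Board k n X) : 3 * k + 1 ≤ n := by
  have := mul_le_mul_of_nonneg_right h.hk (by have := h.hk; omega : 0 ≤ k)
  rw [h.hn]; omega

/-- The part of a set on the path power. -/
def seg (n : ℤ) (S : Set ℤ) : Set ℤ := {p | p ∈ S ∧ 1 ≤ p ∧ p ≤ n}

theorem mem_seg : x ∈ seg n S ↔ x ∈ S ∧ 1 ≤ x ∧ x ≤ n := Iff.rfl

namespace Uni

theorem symm (h : Uni k X A B l J) : Uni k X B A l J where
  subA := h.subB
  subB := h.subA
  disj p h1 h2 := h.disj p h2 h1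
  irr := h.irr
  comm := h.comm
  out := by rw [Set.union_comm]; exact h.out
  inn := by rw [Set.union_comm]; exact h.inn
  cross u hu v hv h1 h2 := h.comm _ _ (h.cross v hv u hu (by omega) (by omega))

/-- The neighbours outside of `A` of an element of `A` are neighbours of all elements of the same
label. -/
theorem adj (h : Uni k X A B l J) (hu : u ∈ A) (hw : w ∈ A ∪ B) (hl : l u = l w) (hx : x ∈ X)
    (hxA : x ∉ A) (h1 : u - k ≤ x) (h2 : x ≤ u + k) : x ≠ w ∧ w - k ≤ x ∧ x ≤ w + k := by
  by_cases hxB : x ∈ B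
  · have hJ := h.cross u hu x hxB h1 h2
    rw [hl] at hJ
    have := h.inn w hw x (Or.inr hxB) hJ
    omega
  · have hxT : x ∉ A ∪ B := fun h => h.elim hxA hxB
    have := (h.out u (Or.inl hu) w hw hl x ⟨hx, hxT⟩).1 ⟨h1, h2⟩
    exact ⟨fun e => hxT (e ▸ hw), this⟩

theorem same (h : Uni k X A B l J) (hu : u ∈ A) (hv : v ∈ A) (hl : l u = l v) :
    Same k (X \ A) u v := fun _ hx =>
  ⟨fun h1 => (h.adj hu (Or.inl hv) hl hx.1 hx.2 h1.1 h1.2).2,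
    fun h1 => (h.adj hv (Or.inl hu) hl.symm hx.1 hx.2 h1.1 h1.2).2⟩

end Uni

/-- Elements of a set without full windows have neighbours outside. -/
theorem exists_right (hS : Meets k n (X \ S)) (hu : u ∈ S) (h1 : 1 ≤ u) (h2 : u + k ≤ n) :
    ∃ p ∈ X, p ∉ S ∧ u < p ∧ p ≤ u + k := by
  obtain ⟨p, hp, h3, h4⟩ := hS u h1 h2
  have : p ≠ u := fun e => hp.2 (e ▸ hu)
  exact ⟨p, hp.1, hp.2, by omega, h4⟩

theorem exists_left (hS : Meets k n (X \ S)) (hu : u ∈ S) (h1 : 1 ≤ u - k) (h2 : u ≤ n) :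
    ∃ p ∈ X, p ∉ S ∧ u - k ≤ p ∧ p < u := by
  obtain ⟨p, hp, h3, h4⟩ := hS (u - k) h1 (by omega)
  have : p ≠ u := fun e => hp.2 (e ▸ hu)
  exact ⟨p, hp.1, hp.2, h3, by omega⟩

namespace Uni

/-- There are no common labels on the path power. -/
theorem label_ne (h : Uni k X A B l J) (hX : Board k n X) (hA : Meets k n (X \ A))
    (hB : Meets k n (X \ B)) (hu : u ∈ seg n A) (hv : v ∈ seg n B) : l u ≠ l v := by
  intro hl
  have hk := hX.hk
  have hn := hX.le_n
  have key : ∀ A B u v, Uni k X A B l J → Meets k n (X \ A) → Meets k n (X \ B) →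
      u ∈ seg n A → v ∈ seg n B → l u = l v → u < v → False := by
    intro A B u v h hA hB hu hv hl huv
    obtain ⟨huA, hu1, hun⟩ := hu
    obtain ⟨hvB, hv1, hvn⟩ := hv
    have huv' : u + k < v := by
      by_contra hc
      have := h.adj huA (Or.inr hvB) hl (hX.path v hv1 hvn) (fun hvA => h.disj v hvA hvB) (by omega)
        (by omega)
      omega
    have huk : u ≤ k := by
      by_contra hc
      obtain ⟨p, hp, hpA, h1, h2⟩ := exists_left hA huA (by omega) hun
      have := h.adj huA (Or.inr hvB) hl hp hpA (by omega) (by omega)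
      omega
    have hvk : n - k < v := by
      by_contra hc
      obtain ⟨p, hp, hpA, h1, h2⟩ := exists_right hB hvB (by omega) (by omega)
      have := h.symm.adj hvB (Or.inr huA) hl.symm hp hpA (by omega) (by omega)
      omega
    obtain ⟨p, hp, h1, h2⟩ := hA 1 le_rfl (by omega)
    have := h.adj huA (Or.inr hvB) hl hp.1 hp.2 (by omega) (by omega)
    omega
  have : u ≠ v := fun e => h.disj u hu.1 (e ▸ hv.1)
  rcases lt_or_gt_of_ne this with hlt | hlt
  · exact key A B u v h hA hB hu hv hl hlt
  · exact key B A v u h.symm hB hA hv hu hl.symm hlt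

/-- The vertex `u` has a path neighbour outside of `A` that is too far inside the path to be a
neighbour of `w`. Only `w = -1` has many path neighbours, and it is distinguished from `u` by `-1 -
k`. -/
theorem label_ne_outside (h : Uni k X A B l J) (hX : Board k n X) (hA : Meets k n (X \ A))
    (hu : u ∈ seg n A) (hw : w ∈ A ∪ B) (hw1 : ¬ (1 ≤ w ∧ w ≤ n)) (hw2 : w = -1 → -1 - k ∉ A ∪ B) :
    l u ≠ l w := by
  intro hl
  have hk := hX.hk
  have hn := hX.le_n
  obtain ⟨huA, hu1, hun⟩ := hu
  have hwX : w ∈ X := hw.elim (fun h' => h.subA h') fun h' => h.subB h'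
  have hc := hX.cases w hwX
  by_cases hw' : w = -1
  · have := h.out u (Or.inl huA) w hw hl (-1 - k) ⟨hX.left', hw2 hw'⟩
    omega
  have hside : ∃ p ∈ X, p ∉ A ∧ u - k ≤ p ∧ p ≤ u + k ∧ (w ≤ 0 → 1 < p) ∧ (0 < w → p < n) := by
    by_cases hw0 : w ≤ 0
    · by_cases huk : u + k ≤ n
      · obtain ⟨p, hp, hpA, h1, h2⟩ := exists_right hA huA hu1 huk
        exact ⟨p, hp, hpA, by omega, h2, by omega, by omega⟩
      · obtain ⟨p, hp, hpA, h1, h2⟩ := exists_left hA huA (by omega) hun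
        exact ⟨p, hp, hpA, h1, by omega, by omega, by omega⟩
    · by_cases huk : 1 ≤ u - k
      · obtain ⟨p, hp, hpA, h1, h2⟩ := exists_left hA huA huk hun
        exact ⟨p, hp, hpA, h1, by omega, by omega, by omega⟩
      · obtain ⟨p, hp, hpA, h1, h2⟩ := exists_right hA huA hu1 (by omega)
        exact ⟨p, hp, hpA, by omega, h2, by omega, by omega⟩
  obtain ⟨p, hp, hpA, h1, h2, h3, h4⟩ := hside
  have := h.adj huA hw hl hp hpA h1 h2
  omega

theorem split (h : Uni k X A B l J) (hX : Board k n X) (hA : Meets k n (X \ A))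
    (hB : Meets k n (X \ B)) (hT : ¬ Meets k n (X \ (A ∪ B))) :
    Split k n (seg n A) (seg n B) (X \ (A ∪ B)) where
  hk := hX.hk
  hn := hX.hn
  subA p hp := hp.2
  subB p hp := hp.2
  cover p h1 h2 := by
    have := hX.path p h1 h2
    simp only [mem_seg, Set.mem_sdiff, Set.mem_union]
    tauto
  AB p h1 h2 := h.disj p h1.1 h2.1
  AC p h1 h2 := h2.2 (Or.inl h1.1)
  BC p h1 h2 := h2.2 (Or.inr h1.1)
  meetsA a h1 h2 := by
    obtain ⟨p, hp, h3, h4⟩ := hA a h1 h2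
    refine ⟨p, ?_, h3, h4⟩
    by_cases hpB : p ∈ B
    · exact Or.inl ⟨hpB, by omega, by omega⟩
    · exact Or.inr ⟨hp.1, fun h => h.elim hp.2 hpB⟩
  meetsB a h1 h2 := by
    obtain ⟨p, hp, h3, h4⟩ := hB a h1 h2
    refine ⟨p, ?_, h3, h4⟩
    by_cases hpA : p ∈ A
    · exact Or.inl ⟨hpA, by omega, by omega⟩
    · exact Or.inr ⟨hp.1, fun h => h.elim hpA hp.2⟩
  window := by
    unfold Meets at hT
    push Not at hT
    obtain ⟨a, h1, h2, h3⟩ := hT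
    refine ⟨a, h1, h2, fun p h4 h5 => ?_⟩
    have h6 : p ∈ A ∪ B := by
      by_contra hp
      have := h3 p ⟨hX.path p (by omega) (by omega), hp⟩ h4
      omega
    exact h6.imp (fun h => ⟨h, by omega, by omega⟩) fun h => ⟨h, by omega, by omega⟩

/-- The types on the path power need different labels. -/
theorem cost (h : Uni k X A B l J) (hX : Board k n X) (hA : Meets k n (X \ A))
    (hB : Meets k n (X \ B)) (s : Finset (Fin M)) (hs : ∀ u ∈ seg n (A ∪ B), l u ∈ s) {m' : ℤ}
    (hm : Indep k (seg n A) (seg n B ∪ (X \ (A ∪ B))) m 1 n)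
    (hm' : Indep k (seg n B) (seg n A ∪ (X \ (A ∪ B))) m' 1 n) : m + m' ≤ s.card := by
  classical
  obtain ⟨r, hr, hr1, hr2⟩ := hm
  obtain ⟨r', hr', hr1', hr2'⟩ := hm'
  have inj : ∀ u ∈ r, ∀ v ∈ r, l u = l v → u = v := fun u hu v hv hl =>
    hr2 u hu v hv ((h.same (hr1 u hu).1.1 (hr1 v hv).1.1 hl).mono fun p hp => by
      rcases hp with hp | hp
      · exact ⟨h.subB hp.1, fun hpA => h.disj p hpA hp.1⟩
      · exact ⟨hp.1, fun hpA => hp.2 (Or.inl hpA)⟩)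
  have inj' : ∀ u ∈ r', ∀ v ∈ r', l u = l v → u = v := fun u hu v hv hl =>
    hr2' u hu v hv ((h.symm.same (hr1' u hu).1.1 (hr1' v hv).1.1 hl).mono fun p hp => by
      rcases hp with hp | hp
      · exact ⟨h.subA hp.1, fun hpB => h.disj p hp.1 hpB⟩
      · exact ⟨hp.1, fun hpB => hp.2 (Or.inr hpB)⟩)
  have hd : Disjoint (r.image l) (r'.image l) := by
    rw [Finset.disjoint_left]
    intro c hc hc'
    obtain ⟨u, hu, rfl⟩ := Finset.mem_image.1 hc
    obtain ⟨v, hv, hl⟩ := Finset.mem_image.1 hc'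
    exact h.label_ne hX hA hB (hr1 u hu).1 (hr1' v hv).1 hl.symm
  have hsub : r.image l ∪ r'.image l ⊆ s := by
    intro c hc
    rcases Finset.mem_union.1 hc with hc | hc
    · obtain ⟨u, hu, rfl⟩ := Finset.mem_image.1 hc
      exact hs u ⟨Or.inl (hr1 u hu).1.1, (hr1 u hu).1.2⟩
    · obtain ⟨u, hu, rfl⟩ := Finset.mem_image.1 hc
      exact hs u ⟨Or.inr (hr1' u hu).1.1, (hr1' u hu).1.2⟩
  have hcard := Finset.card_le_card hsub
  rw [Finset.card_union_of_disjoint hd, Finset.card_image_of_injOn (fun u hu v hv => inj u hu v hv),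
    Finset.card_image_of_injOn (fun u hu v hv => inj' u hu v hv)] at hcard
  omega

/-- A vertex off the path would occupy a label that no path vertex has, so at most `k` labels would
remain for the types of `A` and `B`, against `false_of_cost`. If `-1 - k` is present, it is taken as
this vertex, since `-1` qualifies only in its absence. -/
theorem subset_seg (h : Uni k X A B l J) (hX : Board k n X) (hM : (M : ℤ) = k + 1)
    (hA : Meets k n (X \ A)) (hB : Meets k n (X \ B)) (hT : ¬ Meets k n (X \ (A ∪ B))) :
    ∀ p ∈ A ∪ B, 1 ≤ p ∧ p ≤ n := by
  intro p hp
  by_contra hpn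
  have hk := hX.hk
  obtain ⟨w, hw, hwn, hw'⟩ : ∃ w ∈ A ∪ B, ¬ (1 ≤ w ∧ w ≤ n) ∧ (w = -1 → -1 - k ∉ A ∪ B) := by
    by_cases h1 : -1 - k ∈ A ∪ B
    · exact ⟨_, h1, by omega, by omega⟩
    · exact ⟨p, hp, hpn, fun _ => h1⟩
  refine (h.split hX hA hB hT).false_of_cost fun m m' hm hm' => ?_
  have := h.cost hX hA hB (Finset.univ.erase (l w)) (fun u hu => by
    rw [Finset.mem_erase]
    refine ⟨?_, Finset.mem_univ _⟩
    obtain ⟨hu | hu, hun⟩ := hu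
    · exact h.label_ne_outside hX hA ⟨hu, hun⟩ hw hwn hw'
    · exact h.symm.label_ne_outside hX hB ⟨hu, hun⟩ (Set.union_comm A B ▸ hw) hwn
        (Set.union_comm A B ▸ hw')) hm hm'
  rw [Finset.card_erase_of_mem (Finset.mem_univ _), Finset.card_univ, Fintype.card_fin] at this
  omega

theorem seg_eq (hS : ∀ p ∈ S, 1 ≤ p ∧ p ≤ n) : seg n S = S :=
  Set.ext fun p => ⟨fun h => h.1, fun h => ⟨h, hS p h⟩⟩

theorem joined (h : Uni k X A B l J) (hX : Board k n X) (hM : (M : ℤ) = k + 1)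
    (hA : Meets k n (X \ A)) (hB : Meets k n (X \ B)) (hT : ¬ Meets k n (X \ (A ∪ B))) :
    Joined k n A B (X \ (A ∪ B)) := by
  have hs := h.subset_seg hX hM hA hB hT
  have hk := hX.hk
  have eA := seg_eq fun p hp => hs p (Or.inl hp)
  have eB := seg_eq fun p hp => hs p (Or.inr hp)
  have hsp := h.split hX hA hB hT
  rw [eA, eB] at hsp
  refine ⟨hsp, ⟨hX.left, fun h => by have := hs _ h; omega⟩,
    ⟨hX.right, fun h => by have := hs _ h; omega⟩, fun m m' hm hm' => ?_⟩
  have := h.cost hX hA hB Finset.univ (fun _ _ => Finset.mem_univ _) (by rwa [eA, eB])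
    (by rwa [eA, eB])
  rw [Finset.card_univ, Fintype.card_fin] at this
  omega

/-- If one element is added to a set with many types, then it is one of the outer elements. -/
theorem indep_insert (h : Uni k X A {x} l J) (hX : Board k n X) (hM : (M : ℤ) = k + 1)
    (hA : Indep k (seg n A) (X \ A) (k + 1) 1 n) :
    Indep k (seg n (A ∪ {x})) (X \ (A ∪ {x})) (k + 1) 1 n := by
  classical
  obtain ⟨r, hr, hr1, hr2⟩ := hA
  have hk := hX.hk
  have hn := hX.le_n
  -- The `k + 1` types occupy all labels, so `x` shares its label with a path vertex `u`, and all
  -- neighbours of `x` are neighbours of `u`. Every vertex except for `w_1` and `w_4` has a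
  -- neighbour that violates this.
  have hsurj : r.image l = Finset.univ := by
    refine Finset.eq_univ_of_card _ ?_
    rw [Finset.card_image_of_injOn (fun u hu v hv hl =>
      hr2 u hu v hv (h.same (hr1 u hu).1.1 (hr1 v hv).1.1 hl)), Fintype.card_fin]
    omega
  obtain ⟨u, hu, hl⟩ := Finset.mem_image.1 (hsurj ▸ Finset.mem_univ (l x))
  have hu' := hr1 u hu
  have hadj : ∀ y ∈ X, y ≠ x → x - k ≤ y → y ≤ x + k → y ≠ u ∧ u - k ≤ y ∧ y ≤ u + k :=
    fun y hy hyx h1 h2 => h.symm.adj rfl (Or.inr hu'.1.1) hl.symm hy hyx h1 h2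
  have hux : u ≠ x := fun e => h.disj u hu'.1.1 e
  have hfar : x = -1 - k ∨ x = n + k + 2 := by
    rcases hX.cases x (h.subB rfl) with hx | hx | rfl | rfl | rfl | hx
    · exfalso
      have h1 := hadj u (hX.path u (by omega) (by omega)) hux
      rcases lt_or_gt_of_ne hux with hlt | hlt
      · by_cases hxn : x = n
        · have := hadj _ hX.right; omega
        · have := hadj (x + 1) (hX.path _ (by omega) (by omega)); omega
      · by_cases hxn : x = 1
        · have := hadj _ hX.left; omega
        · have := hadj (x - 1) (hX.path _ (by omega) (by omega)); omega
    · exact Or.inl hx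
    · have := hadj _ hX.left'; omega
    · have := hadj _ hX.left'; omega
    · have := hadj _ hX.right'; omega
    · exact Or.inr hx
  refine ⟨r, hr, fun v hv => ⟨⟨Or.inl (hr1 v hv).1.1, (hr1 v hv).2⟩, (hr1 v hv).2⟩,
    fun v hv w hw hS => hr2 v hv w hw fun y hy => ?_⟩
  by_cases hyx : y = x
  · have := hr1 v hv
    have := hr1 w hw
    omega
  · exact hS y ⟨hy.1, fun h => h.elim hy.2 hyx⟩

end Uni

theorem Board.meets_singleton (hX : Board k n X) (p : ℤ) : Meets k n (X \ {p}) := by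
  have hk := hX.hk
  intro a h1 h2
  by_cases hpa : p = a
  · exact ⟨a + 1, ⟨hX.path _ (by omega) (by omega), by simp only [Set.mem_singleton_iff]; omega⟩,
      by omega, by omega⟩
  · exact ⟨a, ⟨hX.path _ (by omega) (by omega), by simp only [Set.mem_singleton_iff]; omega⟩,
      by omega, by omega⟩

/-- Sets of positions that occur in linear expressions. -/
theorem Board.not_linear (hX : Board k n X)
    (h : ∀ F : Set ℤ → Prop, (∀ p ∈ X, F {p}) → (∀ A x, F A → (∃ (M : ℕ) (l : ℤ → Fin M) (J : _),
      (M : ℤ) = k + 1 ∧ Uni k X A {x} l J) → F (A ∪ {x})) → F X) : False := by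
  have hk := hX.hk
  have hn := hX.le_n
  have hsingle : ∀ p : ℤ, Meets k n (X \ {p}) := hX.meets_singleton
  -- Either there is no full window, or there are `k + 1` types. The set of all positions satisfies
  -- neither: nothing is left outside to separate.
  have := h (fun T => Meets k n (X \ T) ∨ Indep k (seg n T) (X \ T) (k + 1) 1 n)
    (fun p _ => Or.inl (hsingle p)) ?_
  · rcases this with h | ⟨s, h1, -, h3⟩
    · obtain ⟨p, hp, -⟩ := h 1 le_rfl (by omega)
      exact hp.2 hp.1
    · have : s.card ≤ 1 := Finset.card_le_one.2 fun u hu v hv =>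
        h3 u hu v hv fun y hy => absurd hy.1 hy.2
      omega
  · rintro A x hA ⟨M, l, J, hM, hU⟩
    rcases hA with hA | hA
    · by_cases hT : Meets k n (X \ (A ∪ {x}))
      · exact Or.inl hT
      · have hj := hU.joined hX hM hA (hsingle x) hT
        rw [Uni.seg_eq (hU.subset_seg hX hM hA (hsingle x) hT)]
        exact Or.inr hj.main.1
    · exact Or.inr (hU.indep_insert hX hM hA)

end Line

open CWExpr

/-! ### From unions of vertex sets to unions of sets of positions -/

namespace Line

variable {V : Type} {G : SimpleGraph V} {k : ℤ} {m : ℕ} {pl : V → ℤ} {A B : Set V}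

/-- A union of vertex sets as a union of sets of positions. -/
theorem exists_uni [Nonempty V] (hpl : Function.Injective pl)
    (hadj : ∀ a b, G.Adj a b ↔ pl a ≠ pl b ∧ pl a ≤ pl b + k ∧ pl b ≤ pl a + k)
    (h : Unitable G m A B) :
    ∃ (l : ℤ → Fin m) (J : _), Uni k (Set.range pl) (pl '' A) (pl '' B) l J := by
  obtain ⟨hd, l, J, hJ, hJs, hout, hin, hcross⟩ := h
  have hinv : ∀ a, Function.invFun pl (pl a) = a := Function.leftInverse_invFun hpl
  have hmem : ∀ S : Set V, ∀ a, pl a ∈ pl '' S ↔ a ∈ S := fun S a => hpl.mem_set_image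
  refine ⟨fun p => l (Function.invFun pl p), J, ⟨Set.image_subset_range _ _,
    Set.image_subset_range _ _, ?_, hJ, hJs, ?_, ?_, ?_⟩⟩
  · rintro _ ⟨a, ha, rfl⟩ hb
    exact Set.disjoint_left.1 hd ha ((hmem B a).1 hb)
  · rw [← Set.image_union]
    rintro _ ⟨u, hu, rfl⟩ _ ⟨v, hv, rfl⟩ hl _ ⟨⟨x, rfl⟩, hx⟩
    rw [hmem] at hx
    simp only [hinv] at hl
    have := hout u hu v hv hl x hx
    rw [hadj, hadj] at this
    have h1 : pl u ≠ pl x := fun e => hx (hpl e ▸ hu)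
    have h2 : pl v ≠ pl x := fun e => hx (hpl e ▸ hv)
    constructor <;> intro _ <;> omega
  · rw [← Set.image_union]
    rintro _ ⟨u, hu, rfl⟩ _ ⟨v, hv, rfl⟩ hl
    simp only [hinv] at hl
    have := hin u hu v hv hl
    rw [hadj] at this
    exact ⟨this.1, by omega, by omega⟩
  · rintro _ ⟨u, hu, rfl⟩ _ ⟨v, hv, rfl⟩ h1 h2
    simp only [hinv]
    rw [← hcross u hu v hv, hadj]
    exact ⟨fun e => Set.disjoint_left.1 hd hu (hpl e ▸ hv), by omega, by omega⟩

end Line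

/-! ### The lower bound for the linear clique-width of `S_k` -/

namespace SVertex

open Line

variable {k : ℕ}

theorem exists_place_eq (hk : 3 ≤ k) {p : ℤ} (h1 : 1 ≤ p) (h2 : p ≤ k * k + 1) :
    ∃ i, place k (some (v i)) = p := by
  have hs := sSize_eq (by omega : 1 ≤ k)
  refine ⟨⟨(p - 1).toNat, by omega⟩, ?_⟩
  simp only [place]
  omega

theorem board (hk : 3 ≤ k) : Board k (k * k + 1) (Set.range fun a : SVertex k => place k (some a)) where
  hk := by omega
  hn := rfl
  path p h1 h2 := by
    obtain ⟨i, hi⟩ := exists_place_eq hk h1 h2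
    exact ⟨v i, hi⟩
  left := ⟨w₂, rfl⟩
  left' := ⟨w₁, rfl⟩
  right := ⟨w₃, rfl⟩
  right' := ⟨w₄, rfl⟩
  cases := by
    have hs := sSize_eq (by omega : 1 ≤ k)
    rintro _ ⟨i | _ | _ | _ | _, rfl⟩ <;> simp only [place]
    · have := i.2; omega
    all_goals simp

theorem board_plus (hk : 3 ≤ k) : Board k (k * k + 1) (Set.range (place k)) where
  hk := by omega
  hn := rfl
  path p h1 h2 := by
    obtain ⟨i, hi⟩ := exists_place_eq hk h1 h2
    exact ⟨_, hi⟩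
  left := ⟨some w₂, rfl⟩
  left' := ⟨some w₁, rfl⟩
  right := ⟨some w₃, rfl⟩
  right' := ⟨some w₄, rfl⟩
  cases := by
    have hs := sSize_eq (by omega : 1 ≤ k)
    rintro _ ⟨_ | i | _ | _ | _ | _, rfl⟩ <;> simp only [place]
    · simp
    · have := i.2; omega
    all_goals simp

theorem not_linearCliqueWidth_le (hk : 3 ≤ k) : ¬ linearCliqueWidth (graphS k) ≤ k + 1 := by
  intro h
  have : Nonempty (SVertex k) := ⟨w₁⟩
  obtain ⟨e, hlin, he⟩ := exists_defines_of_linearCliqueWidth_le (m := k + 1) (by exact_mod_cast h)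
  refine (board hk).not_linear fun F hF1 hF2 => ?_
  have := he.mem_family (lin := True) (fun _ => hlin)
    (fun S => F ((fun a : SVertex k => place k (some a)) '' S)) (fun a => ?_)
    fun A B hA _ _ _ hB hU => ?_
  · rwa [Set.image_univ] at this
  · rw [Set.image_singleton]
    exact hF1 _ ⟨a, rfl⟩
  · obtain ⟨x, rfl⟩ := hB trivial
    obtain ⟨l, J, hU⟩ := exists_uni (pl := fun a : SVertex k => place k (some a))
      (fun a b h => by simpa using place_injective hk h) (adj_iff_place hk) hU
    rw [Set.image_union]
    rw [Set.image_singleton] at hU ⊢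
    exact hF2 _ _ hA ⟨k + 1, l, J, by push_cast; ring, hU⟩

end SVertex

/-! ### Counting the types around a completing element without outside neighbours -/

namespace Line

variable {k n m a b u v w x y z i j d : ℤ} {A Q : Set ℤ}

namespace Near

/-- Walk to the left from the run `[z - k, z - 1]`, one row at a time. If the run has a single type
at its ends, then a run shorter by one is present in the next row; otherwise it contributes two
types, and windows on both sides supply the rest. If all runs have one type, the walk ends near `1`;
for `d = 0` the final run contains `k - 1` and `k + 1`, which `-1` separates. -/
theorem indep_left (h : Near k n A Q z) (hz : z = n - k - 2 - d) (hd : 0 ≤ d) (hdk : d ≤ k - 1)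
    (hA : ∀ p, z - k ≤ p → p ≤ z + k → p ≠ z → p ∈ A)
    (hm : m = k - 2 ∧ 1 ≤ d ∨ m = k - 1 ∧ d = 0 ∧ -1 ∈ Q) : Indep k A Q m 1 (z - 1) := by
  have hk := h.part.hk
  have hk0 : 0 ≤ k := by omega
  have hl := h.part.row_last
  have hl2 : row k (k - 2) = n - k - 3 := by
    rw [show k - 2 = k - 1 - 1 by ring, row_pred, hl]; ring
  have hl3 : row k (k - 3) = n - 2 * k - 4 := by
    rw [show k - 3 = k - 2 - 1 by ring, row_pred, hl2]; ring
  have hn := h.part.le_n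
  have key : ∀ q : ℕ, (q : ℤ) ≤ k - 3 → (∀ p, 1 ≤ p → z - k - row k q + q ≤ p →
      p ≤ z - 1 - row k q → p ∈ A) ∨ Indep k A Q m 1 (z - 1) := by
    intro q
    induction q with
    | zero =>
      intro _
      refine Or.inl fun p _ h1 h2 => ?_
      rw [Nat.cast_zero, row_zero] at *
      exact hA p (by omega) (by omega) (by omega)
    | succ q ih =>
      intro hq
      push_cast at hq ⊢
      rcases ih (by omega) with hR | hI
      · have hr1 := row_succ k q
        have hr2 : row k (k - 2 - q) = row k (k - 2) - row k q := row_sub _ _ _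
        have hr3 := row_le hk0 (by omega : (2 : ℤ) ≤ k - 2 - q)
        have hr4 : row k 2 = 2 * k + 2 := by unfold row; ring
        have hr5 : row k (k - 3 - q) = row k (k - 3) - row k q := row_sub _ _ _
        have hr6 : row k (k - 4 - q) = row k (k - 3 - q) - k - 1 := by
          rw [← row_pred]; congr 1; ring
        have hr7 := row_le hk0 (by omega : (0 : ℤ) ≤ q)
        rw [row_zero] at hr7
        have hu := hR (z - k - row k q + q) (by omega) le_rfl (by omega)
        have hv := hR (z - 1 - row k q) (by omega) (by omega) le_rfl
        by_cases hS : Same k Q (z - k - row k q + q) (z - 1 - row k q)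
        · exact Or.inl fun p h1 h2 h3 =>
            h.part.mem_left hS (by omega) (by omega) (by omega) (by omega) (by omega)
        · have h2 := indep_two hu hv (by omega) hS
          right
          rcases hm with ⟨rfl, hm⟩ | ⟨rfl, rfl, -⟩
          · have := (h.part.grow h.spanA h.meetsA h2 (i := k - 4 - q) (j := q) (by omega)
              (by omega) (by omega) (by omega) (by omega) (by omega) (by omega)).mono
              (a' := 1) (b' := z - 1) (by omega) (by omega)
            rwa [show 2 + (k - 4 - q) + q = k - 2 by ring] at this
          · have := (h.part.grow h.spanA h.meetsA h2 (i := k - 3 - q) (j := q) (by omega)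
              (by omega) (by omega) (by omega) (by omega) (by omega) (by omega)).mono
              (a' := 1) (b' := z - 1) (by omega) (by omega)
            rwa [show 2 + (k - 3 - q) + q = k - 1 by ring] at this
      · exact Or.inr hI
  have hq : ((k - 3).toNat : ℤ) = k - 3 := by omega
  rcases key (k - 3).toNat (by omega) with hR | hI
  · rw [hq] at hR
    rcases hm with ⟨rfl, hm⟩ | ⟨rfl, rfl, hm⟩
    · have hv := hR (k + 1 - d) (by omega) (by omega) (by omega)
      have := (h.part.grow h.spanA h.meetsA (indep_one hv) (i := 0) (j := k - 3) le_rfl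
        (by omega) (by rw [row_zero]; omega) (by omega) (by omega) (by omega) (by omega)).mono
        (a' := 1) (b' := z - 1) (by rw [row_zero]; omega) (by omega)
      rwa [show 1 + 0 + (k - 3) = k - 2 by ring] at this
    · have hu := hR (k - 1) (by omega) (by omega) (by omega)
      have hv := hR (k + 1) (by omega) (by omega) (by omega)
      have := (h.part.grow h.spanA h.meetsA (indep_two hu hv (by omega)
        (not_same_of_left hm (by omega) (by omega) (by omega))) (i := 0) (j := k - 3) le_rfl
        (by omega) (by rw [row_zero]; omega) (by omega) (by omega) (by omega) (by omega)).mono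
        (a' := 1) (b' := z - 1) (by rw [row_zero]; omega) (by omega)
      rwa [show 2 + 0 + (k - 3) = k - 1 by ring] at this
  · exact hI

/-- The element `z + k + 1` is missing, as `A` has no full window. An element of `A` beyond it is
separated from those near `z` by `z` itself, and the latter have two types because of `i`. If there
is no such element, everything from `z + k + 1` to `n` is missing, and this separates `z + 1`, `z +
2` and, for `d > 0`, also `z + 3`. -/
theorem indep_right (h : Near k n A Q z) (hz : z = n - k - 2 - d) (hd : 0 ≤ d)
    (hA : ∀ p, z - k ≤ p → p ≤ z + k → p ≠ z → p ∈ A) (hi : z < i) (hi' : i ≤ z + k)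
    (hiQ : i + k + 1 ∈ Q)
    (hH : i = z + k → ∀ u ∈ A, z + k + 1 < u → ¬ Same k Q (z + 1) (z + k)) :
    Indep k A Q 3 (z + 1) n ∨ d = 0 ∧ Indep k A Q 2 (z + 1) n := by
  have hk := h.part.hk
  have hzk : z + k + 1 ∉ A := by
    intro hzk
    have h1 := h.one_le
    obtain ⟨p, hp, h2, h3⟩ := h.meetsQ (z + 1) (by omega) (by omega)
    refine h.part.notMem ?_ hp
    by_cases hpz : p = z + k + 1
    · exact hpz ▸ hzk
    · exact hA p (by omega) (by omega) (by omega)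
  have hA' : ∀ p, z < p → p ≤ z + k → p ∈ A := fun p h1 h2 => hA p (by omega) h2 (by omega)
  by_cases hu : ∃ u ∈ A, z + k + 1 < u
  · obtain ⟨u, hu, hzu⟩ := hu
    have hun := h.part.sub u hu
    left
    have hne : ∀ p, z < p → p ≤ z + k → ¬ Same k Q p u := fun p h1 h2 =>
      not_same_of_left h.mem (by omega) (by omega) (by omega)
    by_cases hik : i = z + k
    · exact (indep_three (hA' (z + 1) (by omega) (by omega)) (hA' (z + k) (by omega) le_rfl) hu
        (by omega) (by omega) (hH hik u hu hzu) (hne _ (by omega) (by omega))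
        (hne _ (by omega) (by omega))).mono le_rfl hun.2
    · exact (indep_three (hA' i hi hi') (hA' (i + 1) (by omega) (by omega)) hu (by omega) (by omega)
        (not_same_of_right hiQ (by omega) (by omega) (by omega)) (hne _ (by omega) (by omega))
        (hne _ (by omega) (by omega))).mono (by omega) hun.2
  · push Not at hu
    have hQ : ∀ p, z + k + 1 ≤ p → p ≤ n → p ∈ Q := fun p h1 h2 =>
      (h.part.mem_or (by have := h.one_le; omega) h2).resolve_left fun hp => by
        have := hu p hp
        have : p ≠ z + k + 1 := fun e => hzk (e ▸ hp)
        omega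
    have h12 : ¬ Same k Q (z + 1) (z + 2) :=
      not_same_of_right (hQ (z + k + 2) (by omega) (by omega)) (by omega) (by omega) (by omega)
    by_cases hd0 : d = 0
    · exact Or.inr ⟨hd0, (indep_two (hA' (z + 1) (by omega) (by omega))
        (hA' (z + 2) (by omega) (by omega)) (by omega) h12).mono le_rfl (by omega)⟩
    · have hq3 := hQ (z + k + 3) (by omega) (by omega)
      exact Or.inl ((indep_three (hA' (z + 1) (by omega) (by omega))
        (hA' (z + 2) (by omega) (by omega)) (hA' (z + 3) (by omega) (by omega)) (by omega)
        (by omega) h12 (not_same_of_right hq3 (by omega) (by omega) (by omega))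
        (not_same_of_right hq3 (by omega) (by omega) (by omega))).mono le_rfl (by omega))

/-- The missing `z + k + 1` separates the elements on the left of `z` from those on the right, so
the two counts add up: `(k - 2) + 3`, or at least `(k - 1) + 2` for `d = 0`, which exceeds `k`. -/
theorem false_of_right (h : Near k n A Q z) (hz : z = n - k - 2 - d) (hd : 0 ≤ d) (hdk : d ≤ k - 1)
    (hA : ∀ p, z - k ≤ p → p ≤ z + k → p ≠ z → p ∈ A) (hi : z < i) (hi' : i ≤ z + k)
    (hiQ : i + k + 1 ∈ Q)
    (hH : i = z + k → ∀ u ∈ A, z + k + 1 < u → ¬ Same k Q (z + 1) (z + k))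
    (hplus : d = 0 → -1 ∈ Q) : False := by
  have hk := h.part.hk
  have hz1 := h.one_le
  have hzk : z + k + 1 ∈ Q := by
    refine (h.part.mem_or (by omega) (by omega)).resolve_left fun hzk => ?_
    obtain ⟨p, hp, h2, h3⟩ := h.meetsQ (z + 1) (by omega) (by omega)
    refine h.part.notMem ?_ hp
    by_cases hpz : p = z + k + 1
    · exact hpz ▸ hzk
    · exact hA p (by omega) (by omega) (by omega)
  have hne : ∀ u ∈ A, ∀ v ∈ A, 1 ≤ u → u ≤ z - 1 → z - 1 < v → v ≤ n → ¬ Same k Q u v := by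
    intro u hu v hv h1 h2 h3 h4
    have : v ≠ z := fun e => h.part.notMem (e ▸ hv) h.mem
    exact not_same_of_right hzk (by omega) (by omega) (by omega)
  have join : ∀ m m', Indep k A Q m 1 (z - 1) → Indep k A Q m' (z + 1) n → m + m' ≤ k :=
    fun m m' h1 h2 => h.few _ (h1.union (h2.mono (by omega) le_rfl) (by omega) (by omega) hne)
  by_cases hd0 : d = 0
  · have h1 := h.indep_left hz hd hdk hA (Or.inr ⟨rfl, hd0, hplus hd0⟩)
    rcases h.indep_right hz hd hA hi hi' hiQ hH with h2 | ⟨-, h2⟩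
    · have := join _ _ h1 h2; omega
    · have := join _ _ h1 h2; omega
  · have h1 := h.indep_left hz hd hdk hA (Or.inl ⟨rfl, by omega⟩)
    rcases h.indep_right hz hd hA hi hi' hiQ hH with h2 | ⟨h0, -⟩
    · have := join _ _ h1 h2; omega
    · exact hd0 h0

end Near

end Line

/-! ### Uniting a set with many types and another set -/

namespace Line

variable {k n m a b q u v w x y z i j d : ℤ} {A B C D Q T X S : Set ℤ} {M : ℕ}
  {l : ℤ → Fin M} {J : Fin M → Fin M → Prop}

/-- The element `u` of `T` can have the same label as the element `y` of `D`. -/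
structure Matched (k n : ℤ) (X T D : Set ℤ) (y u : ℤ) : Prop where
  mem : u ∈ seg n T
  notD : ∀ x ∈ D, ¬ (u - k ≤ x ∧ x ≤ u + k)
  out : ∀ x ∈ X, x ∉ T → x ∉ D → ((u - k ≤ x ∧ x ≤ u + k) ↔ (y - k ≤ x ∧ x ≤ y + k))
  sub : ∀ x ∈ T, y - k ≤ x → x ≤ y + k → u - k ≤ x ∧ x ≤ u + k

/-- One element completes a window, and there are few types without it. -/
def Rigid (k n : ℤ) (X T : Set ℤ) : Prop := ∃ A x, seg n T = insert x A ∧ Near k n A (X \ A) x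

/-- The sets with a window that occur in expressions for `S⁺_k` have many types and are as follows. -/
structure Good (k n : ℤ) (X T : Set ℤ) : Prop where
  many : Indep k (seg n T) (X \ T) (k + 1) 1 n
  quiet : ∀ w ∈ T, ∀ p ∈ seg n T, w - k ≤ p → p ≤ w + k → 1 ≤ w ∧ w ≤ n
  alive : Alive k (seg n T) (X \ T) ∨ Rigid k n X T

/-- The consequences of a union of `T` and `D`. -/
structure Attach (k n : ℤ) (X T D : Set ℤ) : Prop where
  board : Board k n X
  plus : -1 ∈ X
  subT : T ⊆ X
  subD : D ⊆ X
  disj : ∀ p ∈ T, p ∉ D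
  good : Good k n X T
  exists_matched : ∀ y ∈ D, ∃ u, Matched k n X T D y u
  star : ∀ y ∈ D, ∀ y' ∈ D, (∀ x ∈ X, x ∉ T → x ∉ D →
    ((y - k ≤ x ∧ x ≤ y + k) ↔ (y' - k ≤ x ∧ x ≤ y' + k))) →
    ∀ x ∈ T, y - k ≤ x → x ≤ y + k → y' - k ≤ x ∧ x ≤ y' + k
  of_same : ∀ y ∈ D, ∀ u u', Matched k n X T D y u → u' ∈ seg n T → Same k (X \ T) u u' →
    Matched k n X T D y u'

/-- Let `u'` in `T` have the label of `x`. If `u` were adjacent to `x`, then `u, x, y, u'` would be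
an induced cycle of length four, which does not exist on the line. -/
theorem Uni.not_adj (h : Uni k X T D l J) (hT : ∀ y ∈ D, ∃ u ∈ T, l u = l y) (hu : u ∈ T)
    (hy : y ∈ D) (hl : l u = l y) (hx : x ∈ D) : ¬ (u - k ≤ x ∧ x ≤ u + k) := by
  intro hux
  have hxT : x ∉ T := fun hxT => h.disj x hxT hx
  have h1 := h.adj hu (Or.inr hy) hl (h.subB hx) hxT hux.1 hux.2
  obtain ⟨u', hu', hl'⟩ := hT x hx
  have h2 := h.symm.adj hx (Or.inr hu') hl'.symm (h.subA hu) (h.disj u hu) (by omega) (by omega)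
  have h3 : u' ≠ y ∧ y - k ≤ u' ∧ u' ≤ y + k := by
    have hJ := h.cross u hu x hx hux.1 hux.2
    rw [hl, ← hl'] at hJ
    have := h.inn y (Or.inr hy) u' (Or.inl hu') hJ
    omega
  have h4 : ¬ (u - k ≤ y ∧ y ≤ u + k) := fun hc => by
    have := h.adj hu (Or.inr hy) hl (h.subB hy) (fun hyT => h.disj y hyT hy) hc.1 hc.2
    omega
  have h5 : ¬ (u' - k ≤ x ∧ x ≤ u' + k) := fun hc => by
    have := h.adj hu' (Or.inr hx) hl' (h.subB hx) hxT hc.1 hc.2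
    omega
  omega

/-- The `k + 1` types of `T` use all labels, so every vertex of `D` shares the label of some path
vertex of `T`. Conversely, on the path a type of `T` has only one label, which yields `star` and
`of_same`. -/
theorem Uni.attach (h : Uni k X T D l J) (hX : Board k n X) (hp : -1 ∈ X) (hM : (M : ℤ) = k + 1)
    (hg : Good k n X T) : Attach k n X T D := by
  classical
  obtain ⟨r, hr, hr1, hr2⟩ := hg.many
  have hk := hX.hk
  have hsurj : r.image l = Finset.univ := by
    refine Finset.eq_univ_of_card _ ?_
    rw [Finset.card_image_of_injOn (fun u hu v hv hl =>
      hr2 u hu v hv (h.same (hr1 u hu).1.1 (hr1 v hv).1.1 hl)), Fintype.card_fin]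
    omega
  have hex : ∀ c, ∃ u ∈ r, l u = c := fun c => Finset.mem_image.1 (hsurj ▸ Finset.mem_univ c)
  have label : ∀ u ∈ seg n T, ∀ u' ∈ seg n T, Same k (X \ T) u u' → l u = l u' := by
    intro u hu u' hu' hS
    obtain ⟨e, he, hl⟩ := hex (l u)
    obtain ⟨e', he', hl'⟩ := hex (l u')
    have h1 := h.same (hr1 e he).1.1 hu.1 hl
    have h2 := h.same (hr1 e' he').1.1 hu'.1 hl'
    rw [← hl, ← hl', hr2 e he e' he' ((h1.trans hS).trans h2.symm)]
  have hT : ∀ y ∈ D, ∃ u ∈ T, l u = l y := fun y _ => by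
    obtain ⟨u, hu, hl⟩ := hex (l y)
    exact ⟨u, (hr1 u hu).1.1, hl⟩
  have hmatch : ∀ y ∈ D, ∀ u ∈ seg n T, l u = l y → Matched k n X T D y u := by
    intro y hy u hu hl
    refine ⟨hu, fun x hx => h.not_adj hT hu.1 hy hl hx, fun x hx hxT hxD => ?_, fun x hx h1 h2 => ?_⟩
    · exact ⟨fun hc => (h.adj hu.1 (Or.inr hy) hl hx hxT hc.1 hc.2).2,
        fun hc => (h.symm.adj hy (Or.inr hu.1) hl.symm hx hxD hc.1 hc.2).2⟩
    · exact (h.symm.adj hy (Or.inr hu.1) hl.symm (h.subA hx) (h.disj x hx) h1 h2).2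
  have hmlabel : ∀ y ∈ D, ∃ u ∈ seg n T, l u = l y := fun y _ => by
    obtain ⟨u, hu, hl⟩ := hex (l y)
    exact ⟨u, (hr1 u hu).1, hl⟩
  refine ⟨hX, hp, h.subA, h.subB, h.disj, hg, fun y hy => ?_, fun y hy y' hy' hC x hx h1 h2 => ?_,
    fun y hy u u' hm hu' hS => ?_⟩
  · obtain ⟨u, hu, hl⟩ := hmlabel y hy
    exact ⟨u, hmatch y hy u hu hl⟩
  · obtain ⟨u, hu, hl⟩ := hmlabel y hy
    obtain ⟨u', hu', hl'⟩ := hmlabel y' hy'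
    have m1 := hmatch y hy u hu hl
    have m2 := hmatch y' hy' u' hu' hl'
    have hS : Same k (X \ T) u u' := fun c hc => by
      by_cases hcD : c ∈ D
      · have := m1.notD c hcD
        have := m2.notD c hcD
        tauto
      · rw [m1.out c hc.1 hc.2 hcD, m2.out c hc.1 hc.2 hcD]
        exact hC c hc.1 hc.2 hcD
    have hll : l y = l y' := by rw [← hl, ← hl', label u hu u' hu' hS]
    exact (h.symm.adj hy (Or.inl hy') hll (h.subA hx) (h.disj x hx) h1 h2).2
  · obtain ⟨e, he, hl⟩ := hmlabel y hy
    have m1 := hmatch y hy e he hl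
    have hS' : Same k (X \ T) e u := fun c hc => by
      by_cases hcD : c ∈ D
      · have := m1.notD c hcD
        have := hm.notD c hcD
        tauto
      · rw [m1.out c hc.1 hc.2 hcD, hm.out c hc.1 hc.2 hcD]
    exact hmatch y hy u' hu' (by rw [← hl]; exact (label e he u' hu' (hS'.trans hS)).symm)

namespace Attach

theorem hk (h : Attach k n X T D) : 3 ≤ k := h.board.hk

theorem le_n (h : Attach k n X T D) : 3 * k + 1 ≤ n := h.board.le_n

/-- A neighbour of `y` that is not a neighbour of the matched element is in `D`. -/
theorem _root_.Line.Matched.mem_right (hm : Matched k n X T D y u) (hx : x ∈ X)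
    (h1 : y - k ≤ x) (h2 : x ≤ y + k) (h3 : ¬ (u - k ≤ x ∧ x ≤ u + k)) : x ∈ D := by
  by_contra hxD
  by_cases hxT : x ∈ T
  · exact h3 (hm.sub x hxT h1 h2)
  · exact h3 ((hm.out x hx hxT hxD).2 ⟨h1, h2⟩)

theorem _root_.Line.Matched.mem_left (hm : Matched k n X T D y u) (hx : x ∈ X)
    (h1 : u - k ≤ x) (h2 : x ≤ u + k) (h3 : ¬ (y - k ≤ x ∧ x ≤ y + k)) : x ∈ T := by
  by_contra hxT
  by_cases hxD : x ∈ D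
  · exact hm.notD x hxD ⟨h1, h2⟩
  · exact h3 ((hm.out x hx hxT hxD).1 ⟨h1, h2⟩)

/-- If `y` is outside of the path power and all its neighbours are in `D`, then some element of `T`
has no neighbour outside. -/
theorem rigid (h : Attach k n X T D) (hy : y ∈ D) (hN : ∀ x ∈ X, y - k ≤ x → x ≤ y + k → x ∈ D ∨ x = y) :
    Rigid k n X T ∧ ∃ z ∈ seg n T, ∀ x ∈ X, z - k ≤ x → x ≤ z + k → x ∈ T := by
  obtain ⟨z, hm⟩ := h.exists_matched y hy
  have hz : ∀ x ∈ X, z - k ≤ x → x ≤ z + k → x ∈ T := fun x hx h1 h2 => by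
    by_contra hxT
    have hxD : x ∉ D := fun hxD => hm.notD x hxD ⟨h1, h2⟩
    have := (hm.out x hx hxT hxD).1 ⟨h1, h2⟩
    rcases hN x hx this.1 this.2 with h' | rfl
    · exact hxD h'
    · exact hxD hy
  refine ⟨h.good.alive.resolve_left fun hal => ?_, z, hm.mem, hz⟩
  obtain ⟨c, hc, h1, h2⟩ := hal z hm.mem
  exact hc.2 (hz c hc.1 h1 h2)

/-- The neighbour `n + k` of `n` is close to no other path vertex, in particular not to the matched
one, and so belongs to `D`; then the same holds for `n + k + 2`. -/
theorem outer_right (h : Attach k n X T D) (hn : n ∈ D) : n + k ∈ D ∧ n + k + 2 ∈ D := by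
  have hk := h.hk
  have hn' := h.le_n
  obtain ⟨u, hm⟩ := h.exists_matched n hn
  have hu := hm.mem.2
  have hun : u ≠ n := fun e => h.disj u hm.mem.1 (e ▸ hn)
  have h1 := hm.mem_right h.board.right (by omega) (by omega) (by omega)
  obtain ⟨u', hm'⟩ := h.exists_matched _ h1
  have hu' := hm'.mem.2
  exact ⟨h1, hm'.mem_right h.board.right' (by omega) (by omega) (by omega)⟩

theorem outer_left (h : Attach k n X T D) (h1 : 1 ∈ D) :
    1 - k ∈ D ∧ -1 - k ∈ D ∧ -1 ∈ D := by
  have hk := h.hk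
  have hn' := h.le_n
  obtain ⟨u, hm⟩ := h.exists_matched 1 h1
  have hu := hm.mem.2
  have hun : u ≠ 1 := fun e => h.disj u hm.mem.1 (e ▸ h1)
  have hu1 : ¬ (u - k ≤ 1 ∧ 1 ≤ u + k) := hm.notD 1 h1
  have h2 := hm.mem_right h.board.left (by omega) (by omega) (by omega)
  have h3 := hm.mem_right h.plus (by omega) (by omega) (by omega)
  obtain ⟨u', hm'⟩ := h.exists_matched _ h2
  have hu' := hm'.mem.2
  exact ⟨h2, hm'.mem_right h.board.left' (by omega) (by omega) (by omega), h3⟩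

theorem rigid_right (h : Attach k n X T D) (hn : n ∈ D) :
    Rigid k n X T ∧ ∃ z ∈ seg n T, ∀ x ∈ X, z - k ≤ x → x ≤ z + k → x ∈ T := by
  have hk := h.hk
  have hn' := h.le_n
  obtain ⟨h3, h4⟩ := h.outer_right hn
  refine h.rigid h4 fun x hx h1 h2 => ?_
  have hc := h.board.cases x hx
  by_cases hx3 : x = n + k
  · exact Or.inl (hx3 ▸ h3)
  · exact Or.inr (by omega)

theorem rigid_left (h : Attach k n X T D) (h1 : 1 ∈ D) :
    Rigid k n X T ∧ ∃ z ∈ seg n T, ∀ x ∈ X, z - k ≤ x → x ≤ z + k → x ∈ T := by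
  have hk := h.hk
  have hn' := h.le_n
  obtain ⟨h2, h3, h4⟩ := h.outer_left h1
  refine h.rigid h3 fun x hx h1 h2' => ?_
  have hc := h.board.cases x hx
  by_cases hx2 : x = 1 - k
  · exact Or.inl (hx2 ▸ h2)
  by_cases hx3 : x = -1
  · exact Or.inl (hx3 ▸ h4)
  · exact Or.inr (by omega)

/-- The other set has no full window. -/
theorem false_of_max (h : Attach k n X T D) (hD : ¬ Meets k n (X \ D)) (hy : y ∈ seg n D)
    (hmax : ∀ x ∈ seg n (T ∪ D), x ≤ y) : False := by
  have hk := h.hk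
  have hn' := h.le_n
  -- The matched vertex lies to the left of `y` and is not adjacent to it. So `y + 1`, close to `y`
  -- only, would be in `D` beyond the maximum.
  have hyn : y = n := by
    by_contra hyn
    obtain ⟨hyD, hy1, hy2⟩ := hy
    obtain ⟨u, hm⟩ := h.exists_matched y hyD
    have hu := hm.mem.2
    have := hmax u ⟨Or.inl hm.mem.1, hu⟩
    have huy : u ≠ y := fun e => h.disj u hm.mem.1 (e ▸ hyD)
    have := hm.notD y hyD
    have h1 := hm.mem_right (h.board.path (y + 1) (by omega) (by omega)) (by omega) (by omega)
      (by omega)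
    have := hmax (y + 1) ⟨Or.inr h1, by omega, by omega⟩
    omega
  obtain ⟨⟨A, x, hT, hnear⟩, -⟩ := h.rigid_right (hyn ▸ hy.1)
  unfold Meets at hD
  push Not at hD
  obtain ⟨a, ha, han, haD⟩ := hD
  obtain ⟨p, hp, h1, h2⟩ := hnear.meetsA a ha han
  have hpT : p ∈ seg n T := hT ▸ Or.inr hp
  have := haD p ⟨h.subT hpT.1, h.disj p hpT.1⟩ h1
  omega

/-- If `D` does not meet the path power, then it has no neighbours there. -/
theorem not_adj_of_seg_empty (h : Attach k n X T D) (hD : ∀ y ∈ D, ¬ (1 ≤ y ∧ y ≤ n)) (hy : y ∈ D)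
    (hu : u ∈ seg n T) : ¬ (y - k ≤ u ∧ u ≤ y + k) := by
  rintro ⟨h1, h2⟩
  have hk := h.hk
  have hn' := h.le_n
  have hu' := hu.2
  have hc := h.board.cases y (h.subD hy)
  have hy' := hD y hy
  obtain ⟨e, hm⟩ := h.exists_matched y hy
  have he := hm.mem.2
  -- If `1` were in `T`, then `1 - k` and `-1 - k` would both be in `D` with the same outside
  -- neighbours, and by `star` both would be adjacent to `1`.
  have w2 : 1 - k ∈ D → 1 ∉ T := by
    intro h2 h1T
    obtain ⟨e, hm⟩ := h.exists_matched _ h2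
    have he := hm.mem.2
    have hw1 := hm.mem_right h.board.left' (by omega) (by omega) (by omega)
    have := h.star _ h2 _ hw1 (fun x hx hxT hxD => by
      have := h.board.cases x hx
      have : x ≠ 1 - k := fun e => hxD (e ▸ h2)
      have : x ≠ -1 - k := fun e => hxD (e ▸ hw1)
      have : x ≠ 1 := fun e => hxT (e ▸ h1T)
      constructor <;> intro _ <;> omega) 1 h1T (by omega) (by omega)
    omega
  have hy4 : y = n + k ∨ y = 1 - k ∨ y = -1 := by omega
  rcases hy4 with rfl | rfl | rfl
  · have h4 := hm.mem_right h.board.right' (by omega) (by omega) (by omega)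
    have := h.star _ hy _ h4 (fun x hx hxT hxD => by
      have := h.board.cases x hx
      have : x ≠ n + k := fun e => hxD (e ▸ hy)
      have : x ≠ n + k + 2 := fun e => hxD (e ▸ h4)
      have : x ≠ n := fun e => hxT (by rw [e]; convert hu.1 using 1; omega)
      constructor <;> intro _ <;> omega) u hu.1 h1 h2
    omega
  · obtain rfl : u = 1 := by omega
    exact w2 hy hu.1
  · have hw1 := hm.mem_right h.board.left' (by omega) (by omega) (by omega)
    have hw2 : 1 - k ∈ D := by
      by_contra hw2
      have h5 : e - k ≤ 1 - k ∧ 1 - k ≤ e + k := by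
        by_cases hT : 1 - k ∈ T
        · exact hm.sub _ hT (by omega) (by omega)
        · exact (hm.out _ h.board.left hT hw2).2 ⟨by omega, by omega⟩
      exact hm.notD _ hy ⟨by omega, by omega⟩
    have h1T := w2 hw2
    obtain ⟨i, hi⟩ := h.exists_matched _ hw2
    have hi' := hi.mem.2
    have hik : k ≤ i := by
      by_contra hc
      exact hi.notD _ hy ⟨by omega, by omega⟩
    have h1D : 1 ∉ D := fun h1 => hD 1 h1 ⟨le_rfl, by omega⟩
    have hi1 := (hi.out 1 (h.board.path 1 le_rfl (by omega)) h1T h1D).2 ⟨by omega, by omega⟩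
    have hT : ∀ p, 2 ≤ p → p ≤ k - 1 → p ∈ T := fun p h1 h2 =>
      hi.mem_left (h.board.path p (by omega) (by omega)) (by omega) (by omega) (by omega)
    have := h.star _ hy _ hw2 (fun x hx hxT hxD => by
      have := h.board.cases x hx
      have : x ≠ 1 - k := fun e => hxD (e ▸ hw2)
      have : x ≠ -1 - k := fun e => hxD (e ▸ hw1)
      have : x ≠ -1 := fun e => hxD (e ▸ hy)
      have := hT x
      constructor <;> intro _ <;> by_contra hc <;> exact hxT (this (by omega) (by omega)))
      u hu.1 h1 h2
    obtain rfl : u = 1 := by omega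
    exact h1T hu.1

/-- The vertices of `D` are adjacent to no path vertex of `T`, so the types on the path do not
depend on `D`. -/
theorem good_of_seg_empty (h : Attach k n X T D) (hD : ∀ y ∈ D, ¬ (1 ≤ y ∧ y ≤ n)) :
    Good k n X (T ∪ D) := by
  have hseg : seg n (T ∪ D) = seg n T := by
    ext p
    simp only [mem_seg, Set.mem_union]
    have := hD p
    tauto
  have hna := fun y (hy : y ∈ D) u (hu : u ∈ seg n T) => h.not_adj_of_seg_empty hD hy hu
  refine ⟨?_, ?_, ?_⟩
  · rw [hseg]
    obtain ⟨r, hr, hr1, hr2⟩ := h.good.many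
    refine ⟨r, hr, hr1, fun u hu v hv hS => hr2 u hu v hv fun c hc => ?_⟩
    by_cases hcD : c ∈ D
    · have := hna c hcD u (hr1 u hu).1
      have := hna c hcD v (hr1 v hv).1
      omega
    · exact hS c ⟨hc.1, fun hcT => hcT.elim hc.2 hcD⟩
  · intro w hw p hp h1 h2
    rw [hseg] at hp
    rcases hw with hw | hw
    · exact h.good.quiet w hw p hp h1 h2
    · exact absurd ⟨h1, h2⟩ (hna w hw p hp)
  · refine h.good.alive.imp (fun hal z hz => ?_) fun hr => ?_
    · rw [hseg] at hz
      obtain ⟨c, hc, h1, h2⟩ := hal z hz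
      refine ⟨c, ⟨hc.1, fun hcT => hcT.elim hc.2 fun hcD => hna c hcD z hz ⟨by omega, by omega⟩⟩, h1, h2⟩
    · unfold Rigid
      rw [hseg]
      exact hr

end Attach

end Line

open CWExpr

/-! ### The other operand contains no path vertex -/

namespace Line

variable {k n m a b q u v w x y z i j d : ℤ} {A B C D Q T X S : Set ℤ} {M : ℕ}
  {l : ℤ → Fin M} {J : Fin M → Fin M → Prop}

namespace Attach

/-- The matched `u` is to the left of `y` and not adjacent to it, so all of `[y, y + k]` on the path
belongs to `D`. As `D` has no full window, the path ends before `y + k`. -/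
theorem n_mem (h : Attach k n X T D) (hD : Meets k n (X \ D)) (hy : y ∈ seg n D)
    (hm : Matched k n X T D y u) (huy : u < y) : n ∈ D := by
  have hk := h.hk
  obtain ⟨hyD, hy1, hyn⟩ := hy
  have hd := hm.notD y hyD
  have hp : ∀ p, y ≤ p → p ≤ y + k → p ≤ n → p ∈ D := fun p h1 h2 h3 =>
    hm.mem_right (h.board.path p (by omega) h3) (by omega) h2 (by omega)
  by_cases hyk : y + k ≤ n
  · obtain ⟨p, hp', h1, h2⟩ := hD y hy1 hyk
    exact absurd (hp p h1 h2 (by omega)) hp'.2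
  · exact hp n hyn (by omega) le_rfl

theorem one_mem (h : Attach k n X T D) (hD : Meets k n (X \ D)) (hy : y ∈ seg n D)
    (hm : Matched k n X T D y u) (huy : y < u) : 1 ∈ D := by
  have hk := h.hk
  obtain ⟨hyD, hy1, hyn⟩ := hy
  have hd := hm.notD y hyD
  have hp : ∀ p, y - k ≤ p → p ≤ y → 1 ≤ p → p ∈ D := fun p h1 h2 h3 =>
    hm.mem_right (h.board.path p h3 (by omega)) h1 (by omega) (by omega)
  by_cases hyk : 1 ≤ y - k
  · obtain ⟨p, hp', h1, h2⟩ := hD (y - k) hyk (by omega)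
    exact absurd (hp p h1 (by omega) (by omega)) hp'.2
  · exact hp 1 (by omega) hy1 le_rfl

/-- If `n` is in `D`, so are the right ends, and `T` contains a vertex without outside neighbours.
This turns out to be the completing element `x`, surrounded by `[x - k, x + k]` inside `T`, and the
vertex `i` matched with `n` lies just to its right. Then `false_of_right` counts too many types; the
vertex `-1` is outside of `A` as it requires. -/
theorem false_of_n_mem (h : Attach k n X T D) (hD : Meets k n (X \ D)) (hn : n ∈ D) : False := by
  have hk := h.hk
  have hn' := h.le_n
  obtain ⟨h3, h4⟩ := h.outer_right hn
  obtain ⟨⟨A, x, hT, hnear⟩, z, hz, hzT⟩ := h.rigid_right hn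
  obtain ⟨i, hm⟩ := h.exists_matched n hn
  have hi := hm.mem.2
  have hin : i ≠ n := fun e => h.disj i hm.mem.1 (e ▸ hn)
  have hin' := hm.notD n hn
  have hside : ∀ p, n - k ≤ p → p ≤ n → i + k < p → p ∈ D := fun p h1 h2 h3 =>
    hm.mem_right (h.board.path p (by omega) h2) h1 (by omega) (by omega)
  have hins : ∀ p, p ∈ T → 1 ≤ p → p ≤ n → p ∈ insert x A := fun p h1 h2 h3 =>
    hT ▸ (⟨h1, h2, h3⟩ : p ∈ seg n T)
  have hAT : ∀ p ∈ A, p ∈ T := fun p hp => (hT.symm ▸ Or.inr hp : p ∈ seg n T).1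
  obtain ⟨p, hp, hp1, hp2⟩ := hD (n - k) (by omega) (by omega)
  have hpi : p ≤ i + k := by
    by_contra hc
    exact hp.2 (hside p hp1 (by omega) (by omega))
  obtain ⟨c, hcX, hcT, hcD, hc1, hc2⟩ : ∃ c ∈ X, c ∉ T ∧ c ∉ D ∧ n - k ≤ c ∧ c ≤ n := by
    by_contra hc
    push Not at hc
    by_cases hpT : p ∈ T
    · have := h.star n hn _ h4 (fun x hx hxT hxD => by
        have := h.board.cases x hx
        have : x ≠ n + k := fun e => hxD (e ▸ h3)
        have : x ≠ n + k + 2 := fun e => hxD (e ▸ h4)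
        have := hc x hx hxT hxD
        constructor <;> intro _ <;> omega) p hpT hp1 (by omega)
      omega
    · have := hc p hp.1 hpT hp.2 hp1
      omega
  have hci : c ≤ i + k := by
    by_contra hc
    exact hcD (hside c hc1 hc2 (by omega))
  have hcn : c ≠ n := fun e => hcD (e ▸ hn)
  have hiT : ∀ p, i - k ≤ p → p ≤ n - k - 1 → p ∈ insert x A := fun p h1 h2 =>
    hins p (hm.mem_left (h.board.path p (by omega) (by omega)) h1 (by omega) (by omega)) (by omega)
      (by omega)
  have hz1 := hz.2
  have hzc : ¬ (z - k ≤ c ∧ c ≤ z + k) := fun hc => hcT (hzT c hcX hc.1 hc.2)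
  have hzk : k ≤ z := by
    by_contra hc
    have := h.good.quiet (-1) (hzT _ h.plus (by omega) (by omega)) z hz (by omega) (by omega)
    omega
  have hzT' : ∀ p, 1 ≤ p → z - k ≤ p → p ≤ z + k → p ∈ insert x A := fun p h0 h1 h2 =>
    hins p (hzT p (h.board.path p h0 (by omega)) h1 h2) h0 (by omega)
  have hzk' : k + 1 ≤ z := by
    by_contra hc
    obtain rfl : z = k := by omega
    have x1 := hnear.mem_window (a := z) (by omega) (by omega) fun p h1 h2 =>
      hzT' p (by omega) (by omega) h2
    have := hnear.row_notMem ((hzT' 1 le_rfl (by omega) (by omega)).resolve_left (by omega)) le_rfl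
      (by omega)
    rw [row_zero] at this
    exact this ((hzT' 2 (by omega) (by omega) (by omega)).resolve_left (by omega))
  have hxz : x = z := by
    have x1 := hnear.mem_window (a := z) (by omega) (by omega) fun p h1 h2 =>
      hzT' p (by omega) (by omega) h2
    have x2 := hnear.mem_window (a := z - k) (by omega) (by omega) fun p h1 h2 =>
      hzT' p (by omega) (by omega) (by omega)
    omega
  subst hxz
  have x3 := hnear.mem_window (a := i - k) (by omega) (by omega) fun p h1 h2 =>
    hiT p (by omega) (by omega)
  have x4 := hnear.mem_window (a := n - 2 * k - 1) (by omega) (by omega) fun p h1 h2 =>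
    hiT p (by omega) (by omega)
  refine hnear.false_of_right (d := n - k - 2 - x) (i := i) (by omega) (by omega) (by omega)
    (fun p h1 h2 h3 => (hzT' p (by omega) h1 h2).resolve_left h3) (by omega) (by omega) ?_ ?_
    fun _ => ⟨h.plus, fun hA => by have := hnear.part.sub _ hA; omega⟩
  · have := hside (i + k + 1) (by omega) (by omega) (by omega)
    exact ⟨h.subD this, fun hA => h.disj _ (hAT _ hA) this⟩
  · intro hix u hu hxu hS
    have hu' := hnear.part.sub u hu
    have hmem : x + 1 ∈ seg n T := hT.symm ▸ hzT' (x + 1) (by omega) (by omega) (by omega)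
    have hm' := h.of_same n hn i (x + 1) hm hmem (by
      rw [hix]
      exact (hS.mono (Set.sdiff_subset_sdiff_right hAT)).symm)
    have := hm'.sub u (hAT u hu) (by omega) (by omega)
    omega

/-- The mirror image of `false_of_n_mem`, except that there is no `w⁺` on the right for the case `d
= 0`. In that case `[3, 2k + 3]` lies in `T`, so `1` and `-1`, both in `D`, have the same outside
neighbours, and `star` would make `-1` adjacent to `k + 1`. -/
theorem false_of_one_mem (h : Attach k n X T D) (hD : Meets k n (X \ D)) (hn : 1 ∈ D) : False := by
  have hk := h.hk
  have hn' := h.le_n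
  obtain ⟨h2, h3, h4⟩ := h.outer_left hn
  obtain ⟨⟨A, x, hT, hnear⟩, z, hz, hzT⟩ := h.rigid_left hn
  obtain ⟨i, hm⟩ := h.exists_matched 1 hn
  have hi := hm.mem.2
  have hin : i ≠ 1 := fun e => h.disj i hm.mem.1 (e ▸ hn)
  have hin' := hm.notD 1 hn
  have hside : ∀ p, 1 ≤ p → p ≤ k + 1 → p < i - k → p ∈ D := fun p h1 h2 h3 =>
    hm.mem_right (h.board.path p h1 (by omega)) (by omega) (by omega) (by omega)
  have hins : ∀ p, p ∈ T → 1 ≤ p → p ≤ n → p ∈ insert x A := fun p h1 h2 h3 =>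
    hT ▸ (⟨h1, h2, h3⟩ : p ∈ seg n T)
  have hAT : ∀ p ∈ A, p ∈ T := fun p hp => (hT.symm ▸ Or.inr hp : p ∈ seg n T).1
  obtain ⟨p, hp, hp1, hp2⟩ := hD 1 le_rfl (by omega)
  have hpi : i - k ≤ p := by
    by_contra hc
    exact hp.2 (hside p hp1 (by omega) (by omega))
  have hleft : ∀ x ∈ X, x ∉ D → 1 < x := fun x hx hxD => by
    have := h.board.cases x hx
    have : x ≠ 1 - k := fun e => hxD (e ▸ h2)
    have : x ≠ -1 - k := fun e => hxD (e ▸ h3)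
    have : x ≠ -1 := fun e => hxD (e ▸ h4)
    have : x ≠ 1 := fun e => hxD (e ▸ hn)
    omega
  obtain ⟨c, hcX, hcT, hcD, hc1, hc2⟩ : ∃ c ∈ X, c ∉ T ∧ c ∉ D ∧ 1 ≤ c ∧ c ≤ k + 1 := by
    by_contra hc
    push Not at hc
    by_cases hpT : p ∈ T
    · have := h.star 1 hn _ h3 (fun x hx hxT hxD => by
        have := hleft x hx hxD
        have := hc x hx hxT hxD
        constructor <;> intro _ <;> omega) p hpT (by omega) (by omega)
      omega
    · have := hc p hp.1 hpT hp.2 hp1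
      omega
  have hci : i - k ≤ c := by
    by_contra hc
    exact hcD (hside c hc1 hc2 (by omega))
  have hiT : ∀ p, k + 2 ≤ p → p ≤ i + k → p ∈ insert x A := fun p h1 h2 =>
    hins p (hm.mem_left (h.board.path p (by omega) (by omega)) (by omega) (by omega) (by omega))
      (by omega) (by omega)
  have hz1 := hz.2
  have hzc : ¬ (z - k ≤ c ∧ c ≤ z + k) := fun hc => hcT (hzT c hcX hc.1 hc.2)
  have hzT' : ∀ p, p ≤ n → z - k ≤ p → p ≤ z + k → p ∈ insert x A := fun p h0 h1 h2 =>
    hins p (hzT p (h.board.path p (by omega) h0) h1 h2) (by omega) h0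
  have x1 := hnear.mem_window (a := k + 2) (by omega) (by omega) fun p h1 h2 =>
    hiT p (by omega) (by omega)
  have hzk : z + k ≤ n := by
    by_contra hc
    have hm1 : (1 : ℤ) ∈ Line.mir n A := by
      rw [mem_mir]
      exact (hzT' (n + 1 - 1) (by omega) (by omega) (by omega)).resolve_left (by omega)
    have := hnear.mir.row_notMem hm1 le_rfl (by omega)
    rw [row_zero, mem_mir] at this
    exact this ((hzT' _ (by omega) (by omega) (by omega)).resolve_left (by omega))
  have hxz : x = z := by
    have x1 := hnear.mem_window (a := z) (by omega) (by omega) fun p h1 h2 =>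
      hzT' p (by omega) (by omega) h2
    have x2 := hnear.mem_window (a := z - k) (by omega) (by omega) fun p h1 h2 =>
      hzT' p (by omega) (by omega) (by omega)
    omega
  subst hxz
  have x3 := hnear.mem_window (a := i) (by omega) (by omega) fun p h1 h2 =>
    hiT p (by omega) (by omega)
  refine hnear.mir.false_of_right (d := x - k - 3) (i := n + 1 - i) (by omega) (by omega)
    (by omega) (fun p h1 h2 h3 => ?_) (by omega) (by omega) ?_ ?_ fun hd => ?_
  · exact (hzT' (n + 1 - p) (by omega) (by omega) (by omega)).resolve_left (by omega)
  · have := hside (i - k - 1) (by omega) (by omega) (by omega)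
    rw [mem_mir, show n + 1 - (n + 1 - i + k + 1) = i - k - 1 by ring]
    exact ⟨h.subD this, fun hA => h.disj _ (hAT _ hA) this⟩
  · intro hix u hu hxu hS
    rw [mem_mir] at hu
    have hu' := hnear.part.sub _ hu
    rw [same_mir, show n + 1 - (n + 1 - x + 1) = x - 1 by ring,
      show n + 1 - (n + 1 - x + k) = i by omega] at hS
    have hmem : x - 1 ∈ seg n T := hT.symm ▸ hzT' (x - 1) (by omega) (by omega) (by omega)
    have hm' := h.of_same 1 hn i (x - 1) hm hmem (hS.mono (Set.sdiff_subset_sdiff_right hAT)).symm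
    have := hm'.sub _ (hAT _ hu) (by omega) (by omega)
    omega
  · exfalso
    have hT3 : ∀ p, 3 ≤ p → p ≤ 2 * k + 3 → p ∈ seg n T := fun p h1 h2 =>
      hT.symm ▸ hzT' p (by omega) (by omega) (by omega)
    have := h.star 1 hn _ h4 (fun x hx hxT hxD => by
      have := hleft x hx hxD
      have : ¬ (3 ≤ x ∧ x ≤ 2 * k + 3) := fun hc => hxT (hT3 x hc.1 hc.2).1
      constructor <;> intro _ <;> omega) (k + 1) (hT3 _ (by omega) (by omega)).1 (by omega)
      (by omega)
    omega

theorem good_union (h : Attach k n X T D) (hD : Meets k n (X \ D)) : Good k n X (T ∪ D) := by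
  refine h.good_of_seg_empty fun y hyD hy => ?_
  obtain ⟨u, hm⟩ := h.exists_matched y hyD
  have : u ≠ y := fun e => h.disj u hm.mem.1 (e ▸ hyD)
  rcases lt_or_gt_of_ne this with huy | huy
  · exact h.false_of_n_mem hD (h.n_mem hD ⟨hyD, hy⟩ hm huy)
  · exact h.false_of_one_mem hD (h.one_mem hD ⟨hyD, hy⟩ hm huy)

end Attach

/-- A union that completes a first window stays on the path, so the condition about vertices off the
path is void. -/
theorem Uni.good (h : Uni k X A B l J) (hX : Board k n X) (hM : (M : ℤ) = k + 1)
    (hA : Meets k n (X \ A)) (hB : Meets k n (X \ B)) (hT : ¬ Meets k n (X \ (A ∪ B))) :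
    Good k n X (A ∪ B) := by
  have hs := h.subset_seg hX hM hA hB hT
  obtain ⟨h1, h2⟩ := (h.joined hX hM hA hB hT).main
  refine ⟨by rwa [Uni.seg_eq hs], fun w hw _ _ _ _ => hs w hw, ?_⟩
  unfold Rigid
  rw [Uni.seg_eq hs]
  refine h2.imp id ?_
  rintro ⟨D, x, hD, hnear⟩
  refine ⟨D, x, hD, ?_⟩
  convert hnear using 1
  ext p
  have hxD : x ∉ D := fun hx => hnear.part.notMem hx hnear.mem
  have hxX : x ∈ X := hX.path x hnear.one_le hnear.le_n
  rw [hD]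
  simp only [Set.mem_sdiff, Set.mem_insert_iff]
  by_cases hpx : p = x
  · rw [hpx]
    tauto
  · tauto

/-- Sets of positions that occur in expressions. -/
theorem Board.not_clique (hX : Board k n X) (hp : -1 ∈ X)
    (h : ∀ F : Set ℤ → Prop, (∀ p ∈ X, F {p}) → (∀ A B, F A → F B → (∃ (M : ℕ) (l : ℤ → Fin M)
      (J : _), (M : ℤ) = k + 1 ∧ Uni k X A B l J) → F (A ∪ B)) → F X) : False := by
  have hk := hX.hk
  have hn := hX.le_n
  have hsingle : ∀ p : ℤ, Meets k n (X \ {p}) := hX.meets_singleton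
  -- As in the linear case, but the sets with a full window carry the additional information in
  -- `Good`, which survives unions with arbitrary sets.
  have := h (fun T => Meets k n (X \ T) ∨ Good k n X T) (fun p _ => Or.inl (hsingle p)) ?_
  · rcases this with h | h
    · obtain ⟨p, hp, -⟩ := h 1 le_rfl (by omega)
      exact hp.2 hp.1
    · obtain ⟨s, h1, -, h3⟩ := h.many
      have : s.card ≤ 1 := Finset.card_le_one.2 fun u hu v hv =>
        h3 u hu v hv fun y hy => absurd hy.1 hy.2
      omega
  · rintro A B hFA hFB ⟨M, l, J, hM, hU⟩
    by_cases hA : Meets k n (X \ A)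
    · by_cases hB : Meets k n (X \ B)
      · by_cases hT : Meets k n (X \ (A ∪ B))
        · exact Or.inl hT
        · exact Or.inr (hU.good hX hM hA hB hT)
      · rw [Set.union_comm]
        exact Or.inr ((hU.symm.attach hX hp hM (hFB.resolve_left hB)).good_union hA)
    · have hUA := hU.attach hX hp hM (hFA.resolve_left hA)
      by_cases hB : Meets k n (X \ B)
      · exact Or.inr (hUA.good_union hB)
      · have hUB := hU.symm.attach hX hp hM (hFB.resolve_left hB)
        -- If both operands contain full windows, the greatest path vertex belongs to one of them,
        -- and the other one serves as `T` in `false_of_max`.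
        exfalso
        obtain ⟨y, hy, -, -, hmax⟩ := exists_greatest (A := seg n (A ∪ B)) (a := 1) (b := n) (by
          have hB' := hB
          unfold Meets at hB'
          push Not at hB'
          obtain ⟨a, ha, han, haB⟩ := hB'
          have haB' : a ∈ B := by
            by_contra hc
            have := haB a ⟨hX.path a ha (by omega), hc⟩ le_rfl
            omega
          exact ⟨a, ⟨Or.inr haB', ha, by omega⟩, ha, by omega⟩)
        have hmax' : ∀ x ∈ seg n (A ∪ B), x ≤ y := fun x hx => hmax x hx hx.2.2
        obtain ⟨hy | hy, hy'⟩ := hy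
        · exact hUB.false_of_max hA ⟨hy, hy'⟩ (by rwa [Set.union_comm])
        · exact hUA.false_of_max hB ⟨hy, hy'⟩ hmax'

end Line

/-! ### The lower bound for the clique-width of `S⁺_k` -/

namespace SVertex

open Line

variable {k : ℕ}

theorem not_cliqueWidth_plus_le (hk : 3 ≤ k) : ¬ cliqueWidth (graphSPlus k) ≤ k + 1 := by
  intro h
  obtain ⟨e, he⟩ := exists_defines_of_cliqueWidth_le (m := k + 1) (by exact_mod_cast h)
  refine (board_plus hk).not_clique ⟨none, rfl⟩ fun F hF1 hF2 => ?_
  have := he.mem_family (lin := False) False.elim (fun S => F (place k '' S)) (fun a => ?_)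
    fun A B hA hB _ _ _ hU => ?_
  · rwa [Set.image_univ] at this
  · rw [Set.image_singleton]
    exact hF1 _ ⟨a, rfl⟩
  · obtain ⟨l, J, hU⟩ := exists_uni (place_injective hk) (plus_adj_iff_place hk) hU
    rw [Set.image_union]
    exact hF2 _ _ hA hB ⟨k + 1, l, J, by push_cast; ring, hU⟩

end SVertex

open CWExpr

/-! ### The main theorem -/

theorem mainTheorem2 :
    (∀ k : ℕ, 3 ≤ k →
      (∀ s : Set (Option (SVertex k)), s ≠ Set.univ →
        cliqueWidth ((graphSPlus k).induce s) ≤ k + 1) ∧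
      (∀ s : Set (SVertex k), s ≠ Set.univ →
        linearCliqueWidth ((graphS k).induce s) ≤ k + 1)) ∧
    (∀ s : Set (SVertex 2), s ≠ Set.univ →
      linearCliqueWidth ((graphS 2).induce s) ≤ 3) ∧
    (∀ k : ℕ, 3 ≤ k →
      IsMinimalForbidden (fun _ G => cliqueWidth G ≤ k + 1) (graphSPlus k) ∧
      IsMinimalForbidden (fun _ G => linearCliqueWidth G ≤ k + 1) (graphS k)) ∧
    IsMinimalForbidden (fun _ G => cliqueWidth G ≤ 3) (graphS 2) ∧
    IsMinimalForbidden (fun _ G => linearCliqueWidth G ≤ 3) (graphS 2) := by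
  have hS2 := STwo.linearCliqueWidth_induce_le
  refine ⟨fun k hk => ⟨SVertex.cliqueWidth_plus_induce_le hk, SVertex.linearCliqueWidth_induce_le hk⟩,
    hS2, fun k hk => ⟨⟨SVertex.not_cliqueWidth_plus_le hk, SVertex.cliqueWidth_plus_induce_le hk⟩,
      SVertex.not_linearCliqueWidth_le hk, SVertex.linearCliqueWidth_induce_le hk⟩,
    ⟨STwo.not_cliqueWidth_le, fun s hs => (cliqueWidth_le_linearCliqueWidth _).trans (hS2 s hs)⟩,
    fun h => STwo.not_cliqueWidth_le ((cliqueWidth_le_linearCliqueWidth _).trans h), hS2⟩
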